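/- **Setting.** Let $N\ge 2$, $g=N$, $k\in\mathbb C$, and let $q\in\mathbb C$ with $0<|q|<1$; fix a value of $\log q$ and put $q^x=e^{x\log q}$, $[x]=\frac{q^x-q^{-x}}{q-q^{-1}}$. Assume $[(k+g)n]\neq 0$ for all integers $n\ge 1$. Let $(a_{ij})_{1\le i,j\le N-1}$ be the Cartan matrix of $sl_N$. Consider free bosons $a^i$ $(1\le i\le N-1)$, $b^{ij}$, $c^{ij}$ $(1\le i<j\le N)$, with modes $x_n$ $(n\ne0)$ and zero modes $\hat p_x,\hat q_x$, whose only nonzero commutators are $$[a^i_n,a^j_m]=\tfrac1n[(k+g)n][a_{ij}n]\delta_{n+m,0},\quad [\hat p_a^i,\hat q_a^j]=(k+g)a_{ij},$$ $$[b^{ij}_n,b^{i'j'}_m]=-\tfrac1n[n]^2\delta^{ii'}\delta^{jj'}\delta_{n+m,0},\quad [\hat p_b^{ij},\hat q_b^{i'j'}]=-\delta^{ii'}\delta^{jj'},$$ $$[c^{ij}_n,c^{i'j'}_m]=\tfrac1n[n]^2\delta^{ii'}\delta^{jj'}\delta_{n+m,0},\quad [\hat p_c^{ij},\hat q_c^{i'j'}]=\delta^{ii'}\delta^{jj'}.$$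 They act on the direct sum of the Fock spaces $F(p_a,p_b,p_c)$ generated by the negative modes from a highest weight state on which the $\hat p$'s have the complex eigenvalues $p_a,p_b,p_c$. Normal ordering $:\ :$ puts negative modes and $\hat q$ to the left of positive modes and $\hat p$. For a boson $x$ put $$x(z;\alpha)=-\sum_{n\ne0}\tfrac{x_n}{[n]}q^{-\alpha|n|}z^{-n}+\hat q_x+\hat p_x\log z,\quad x(z)=x(z;0),$$ $$\bigl(\tfrac1{k+g}a^i\bigr)(z;\alpha)=-\sum_{n\neq0}\tfrac{a^i_n}{[(k+g)n]}q^{-\alpha|n|}z^{-n}+\tfrac1{k+g}(\hat q_a^i+\hat p_a^i\log z),$$ $$x_\pm(z)=\pm\Bigl((q-q^{-1})\sum_{\pm n>0}x_nz^{-n}+\hat p_x\log q\Bigr),\quad (b+c)^{ij}=b^{ij}+c^{ij},\quad b^{ii}=c^{ii}=0.$$ Let ${}_\alpha\partial_wf(w)=\frac{f(q^\alpha w)-f(q^{-\alpha}w)}{(q-q^{-1})w}$. **Currents.** For $1\le i\le N-1$ define $H^i_n$ by $\sum_{n\in\mathbb Z}H^i_nz^{-n-1}=H^i(z)$, where $$(q-q^{-1})z\,H^i(z)=\sum_{j=1}^i\bigl(b_+^{j,i+1}(q^{\frac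 k2+j-1}z)-b_+^{j,i}(q^{\frac k2+j}z)\bigr)+a^i_+(q^{\frac g2}z)+\sum_{j=i+1}^N\bigl(b_+^{i,j}(q^{\frac k2+j}z)-b_+^{i+1,j}(q^{\frac k2+j-1}z)\bigr)$$ $$-\ (\text{the same with every } x_+(q^\alpha z)\text{ replaced by }x_-(q^{-\alpha}z)).$$ Define further $$E^{+,i}(z)=\frac{-1}{(q-q^{-1})z}\sum_{j=1}^i:e^{(b+c)^{j,i}(q^{j-1}z)}\Bigl(e^{b_+^{j,i+1}(q^{j-1}z)-(b+c)^{j,i+1}(q^jz)}-e^{b_-^{j,i+1}(q^{j-1}z)-(b+c)^{j,i+1}(q^{j-2}z)}\Bigr)e^{\sum_{\ell=1}^{j-1}(b_+^{\ell,i+1}(q^{\ell-1}z)-b_+^{\ell,i}(q^\ell z))}:,$$ and, with $$A^{i}_{m,\pm}=a^i_\pm(q^{\pm\frac{k+g}2}z)+\sum_{\ell=m}^N\bigl(b_\pm^{i,\ell}(q^{\pm(k+\ell)}z)-b_\pm^{i+1,\ell}(q^{\pm(k+\ell-1)}z)\bigr),$$ $$E^{-,i}(z)=\frac{-1}{(q-q^{-1})z}\Bigl(\sum_{j=1}^{i-1}:e^{(b+c)^{j,i+1}(q^{-(k+j)}z)}\Bigl(e^{-b_-^{j,i}(q^{-(k+j)}z)-(b+c)^{j,i}(q^{-(k+j-1)}z)}-e^{-b_+^{j,i}(q^{-(k+j)}z)-(b+c)^{j,i}(q^{-(k+j+1)}z)}\Bigr)$$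 $$\times e^{\sum_{\ell=j+1}^i(b_-^{\ell,i+1}(q^{-(k+\ell-1)}z)-b_-^{\ell,i}(q^{-(k+\ell)}z))+A^i_{i+1,-}}:\ +:e^{(b+c)^{i,i+1}(q^{-(k+i)}z)+A^i_{i+1,-}}:-:e^{(b+c)^{i,i+1}(q^{k+i}z)+A^i_{i+1,+}}:$$ $$-\sum_{j=i+2}^N:e^{(b+c)^{i,j}(q^{k+j-1}z)}\Bigl(e^{b_+^{i+1,j}(q^{k+j-1}z)-(b+c)^{i+1,j}(q^{k+j}z)}-e^{b_-^{i+1,j}(q^{k+j-1}z)-(b+c)^{i+1,j}(q^{k+j-2}z)}\Bigr)e^{A^i_{j,+}}:\Bigr),$$ $$\tilde S^i(z)=\frac{-1}{(q-q^{-1})z}\sum_{j=i+1}^N:e^{(b+c)^{i+1,j}(q^{N-j}z)}\Bigl(e^{-b_-^{i,j}(q^{N-j}z)-(b+c)^{i,j}(q^{N-j+1}z)}-e^{-b_+^{i,j}(q^{N-j}z)-(b+c)^{i,j}(q^{N-j-1}z)}\Bigr)$$ $$\times e^{\sum_{\ell=j+1}^N(b_-^{i+1,\ell}(q^{N-\ell+1}z)-b_-^{i,\ell}(q^{N-\ell}z))}:,\qquad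 S^i(z)=\,:e^{-(\frac1{k+g}a^i)(z;\frac{k+g}2)}:\,\tilde S^i(z).$$ **Meaning of the relations.** For scalar functions $f,f'$ and fields $A,B$, the relation $f(z,w)A(z)B(w)\simeq f'(z,w)B(w)A(z)\sim\mathrm{reg.}+T(z,w)$ means: there are functions $G(z,w)$, one for each matrix element between monomial basis states of the Fock spaces, holomorphic for all $z,w\neq0$ (on the universal cover, since $\log z$, $\log w$ occur), and a constant $R$, such that the matrix elements of $f(z,w)A(z)B(w)$ converge to those of $G+T$ for $|z|>R|w|$, and the matrix elements of $f'(z,w)B(w)A(z)$ converge to those of $G+T$ for $|w|>R|z|$. Here the states have integral eigenvalues of all $\hat p_b^{ij}+\hat p_c^{ij}$, so that $E^{\pm,i}(z)$ and $\tilde S^i(z)$ have expansions in integer powers of $z$. **Proposition.** For all $1\le i,j\le N-1$: 1. $[H^i_n,S^j(z)]=0$ for all $n\in\mathbb Z$. 2. $E^{+,i}(z)S^j(w)\simeq S^j(w)E^{+,i}(z)\sim\mathrm{reg.}$ 3. $E^{-,i}(z)S^j(w)\simeq S^j(w)E^{-,i}(z)\sim\mathrm{reg.}+\delta^{ij}\,{}_{k+g}\partial_w\Bigl(\dfrac1{z-w}:\exp\bigl(-(\tfrac1{k+g}a^j)(w;-\tfrac{k+g}2)\bigr):\Bigr)$.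 4. $(z-q^{-a_{ij}}w)\tilde S^i(z)\tilde S^j(w)\simeq(q^{-a_{ij}}z-w)\tilde S^j(w)\tilde S^i(z)\sim\mathrm{reg.}$ 5. If $a_{ij}=0$, then $\tilde S^i(z)\tilde S^j(w)\simeq\tilde S^j(w)\tilde S^i(z)\sim\mathrm{reg.}$ -/

import Mathlib

namespace UqSlN

noncomputable section

open scoped BigOperators

/-! ### Scalars

The deformation parameter is `q = exp lq`, so that `lq` is the chosen value of `log q`
and `q ^ x` means `exp (x * lq)` for every complex `x`. A point `z ≠ 0` is given by a logarithm
`u`, so `z = exp u` and `q ^ s * z` is `exp (u + s * lq)`; this is needed since the boson fields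
involve `log z`. -/

/-- `q ^ x`. -/
def qpow (lq x : ℂ) : ℂ := Complex.exp (x * lq)

/-- `q - q⁻¹`. -/
def qd (lq : ℂ) : ℂ := qpow lq 1 - qpow lq (-1)

/-- The symbol `[x] = (q ^ x - q ^ (-x)) / (q - q⁻¹)`. -/
def qnum (lq x : ℂ) : ℂ := (qpow lq x - qpow lq (-x)) / qd lq

/-! ### Bosons, momenta and the Fock space -/

/-- The pairs `i < j`, labelling the bosons `b ^ {ij}` and `c ^ {ij}`. -/
abbrev PosRoot (N : ℕ) := {r : Fin N × Fin N // r.1 < r.2}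

/-- The `N ^ 2 - 1` bosons: `a ^ i`, then `b ^ {ij}`, then `c ^ {ij}`. -/
abbrev Boson (N : ℕ) := Fin (N - 1) ⊕ PosRoot N ⊕ PosRoot N

abbrev aB {N : ℕ} (i : Fin (N - 1)) : Boson N := Sum.inl i
abbrev bB {N : ℕ} (r : PosRoot N) : Boson N := Sum.inr (Sum.inl r)
abbrev cB {N : ℕ} (r : PosRoot N) : Boson N := Sum.inr (Sum.inr r)

/-- The value of the oscillator commutator `[x_n, y_{-n}]` for `n > 0`; here `g = N`. -/
def kappa (N : ℕ) (lq k : ℂ) (x y : Boson N) (n : ℕ+) : ℂ :=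
  match x, y with
  | Sum.inl i, Sum.inl j =>
      1 / (n : ℂ) * qnum lq ((k + N) * n) * qnum lq ((CartanMatrix.A (N - 1) i j : ℂ) * n)
  | Sum.inr (Sum.inl r), Sum.inr (Sum.inl t) =>
      if r = t then -(1 / (n : ℂ)) * qnum lq n ^ 2 else 0
  | Sum.inr (Sum.inr r), Sum.inr (Sum.inr t) =>
      if r = t then 1 / (n : ℂ) * qnum lq n ^ 2 else 0
  | _, _ => 0

/-- The value of the zero mode commutator `[p_x, q_y]`. -/
def rho (N : ℕ) (k : ℂ) (x y : Boson N) : ℂ :=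
  match x, y with
  | Sum.inl i, Sum.inl j => (k + N) * (CartanMatrix.A (N - 1) i j : ℂ)
  | Sum.inr (Sum.inl r), Sum.inr (Sum.inl t) => if r = t then -1 else 0
  | Sum.inr (Sum.inr r), Sum.inr (Sum.inr t) => if r = t then 1 else 0
  | _, _ => 0

/-- The polynomial ring in the creation operators `x_{-m}`, `m > 0`. -/
abbrev Poly (N : ℕ) := MvPolynomial (Boson N × ℕ+) ℂ

/-- A basis state of the direct sum of all boson Fock spaces: the monomial `∏ x_{-m} ^ d(x, m)`
applied to the highest weight state with `p_x`-eigenvalues `p x`. The state is `(p, d)`. -/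
abbrev State (N : ℕ) := (Boson N → ℂ) × ((Boson N × ℕ+) →₀ ℕ)

/-- Operators from the Fock space to its completion by arbitrary combinations of basis states,
as matrices: `A s t` is the coefficient of `s` in the image of `t`. -/
abbrev FockOp (N : ℕ) := State N → State N → ℂ

/-- All series occurring in the matrix elements of the product `A B` converge. -/
def Composable {N : ℕ} (A B : FockOp N) (s t : State N) : Prop :=
  Summable fun m : State N => A s m * B m t

/-- The product of operators, through the sum over intermediate basis states. -/
def comp {N : ℕ} (A B : FockOp N) : FockOp N := fun s t => ∑' m : State N, A s m * B m t

open Classical in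
/-- The creation operator `x_{-m}`: multiplication by the variable `x_{-m}`. -/
def creOp {N : ℕ} (x : Boson N) (m : ℕ+) : FockOp N := fun s t =>
  if s.1 = t.1 then
    MvPolynomial.coeff s.2 (MvPolynomial.X (x, m) * MvPolynomial.monomial t.2 (1 : ℂ))
  else 0

open Classical in
/-- The annihilation operator `x_m`: the derivation with `y_{-m} ↦ [x_m, y_{-m}]`. -/
def annOp (N : ℕ) (lq k : ℂ) (x : Boson N) (m : ℕ+) : FockOp N := fun s t =>
  if s.1 = t.1 then
    MvPolynomial.coeff s.2
      (∑ y, kappa N lq k x y m •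
        MvPolynomial.pderiv (y, m) (MvPolynomial.monomial t.2 (1 : ℂ)))
  else 0

open Classical in
/-- The zero mode `p_x`. -/
def momOp {N : ℕ} (x : Boson N) : FockOp N := fun s t => if s = t then t.1 x else 0

/-! ### Linear forms in the modes and normal ordered exponentials -/

/-- The generators `x_{-m}`, `x_m` (`m > 0`), `p_x` and `q_x`. -/
inductive Gen (N : ℕ) where
  | cre (x : Boson N) (m : ℕ+)
  | ann (x : Boson N) (m : ℕ+)
  | mom (x : Boson N)
  | pos (x : Boson N)

/-- Formal (infinite) linear combinations of the generators. -/
abbrev LinForm (N : ℕ) := Gen N → ℂ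

/-- The commutator of the annihilation part of `Φ` with `y_{-m}`. -/
def annShift (N : ℕ) (lq k : ℂ) (Φ : LinForm N) (v : Boson N × ℕ+) : ℂ :=
  ∑ x, Φ (Gen.ann x v.2) * kappa N lq k x v.1 v.2

/-- The action on polynomials of the annihilation part `∑ Φ(x_m) x_m` of `Φ`. -/
def annDer (N : ℕ) (lq k : ℂ) (Φ : LinForm N) : Derivation ℂ (Poly N) (Poly N) :=
  MvPolynomial.mkDerivation ℂ fun v => MvPolynomial.C (annShift N lq k Φ v)

/-- The exponential of the annihilation part of `Φ`, in the form of a translation of variables;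
`expAnn_eq_exp` identifies it with the exponential series of `annDer`. -/
def expAnn (N : ℕ) (lq k : ℂ) (Φ : LinForm N) : Poly N →ₐ[ℂ] Poly N :=
  MvPolynomial.aeval fun v => MvPolynomial.X v + MvPolynomial.C (annShift N lq k Φ v)

/-- `exp D f = ∑ r, D ^ r f / r!`, the sum being finite. -/
theorem expAnn_eq_exp (N : ℕ) (lq k : ℂ) (Φ : LinForm N) (f : Poly N) :
    ∃ n₀ : ℕ, (∀ n, n₀ ≤ n → (annDer N lq k Φ)^[n] f = 0) ∧ ∀ n, n₀ ≤ n →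
      expAnn N lq k Φ f =
        ∑ r ∈ Finset.range n, ((r.factorial : ℂ)⁻¹) • (annDer N lq k Φ)^[r] f := by
  have hC : ∀ v, annDer N lq k Φ (MvPolynomial.X v) = MvPolynomial.C (annShift N lq k Φ v) :=
    fun v => MvPolynomial.mkDerivation_X _ _ _
  have hD : ∀ (a : ℂ), annDer N lq k Φ (MvPolynomial.C a) = 0 :=
    fun a => (annDer N lq k Φ).map_algebraMap a
  have hT : ∀ v, expAnn N lq k Φ (MvPolynomial.X v) =
      MvPolynomial.X v + MvPolynomial.C (annShift N lq k Φ v) :=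
    fun v => MvPolynomial.aeval_X _ _
  have hz : ∀ n : ℕ, (annDer N lq k Φ)^[n] 0 = 0 := fun n => by
    induction n with
    | zero => rfl
    | succ n ih => rw [Function.iterate_succ_apply', ih, map_zero]
  have hadd : ∀ (n : ℕ) (p r : Poly N), (annDer N lq k Φ)^[n] (p + r) =
      (annDer N lq k Φ)^[n] p + (annDer N lq k Φ)^[n] r := fun n p r => by
    induction n with
    | zero => rfl
    | succ n ih => simp only [Function.iterate_succ_apply', ih, map_add]
  induction f using MvPolynomial.induction_on with
  | C a =>
    have h0 : ∀ n, (annDer N lq k Φ)^[n + 1] (MvPolynomial.C a) = 0 := fun n => by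
      rw [Function.iterate_succ_apply, hD, hz]
    refine ⟨1, fun n hn => ?_, fun n hn => ?_⟩
    · obtain ⟨m, rfl⟩ := Nat.exists_eq_add_of_le' hn
      exact h0 m
    · obtain ⟨m, rfl⟩ := Nat.exists_eq_add_of_le' hn
      rw [Finset.sum_range_succ', Finset.sum_eq_zero fun r _ => by rw [h0, smul_zero]]
      simp [expAnn]
  | add p r hp hr =>
    obtain ⟨n₁, h1, h1'⟩ := hp
    obtain ⟨n₂, h2, h2'⟩ := hr
    refine ⟨max n₁ n₂, fun n hn => ?_, fun n hn => ?_⟩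
    · rw [hadd, h1 n (le_trans (le_max_left _ _) hn), h2 n (le_trans (le_max_right _ _) hn),
        add_zero]
    · rw [map_add, h1' n (le_trans (le_max_left _ _) hn),
        h2' n (le_trans (le_max_right _ _) hn), ← Finset.sum_add_distrib]
      exact Finset.sum_congr rfl fun r _ => by rw [hadd, smul_add]
  | mul_X p v hp =>
    obtain ⟨n₀, h1, h2⟩ := hp
    have hit : ∀ n : ℕ, (annDer N lq k Φ)^[n + 1] (p * MvPolynomial.X v) =
        (annDer N lq k Φ)^[n + 1] p * MvPolynomial.X v +
          ((n : ℂ) + 1) • ((annDer N lq k Φ)^[n] p *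
            MvPolynomial.C (annShift N lq k Φ v)) := fun n => by
      induction n with
      | zero => simp [hC, Derivation.leibniz]; ring
      | succ n ih =>
        rw [Function.iterate_succ_apply', ih, Function.iterate_succ_apply' _ (n + 1) p,
          map_add, Derivation.map_smul, Derivation.leibniz, Derivation.leibniz, hC, hD,
          ← Function.iterate_succ_apply' (annDer N lq k Φ) n p]
        simp only [smul_eq_mul, MvPolynomial.smul_eq_C_mul, map_add, map_one, Nat.cast_add,
          Nat.cast_one]
        ring
    refine ⟨n₀ + 1, fun n hn => ?_, fun n hn => ?_⟩
    · obtain ⟨m, rfl⟩ := Nat.exists_eq_add_of_le' (le_trans (Nat.le_add_left 1 n₀) hn)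
      rw [hit, h1 _ (by omega), h1 _ (by omega)]
      simp
    · obtain ⟨m, rfl⟩ := Nat.exists_eq_add_of_le' (le_trans (Nat.le_add_left 1 n₀) hn)
      rw [map_mul, hT, mul_add]
      nth_rewrite 1 [h2 (m + 1) (by omega)]
      rw [h2 m (by omega), Finset.sum_range_succ', Finset.sum_range_succ',
        add_mul, Finset.sum_mul, Finset.sum_mul]
      simp only [hit, smul_add, Finset.sum_add_distrib]
      have : ∀ r : ℕ, (((r + 1).factorial : ℂ)⁻¹) • (((r : ℂ) + 1) •
          ((annDer N lq k Φ)^[r] p * MvPolynomial.C (annShift N lq k Φ v))) =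
          ((r.factorial : ℂ)⁻¹) • (annDer N lq k Φ)^[r] p *
            MvPolynomial.C (annShift N lq k Φ v) := fun r => by
        rw [smul_smul, smul_mul_assoc]
        congr 1
        have h3 : (r : ℂ) + 1 ≠ 0 := Nat.cast_add_one_ne_zero r
        rw [Nat.factorial_succ, Nat.cast_mul, mul_inv, Nat.cast_add, Nat.cast_one]
        field_simp
      simp only [this, smul_mul_assoc, Function.iterate_zero, id_eq]
      abel

/-- The exponential `exp (∑ Φ(x_{-m}) x_{-m})` of the creation part of `Φ`, as a power series:
the coefficient of `∏ x_{-m} ^ d(x, m)` is `∏ Φ(x_{-m}) ^ d(x, m) / d(x, m)!`. -/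
def expCre {N : ℕ} (Φ : LinForm N) : MvPowerSeries (Boson N × ℕ+) ℂ := fun d =>
  d.prod fun v r => Φ (Gen.cre v.1 v.2) ^ r / (r.factorial : ℂ)

open Classical in
/-- The normal ordered exponential `:exp Φ:`, that is,
`exp (creation part) * exp (∑ Φ(q_x) q_x) * exp (∑ Φ(p_x) p_x) * exp (annihilation part)`,
where `exp (∑ Φ(q_x) q_x)` raises the eigenvalue of `p_y` by `∑ Φ(q_x) [p_y, q_x]`. -/
def nexp (N : ℕ) (lq k : ℂ) (Φ : LinForm N) : FockOp N := fun s t =>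
  if s.1 = t.1 + (fun y => ∑ x, Φ (Gen.pos x) * rho N k y x) then
    Complex.exp (∑ x, Φ (Gen.mom x) * t.1 x) *
      MvPowerSeries.coeff s.2
        (expCre Φ *
          ((expAnn N lq k Φ (MvPolynomial.monomial t.2 (1 : ℂ)) : Poly N) :
            MvPowerSeries (Boson N × ℕ+) ℂ))
  else 0

/-! ### Boson fields -/

/-- Coefficient of `x_n`, `n ≠ 0`, in `x(L; M | z; α)` at `z = exp u`. -/
def fieldCoeff (lq : ℂ) (L M : List ℂ) (α u : ℂ) (n : ℤ) : ℂ :=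
  -((L.map fun l => qnum lq (l * n)).prod / (M.map fun l => qnum lq (l * n)).prod) /
      qnum lq n * qpow lq (-α * (|n| : ℤ)) * Complex.exp (-n * u)

/-- The boson field `x(L₁, …, L_r; M₁, …, M_r | z; α)` at `z = exp u`. -/
def field {N : ℕ} (lq : ℂ) (L M : List ℂ) (x : Boson N) (α u : ℂ) : LinForm N
  | Gen.cre y m => if y = x then fieldCoeff lq L M α u (-(m : ℤ)) else 0
  | Gen.ann y m => if y = x then fieldCoeff lq L M α u (m : ℤ) else 0
  | Gen.mom y => if y = x then L.prod / M.prod * u else 0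
  | Gen.pos y => if y = x then L.prod / M.prod else 0

/-- The field `x_+(z)` at `z = exp u`. -/
def plusF {N : ℕ} (lq : ℂ) (x : Boson N) (u : ℂ) : LinForm N
  | Gen.ann y m => if y = x then qd lq * Complex.exp (-(m : ℂ) * u) else 0
  | Gen.mom y => if y = x then lq else 0
  | _ => 0

/-- The field `x_-(z)` at `z = exp u`. -/
def minusF {N : ℕ} (lq : ℂ) (x : Boson N) (u : ℂ) : LinForm N
  | Gen.cre y m => if y = x then -(qd lq * Complex.exp ((m : ℂ) * u)) else 0
  | Gen.mom y => if y = x then -lq else 0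
  | _ => 0

/-- The coefficient of `z ^ (-n)` in `x_+(q ^ s z)`. -/
def plusMode (N : ℕ) (lq k : ℂ) (x : Boson N) (s : ℂ) : ℤ → FockOp N
  | Int.ofNat 0 => lq • momOp x
  | Int.ofNat (m + 1) => (qd lq * qpow lq (-s * (m + 1))) • annOp N lq k x m.succPNat
  | Int.negSucc _ => 0

/-- The coefficient of `z ^ (-n)` in `x_-(q ^ s z)`. -/
def minusMode (N : ℕ) (lq : ℂ) (x : Boson N) (s : ℂ) : ℤ → FockOp N
  | Int.ofNat 0 => -(lq • momOp x)
  | Int.ofNat (_ + 1) => 0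
  | Int.negSucc m => -((qd lq * qpow lq (s * (m + 1))) • creOp x m.succPNat)

/-- `f` at the pair `(i, j)`, with labels counted from one as in `1 ≤ i < j ≤ N`; the value is
zero for other labels, in particular for `i = j`. -/
def atRoot (N : ℕ) {M : Type*} [Zero M] (f : PosRoot N → M) (i j : ℕ) : M :=
  if h : 1 ≤ i ∧ i < j ∧ j ≤ N then
    f ⟨(⟨i - 1, by omega⟩, ⟨j - 1, by omega⟩), Fin.mk_lt_mk.mpr (by omega)⟩
  else 0

/-- `b_+ ^ {ij}(z)`. -/
def bP (N : ℕ) (lq : ℂ) (i j : ℕ) (u : ℂ) : LinForm N :=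
  atRoot N (fun r => plusF lq (bB r) u) i j

/-- `b_- ^ {ij}(z)`. -/
def bM (N : ℕ) (lq : ℂ) (i j : ℕ) (u : ℂ) : LinForm N :=
  atRoot N (fun r => minusF lq (bB r) u) i j

/-- `(b + c) ^ {ij}(z)`. -/
def bc (N : ℕ) (lq : ℂ) (i j : ℕ) (u : ℂ) : LinForm N :=
  atRoot N (fun r => field lq [] [] (bB r) 0 u + field lq [] [] (cB r) 0 u) i j

/-! ### The currents

In the following definitions `i₀ : Fin (N - 1)` stands for the label `i = i₀ + 1`. -/

/-- The combination of `b_±` and `a_±` that occurs in `H ^ i(z)`, for given values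
`β i j s` of `b_± ^ {ij}(q ^ {±s} z)` and `a s` of `a_± ^ i(q ^ {±s} z)`. -/
def hComb {M : Type*} [AddCommGroup M] (N : ℕ) (k : ℂ) (i : ℕ)
    (β : ℕ → ℕ → ℂ → M) (a : ℂ → M) : M :=
  (∑ j ∈ Finset.Icc 1 i, (β j (i + 1) (k / 2 + j - 1) - β j i (k / 2 + j)))
    + a (N / 2)
    + ∑ j ∈ Finset.Icc (i + 1) N, (β i j (k / 2 + j) - β (i + 1) j (k / 2 + j - 1))

/-- `H_n ^ i`, the coefficient of `z ^ (-n-1)` in `H ^ i(z)`. -/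
def Hmode (N : ℕ) (lq k : ℂ) (i₀ : Fin (N - 1)) (n : ℤ) : FockOp N :=
  (qd lq)⁻¹ •
    (hComb N k ((i₀ : ℕ) + 1)
        (fun i j s => atRoot N (fun r => plusMode N lq k (bB r) s n) i j)
        (fun s => plusMode N lq k (aB i₀) s n)
      - hComb N k ((i₀ : ℕ) + 1)
        (fun i j s => atRoot N (fun r => minusMode N lq (bB r) (-s) n) i j)
        (fun s => minusMode N lq (aB i₀) (-s) n))

/-- `E ^ {+,i}(z)` at `z = exp u`. -/
def Eplus (N : ℕ) (lq k : ℂ) (i₀ : Fin (N - 1)) (u : ℂ) : FockOp N :=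
  let i : ℕ := (i₀ : ℕ) + 1
  let bp := fun (i j : ℕ) (s : ℂ) => bP N lq i j (u + s * lq)
  let bm := fun (i j : ℕ) (s : ℂ) => bM N lq i j (u + s * lq)
  let e := fun (i j : ℕ) (s : ℂ) => bc N lq i j (u + s * lq)
  (-1 / (qd lq * Complex.exp u)) •
    ∑ j ∈ Finset.Icc 1 i,
      (nexp N lq k (e j i (j - 1) + (bp j (i + 1) (j - 1) - e j (i + 1) j)
          + ∑ l ∈ Finset.Ico 1 j, (bp l (i + 1) (l - 1) - bp l i l))
        - nexp N lq k (e j i (j - 1) + (bm j (i + 1) (j - 1) - e j (i + 1) (j - 2))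
          + ∑ l ∈ Finset.Ico 1 j, (bp l (i + 1) (l - 1) - bp l i l)))

/-- `E ^ {-,i}(z)` at `z = exp u`. -/
def Eminus (N : ℕ) (lq k : ℂ) (i₀ : Fin (N - 1)) (u : ℂ) : FockOp N :=
  let i : ℕ := (i₀ : ℕ) + 1
  let bp := fun (i j : ℕ) (s : ℂ) => bP N lq i j (u + s * lq)
  let bm := fun (i j : ℕ) (s : ℂ) => bM N lq i j (u + s * lq)
  let e := fun (i j : ℕ) (s : ℂ) => bc N lq i j (u + s * lq)
  let ap : LinForm N := plusF lq (aB i₀) (u + (k + N) / 2 * lq)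
  let am : LinForm N := minusF lq (aB i₀) (u + -((k + N) / 2) * lq)
  (-1 / (qd lq * Complex.exp u)) •
    ((∑ j ∈ Finset.Ico 1 i,
        (nexp N lq k (e j (i + 1) (-(k + j))
            + (-bm j i (-(k + j)) - e j i (-(k + j - 1)))
            + ((∑ l ∈ Finset.Icc (j + 1) i, (bm l (i + 1) (-(k + l - 1)) - bm l i (-(k + l))))
              + am
              + ∑ l ∈ Finset.Icc (i + 1) N, (bm i l (-(k + l)) - bm (i + 1) l (-(k + l - 1)))))
          - nexp N lq k (e j (i + 1) (-(k + j))
            + (-bp j i (-(k + j)) - e j i (-(k + j + 1)))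
            + ((∑ l ∈ Finset.Icc (j + 1) i, (bm l (i + 1) (-(k + l - 1)) - bm l i (-(k + l))))
              + am
              + ∑ l ∈ Finset.Icc (i + 1) N,
                  (bm i l (-(k + l)) - bm (i + 1) l (-(k + l - 1)))))))
      + nexp N lq k (e i (i + 1) (-(k + i))
          + (am + ∑ l ∈ Finset.Icc (i + 1) N,
              (bm i l (-(k + l)) - bm (i + 1) l (-(k + l - 1)))))
      - nexp N lq k (e i (i + 1) (k + i)
          + (ap + ∑ l ∈ Finset.Icc (i + 1) N,
              (bp i l (k + l) - bp (i + 1) l (k + l - 1))))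
      - ∑ j ∈ Finset.Icc (i + 2) N,
        (nexp N lq k (e i j (k + j - 1)
            + (bp (i + 1) j (k + j - 1) - e (i + 1) j (k + j))
            + (ap + ∑ l ∈ Finset.Icc j N, (bp i l (k + l) - bp (i + 1) l (k + l - 1))))
          - nexp N lq k (e i j (k + j - 1)
            + (bm (i + 1) j (k + j - 1) - e (i + 1) j (k + j - 2))
            + (ap + ∑ l ∈ Finset.Icc j N, (bp i l (k + l) - bp (i + 1) l (k + l - 1))))))

/-- The current `S̃ ^ i(z)` at `z = exp u`. -/
def Stilde (N : ℕ) (lq k : ℂ) (i₀ : Fin (N - 1)) (u : ℂ) : FockOp N :=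
  let i : ℕ := (i₀ : ℕ) + 1
  let bp := fun (i j : ℕ) (s : ℂ) => bP N lq i j (u + s * lq)
  let bm := fun (i j : ℕ) (s : ℂ) => bM N lq i j (u + s * lq)
  let e := fun (i j : ℕ) (s : ℂ) => bc N lq i j (u + s * lq)
  (-1 / (qd lq * Complex.exp u)) •
    ∑ j ∈ Finset.Icc (i + 1) N,
      (nexp N lq k (e (i + 1) j (N - j) + (-bm i j (N - j) - e i j (N - j + 1))
          + ∑ l ∈ Finset.Icc (j + 1) N, (bm (i + 1) l (N - l + 1) - bm i l (N - l)))
        - nexp N lq k (e (i + 1) j (N - j) + (-bp i j (N - j) - e i j (N - j - 1))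
          + ∑ l ∈ Finset.Icc (j + 1) N, (bm (i + 1) l (N - l + 1) - bm i l (N - l))))

/-- The vertex operator `:exp(-((1/(k+g)) a ^ i)(z; α)):` at `z = exp u`. -/
def aVertex (N : ℕ) (lq k : ℂ) (i₀ : Fin (N - 1)) (α u : ℂ) : FockOp N :=
  nexp N lq k (-field lq [1] [k + N] (aB i₀) α u)

/-- The screening current `S ^ i(z)` at `z = exp u`. The two factors act on different bosons, so
the sum over intermediate states in their product has only one nonzero term. -/
def Scurrent (N : ℕ) (lq k : ℂ) (i₀ : Fin (N - 1)) (u : ℂ) : FockOp N :=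
  comp (aVertex N lq k i₀ ((k + N) / 2) u) (Stilde N lq k i₀ u)

/-! ### Difference operator and operator product expansions -/

/-- The `q`-difference `(f(q ^ α w) - f(q ^ {-α} w)) / ((q - q⁻¹) w)` at `w = exp v`. -/
def qdiff {M : Type*} [AddCommGroup M] [Module ℂ M] (lq α : ℂ) (f : ℂ → M) (v : ℂ) : M :=
  (qd lq * Complex.exp v)⁻¹ • (f (v + α * lq) - f (v - α * lq))

/-- The states on which the fields `exp((b+c)(z))` are single valued in `z`, i.e. expand in integer
powers of `z`: the eigenvalues of all `p_b ^ {ij} + p_c ^ {ij}` are integers. -/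
def Integral {N : ℕ} (t : State N) : Prop :=
  ∀ r : PosRoot N, ∃ m : ℤ, t.1 (bB r) + t.1 (cB r) = m

/-- `f(z,w) A(z) B(w) ≃ g(z,w) B(w) A(z) ∼ reg. + sing(z,w)` at `z = exp u`, `w = exp v`:
there is a function `G`, with matrix elements holomorphic for all nonzero `z` and `w`, such that
`f A B` converges to `G + sing` when `|z| ≫ |w|`, and `g B A` converges to `G + sing` when
`|w| ≫ |z|`. -/
def OPE {N : ℕ} (A B : ℂ → FockOp N) (f g : ℂ → ℂ → ℂ) (sing : ℂ → ℂ → FockOp N) : Prop :=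
  ∃ G : ℂ → ℂ → FockOp N,
    (∀ s t, Integral t →
      AnalyticOnNhd ℂ (fun x : ℂ × ℂ => G x.1 x.2 s t) Set.univ) ∧
    ∃ R : ℝ,
      (∀ u v : ℂ, R * ‖Complex.exp v‖ < ‖Complex.exp u‖ → ∀ s t, Integral t →
        Composable (A u) (B v) s t ∧
        f u v * comp (A u) (B v) s t = G u v s t + sing u v s t) ∧
      (∀ u v : ℂ, R * ‖Complex.exp u‖ < ‖Complex.exp v‖ → ∀ s t, Integral t →
        Composable (B v) (A u) s t ∧
        g u v * comp (B v) (A u) s t = G u v s t + sing u v s t)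

end

end UqSlN

open UqSlN

namespace UqSlN

noncomputable section

open scoped BigOperators
open Filter Topology

/-! ### Exponential polynomials in two variables -/

/-! Every current is a scalar times a signed finite sum of normal ordered exponentials, so the
relations reduce to products of two such exponentials. By Wick's theorem (`hasComp_nexp`) a product
is the exponential of a contraction times the normal ordered exponential of the sum of the
exponents. For the products of `E ^ ±` with `S` each contraction has modes `(q ^ (b n) - q ^ (a n))
(w / z) ^ n / n`, so it exponentiates to `q ^ c (z - q ^ a w) / (z - q ^ b w)`, and the opposite
order yields the expansion of the same rational function for `|w| ≫ |z|` (`Contraction`).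

Partial fractions then leave a constant and a pole at `z = q ^ b w`. On states with integral `b + c`
momenta the matrix elements of the exponentials are Laurent polynomials in `z`, so replacing one by
its value at the pole costs a multiple of `z - q ^ b w` (`expAlg_dvd`). Hence the singular part is
governed by the operators `residue`, one for each pole (`ope_of_residues`), and only these have to
be computed.

At a pole the `b` and `c` fields of both currents sit at matching points, so the exponents of
different pairs of terms coincide there. For `E ^ +` all residues cancel in pairs (`residue_eTerm`).
For `E ^ -` the terms with negative tails have a single pole and those with positive tails one pole
for each column. Again the residues cancel in pairs (`residue_lTerm`, `residue_rTerm`), except for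
one term at each end when `i = j`. In these two the `b` and `c` fields disappear altogether, and
`a_∓` merges with the vertex operator of the boson `a` into the vertex operator with reversed `α` at
`q ^ (±(k+g)) w` (`minusF_add_aV`, `plusF_add_aV`). The two surviving residues have opposite signs
and form the total difference.

For `S̃ S̃` all contractions in a given order share the pole with exponent `-a_ij`, which the
prefactor clears (`ope_of_denominator`); if `a_ij = 0` they are all equal to one. For the modes of
`H` the commutator with a normal ordered exponential is a multiple of that exponential. The multiple
is a pairing of linear forms, and it vanishes because the sums over rows and columns collapse
against the contribution of the boson `a`.

Convergence is uniform in the matrix elements: annihilation and creation parts grow at most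
exponentially in the mode number (`Tame`), so the contraction series converge once `|z / w|` exceeds
a constant. The factors `1 / [(k+g) n]` need not satisfy such a bound, so they are weighed against
the factor `[(k+g) n]` in the commutators of the bosons `a`. -/

/-- The algebra of functions of `(u, v)` generated by `e ^ u`, `e ^ (-u)` and all `e ^ (b v)`. -/
def expAlg : Subalgebra ℂ (ℂ → ℂ → ℂ) :=
  Algebra.adjoin ℂ ({fun u _ => Complex.exp u, fun u _ => Complex.exp (-u)} ∪
    Set.range fun (b : ℂ) (_ v : ℂ) => Complex.exp (b * v))

theorem expAlg_exp_fst : (fun u _ => Complex.exp u) ∈ expAlg :=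
  Algebra.subset_adjoin (by simp)

theorem expAlg_exp_neg_fst : (fun u _ => Complex.exp (-u)) ∈ expAlg :=
  Algebra.subset_adjoin (by simp)

theorem expAlg_exp_snd (b : ℂ) : (fun _ v => Complex.exp (b * v)) ∈ expAlg :=
  Algebra.subset_adjoin (Or.inr ⟨b, rfl⟩)

theorem expAlg_const (c : ℂ) : (fun _ _ => c) ∈ expAlg :=
  expAlg.algebraMap_mem c

theorem expAlg_add {F G : ℂ → ℂ → ℂ} (hF : F ∈ expAlg) (hG : G ∈ expAlg) :
    (fun u v => F u v + G u v) ∈ expAlg := expAlg.add_mem hF hG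

theorem expAlg_sub {F G : ℂ → ℂ → ℂ} (hF : F ∈ expAlg) (hG : G ∈ expAlg) :
    (fun u v => F u v - G u v) ∈ expAlg := expAlg.sub_mem hF hG

theorem expAlg_neg {F : ℂ → ℂ → ℂ} (hF : F ∈ expAlg) :
    (fun u v => -F u v) ∈ expAlg := expAlg.neg_mem hF

theorem expAlg_mul {F G : ℂ → ℂ → ℂ} (hF : F ∈ expAlg) (hG : G ∈ expAlg) :
    (fun u v => F u v * G u v) ∈ expAlg := expAlg.mul_mem hF hG

theorem expAlg_const_mul {F : ℂ → ℂ → ℂ} (c : ℂ) (hF : F ∈ expAlg) :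
    (fun u v => c * F u v) ∈ expAlg := expAlg_mul (expAlg_const c) hF

theorem expAlg_pow {F : ℂ → ℂ → ℂ} (hF : F ∈ expAlg) (n : ℕ) :
    (fun u v => F u v ^ n) ∈ expAlg := expAlg.pow_mem hF n

theorem expAlg_sum {ι : Type*} (s : Finset ι) {F : ι → ℂ → ℂ → ℂ} (hF : ∀ i ∈ s, F i ∈ expAlg) :
    (fun u v => ∑ i ∈ s, F i u v) ∈ expAlg := by
  have := expAlg.sum_mem hF
  convert this using 1
  ext u v
  simp

theorem expAlg_prod {ι : Type*} (s : Finset ι) {F : ι → ℂ → ℂ → ℂ} (hF : ∀ i ∈ s, F i ∈ expAlg) :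
    (fun u v => ∏ i ∈ s, F i u v) ∈ expAlg := by
  have := expAlg.prod_mem hF
  convert this using 1
  ext u v
  simp

theorem expAlg_exp_int (a : ℤ) : (fun u _ => Complex.exp (a * u)) ∈ expAlg := by
  obtain ⟨n, rfl | rfl⟩ := a.eq_nat_or_neg
  · convert expAlg_pow expAlg_exp_fst n using 3
    rw [← Complex.exp_nat_mul]; simp
  · convert expAlg_pow expAlg_exp_neg_fst n using 3
    rw [← Complex.exp_nat_mul]; simp

theorem expAlg_exp_affine (a : ℤ) (b c : ℂ) :
    (fun u v => Complex.exp (a * u + b * v + c)) ∈ expAlg := by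
  convert expAlg_mul (expAlg_mul (expAlg_exp_int a) (expAlg_exp_snd b))
    (expAlg_const (Complex.exp c)) using 3
  rw [Complex.exp_add, Complex.exp_add]

theorem expAlg_analytic {F : ℂ → ℂ → ℂ} (hF : F ∈ expAlg) :
    AnalyticOnNhd ℂ (fun x : ℂ × ℂ => F x.1 x.2) Set.univ := by
  induction hF using Algebra.adjoin_induction with
  | mem F hF =>
    rcases hF with (rfl | rfl) | ⟨b, rfl⟩
    · exact fun x _ => analyticAt_fst.cexp
    · exact fun x _ => analyticAt_fst.neg.cexp
    · exact fun x _ => (analyticAt_const.mul analyticAt_snd).cexp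
  | algebraMap r => exact fun x _ => analyticAt_const
  | add F G _ _ h1 h2 => exact h1.add h2
  | mul F G _ _ h1 h2 => exact h1.mul h2

/-- Restriction to the divisor `u = v + c`. -/
theorem expAlg_restrict {F : ℂ → ℂ → ℂ} (hF : F ∈ expAlg) (c : ℂ) :
    (fun _ v => F (v + c) v) ∈ expAlg := by
  induction hF using Algebra.adjoin_induction with
  | mem F hF =>
    rcases hF with (rfl | rfl) | ⟨b, rfl⟩
    · simpa using expAlg_exp_affine 0 1 c
    · simpa [add_comm] using expAlg_exp_affine 0 (-1) (-c)
    · exact expAlg_exp_snd b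
  | algebraMap r => exact expAlg_const r
  | add F G _ _ h1 h2 => exact expAlg_add h1 h2
  | mul F G _ _ h1 h2 => exact expAlg_mul h1 h2

/-- The property passes to products because `F G - F₀ G₀ = (F - F₀) G + F₀ (G - G₀)`, so only the
generators matter. This is why `expAlg` admits only integral powers of `e ^ u`: for any other power
the quotient would have poles at the points `u = v + c + 2πi m`. Powers of `e ^ v` are unrestricted,
since the restriction does not touch them. -/
theorem expAlg_sub_restrict_dvd {F : ℂ → ℂ → ℂ} (hF : F ∈ expAlg) (c : ℂ) :
    ∃ G ∈ expAlg, ∀ u v, F u v - F (v + c) v = (Complex.exp u - Complex.exp (v + c)) * G u v := by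
  induction hF using Algebra.adjoin_induction with
  | mem F hF =>
    rcases hF with (rfl | rfl) | ⟨b, rfl⟩
    · exact ⟨fun _ _ => 1, expAlg_const 1, fun u v => by simp⟩
    · refine ⟨fun u v => -Complex.exp (((-1 : ℤ) : ℂ) * u + (-1) * v + (-c)),
        expAlg_neg (expAlg_exp_affine _ _ _), fun u v => ?_⟩
      have h1 : Complex.exp u ≠ 0 := Complex.exp_ne_zero u
      have h2 : Complex.exp (v + c) ≠ 0 := Complex.exp_ne_zero _
      have h3 : Complex.exp (((-1 : ℤ) : ℂ) * u + (-1) * v + (-c)) =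
          (Complex.exp u)⁻¹ * (Complex.exp (v + c))⁻¹ := by
        rw [← Complex.exp_neg, ← Complex.exp_neg, ← Complex.exp_add]
        congr 1; push_cast; ring
      simp only [h3, Complex.exp_neg]
      field_simp
      ring
    · exact ⟨fun _ _ => 0, expAlg_const 0, fun u v => by simp⟩
  | algebraMap r => exact ⟨fun _ _ => 0, expAlg_const 0, fun u v => by simp⟩
  | add F G _ _ h1 h2 =>
    obtain ⟨F', hF', h1⟩ := h1
    obtain ⟨G', hG', h2⟩ := h2
    refine ⟨_, expAlg_add hF' hG', fun u v => ?_⟩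
    rw [mul_add, ← h1, ← h2]
    simp only [Pi.add_apply]; ring
  | mul F G hF hG h1 h2 =>
    obtain ⟨F', hF', h1⟩ := h1
    obtain ⟨G', hG', h2⟩ := h2
    refine ⟨_, expAlg_add (expAlg_mul hF' hG) (expAlg_mul (expAlg_restrict hF c) hG'),
      fun u v => ?_⟩
    have e1 := h1 u v
    have e2 := h2 u v
    simp only [Pi.mul_apply]
    linear_combination e1 * G u v + e2 * F (v + c) v

/-- An exponential polynomial vanishing on `u = v + c` is divisible by `e ^ u - e ^ (v + c)`. -/
theorem expAlg_dvd {F : ℂ → ℂ → ℂ} (hF : F ∈ expAlg) (c : ℂ) (h0 : ∀ v, F (v + c) v = 0) :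
    ∃ G ∈ expAlg, ∀ u v, F u v = (Complex.exp u - Complex.exp (v + c)) * G u v := by
  obtain ⟨G, hG, h⟩ := expAlg_sub_restrict_dvd hF c
  exact ⟨G, hG, fun u v => by rw [← h, h0, sub_zero]⟩

/-! ### Products of operators -/

/-- `C` is the product `A B`, all series in the matrix elements being summable. -/
def HasComp {N : ℕ} (A B C : FockOp N) : Prop :=
  ∀ s t, HasSum (fun m : State N => A s m * B m t) (C s t)

namespace HasComp

variable {N : ℕ} {A A' B B' C C' : FockOp N}

theorem composable (h : HasComp A B C) (s t : State N) : Composable A B s t := (h s t).summable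

theorem comp_eq (h : HasComp A B C) : comp A B = C := by
  funext s t; exact (h s t).tsum_eq

theorem zero_left : HasComp 0 B 0 := fun s t => by simp

theorem zero_right : HasComp A 0 0 := fun s t => by simp

theorem add_left (h : HasComp A B C) (h' : HasComp A' B C') : HasComp (A + A') B (C + C') :=
  fun s t => by simpa [add_mul] using (h s t).add (h' s t)

theorem add_right (h : HasComp A B C) (h' : HasComp A B' C') : HasComp A (B + B') (C + C') :=
  fun s t => by simpa [mul_add] using (h s t).add (h' s t)

theorem smul_left (c : ℂ) (h : HasComp A B C) : HasComp (c • A) B (c • C) :=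
  fun s t => by simpa [mul_assoc] using (h s t).mul_left c

theorem smul_right (c : ℂ) (h : HasComp A B C) : HasComp A (c • B) (c • C) :=
  fun s t => by simpa [mul_left_comm] using (h s t).mul_left c

theorem sum_left {ι : Type*} (I : Finset ι) {A C : ι → FockOp N}
    (h : ∀ i ∈ I, HasComp (A i) B (C i)) : HasComp (∑ i ∈ I, A i) B (∑ i ∈ I, C i) := by
  classical
  induction I using Finset.induction_on with
  | empty => simpa using zero_left
  | insert a s ha ih =>
    rw [Finset.sum_insert ha, Finset.sum_insert ha]
    exact (h a (Finset.mem_insert_self a s)).add_left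
      (ih fun i hi => h i (Finset.mem_insert_of_mem hi))

theorem sum_right {ι : Type*} (I : Finset ι) {B C : ι → FockOp N}
    (h : ∀ i ∈ I, HasComp A (B i) (C i)) : HasComp A (∑ i ∈ I, B i) (∑ i ∈ I, C i) := by
  classical
  induction I using Finset.induction_on with
  | empty => simpa using zero_right
  | insert a s ha ih =>
    rw [Finset.sum_insert ha, Finset.sum_insert ha]
    exact (h a (Finset.mem_insert_self a s)).add_right
      (ih fun i hi => h i (Finset.mem_insert_of_mem hi))

/-- The product of two finite linear combinations. -/
theorem smul_sum_smul_sum {ι κ : Type*} (I : Finset ι) (J : Finset κ) (a b : ℂ) (ε : ι → ℂ)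
    (η : κ → ℂ) {A : ι → FockOp N} {B : κ → FockOp N} {C : ι → κ → FockOp N}
    (h : ∀ i ∈ I, ∀ j ∈ J, HasComp (A i) (B j) (C i j)) :
    HasComp (a • ∑ i ∈ I, ε i • A i) (b • ∑ j ∈ J, η j • B j)
      (a • ∑ i ∈ I, ε i • b • ∑ j ∈ J, η j • C i j) :=
  (sum_left I fun i hi => ((sum_right J fun j hj => (h i hi j hj).smul_right _).smul_right
    b).smul_left _).smul_left a

end HasComp

end

end UqSlN

namespace UqSlN

noncomputable section

open scoped BigOperators
open Filter Topology

/-! ### Exponential power series -/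

section ExpSeries

variable {σ : Type*}

/-- The power series `exp (∑ φ v X v)`. -/
def expSeries (φ : σ → ℂ) : MvPowerSeries σ ℂ := fun d =>
  d.prod fun v r => φ v ^ r / (r.factorial : ℂ)

/-- The substitution `X v ↦ X v + c v`. -/
def shiftHom (c : σ → ℂ) : MvPolynomial σ ℂ →ₐ[ℂ] MvPolynomial σ ℂ :=
  MvPolynomial.aeval fun v => MvPolynomial.X v + MvPolynomial.C (c v)

theorem coeff_expSeries (φ : σ → ℂ) (d : σ →₀ ℕ) :
    MvPowerSeries.coeff d (expSeries φ) = d.prod fun v r => φ v ^ r / (r.factorial : ℂ) := rfl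

theorem coeff_expSeries_zero (φ : σ → ℂ) : MvPowerSeries.coeff 0 (expSeries φ) = 1 := by
  rw [coeff_expSeries, Finsupp.prod_zero_index]

theorem coeff_expSeries_add_single (φ : σ → ℂ) (d : σ →₀ ℕ) (v : σ) :
    MvPowerSeries.coeff (d + Finsupp.single v 1) (expSeries φ) * (d v + 1) =
      φ v * MvPowerSeries.coeff d (expSeries φ) := by
  classical
  have h0 : ∀ i : σ, φ i ^ 0 / ((Nat.factorial 0 : ℕ) : ℂ) = 1 := by simp
  rw [coeff_expSeries, coeff_expSeries, ← Finsupp.mul_prod_erase' _ v _ h0,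
    ← Finsupp.mul_prod_erase' d v _ h0, Finsupp.erase_add, Finsupp.erase_single, add_zero]
  have h1 : ((d v : ℂ) + 1) ≠ 0 := Nat.cast_add_one_ne_zero _
  simp only [Finsupp.add_apply, Finsupp.single_eq_same, Nat.factorial_succ, Nat.cast_mul,
    Nat.cast_add, Nat.cast_one, pow_succ]
  have h2 : ((d v).factorial : ℂ) ≠ 0 := Nat.cast_ne_zero.mpr (Nat.factorial_ne_zero _)
  field_simp

theorem pderiv_expSeries (φ : σ → ℂ) (v : σ) :
    MvPowerSeries.pderiv ℂ v (expSeries φ) = φ v • expSeries φ := by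
  ext d
  rw [MvPowerSeries.coeff_pderiv, coeff_expSeries_add_single, map_smul, smul_eq_mul]

/-- Induction on monomials by multiplying with one variable at a time. -/
theorem finsupp_nat_induction {p : (σ →₀ ℕ) → Prop} (h0 : p 0)
    (h1 : ∀ d v, p d → p (d + Finsupp.single v 1)) (d : σ →₀ ℕ) : p d := by
  classical
  induction d using Finsupp.induction with
  | zero => exact h0
  | single_add a b f ha hb ih =>
    clear ha hb
    induction b with
    | zero => simpa using ih
    | succ b ihb =>
      rw [Finsupp.single_add, add_assoc, add_comm (Finsupp.single a 1), ← add_assoc]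
      exact h1 _ _ ihb

/-- The first order equations determine each coefficient from one of lower degree, so a solution
with constant term one is unique. -/
theorem eq_expSeries {F : MvPowerSeries σ ℂ} {φ : σ → ℂ}
    (hF : ∀ v, MvPowerSeries.pderiv ℂ v F = φ v • F) (h0 : MvPowerSeries.coeff 0 F = 1) :
    F = expSeries φ := by
  ext d
  induction d using finsupp_nat_induction with
  | h0 => rw [h0, coeff_expSeries_zero]
  | h1 d v ih =>
    have h1 := congrArg (MvPowerSeries.coeff d) (hF v)
    rw [MvPowerSeries.coeff_pderiv, map_smul, smul_eq_mul, ih, ← coeff_expSeries_add_single] at h1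
    exact mul_right_cancel₀ (Nat.cast_add_one_ne_zero _) h1

/-- By the Leibniz rule the product solves the first order equations that characterise the
exponential of the sum. -/
theorem expSeries_add (φ ψ : σ → ℂ) : expSeries (φ + ψ) = expSeries φ * expSeries ψ := by
  refine (eq_expSeries (fun v => ?_) ?_).symm
  · rw [Derivation.leibniz, pderiv_expSeries, pderiv_expSeries]
    simp only [smul_eq_mul, Pi.add_apply, add_smul]
    rw [Algebra.mul_smul_comm, Algebra.mul_smul_comm, mul_comm (expSeries ψ), add_comm]
  · have := coeff_expSeries_zero φ
    have h' := coeff_expSeries_zero ψ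
    rw [MvPowerSeries.coeff_zero_eq_constantCoeff] at *
    rw [map_mul, this, h', one_mul]

theorem shiftHom_comp (c d : σ → ℂ) (P : MvPolynomial σ ℂ) :
    shiftHom c (shiftHom d P) = shiftHom (c + d) P := by
  rw [← AlgHom.comp_apply]
  congr 1
  ext v
  simp [shiftHom, MvPolynomial.algebraMap_eq, add_assoc]

theorem pderiv_shiftHom (c : σ → ℂ) (v : σ) (P : MvPolynomial σ ℂ) :
    MvPolynomial.pderiv v (shiftHom c P) = shiftHom c (MvPolynomial.pderiv v P) := by
  classical
  induction P using MvPolynomial.induction_on with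
  | C a => simp [shiftHom]
  | add p r hp hr => simp [hp, hr]
  | mul_X p w hp =>
    rw [map_mul, Derivation.leibniz, Derivation.leibniz, map_add, hp]
    simp only [smul_eq_mul, map_mul]
    congr 2
    simp only [shiftHom, MvPolynomial.aeval_X, map_add, MvPolynomial.pderiv_X,
      MvPolynomial.pderiv_C, add_zero]
    by_cases h : v = w
    · subst h; simp
    · simp [Ne.symm h]

theorem coeff_zero_shiftHom_monomial (c : σ → ℂ) (n : σ →₀ ℕ) :
    MvPolynomial.coeff 0 (shiftHom c (MvPolynomial.monomial n (1 : ℂ))) =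
      n.prod fun v r => c v ^ r := by
  rw [shiftHom, MvPolynomial.aeval_monomial, map_one, one_mul,
    ← MvPolynomial.constantCoeff_eq, map_finsuppProd]
  simp

theorem shiftHom_monomial_add_single (c : σ → ℂ) (n : σ →₀ ℕ) (v : σ) :
    shiftHom c (MvPolynomial.monomial (n + Finsupp.single v 1) (1 : ℂ)) =
      shiftHom c (MvPolynomial.monomial n (1 : ℂ)) * MvPolynomial.X v +
        c v • shiftHom c (MvPolynomial.monomial n (1 : ℂ)) := by
  rw [← one_mul (1 : ℂ), ← MvPolynomial.monomial_mul, map_mul, one_mul]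
  have : shiftHom c (MvPolynomial.monomial (Finsupp.single v 1) (1 : ℂ)) =
      MvPolynomial.X v + MvPolynomial.C (c v) := MvPolynomial.aeval_X _ _
  rw [this, mul_add, MvPolynomial.smul_eq_C_mul, mul_comm _ (MvPolynomial.C _)]

theorem coeff_mul_X_series [DecidableEq σ] (F : MvPowerSeries σ ℂ) (n : σ →₀ ℕ)
    (v : σ) : MvPowerSeries.coeff n (F * MvPowerSeries.X v) =
      if Finsupp.single v 1 ≤ n then MvPowerSeries.coeff (n - Finsupp.single v 1) F else 0 := by
  rw [MvPowerSeries.X, MvPowerSeries.coeff_mul_monomial]; simp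

/-! ### The sum of `∏ x ^ n / n!` over all exponents -/

theorem sum_finsupp_prod [DecidableEq σ] {R : Type*} [CommSemiring R] (S : Finset σ)
    (T : Finset ℕ) (f : σ → ℕ → R) (hf : ∀ v, f v 0 = 1) :
    ∑ d ∈ S.finsupp (fun _ => T), d.prod f = ∏ v ∈ S, ∑ r ∈ T, f v r := by
  rw [Finset.prod_sum, Finset.finsupp, Finset.sum_map]
  refine Finset.sum_congr (by congr!) fun p hp => ?_
  change (Finsupp.indicator S p).prod f = _
  rw [Finsupp.prod_of_support_subset (s := S) _ (Finsupp.support_indicator_subset _ _) _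
    (fun i _ => hf i), ← Finset.prod_attach]
  refine Finset.prod_congr rfl fun i _ => ?_
  simp [Finsupp.indicator_of_mem i.2]

/-- A finite set of exponents lies in a box: support in a finite `S`, all entries less than `K`.
Over a box the sum of the norms factors into truncated exponential series, so every finite partial
sum is at most `exp (∑ ‖x v‖)`. -/
theorem summable_finsupp_prod_exp {x : σ → ℂ} (hx : Summable x) :
    Summable fun n : σ →₀ ℕ => n.prod fun v r => x v ^ r / (r.factorial : ℂ) := by
  classical
  refine Summable.of_norm (summable_of_sum_le (c := Real.exp (∑' v, ‖x v‖))
    (fun _ => norm_nonneg _) fun T => ?_)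
  set S : Finset σ := T.biUnion Finsupp.support with hS
  set K : ℕ := (T.sup fun d => d.sum fun _ r => r) + 1 with hK
  have hsub : T ⊆ S.finsupp (fun _ => Finset.range K) := fun d hd => by
    rw [Finset.mem_finsupp_iff]
    refine ⟨Finset.subset_biUnion_of_mem _ hd, fun i _ => ?_⟩
    rw [Finset.mem_range, hK, Nat.lt_succ_iff]
    refine le_trans ?_ (Finset.le_sup (f := fun d : σ →₀ ℕ => d.sum fun _ r => r) hd)
    by_cases hi : i ∈ d.support
    · exact Finset.single_le_sum (f := fun i => d i) (fun _ _ => Nat.zero_le _) hi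
    · rw [Finsupp.notMem_support_iff.1 hi]; exact Nat.zero_le _
  have hnorm : ∀ n : σ →₀ ℕ, ‖n.prod fun v r => x v ^ r / (r.factorial : ℂ)‖ =
      n.prod fun v r => ‖x v‖ ^ r / (r.factorial : ℝ) := fun n => by
    simp [Finsupp.prod, norm_prod]
  calc ∑ d ∈ T, ‖d.prod fun v r => x v ^ r / (r.factorial : ℂ)‖
      ≤ ∑ d ∈ S.finsupp (fun _ => Finset.range K),
          ‖d.prod fun v r => x v ^ r / (r.factorial : ℂ)‖ :=
        Finset.sum_le_sum_of_subset_of_nonneg hsub fun _ _ _ => norm_nonneg _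
    _ = ∏ v ∈ S, ∑ r ∈ Finset.range K, ‖x v‖ ^ r / (r.factorial : ℝ) := by
        simp only [hnorm]
        exact sum_finsupp_prod S _ _ (by simp)
    _ ≤ ∏ v ∈ S, Real.exp ‖x v‖ := Finset.prod_le_prod
        (fun v _ => Finset.sum_nonneg fun r _ => by positivity)
        fun v _ => Real.sum_le_exp_of_nonneg (norm_nonneg _) _
    _ = Real.exp (∑ v ∈ S, ‖x v‖) := (Real.exp_sum _ _).symm
    _ ≤ Real.exp (∑' v, ‖x v‖) := Real.exp_le_exp.mpr
        (hx.norm.sum_le_tsum _ fun _ _ => norm_nonneg _)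

/-- Summability being known, the value may be computed along boxes. For fixed `S` the box sum tends
to `exp (∑ v ∈ S, x v)` as `K` grows, and then `S` exhausts the index set. -/
theorem hasSum_finsupp_prod_exp {x : σ → ℂ} (hx : Summable x) :
    HasSum (fun n : σ →₀ ℕ => n.prod fun v r => x v ^ r / (r.factorial : ℂ))
      (Complex.exp (∑' v, x v)) := by
  classical
  obtain ⟨a, ha⟩ := summable_finsupp_prod_exp hx
  suffices h : Tendsto (fun S : Finset σ => Complex.exp (∑ v ∈ S, x v)) atTop (𝓝 a) by
    rwa [tendsto_nhds_unique ((Complex.continuous_exp.tendsto _).comp hx.hasSum) h]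
  rw [Metric.tendsto_atTop]
  intro ε hε
  obtain ⟨T, hT⟩ := (Metric.tendsto_atTop.1 ha) (ε / 2) (by positivity)
  refine ⟨T.biUnion Finsupp.support, fun S hS => lt_of_le_of_lt ?_ (half_lt_self hε)⟩
  have hlim : Tendsto (fun K : ℕ => ∏ v ∈ S, ∑ r ∈ Finset.range K, x v ^ r / (r.factorial : ℂ))
      atTop (𝓝 (Complex.exp (∑ v ∈ S, x v))) := by
    rw [Complex.exp_sum]
    refine tendsto_finsetProd _ fun v _ => ?_
    have := (NormedSpace.expSeries_div_hasSum_exp (x v)).tendsto_sum_nat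
    rwa [← Complex.exp_eq_exp_ℂ] at this
  refine le_of_tendsto (hlim.dist tendsto_const_nhds) ?_
  -- From this size on the box contains `T`, so its sum is close to `a`.
  filter_upwards [eventually_gt_atTop (T.sup fun d => d.sum fun _ r => r)] with K hK
  rw [← sum_finsupp_prod S _ (fun v r => x v ^ r / (r.factorial : ℂ)) (by simp)]
  refine (hT _ fun d hd => ?_).le
  rw [Finset.mem_finsupp_iff]
  refine ⟨(Finset.subset_biUnion_of_mem Finsupp.support hd).trans hS, fun i _ => ?_⟩
  rw [Finset.mem_range]
  refine lt_of_le_of_lt (le_trans ?_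
    (Finset.le_sup (f := fun d : σ →₀ ℕ => d.sum fun _ r => r) hd)) hK
  by_cases hi : i ∈ d.support
  · exact Finset.single_le_sum (f := fun i => d i) (fun _ _ => Nat.zero_le _) hi
  · rw [Finsupp.notMem_support_iff.1 hi]; exact Nat.zero_le _

theorem hasSum_of_eq {ι : Type*} {f g : ι → ℂ} {a b : ℂ} (h : HasSum f a)
    (hf : ∀ n, g n = f n) (hab : b = a) : HasSum g b := by
  rw [hab, funext hf]; exact h

/-- The commutation of `exp (∑ c v ∂ v)` with `exp (∑ ψ v X v)`, on matrix elements. -/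
theorem hasSum_shiftHom_expSeries {c ψ : σ → ℂ} (h : Summable fun v => c v * ψ v)
    (e : σ →₀ ℕ) :
    HasSum (fun n : σ →₀ ℕ => MvPolynomial.coeff e (shiftHom c (MvPolynomial.monomial n (1 : ℂ))) *
      MvPowerSeries.coeff n (expSeries ψ))
      (Complex.exp (∑' v, c v * ψ v) * MvPowerSeries.coeff e (expSeries ψ)) := by
  classical
  induction e using finsupp_nat_induction with
  | h0 =>
    rw [coeff_expSeries_zero, mul_one]
    refine (hasSum_finsupp_prod_exp h).congr_fun fun n => ?_
    rw [coeff_zero_shiftHom_monomial, coeff_expSeries, ← Finsupp.prod_mul]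
    simp only [mul_pow, mul_div_assoc]
  | h1 e v ih =>
    have hne : ((e v : ℂ) + 1) ≠ 0 := Nat.cast_add_one_ne_zero _
    have hinj : Function.Injective fun n : σ →₀ ℕ => n + Finsupp.single v 1 :=
      add_left_injective _
    -- The derivative in `v` lowers `e + v` to `e` and commutes with the translation of variables.
    have key : ∀ n : σ →₀ ℕ, MvPolynomial.coeff (e + Finsupp.single v 1)
        (shiftHom c (MvPolynomial.monomial n (1 : ℂ))) =
        ((e v : ℂ) + 1)⁻¹ * (n v * MvPolynomial.coeff e
          (shiftHom c (MvPolynomial.monomial (n - Finsupp.single v 1) (1 : ℂ)))) := fun n => by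
      rw [eq_inv_mul_iff_mul_eq₀ hne, mul_comm, ← MvPolynomial.coeff_pderiv, pderiv_shiftHom,
        MvPolynomial.pderiv_monomial, one_mul, ← mul_one (n v : ℂ), ← smul_eq_mul,
        ← MvPolynomial.smul_monomial, map_smul, MvPolynomial.coeff_smul, smul_eq_mul, smul_eq_mul,
        mul_one]
    -- By `key` only exponents `n` that contain `v` contribute. After shifting them down by `v` the
    -- series is the one for `e`, up to the ratio of consecutive coefficients of the exponential.
    rw [← hinj.hasSum_iff]
    · have := (ih.mul_left (((e v : ℂ) + 1)⁻¹ * ψ v))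
      refine hasSum_of_eq this (fun n => ?_) ?_
      · simp only [Function.comp_apply]
        rw [key, add_tsub_cancel_right]
        have := coeff_expSeries_add_single ψ n v
        simp only [Finsupp.add_apply, Finsupp.single_eq_same, Nat.cast_add, Nat.cast_one]
        linear_combination ((e v : ℂ) + 1)⁻¹ *
          MvPolynomial.coeff e (shiftHom c (MvPolynomial.monomial n (1 : ℂ))) * this
      · have := coeff_expSeries_add_single ψ e v
        field_simp
        linear_combination this
    · intro n hn
      have h0 : n v = 0 := by
        by_contra h0
        refine hn ⟨n - Finsupp.single v 1, tsub_add_cancel_of_le ?_⟩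
        rw [Finsupp.single_le_iff]; omega
      rw [key, h0]; simp

/-- This lets the two exponentials act on an arbitrary polynomial state instead of the vacuum. The
induction on `P` uses that moving the translation past multiplication by `X v` replaces `X v` by `X
v + c v`. -/
theorem hasSum_shiftHom_expSeries_mul {c ψ : σ → ℂ} (h : Summable fun v => c v * ψ v)
    (P : MvPolynomial σ ℂ) (e : σ →₀ ℕ) :
    HasSum (fun n : σ →₀ ℕ => MvPolynomial.coeff e (shiftHom c (MvPolynomial.monomial n (1 : ℂ))) *
      MvPowerSeries.coeff n (expSeries ψ * (P : MvPowerSeries σ ℂ)))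
      (Complex.exp (∑' v, c v * ψ v) *
        MvPowerSeries.coeff e (expSeries ψ * (shiftHom c P : MvPowerSeries σ ℂ))) := by
  classical
  induction P using MvPolynomial.induction_on generalizing e with
  | C a =>
    have := (hasSum_shiftHom_expSeries h e).mul_right a
    refine hasSum_of_eq this (fun n => ?_) ?_
    · rw [MvPolynomial.coe_C, mul_comm (expSeries ψ), MvPowerSeries.coeff_C_mul]; ring
    · rw [shiftHom, MvPolynomial.aeval_C, MvPolynomial.algebraMap_eq, MvPolynomial.coe_C,
        mul_comm (expSeries ψ), MvPowerSeries.coeff_C_mul]; ring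
  | add P Q hP hQ =>
    refine hasSum_of_eq ((hP e).add (hQ e)) (fun n => ?_) ?_
    · rw [MvPolynomial.coe_add, mul_add, map_add, mul_add]
    · rw [map_add, MvPolynomial.coe_add, mul_add, map_add, mul_add]
  | mul_X P v hP =>
    have hinj : Function.Injective fun n : σ →₀ ℕ => n + Finsupp.single v 1 :=
      add_left_injective _
    rw [← hinj.hasSum_iff]
    · have h2 := (hP e).mul_left (c v)
      have h1 : HasSum (fun n : σ →₀ ℕ => (if Finsupp.single v 1 ≤ e then
          MvPolynomial.coeff (e - Finsupp.single v 1)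
            (shiftHom c (MvPolynomial.monomial n (1 : ℂ))) *
          MvPowerSeries.coeff n (expSeries ψ * (P : MvPowerSeries σ ℂ)) else 0))
          (if Finsupp.single v 1 ≤ e then Complex.exp (∑' v, c v * ψ v) *
            MvPowerSeries.coeff (e - Finsupp.single v 1)
              (expSeries ψ * (shiftHom c P : MvPowerSeries σ ℂ)) else 0) := by
        split_ifs
        · exact hP _
        · exact hasSum_zero
      refine hasSum_of_eq (h1.add h2) (fun n => ?_) ?_
      · simp only [Function.comp_apply]
        rw [shiftHom_monomial_add_single, MvPolynomial.coe_mul, MvPolynomial.coe_X, ← mul_assoc, coeff_mul_X_series, if_pos (by simp),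
          add_tsub_cancel_right, MvPolynomial.coeff_add, MvPolynomial.coeff_mul_X',
          MvPolynomial.coeff_smul]
        simp only [Finsupp.single_le_iff, Finsupp.mem_support_iff, Nat.one_le_iff_ne_zero]
        split_ifs <;> simp <;> ring
      · have : shiftHom c (P * MvPolynomial.X v) = shiftHom c P * MvPolynomial.X v +
            c v • shiftHom c P := by
          rw [map_mul]
          have : shiftHom c (MvPolynomial.X v) =
            MvPolynomial.X v + MvPolynomial.C (c v) := MvPolynomial.aeval_X _ _
          rw [this, mul_add, MvPolynomial.smul_eq_C_mul, mul_comm _ (MvPolynomial.C _)]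
        rw [this, MvPolynomial.coe_add, MvPolynomial.coe_mul, MvPolynomial.coe_X, mul_add, map_add,
          ← mul_assoc, coeff_mul_X_series, MvPolynomial.coe_smul, Algebra.mul_smul_comm, map_smul, smul_eq_mul]
        split_ifs <;> ring
    · intro n hn
      rw [MvPolynomial.coe_mul, MvPolynomial.coe_X, ← mul_assoc, coeff_mul_X_series, if_neg, mul_zero]
      exact fun h0 => hn ⟨n - Finsupp.single v 1, tsub_add_cancel_of_le h0⟩

end ExpSeries

end

end UqSlN

namespace UqSlN

noncomputable section

open scoped BigOperators
open Filter Topology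

/-! ### Products of normal ordered exponentials -/

section Nexp

variable {N : ℕ} {lq k : ℂ}

/-- The shift of the momenta produced by `nexp Φ`. -/
def posShift (k : ℂ) (Φ : LinForm N) (y : Boson N) : ℂ := ∑ x, Φ (Gen.pos x) * rho N k y x

/-- The creation part of a form. -/
def crePart (Φ : LinForm N) (v : Boson N × ℕ+) : ℂ := Φ (Gen.cre v.1 v.2)

theorem crePart_add (Φ Ψ : LinForm N) : crePart (Φ + Ψ) = crePart Φ + crePart Ψ := rfl

theorem annShift_add (Φ Ψ : LinForm N) :
    annShift N lq k (Φ + Ψ) = annShift N lq k Φ + annShift N lq k Ψ := by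
  funext v
  simp [annShift, add_mul, Finset.sum_add_distrib]

theorem posShift_add (Φ Ψ : LinForm N) :
    posShift k (Φ + Ψ) = posShift k Φ + posShift k Ψ := by
  funext v
  simp [posShift, add_mul, Finset.sum_add_distrib]

open Classical in
theorem nexp_apply (Φ : LinForm N) (s t : State N) :
    nexp N lq k Φ s t = if s.1 = t.1 + posShift k Φ then
      Complex.exp (∑ x, Φ (Gen.mom x) * t.1 x) * MvPowerSeries.coeff s.2
        (expSeries (crePart Φ) * (shiftHom (annShift N lq k Φ)
          (MvPolynomial.monomial t.2 (1 : ℂ)) : MvPowerSeries (Boson N × ℕ+) ℂ)) else 0 := rfl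

/-- A sum over intermediate states of fixed momentum. -/
theorem hasSum_state {f : State N → ℂ} {p : Boson N → ℂ} {a : ℂ}
    (h0 : ∀ m : State N, m.1 ≠ p → f m = 0) (h : HasSum (fun d => f (p, d)) a) : HasSum f a := by
  have hinj : Function.Injective fun d : (Boson N × ℕ+) →₀ ℕ => ((p, d) : State N) :=
    fun _ _ h => (Prod.ext_iff.1 h).2
  rw [← hinj.hasSum_iff]
  · exact h
  · intro m hm
    exact h0 m fun h1 => hm ⟨m.2, by rw [← h1]⟩

/-- The contraction of the zero modes of two forms. -/
def zeroPair (k : ℂ) (Φ Ψ : LinForm N) : ℂ := ∑ x, Φ (Gen.mom x) * posShift k Ψ x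

/-- Wick's theorem for two exponentials. Moving the annihilation part of `Φ` through the creation
part of `Ψ` produces the exponential of their commutator. The momentum factor of `Φ` acts after `Ψ`
has shifted the momenta, which produces the zero mode contraction. The remaining factors are already
normally ordered. -/
theorem hasComp_nexp {Φ Ψ : LinForm N}
    (h : Summable fun v => annShift N lq k Φ v * crePart Ψ v) :
    HasComp (nexp N lq k Φ) (nexp N lq k Ψ)
      (Complex.exp (∑' v, annShift N lq k Φ v * crePart Ψ v + zeroPair k Φ Ψ) •
        nexp N lq k (Φ + Ψ)) := by
  classical
  intro s t
  refine hasSum_state (p := t.1 + posShift k Ψ) (fun m hm => ?_) ?_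
  · rw [nexp_apply Ψ, if_neg hm, mul_zero]
  simp only [nexp_apply, if_true]
  by_cases hs : s.1 = t.1 + posShift k Ψ + posShift k Φ
  swap
  · simp only [hs, if_false, zero_mul]
    rw [Pi.smul_apply, Pi.smul_apply, nexp_apply, if_neg, smul_zero]
    · exact hasSum_zero
    · rw [posShift_add, ← add_assoc, add_right_comm]; exact hs
  simp only [hs, if_true]
  set c := annShift N lq k Φ with hc
  set P := shiftHom (annShift N lq k Ψ) (MvPolynomial.monomial t.2 (1 : ℂ)) with hP
  -- The creation part of `Φ` multiplies last, so it only contributes a finite convolution over the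
  -- splittings of the final exponent.
  have h1 : HasSum (fun n => ∑ a ∈ Finset.HasAntidiagonal.antidiagonal s.2,
      MvPowerSeries.coeff a.1 (expSeries (crePart Φ)) *
      (MvPolynomial.coeff a.2 (shiftHom c (MvPolynomial.monomial n (1 : ℂ))) *
        MvPowerSeries.coeff n (expSeries (crePart Ψ) * (P : MvPowerSeries (Boson N × ℕ+) ℂ))))
      (∑ a ∈ Finset.HasAntidiagonal.antidiagonal s.2, MvPowerSeries.coeff a.1 (expSeries (crePart Φ)) *
        (Complex.exp (∑' v, c v * crePart Ψ v) * MvPowerSeries.coeff a.2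
          (expSeries (crePart Ψ) * (shiftHom c P : MvPowerSeries (Boson N × ℕ+) ℂ)))) :=
    hasSum_sum fun a _ => (hasSum_shiftHom_expSeries_mul h P a.2).mul_left _
  refine hasSum_of_eq (h1.mul_left
    (Complex.exp (∑ x, Φ (Gen.mom x) * (t.1 + posShift k Ψ) x) *
      Complex.exp (∑ x, Ψ (Gen.mom x) * t.1 x))) (fun n => ?_) ?_
  · rw [MvPowerSeries.coeff_mul]
    simp only [Finset.mul_sum, Finset.sum_mul, MvPolynomial.coeff_coe]
    refine Finset.sum_congr rfl fun a _ => ?_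
    ring
  · have e1 : (∑ a ∈ Finset.HasAntidiagonal.antidiagonal s.2, MvPowerSeries.coeff a.1 (expSeries (crePart Φ)) *
        (Complex.exp (∑' v, c v * crePart Ψ v) * MvPowerSeries.coeff a.2
          (expSeries (crePart Ψ) * (shiftHom c P : MvPowerSeries (Boson N × ℕ+) ℂ)))) =
        Complex.exp (∑' v, c v * crePart Ψ v) * MvPowerSeries.coeff s.2
          (expSeries (crePart (Φ + Ψ)) * (shiftHom (annShift N lq k (Φ + Ψ))
          (MvPolynomial.monomial t.2 (1 : ℂ)) : MvPowerSeries (Boson N × ℕ+) ℂ)) := by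
      rw [crePart_add, expSeries_add, annShift_add, ← shiftHom_comp, mul_assoc,
        MvPowerSeries.coeff_mul, Finset.mul_sum]
      exact Finset.sum_congr rfl fun a _ => by ring
    rw [e1, Pi.smul_apply, Pi.smul_apply, nexp_apply, if_pos, smul_eq_mul]
    · have e2 : ∑ x, Φ (Gen.mom x) * (t.1 + posShift k Ψ) x + ∑ x, Ψ (Gen.mom x) * t.1 x =
          zeroPair k Φ Ψ + ∑ x, (Φ + Ψ) (Gen.mom x) * t.1 x := by
        rw [zeroPair, ← Finset.sum_add_distrib, ← Finset.sum_add_distrib]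
        refine Finset.sum_congr rfl fun x _ => ?_
        simp only [Pi.add_apply]; ring
      have e3 := congrArg Complex.exp e2
      rw [Complex.exp_add, Complex.exp_add] at e3
      rw [e3, Complex.exp_add]
      ring
    · rw [posShift_add, hs]; abel

/-! ### Commutators of modes with normal ordered exponentials -/

/-- Both products of `A` with `nexp Φ` exist and `[A, nexp Φ] = c nexp Φ`. -/
def HasComm (lq k : ℂ) (Φ : LinForm N) (A : FockOp N) (c : ℂ) : Prop :=
  ∃ X Y, HasComp A (nexp N lq k Φ) X ∧ HasComp (nexp N lq k Φ) A Y ∧ X - Y = c • nexp N lq k Φ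

theorem HasComm.zero {Φ : LinForm N} : HasComm lq k Φ 0 0 :=
  ⟨0, 0, HasComp.zero_left, HasComp.zero_right, by simp⟩

theorem HasComm.add {Φ : LinForm N} {A B : FockOp N} {c d : ℂ} (hA : HasComm lq k Φ A c)
    (hB : HasComm lq k Φ B d) : HasComm lq k Φ (A + B) (c + d) := by
  obtain ⟨X, Y, h1, h2, h3⟩ := hA
  obtain ⟨X', Y', h1', h2', h3'⟩ := hB
  exact ⟨_, _, h1.add_left h1', h2.add_right h2', by rw [add_smul, ← h3, ← h3']; abel⟩

theorem HasComm.smul {Φ : LinForm N} {A : FockOp N} {c : ℂ} (a : ℂ) (hA : HasComm lq k Φ A c) :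
    HasComm lq k Φ (a • A) (a * c) := by
  obtain ⟨X, Y, h1, h2, h3⟩ := hA
  exact ⟨_, _, h1.smul_left a, h2.smul_right a, by rw [mul_smul, ← h3, smul_sub]⟩

/-- The pairs of an operator and its commutator with `nexp Φ`. -/
def commSpace (lq k : ℂ) (Φ : LinForm N) : Submodule ℂ (FockOp N × ℂ) where
  carrier := {p | HasComm lq k Φ p.1 p.2}
  add_mem' h h' := h.add h'
  zero_mem' := HasComm.zero
  smul_mem' a _ h := h.smul a

open Classical in
theorem creOp_apply (x : Boson N) (m : ℕ+) (s t : State N) :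
    creOp x m s t = if s.1 = t.1 ∧ s.2 = t.2 + Finsupp.single (x, m) 1 then 1 else 0 := by
  rw [creOp, MvPolynomial.X, MvPolynomial.monomial_mul, MvPolynomial.coeff_monomial, add_comm]
  by_cases h1 : s.1 = t.1 <;> by_cases h2 : s.2 = t.2 + Finsupp.single (x, m) 1 <;>
    simp [h1, h2, eq_comm]

open Classical in
theorem annOp_apply (x : Boson N) (m : ℕ+) (s t : State N) :
    annOp N lq k x m s t = ∑ y, if t = (s.1, s.2 + Finsupp.single (y, m) 1) then
      kappa N lq k x y m * (s.2 (y, m) + 1) else 0 := by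
  rw [annOp]
  split_ifs with h
  · rw [MvPolynomial.coeff_sum]
    refine Finset.sum_congr rfl fun y _ => ?_
    rw [MvPolynomial.coeff_smul, MvPolynomial.coeff_pderiv, MvPolynomial.coeff_monomial]
    simp only [Prod.ext_iff, h, true_and, smul_eq_mul, ite_mul, one_mul, zero_mul, mul_ite,
      mul_zero]
  · refine (Finset.sum_eq_zero fun y _ => if_neg fun h1 => h ?_).symm
    rw [h1]

/-- Multiplication by a variable commutes with the creation part, and the translation replaces that
variable by itself plus `annShift`; the added constant, with a sign, is the commutator. -/
theorem hasComm_creOp (Φ : LinForm N) (x : Boson N) (m : ℕ+) :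
    HasComm lq k Φ (creOp x m) (-annShift N lq k Φ (x, m)) := by
  classical
  set v : Boson N × ℕ+ := (x, m) with hv
  refine ⟨fun s t => if Finsupp.single v 1 ≤ s.2 then
      nexp N lq k Φ (s.1, s.2 - Finsupp.single v 1) t else 0,
    fun s t => nexp N lq k Φ s (t.1, t.2 + Finsupp.single v 1), fun s t => ?_, fun s t => ?_, ?_⟩
  · by_cases h : Finsupp.single v 1 ≤ s.2
    · simp only [if_pos h]
      refine hasSum_of_eq (hasSum_ite_eq (s.1, s.2 - Finsupp.single v 1)
        (nexp N lq k Φ (s.1, s.2 - Finsupp.single v 1) t)) (fun n => ?_) rfl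
      rw [creOp_apply, ← hv]
      by_cases hn : n = (s.1, s.2 - Finsupp.single v 1)
      · rw [if_pos hn, if_pos, one_mul, hn]
        rw [hn]; exact ⟨rfl, (tsub_add_cancel_of_le h).symm⟩
      · rw [if_neg hn, if_neg, zero_mul]
        rintro ⟨h1, h2⟩
        exact hn (Prod.ext h1.symm (by rw [h2, add_tsub_cancel_right]))
    · simp only [if_neg h]
      refine hasSum_of_eq hasSum_zero (fun n => ?_) rfl
      rw [creOp_apply, if_neg, zero_mul]
      rintro ⟨_, h2⟩
      exact h (h2 ▸ le_add_self)
  · refine hasSum_of_eq (hasSum_ite_eq (t.1, t.2 + Finsupp.single v 1)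
        (nexp N lq k Φ s (t.1, t.2 + Finsupp.single v 1))) (fun n => ?_) rfl
    rw [creOp_apply, ← hv]
    by_cases hn : n = (t.1, t.2 + Finsupp.single v 1)
    · rw [if_pos hn, if_pos, mul_one, hn]
      rw [hn]; exact ⟨rfl, rfl⟩
    · rw [if_neg hn, if_neg, mul_zero]
      rintro ⟨h1, h2⟩
      exact hn (Prod.ext h1 h2)
  · funext s t
    simp only [Pi.sub_apply, Pi.smul_apply, nexp_apply]
    by_cases hs : s.1 = t.1 + posShift k Φ
    swap
    · simp [hs]
    simp only [hs, if_true]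
    rw [shiftHom_monomial_add_single,
      MvPolynomial.coe_add, MvPolynomial.coe_mul, MvPolynomial.coe_X, mul_add, map_add,
      ← mul_assoc, coeff_mul_X_series, MvPolynomial.coe_smul, Algebra.mul_smul_comm, map_smul]
    simp only [smul_eq_mul]
    split_ifs <;> ring

/-- A derivation is applied to the product of the creation exponential and the translated monomial.
By Leibniz its action on the exponential is the commutator, while its action on the monomial is the
product in the other order. -/
theorem hasComm_annOp (Φ : LinForm N) (x : Boson N) (m : ℕ+) :
    HasComm lq k Φ (annOp N lq k x m) (∑ y, kappa N lq k x y m * crePart Φ (y, m)) := by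
  classical
  refine ⟨fun s t => ∑ y, kappa N lq k x y m * (s.2 (y, m) + 1) *
      nexp N lq k Φ (s.1, s.2 + Finsupp.single (y, m) 1) t,
    fun s t => ∑ y, kappa N lq k x y m * t.2 (y, m) *
      nexp N lq k Φ s (t.1, t.2 - Finsupp.single (y, m) 1), fun s t => ?_, fun s t => ?_, ?_⟩
  · refine hasSum_of_eq (hasSum_sum fun y _ => hasSum_ite_eq (s.1, s.2 + Finsupp.single (y, m) 1)
      (kappa N lq k x y m * (s.2 (y, m) + 1) *
      nexp N lq k Φ (s.1, s.2 + Finsupp.single (y, m) 1) t)) (fun n => ?_) rfl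
    rw [annOp_apply, Finset.sum_mul]
    refine Finset.sum_congr rfl fun y _ => ?_
    by_cases hn : n = (s.1, s.2 + Finsupp.single (y, m) 1)
    · rw [if_pos hn, if_pos hn, hn]
    · rw [if_neg hn, if_neg hn, zero_mul]
  · refine hasSum_of_eq (hasSum_sum fun y _ => hasSum_ite_eq (t.1, t.2 - Finsupp.single (y, m) 1)
      (kappa N lq k x y m * t.2 (y, m) *
      nexp N lq k Φ s (t.1, t.2 - Finsupp.single (y, m) 1))) (fun n => ?_) rfl
    rw [annOp_apply, Finset.mul_sum]
    refine Finset.sum_congr rfl fun y _ => ?_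
    by_cases hn : t = (n.1, n.2 + Finsupp.single (y, m) 1)
    · have h' : n = (t.1, t.2 - Finsupp.single (y, m) 1) := by rw [hn]; simp
      rw [if_pos hn, if_pos h', ← h', hn]
      simp only [Finsupp.add_apply, Finsupp.single_eq_same, Nat.cast_add, Nat.cast_one]
      ring
    · rw [if_neg hn]
      split_ifs with h'
      · have : t.2 (y, m) = 0 := by
          by_contra h0
          refine hn ?_
          rw [h', tsub_add_cancel_of_le]
          rw [Finsupp.single_le_iff]; omega
        rw [this]; simp
      · simp
  · funext s t
    simp only [Pi.sub_apply, Pi.smul_apply, nexp_apply]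
    by_cases hs : s.1 = t.1 + posShift k Φ
    swap
    · simp [hs]
    simp only [hs, if_true]
    rw [← Finset.sum_sub_distrib, Finset.sum_smul]
    refine Finset.sum_congr rfl fun y _ => ?_
    set E := Complex.exp (∑ x, Φ (Gen.mom x) * t.1 x)
    set P := shiftHom (annShift N lq k Φ) (MvPolynomial.monomial t.2 (1 : ℂ)) with hP
    have h1 : MvPolynomial.pderiv (y, m) P = (t.2 (y, m) : ℂ) • shiftHom (annShift N lq k Φ)
        (MvPolynomial.monomial (t.2 - Finsupp.single (y, m) 1) (1 : ℂ)) := by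
      rw [hP, pderiv_shiftHom, MvPolynomial.pderiv_monomial, one_mul, ← mul_one (t.2 (y, m) : ℂ),
        ← smul_eq_mul, ← MvPolynomial.smul_monomial, map_smul, smul_eq_mul, mul_one]
    have h2 := congrArg (MvPowerSeries.coeff s.2) (Derivation.leibniz
      (MvPowerSeries.pderiv ℂ (y, m)) (expSeries (crePart Φ))
      (P : MvPowerSeries (Boson N × ℕ+) ℂ))
    rw [MvPowerSeries.coeff_pderiv, MvPowerSeries.pderiv_coe, pderiv_expSeries, map_add, h1,
      MvPolynomial.coe_smul, smul_eq_mul, smul_eq_mul, Algebra.mul_smul_comm,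
      Algebra.mul_smul_comm, map_smul, map_smul, mul_comm (P : MvPowerSeries (Boson N × ℕ+) ℂ),
      smul_eq_mul, smul_eq_mul] at h2
    rw [smul_eq_mul]
    linear_combination (kappa N lq k x y m * E) * h2

/-- The exponential shifts the eigenvalue of `p_x` by a constant. -/
theorem hasComm_momOp (Φ : LinForm N) (x : Boson N) :
    HasComm lq k Φ (momOp x) (posShift k Φ x) := by
  classical
  refine ⟨fun s t => s.1 x * nexp N lq k Φ s t, fun s t => nexp N lq k Φ s t * t.1 x,
    fun s t => ?_, fun s t => ?_, ?_⟩
  · refine hasSum_of_eq (hasSum_ite_eq s (s.1 x * nexp N lq k Φ s t)) (fun n => ?_) rfl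
    rw [momOp]
    by_cases h : s = n
    · rw [if_pos h, if_pos h.symm, h]
    · rw [if_neg h, if_neg (Ne.symm h), zero_mul]
  · refine hasSum_of_eq (hasSum_ite_eq t (nexp N lq k Φ s t * t.1 x)) (fun n => ?_) rfl
    rw [momOp]
    by_cases h : n = t
    · rw [if_pos h, if_pos h, h]
    · rw [if_neg h, if_neg h, mul_zero]
  · funext s t
    simp only [Pi.sub_apply, Pi.smul_apply, nexp_apply]
    by_cases hs : s.1 = t.1 + posShift k Φ
    · simp only [hs, if_true, smul_eq_mul, Pi.add_apply]; ring
    · simp [hs]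

end Nexp

end

end UqSlN

namespace UqSlN

noncomputable section

open scoped BigOperators
open Filter Topology

/-! ### Contractions of linear forms -/

section Pairing

variable {N : ℕ}

/-- `n` times the commutator of the `n`-th annihilation part of `Φ` with the creation part
of `Ψ`. -/
def modePair (N : ℕ) (lq k : ℂ) (n : ℕ+) : LinForm N →ₗ[ℂ] LinForm N →ₗ[ℂ] ℂ :=
  LinearMap.mk₂ ℂ (fun Φ Ψ => n * ∑ y, annShift N lq k Φ (y, n) * crePart Ψ (y, n))
    (fun Φ Φ' Ψ => by
      simp only [annShift_add, Pi.add_apply, add_mul, Finset.sum_add_distrib, mul_add])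
    (fun c Φ Ψ => by
      simp only [annShift, Pi.smul_apply, smul_eq_mul, Finset.mul_sum, Finset.sum_mul]
      exact Finset.sum_congr rfl fun _ _ => Finset.sum_congr rfl fun _ _ => by ring)
    (fun Φ Ψ Ψ' => by
      simp only [crePart_add, Pi.add_apply, mul_add, Finset.sum_add_distrib])
    (fun c Φ Ψ => by
      simp only [crePart, Pi.smul_apply, smul_eq_mul, Finset.mul_sum]
      exact Finset.sum_congr rfl fun _ _ => by ring)

theorem modePair_apply (lq k : ℂ) (n : ℕ+) (Φ Ψ : LinForm N) : modePair N lq k n Φ Ψ =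
    n * ∑ y, annShift N lq k Φ (y, n) * crePart Ψ (y, n) := rfl

/-- `zeroPair` as a bilinear form. -/
def zeroForm (N : ℕ) (k : ℂ) : LinForm N →ₗ[ℂ] LinForm N →ₗ[ℂ] ℂ :=
  LinearMap.mk₂ ℂ (zeroPair k)
    (fun Φ Φ' Ψ => by simp only [zeroPair, Pi.add_apply, add_mul, Finset.sum_add_distrib])
    (fun c Φ Ψ => by
      simp only [zeroPair, Pi.smul_apply, smul_eq_mul, Finset.mul_sum]
      exact Finset.sum_congr rfl fun _ _ => by ring)
    (fun Φ Ψ Ψ' => by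
      simp only [zeroPair, posShift_add, Pi.add_apply, mul_add, Finset.sum_add_distrib])
    (fun c Φ Ψ => by
      simp only [zeroPair, posShift, Pi.smul_apply, smul_eq_mul, Finset.mul_sum]
      exact Finset.sum_congr rfl fun _ _ => Finset.sum_congr rfl fun _ _ => by ring)

theorem zeroForm_apply (k : ℂ) (Φ Ψ : LinForm N) : zeroForm N k Φ Ψ = zeroPair k Φ Ψ := rfl

theorem hasSum_pnat_log {z : ℂ} (hz : ‖z‖ < 1) :
    HasSum (fun n : ℕ+ => (n : ℂ)⁻¹ * z ^ (n : ℕ)) (-Complex.log (1 - z)) := by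
  have h := Complex.hasSum_taylorSeries_neg_log hz
  rw [← PNat.coe_injective.hasSum_iff] at h
  · refine hasSum_of_eq h (fun n => ?_) rfl
    simp only [Function.comp_apply]
    rw [div_eq_inv_mul]
  · intro n hn
    have : n = 0 := by
      by_contra h0
      exact hn ⟨⟨n, Nat.pos_of_ne_zero h0⟩, rfl⟩
    simp [this]

theorem tsum_contraction {lq k : ℂ} {Φ Ψ : LinForm N}
    (h : Summable fun v => annShift N lq k Φ v * crePart Ψ v) :
    ∑' v, annShift N lq k Φ v * crePart Ψ v = ∑' n : ℕ+, (n : ℂ)⁻¹ * modePair N lq k n Φ Ψ := by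
  have e := (Equiv.prodComm ℕ+ (Boson N)).tsum_eq
    fun v => annShift N lq k Φ v * crePart Ψ v
  simp only [Equiv.prodComm_apply] at e
  rw [← e, (h.prod_symm.tsum_prod :)]
  refine tsum_congr fun n => ?_
  have hn : (n : ℂ) ≠ 0 := Nat.cast_ne_zero.mpr n.ne_zero
  rw [modePair_apply, inv_mul_cancel_left₀ hn, tsum_fintype]
  rfl

/-- The factor `n` built into `modePair` removes the `1 / n` of the commutators. What remains is a
difference of two geometric sequences, so the contraction is a difference of two logarithmic series
and its exponential is a quotient of linear factors. -/
theorem hasComp_nexp_of_modePair {lq k : ℂ} {Φ Ψ : LinForm N} {α β κ : ℂ}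
    (h : Summable fun v => annShift N lq k Φ v * crePart Ψ v)
    (hm : ∀ n : ℕ+, modePair N lq k n Φ Ψ = Complex.exp (n * β) - Complex.exp (n * α))
    (hα : ‖Complex.exp α‖ < 1) (hβ : ‖Complex.exp β‖ < 1) (hz : zeroForm N k Φ Ψ = κ) :
    HasComp (nexp N lq k Φ) (nexp N lq k Ψ)
      ((Complex.exp κ * ((1 - Complex.exp α) / (1 - Complex.exp β))) •
        nexp N lq k (Φ + Ψ)) := by
  have h1 : ∀ {z : ℂ}, ‖z‖ < 1 → (1 : ℂ) - z ≠ 0 := fun hz h0 => by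
    rw [← sub_eq_zero.1 h0, norm_one] at hz; exact lt_irrefl _ hz
  convert hasComp_nexp h using 2
  rw [Complex.exp_add, tsum_contraction h, ← zeroForm_apply, hz, mul_comm]
  congr 1
  have hs := (hasSum_pnat_log hβ).sub (hasSum_pnat_log hα)
  have : ∑' n : ℕ+, (n : ℂ)⁻¹ * modePair N lq k n Φ Ψ =
      -Complex.log (1 - Complex.exp β) - -Complex.log (1 - Complex.exp α) := by
    rw [← hs.tsum_eq]
    refine tsum_congr fun n => ?_
    rw [hm, ← Complex.exp_nat_mul, ← Complex.exp_nat_mul, mul_sub]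
  rw [this, Complex.exp_sub, Complex.exp_neg, Complex.exp_neg, Complex.exp_log (h1 hα),
    Complex.exp_log (h1 hβ)]
  simp [div_eq_mul_inv, mul_comm]

/-! ### The regime `|z| ≫ |w|` -/

/-- The filter `|z| ≫ |w|` at `z = exp u`, `w = exp v`. -/
def farFilter : Filter (ℂ × ℂ) :=
  comap (fun x : ℂ × ℂ => ‖Complex.exp x.1‖ / ‖Complex.exp x.2‖) atTop

theorem farFilter_eventually_lt (C : ℝ) :
    ∀ᶠ x in farFilter, C * ‖Complex.exp x.2‖ < ‖Complex.exp x.1‖ := by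
  filter_upwards [tendsto_comap.eventually (eventually_gt_atTop C)] with x hx
  rwa [lt_div_iff₀ (norm_pos_iff.2 (Complex.exp_ne_zero _))] at hx

/-- The claim for every larger `R'` allows finitely many regimes, and both orders of a product, to
share a single constant. -/
theorem exists_of_farFilter {p : ℂ × ℂ → Prop} (h : ∀ᶠ x in farFilter, p x) :
    ∃ R : ℝ, ∀ R', R ≤ R' → ∀ u v : ℂ, R' * ‖Complex.exp v‖ < ‖Complex.exp u‖ → p (u, v) := by
  rw [farFilter, eventually_comap] at h
  obtain ⟨R, hR⟩ := eventually_atTop.1 h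
  refine ⟨R, fun R' hR' u v huv => hR _ (hR'.trans ?_) (u, v) rfl⟩
  rw [← lt_div_iff₀ (norm_pos_iff.2 (Complex.exp_ne_zero _))] at huv
  exact huv.le

/-- The annihilation part of `Φ u` grows at most exponentially, relative to the weight `W`. -/
def AnnTame (lq k : ℂ) (W : Boson N → ℕ+ → ℝ) (Φ : ℂ → LinForm N) : Prop :=
  ∃ C ρ : ℝ, 0 ≤ C ∧ 0 ≤ ρ ∧ ∀ u y (n : ℕ+), ‖annShift N lq k (Φ u) (y, n)‖ ≤
    C * ρ ^ (n : ℕ) * ‖Complex.exp (-u)‖ ^ (n : ℕ) * W y n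

/-- The creation part of `Φ u` grows at most exponentially, relative to the weight `W⁻¹`. -/
def CreTame (W : Boson N → ℕ+ → ℝ) (Φ : ℂ → LinForm N) : Prop :=
  ∃ C ρ : ℝ, 0 ≤ C ∧ 0 ≤ ρ ∧ ∀ u y (n : ℕ+), W y n * ‖crePart (Φ u) (y, n)‖ ≤
    C * ρ ^ (n : ℕ) * ‖Complex.exp u‖ ^ (n : ℕ)

/-- The weight `W` cancels in each product, leaving a geometric majorant of ratio `ρ τ |w / z|`; the
bosons themselves are finitely many. -/
theorem summable_of_tame {lq k : ℂ} {W : Boson N → ℕ+ → ℝ} {Φ Ψ : ℂ → LinForm N}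
    (hΦ : AnnTame lq k W Φ) (hΨ : CreTame W Ψ) :
    ∀ᶠ x in farFilter, Summable fun v => annShift N lq k (Φ x.1) v * crePart (Ψ x.2) v := by
  obtain ⟨C, ρ, hC, hρ, h1⟩ := hΦ
  obtain ⟨D, τ, hD, hτ, h2⟩ := hΨ
  filter_upwards [farFilter_eventually_lt (ρ * τ)] with x hx
  set r : ℝ := ρ * ‖Complex.exp (-x.1)‖ * (τ * ‖Complex.exp x.2‖) with hr
  have hr0 : 0 ≤ r := by positivity
  have hr1 : r < 1 := by
    have h0 : 0 < ‖Complex.exp x.1‖ := norm_pos_iff.2 (Complex.exp_ne_zero _)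
    rw [hr, Complex.exp_neg, norm_inv]
    rw [show ρ * ‖Complex.exp x.1‖⁻¹ * (τ * ‖Complex.exp x.2‖) =
      ρ * τ * ‖Complex.exp x.2‖ / ‖Complex.exp x.1‖ by field_simp]
    rwa [div_lt_one h0]
  have hg : Summable fun n : ℕ+ => C * D * r ^ (n : ℕ) :=
    ((summable_geometric_of_lt_one hr0 hr1).comp_injective PNat.coe_injective).mul_left _
  have hg' : Summable fun v : Boson N × ℕ+ => C * D * r ^ (v.2 : ℕ) := by
    rw [summable_prod_of_nonneg (fun v => by positivity)]
    exact ⟨fun _ => hg, (hasSum_fintype _).summable⟩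
  refine Summable.of_norm_bounded hg' fun v => ?_
  rw [norm_mul]
  calc ‖annShift N lq k (Φ x.1) v‖ * ‖crePart (Ψ x.2) v‖
      ≤ (C * ρ ^ (v.2 : ℕ) * ‖Complex.exp (-x.1)‖ ^ (v.2 : ℕ) * W v.1 v.2) *
        ‖crePart (Ψ x.2) v‖ := mul_le_mul_of_nonneg_right (h1 _ _ _) (norm_nonneg _)
    _ = (C * ρ ^ (v.2 : ℕ) * ‖Complex.exp (-x.1)‖ ^ (v.2 : ℕ)) * (W v.1 v.2 *
        ‖crePart (Ψ x.2) v‖) := by ring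
    _ ≤ (C * ρ ^ (v.2 : ℕ) * ‖Complex.exp (-x.1)‖ ^ (v.2 : ℕ)) *
        (D * τ ^ (v.2 : ℕ) * ‖Complex.exp x.2‖ ^ (v.2 : ℕ)) :=
        mul_le_mul_of_nonneg_left (h2 _ _ _) (by positivity)
    _ = C * D * r ^ (v.2 : ℕ) := by rw [hr]; ring

theorem exp_growth_add {C D ρ τ x y X : ℝ} {n : ℕ} (hC : 0 ≤ C) (hD : 0 ≤ D) (hρ : 0 ≤ ρ)
    (hτ : 0 ≤ τ) (hX : 0 ≤ X) (h1 : x ≤ C * ρ ^ n * X) (h2 : y ≤ D * τ ^ n * X) :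
    x + y ≤ (C + D) * (max ρ τ) ^ n * X := by
  have e1 : C * ρ ^ n * X ≤ C * (max ρ τ) ^ n * X := by gcongr; exact le_max_left _ _
  have e2 : D * τ ^ n * X ≤ D * (max ρ τ) ^ n * X := by gcongr; exact le_max_right _ _
  linarith

theorem AnnTame.add {lq k : ℂ} {W : Boson N → ℕ+ → ℝ} {Φ Ψ : ℂ → LinForm N}
    (hW : ∀ y n, 0 ≤ W y n)
    (hΦ : AnnTame lq k W Φ) (hΨ : AnnTame lq k W Ψ) : AnnTame lq k W (fun u => Φ u + Ψ u) := by
  obtain ⟨C, ρ, hC, hρ, h1⟩ := hΦ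
  obtain ⟨D, τ, hD, hτ, h2⟩ := hΨ
  refine ⟨C + D, max ρ τ, by positivity, by positivity, fun u y n => ?_⟩
  rw [annShift_add, Pi.add_apply, mul_assoc]
  refine (norm_add_le _ _).trans (exp_growth_add hC hD hρ hτ
    (mul_nonneg (by positivity) (hW y n)) ?_ ?_) <;> rw [← mul_assoc]
  exacts [h1 u y n, h2 u y n]

theorem CreTame.add {W : Boson N → ℕ+ → ℝ} {Φ Ψ : ℂ → LinForm N}
    (hW : ∀ y n, 0 ≤ W y n)
    (hΦ : CreTame W Φ) (hΨ : CreTame W Ψ) : CreTame W (fun u => Φ u + Ψ u) := by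
  obtain ⟨C, ρ, hC, hρ, h1⟩ := hΦ
  obtain ⟨D, τ, hD, hτ, h2⟩ := hΨ
  refine ⟨C + D, max ρ τ, by positivity, by positivity, fun u y n => ?_⟩
  rw [crePart_add, Pi.add_apply]
  refine (mul_le_mul_of_nonneg_left (norm_add_le _ _) (hW y n)).trans ?_
  rw [mul_add]
  exact exp_growth_add hC hD hρ hτ (by positivity) (h1 u y n) (h2 u y n)

theorem AnnTame.neg {lq k : ℂ} {W : Boson N → ℕ+ → ℝ} {Φ : ℂ → LinForm N}
    (hΦ : AnnTame lq k W Φ) : AnnTame lq k W (fun u => -Φ u) := by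
  obtain ⟨C, ρ, hC, hρ, h1⟩ := hΦ
  refine ⟨C, ρ, hC, hρ, fun u y n => ?_⟩
  have : annShift N lq k (-Φ u) (y, n) = -annShift N lq k (Φ u) (y, n) := by simp [annShift]
  rw [this, norm_neg]; exact h1 u y n

theorem CreTame.neg {W : Boson N → ℕ+ → ℝ} {Φ : ℂ → LinForm N}
    (hΦ : CreTame W Φ) : CreTame W (fun u => -Φ u) := by
  obtain ⟨C, ρ, hC, hρ, h1⟩ := hΦ
  refine ⟨C, ρ, hC, hρ, fun u y n => ?_⟩
  have : crePart (-Φ u) (y, n) = -crePart (Φ u) (y, n) := rfl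
  rw [this, norm_neg]; exact h1 u y n

theorem AnnTame.of_zero {lq k : ℂ} {W : Boson N → ℕ+ → ℝ} {Φ : ℂ → LinForm N}
    (h : ∀ u y n, annShift N lq k (Φ u) (y, n) = 0) : AnnTame lq k W Φ :=
  ⟨0, 0, le_rfl, le_rfl, fun u y n => by rw [h]; simp⟩

theorem CreTame.of_zero {W : Boson N → ℕ+ → ℝ} {Φ : ℂ → LinForm N}
    (h : ∀ u y n, crePart (Φ u) (y, n) = 0) : CreTame W Φ :=
  ⟨0, 0, le_rfl, le_rfl, fun u y n => by rw [h]; simp⟩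

/-- Both the annihilation and the creation parts are tame. -/
structure Tame (lq k : ℂ) (W W' : Boson N → ℕ+ → ℝ) (Φ : ℂ → LinForm N) : Prop where
  ann : AnnTame lq k W Φ
  cre : CreTame W' Φ

variable {lq k : ℂ} {W W' : Boson N → ℕ+ → ℝ}

theorem Tame.zero : Tame lq k W W' (fun _ => (0 : LinForm N)) :=
  ⟨.of_zero fun _ _ _ => by simp [annShift], .of_zero fun _ _ _ => rfl⟩

theorem Tame.neg {Φ : ℂ → LinForm N} (h : Tame lq k W W' Φ) : Tame lq k W W' (fun u => -Φ u) :=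
  ⟨h.1.neg, h.2.neg⟩

theorem Tame.add {Φ Ψ : ℂ → LinForm N} (hW : ∀ y n, 0 ≤ W y n) (hW' : ∀ y n, 0 ≤ W' y n)
    (h : Tame lq k W W' Φ) (h' : Tame lq k W W' Ψ) : Tame lq k W W' (fun u => Φ u + Ψ u) :=
  ⟨h.1.add hW h'.1, h.2.add hW' h'.2⟩

theorem Tame.sub {Φ Ψ : ℂ → LinForm N} (hW : ∀ y n, 0 ≤ W y n) (hW' : ∀ y n, 0 ≤ W' y n)
    (h : Tame lq k W W' Φ) (h' : Tame lq k W W' Ψ) : Tame lq k W W' (fun u => Φ u - Ψ u) := by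
  simpa only [sub_eq_add_neg] using h.add hW hW' h'.neg

theorem Tame.sum {ι : Type*} (s : Finset ι) {Φ : ι → ℂ → LinForm N} (hW : ∀ y n, 0 ≤ W y n)
    (hW' : ∀ y n, 0 ≤ W' y n) (h : ∀ i ∈ s, Tame lq k W W' (Φ i)) :
    Tame lq k W W' (fun u => ∑ i ∈ s, Φ i u) := by
  classical
  induction s using Finset.induction_on with
  | empty => simpa using Tame.zero
  | insert a s ha ih =>
    simp only [Finset.sum_insert ha]
    exact (h a (Finset.mem_insert_self a s)).add hW hW'
      (ih fun i hi => h i (Finset.mem_insert_of_mem hi))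

/-! ### Rational contractions -/

/-- The contraction of `Φ u` with `Ψ v` is `q ^ c (z - q ^ a w) / (z - q ^ b w)`. -/
def HalfPair (lq k : ℂ) (Φ Ψ : ℂ → LinForm N) (c a b : ℂ) : Prop :=
  ∀ u v, (∀ n : ℕ+, modePair N lq k n (Φ u) (Ψ v) =
      Complex.exp (n * (v - u + b * lq)) - Complex.exp (n * (v - u + a * lq))) ∧
    zeroForm N k (Φ u) (Ψ v) = c * lq

/-- When `|z| ≫ |w|` both `q ^ a w / z` and `q ^ b w / z` lie in the open unit disc. This gives the
convergence of the logarithms and keeps `z` off the pole. -/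
theorem HalfPair.hasComp {Φ Ψ : ℂ → LinForm N} {c a b : ℂ} (h : HalfPair lq k Φ Ψ c a b)
    (hΦ : AnnTame lq k W Φ) (hΨ : CreTame W Ψ) :
    ∀ᶠ x in farFilter, Complex.exp x.1 - Complex.exp (x.2 + b * lq) ≠ 0 ∧
      HasComp (nexp N lq k (Φ x.1)) (nexp N lq k (Ψ x.2))
      ((qpow lq c * ((Complex.exp x.1 - Complex.exp (x.2 + a * lq)) /
        (Complex.exp x.1 - Complex.exp (x.2 + b * lq)))) • nexp N lq k (Φ x.1 + Ψ x.2)) := by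
  have aux : ∀ e : ℂ, ∀ᶠ x : ℂ × ℂ in farFilter,
      ‖Complex.exp (x.2 - x.1 + e * lq)‖ < 1 := fun e => by
    filter_upwards [farFilter_eventually_lt ‖Complex.exp (e * lq)‖] with x hx
    rw [Complex.exp_add, Complex.exp_sub, norm_mul, norm_div, div_mul_eq_mul_div, div_lt_one
      (norm_pos_iff.2 (Complex.exp_ne_zero _)), mul_comm]
    exact hx
  have aux2 : ∀ (x : ℂ × ℂ) (e : ℂ), Complex.exp x.1 - Complex.exp (x.2 + e * lq) =
      Complex.exp x.1 * (1 - Complex.exp (x.2 - x.1 + e * lq)) := fun x e => by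
    rw [mul_sub, ← Complex.exp_add, mul_one]; ring_nf
  filter_upwards [aux a, aux b, summable_of_tame hΦ hΨ] with x ha hb hs
  have h0 : Complex.exp x.1 ≠ 0 := Complex.exp_ne_zero _
  rw [aux2, aux2, mul_div_mul_left _ _ h0]
  refine ⟨mul_ne_zero h0 fun h1 => ?_,
    hasComp_nexp_of_modePair hs (h x.1 x.2).1 ha hb (h x.1 x.2).2⟩
  rw [← sub_eq_zero.1 h1, norm_one] at hb
  exact lt_irrefl _ hb

end Pairing

end

end UqSlN

namespace UqSlN

noncomputable section

open scoped BigOperators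
open Filter Topology

/-! ### Contractions of the boson fields -/

section Fields

variable {N : ℕ} {lq k : ℂ}

/-- `q ^ n`. -/
def qn (lq : ℂ) (n : ℕ+) : ℂ := Complex.exp (n * lq)

theorem qn_ne_zero (lq : ℂ) (n : ℕ+) : qn lq n ≠ 0 := Complex.exp_ne_zero _

/-- `z ^ n` at `z = exp x`. -/
def zn (n : ℕ+) (x : ℂ) : ℂ := Complex.exp (n * x)

theorem zn_ne_zero (n : ℕ+) (x : ℂ) : zn n x ≠ 0 := Complex.exp_ne_zero _

theorem zn_add_lq (n : ℕ+) (x a : ℂ) : zn n (x + lq - a) = zn n (x - a) * qn lq n := by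
  rw [zn, zn, qn, ← Complex.exp_add]; ring_nf

theorem zn_sub_lq (n : ℕ+) (x a : ℂ) : zn n (x - lq - a) = zn n (x - a) * (qn lq n)⁻¹ := by
  rw [zn, zn, qn, ← Complex.exp_neg, ← Complex.exp_add]; ring_nf

theorem zn_sub_add_lq (n : ℕ+) (x a : ℂ) : zn n (x - (a + lq)) = zn n (x - a) * (qn lq n)⁻¹ := by
  rw [zn, zn, qn, ← Complex.exp_neg, ← Complex.exp_add]; ring_nf

theorem zn_sub_sub_lq (n : ℕ+) (x a : ℂ) : zn n (x - (a - lq)) = zn n (x - a) * qn lq n := by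
  rw [zn, zn, qn, ← Complex.exp_add]; ring_nf

theorem qpow_natCast (n : ℕ+) : qpow lq n = qn lq n := rfl

theorem qpow_neg (x : ℂ) : qpow lq (-x) = (qpow lq x)⁻¹ := by
  rw [qpow, qpow, ← Complex.exp_neg]; ring_nf

theorem qpow_ne_zero (x : ℂ) : qpow lq x ≠ 0 := Complex.exp_ne_zero _

theorem qpow_add (x y : ℂ) : qpow lq (x + y) = qpow lq x * qpow lq y := by
  rw [qpow, qpow, qpow, ← Complex.exp_add]; ring_nf

/-- The value of the commutator `[x_n, y_{-n}]` enters the pairing of single boson forms. -/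
theorem modePair_single {n : ℕ+} {Φ Ψ : LinForm N} {x y : Boson N}
    (hΦ : ∀ x', x' ≠ x → Φ (Gen.ann x' n) = 0) (hΨ : ∀ y', y' ≠ y → Ψ (Gen.cre y' n) = 0) :
    modePair N lq k n Φ Ψ = n * (Φ (Gen.ann x n) * kappa N lq k x y n * Ψ (Gen.cre y n)) := by
  rw [modePair_apply, Finset.sum_eq_single y, annShift, Finset.sum_eq_single x]
  · rfl
  · intro x' _ hx; rw [hΦ x' hx, zero_mul]
  · simp
  · intro y' _ hy; rw [crePart, hΨ y' hy, mul_zero]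
  · simp

theorem zeroForm_single {Φ Ψ : LinForm N} {x y : Boson N}
    (hΦ : ∀ x', x' ≠ x → Φ (Gen.mom x') = 0) (hΨ : ∀ y', y' ≠ y → Ψ (Gen.pos y') = 0) :
    zeroForm N k Φ Ψ = Φ (Gen.mom x) * (Ψ (Gen.pos y) * rho N k x y) := by
  rw [zeroForm_apply, zeroPair, Finset.sum_eq_single x, posShift, Finset.sum_eq_single y]
  · intro y' _ hy; rw [hΨ y' hy, zero_mul]
  · simp
  · intro x' _ hx; rw [hΦ x' hx, zero_mul]
  · simp

theorem modePair_of_ann_zero {n : ℕ+} {Φ Ψ : LinForm N} (h : ∀ x, Φ (Gen.ann x n) = 0) :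
    modePair N lq k n Φ Ψ = 0 := by
  simp [modePair_apply, annShift, h]

theorem modePair_of_cre_zero {n : ℕ+} {Φ Ψ : LinForm N} (h : ∀ x, Ψ (Gen.cre x n) = 0) :
    modePair N lq k n Φ Ψ = 0 := by
  simp [modePair_apply, crePart, h]

theorem zeroForm_of_pos_zero {Φ Ψ : LinForm N} (h : ∀ x, Ψ (Gen.pos x) = 0) :
    zeroForm N k Φ Ψ = 0 := by
  simp [zeroForm_apply, zeroPair, posShift, h]

/-- `(i, j)` labels a positive root. -/
def IsRoot (N i j : ℕ) : Prop := 1 ≤ i ∧ i < j ∧ j ≤ N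

instance (N i j : ℕ) : Decidable (IsRoot N i j) := by unfold IsRoot; infer_instance

/-- A pairing that is diagonal in the roots stays diagonal for labels. One root condition suffices,
because on the diagonal both labels agree, and fields with improper labels are zero. -/
theorem pair_atRoot (β : LinForm N →ₗ[ℂ] LinForm N →ₗ[ℂ] ℂ) (f g : PosRoot N → LinForm N) (D : ℂ)
    (h : ∀ r t, β (f r) (g t) = if r = t then D else 0) (i j i' j' : ℕ) :
    β (atRoot N f i j) (atRoot N g i' j') =
      if IsRoot N i j ∧ i = i' ∧ j = j' then D else 0 := by
  unfold atRoot IsRoot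
  by_cases h1 : 1 ≤ i ∧ i < j ∧ j ≤ N
  · by_cases h2 : 1 ≤ i' ∧ i' < j' ∧ j' ≤ N
    · rw [dif_pos h1, dif_pos h2, h]
      congr 1
      simp only [Subtype.mk.injEq, Prod.mk.injEq, Fin.mk.injEq, eq_iff_iff]
      omega
    · rw [dif_neg h2, map_zero, if_neg]
      rintro ⟨_, rfl, rfl⟩; exact h2 h1
  · rw [dif_neg h1, if_neg fun h0 => h1 h0.1]; simp

theorem pair_atRoot_left (β : LinForm N →ₗ[ℂ] LinForm N →ₗ[ℂ] ℂ) (f : PosRoot N → LinForm N)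
    (Ψ : LinForm N) (h : ∀ r, β (f r) Ψ = 0) (i j : ℕ) : β (atRoot N f i j) Ψ = 0 := by
  unfold atRoot
  split_ifs
  · exact h _
  · simp

theorem pair_atRoot_right (β : LinForm N →ₗ[ℂ] LinForm N →ₗ[ℂ] ℂ) (f : PosRoot N → LinForm N)
    (Φ : LinForm N) (h : ∀ r, β Φ (f r) = 0) (i j : ℕ) : β Φ (atRoot N f i j) = 0 := by
  unfold atRoot
  split_ifs
  · exact h _
  · simp

/-- The vertex form `-((1/(k+g)) a)(z; α)`. -/
def aV (N : ℕ) (lq k : ℂ) (j : Fin (N - 1)) (α u : ℂ) : LinForm N :=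
  -field lq [1] [k + N] (aB j) α u

variable (n : ℕ+) (a a' : ℂ) (i j i' j' : ℕ)

theorem modePair_bM_left (Ψ : LinForm N) : modePair N lq k n (bM N lq i j a) Ψ = 0 :=
  pair_atRoot_left _ _ _ (fun _ => modePair_of_ann_zero fun _ => rfl) _ _

theorem modePair_bP_right (Φ : LinForm N) : modePair N lq k n Φ (bP N lq i j a) = 0 :=
  pair_atRoot_right _ _ _ (fun _ => modePair_of_cre_zero fun _ => rfl) _ _

theorem zeroForm_bP_right (Φ : LinForm N) : zeroForm N k Φ (bP N lq i j a) = 0 :=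
  pair_atRoot_right _ _ _ (fun _ => zeroForm_of_pos_zero fun _ => rfl) _ _

theorem zeroForm_bM_right (Φ : LinForm N) : zeroForm N k Φ (bM N lq i j a) = 0 :=
  pair_atRoot_right _ _ _ (fun _ => zeroForm_of_pos_zero fun _ => rfl) _ _

theorem modePair_am_left (i₀ : Fin (N - 1)) (Ψ : LinForm N) :
    modePair N lq k n (minusF lq (aB i₀) a) Ψ = 0 := modePair_of_ann_zero fun _ => rfl

theorem modePair_ap_right (i₀ : Fin (N - 1)) (Φ : LinForm N) :
    modePair N lq k n Φ (plusF lq (aB i₀) a) = 0 := modePair_of_cre_zero fun _ => rfl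

theorem zeroForm_ap_right (i₀ : Fin (N - 1)) (Φ : LinForm N) :
    zeroForm N k Φ (plusF lq (aB i₀) a) = 0 := zeroForm_of_pos_zero fun _ => rfl

theorem zeroForm_am_right (i₀ : Fin (N - 1)) (Φ : LinForm N) :
    zeroForm N k Φ (minusF lq (aB i₀) a) = 0 := zeroForm_of_pos_zero fun _ => rfl

/-! ### Pairings of the individual boson fields. -/

section Values

theorem plusF_ann (x : Boson N) : plusF lq x a (Gen.ann x n) = qd lq * (zn n a)⁻¹ := by
  simp only [plusF, if_true, zn, ← Complex.exp_neg]; ring_nf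

theorem minusF_cre (x : Boson N) : minusF lq x a (Gen.cre x n) = -(qd lq * zn n a) := by
  simp only [minusF, if_true, zn]

theorem qnum_neg (x : ℂ) : qnum lq (-x) = -qnum lq x := by
  rw [qnum, qnum, neg_neg]; ring

theorem field_ann (x : Boson N) :
    field lq [] [] x 0 a (Gen.ann x n) = -(qnum lq n)⁻¹ * (zn n a)⁻¹ := by
  simp only [field, if_true, fieldCoeff, zn, ← Complex.exp_neg]
  simp [qpow]
  ring

theorem field_cre (x : Boson N) :
    field lq [] [] x 0 a (Gen.cre x n) = (qnum lq n)⁻¹ * zn n a := by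
  simp only [field, if_true, fieldCoeff, zn]
  simp [qpow, qnum_neg]

theorem aV_ann (i₀ : Fin (N - 1)) (h : qnum lq n ≠ 0) (α : ℂ) : aV N lq k i₀ α a
    (Gen.ann (aB i₀) n) = (qnum lq ((k + N) * n))⁻¹ * qpow lq (-α * n) * (zn n a)⁻¹ := by
  simp only [aV, Pi.neg_apply, field, if_true, fieldCoeff, zn, ← Complex.exp_neg]
  simp
  field_simp

theorem aV_cre (i₀ : Fin (N - 1)) (h : qnum lq n ≠ 0) (α : ℂ) : aV N lq k i₀ α a
    (Gen.cre (aB i₀) n) = -(qnum lq ((k + N) * n))⁻¹ * qpow lq (-α * n) * zn n a := by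
  simp only [aV, Pi.neg_apply, field, if_true, fieldCoeff, zn]
  simp [qnum_neg]
  field_simp
  simp

/-- The standing assumptions on the parameters. -/
structure Generic (N : ℕ) (lq k : ℂ) : Prop where
  norm_lt : ‖Complex.exp lq‖ < 1
  qnum_ne : ∀ n : ℕ, 0 < n → qnum lq ((k + N) * n) ≠ 0

theorem qn_eq_pow : qn lq n = Complex.exp lq ^ (n : ℕ) := by
  rw [qn, Complex.exp_nat_mul]

theorem Generic.qn_sub_ne_zero (h : Generic N lq k) : qn lq n - (qn lq n)⁻¹ ≠ 0 := by
  intro h0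
  have h1 : ‖qn lq n‖ < 1 := by
    rw [qn_eq_pow, norm_pow]; exact pow_lt_one₀ (norm_nonneg _) h.norm_lt n.ne_zero
  have h2 := congrArg norm (sub_eq_zero.1 h0)
  rw [norm_inv] at h2
  have h3 : 0 < ‖qn lq n‖ := norm_pos_iff.2 (qn_ne_zero lq n)
  have h4 := one_lt_inv₀ h3 |>.2 h1
  linarith

theorem qd_eq : qd lq = qn lq 1 - (qn lq 1)⁻¹ := by
  simp [qd, qpow, qn, Complex.exp_neg]

theorem Generic.qd_ne_zero (h : Generic N lq k) : qd lq ≠ 0 := by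
  rw [qd_eq]; exact h.qn_sub_ne_zero 1

theorem Generic.qd_mul_qnum (h : Generic N lq k) (x : ℂ) :
    qd lq * qnum lq x = qpow lq x - (qpow lq x)⁻¹ := by
  rw [qnum, mul_div_cancel₀ _ h.qd_ne_zero, qpow_neg]

theorem Generic.qnum_ne_zero (h : Generic N lq k) : qnum lq n ≠ 0 := by
  intro h0
  have := h.qd_mul_qnum n
  rw [h0, mul_zero, qpow_natCast] at this
  exact h.qn_sub_ne_zero n this.symm

theorem zn_sub : zn n (a' - a) = zn n a' * (zn n a)⁻¹ := by
  rw [zn, zn, zn, ← Complex.exp_neg, ← Complex.exp_add]; ring_nf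

/-- `q ^ n - q ^ (-n)`. -/
def qb (lq : ℂ) (n : ℕ+) : ℂ := qn lq n - (qn lq n)⁻¹

theorem Generic.qd_mul_qnum_natCast (h : Generic N lq k) : qd lq * qnum lq n = qb lq n :=
  h.qd_mul_qnum n

theorem modePair_plus_field (h : Generic N lq k) (r t : PosRoot N) :
    modePair N lq k n (plusF lq (bB r) a)
      (field lq [] [] (bB t) 0 a' + field lq [] [] (cB t) 0 a') =
      if r = t then -(qb lq n * zn n (a' - a)) else 0 := by
  have hn : (n : ℂ) ≠ 0 := Nat.cast_ne_zero.mpr n.ne_zero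
  have h1 := h.qnum_ne_zero n
  rw [map_add, modePair_single (x := bB r) (y := bB t), modePair_single (x := bB r) (y := cB t),
    plusF_ann, field_cre, field_cre, ← h.qd_mul_qnum_natCast, zn_sub]
  · simp only [kappa]
    split_ifs
    · field_simp; ring
    · simp
  all_goals exact fun x hx => by simp only [plusF, field, if_neg hx]

theorem modePair_plus_minus (h : Generic N lq k) (r t : PosRoot N) :
    modePair N lq k n (plusF lq (bB r) a) (minusF lq (bB t) a') =
      if r = t then qb lq n ^ 2 * zn n (a' - a) else 0 := by
  have hn : (n : ℂ) ≠ 0 := Nat.cast_ne_zero.mpr n.ne_zero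
  rw [modePair_single (x := bB r) (y := bB t),
    plusF_ann, minusF_cre, ← h.qd_mul_qnum_natCast, zn_sub]
  · simp only [kappa]
    split_ifs
    · field_simp
    · simp
  all_goals exact fun x hx => by simp only [plusF, minusF, if_neg hx]

theorem modePair_field_minus (h : Generic N lq k) (r t : PosRoot N) :
    modePair N lq k n (field lq [] [] (bB r) 0 a + field lq [] [] (cB r) 0 a)
      (minusF lq (bB t) a') =
      if r = t then -(qb lq n * zn n (a' - a)) else 0 := by
  have hn : (n : ℂ) ≠ 0 := Nat.cast_ne_zero.mpr n.ne_zero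
  have h1 := h.qnum_ne_zero n
  rw [map_add, LinearMap.add_apply, modePair_single (x := bB r) (y := bB t),
    modePair_single (x := cB r) (y := bB t),
    minusF_cre, field_ann, field_ann, ← h.qd_mul_qnum_natCast, zn_sub]
  · simp only [kappa]
    split_ifs
    · field_simp; ring
    · simp
  all_goals exact fun x hx => by simp only [minusF, field, if_neg hx]

/-- The commutators of `b` and `c` have opposite signs, so the exponentials of `b + c` do not
contract with each other. The two equal branches give the statement the shape required by
`pair_atRoot`. -/
theorem modePair_field_field (h : Generic N lq k) (r t : PosRoot N) :
    modePair N lq k n (field lq [] [] (bB r) 0 a + field lq [] [] (cB r) 0 a)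
      (field lq [] [] (bB t) 0 a' + field lq [] [] (cB t) 0 a') = if r = t then 0 else 0 := by
  have hn : (n : ℂ) ≠ 0 := Nat.cast_ne_zero.mpr n.ne_zero
  have h1 := h.qnum_ne_zero n
  rw [map_add, map_add, LinearMap.add_apply, LinearMap.add_apply,
    modePair_single (x := bB r) (y := bB t),
    modePair_single (x := cB r) (y := bB t), modePair_single (x := bB r) (y := cB t),
    modePair_single (x := cB r) (y := cB t),
    field_ann, field_ann, field_cre, field_cre]
  · simp only [kappa]
    split_ifs
    · field_simp; ring
    · simp
  all_goals exact fun x hx => by simp only [field, if_neg hx]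

theorem zeroForm_plus_field (r t : PosRoot N) :
    zeroForm N k (plusF lq (bB r) a)
      (field lq [] [] (bB t) 0 a' + field lq [] [] (cB t) 0 a') = if r = t then -lq else 0 := by
  rw [map_add, zeroForm_single (x := bB r) (y := bB t), zeroForm_single (x := bB r) (y := cB t)]
  · simp only [rho, plusF, field]
    split_ifs <;> simp
  all_goals exact fun x hx => by simp only [plusF, field, if_neg hx]

theorem zeroForm_minus_field (r t : PosRoot N) :
    zeroForm N k (minusF lq (bB r) a)
      (field lq [] [] (bB t) 0 a' + field lq [] [] (cB t) 0 a') = if r = t then lq else 0 := by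
  rw [map_add, zeroForm_single (x := bB r) (y := bB t), zeroForm_single (x := bB r) (y := cB t)]
  · simp only [rho, minusF, field]
    split_ifs <;> simp
  all_goals exact fun x hx => by simp only [minusF, field, if_neg hx]

theorem zeroForm_field_field (r t : PosRoot N) :
    zeroForm N k (field lq [] [] (bB r) 0 a + field lq [] [] (cB r) 0 a)
      (field lq [] [] (bB t) 0 a' + field lq [] [] (cB t) 0 a') = if r = t then 0 else 0 := by
  rw [map_add, map_add, LinearMap.add_apply, LinearMap.add_apply,
    zeroForm_single (x := bB r) (y := bB t), zeroForm_single (x := cB r) (y := bB t),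
    zeroForm_single (x := bB r) (y := cB t), zeroForm_single (x := cB r) (y := cB t)]
  · simp only [rho, field]
    split_ifs <;> simp
  all_goals exact fun x hx => by simp only [field, if_neg hx]

theorem modePair_bP_bc (h : Generic N lq k) : modePair N lq k n (bP N lq i j a) (bc N lq i' j' a') =
    if IsRoot N i j ∧ i = i' ∧ j = j' then -(qb lq n * zn n (a' - a)) else 0 :=
  pair_atRoot _ _ _ _ (modePair_plus_field n a a' h) _ _ _ _

theorem modePair_bP_bM (h : Generic N lq k) : modePair N lq k n (bP N lq i j a) (bM N lq i' j' a') =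
    if IsRoot N i j ∧ i = i' ∧ j = j' then qb lq n ^ 2 * zn n (a' - a) else 0 :=
  pair_atRoot _ _ _ _ (modePair_plus_minus n a a' h) _ _ _ _

theorem modePair_bc_bM (h : Generic N lq k) : modePair N lq k n (bc N lq i j a) (bM N lq i' j' a') =
    if IsRoot N i j ∧ i = i' ∧ j = j' then -(qb lq n * zn n (a' - a)) else 0 :=
  pair_atRoot _ _ _ _ (modePair_field_minus n a a' h) _ _ _ _

theorem modePair_bc_bc (h : Generic N lq k) :
    modePair N lq k n (bc N lq i j a) (bc N lq i' j' a') = 0 :=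
  (pair_atRoot _ _ _ _ (modePair_field_field n a a' h) i j i' j').trans (ite_self _)

theorem zeroForm_bP_bc : zeroForm N k (bP N lq i j a) (bc N lq i' j' a') =
    if IsRoot N i j ∧ i = i' ∧ j = j' then -lq else 0 :=
  pair_atRoot _ _ _ _ (zeroForm_plus_field a a') _ _ _ _

theorem zeroForm_bM_bc : zeroForm N k (bM N lq i j a) (bc N lq i' j' a') =
    if IsRoot N i j ∧ i = i' ∧ j = j' then lq else 0 :=
  pair_atRoot _ _ _ _ (zeroForm_minus_field a a') _ _ _ _

theorem zeroForm_bc_bc : zeroForm N k (bc N lq i j a) (bc N lq i' j' a') = 0 :=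
  (pair_atRoot _ _ _ _ (zeroForm_field_field a a') i j i' j').trans (ite_self _)

/-! The boson `a` does not interact with `b` and `c`. -/

theorem pair_of_cross {n : ℕ+} {Φ Ψ : LinForm N}
    (h : (∀ x, Φ (Gen.ann (Sum.inl x) n) = 0) ∧ (∀ y, Ψ (Gen.cre (Sum.inr y) n) = 0) ∨
      (∀ x, Φ (Gen.ann (Sum.inr x) n) = 0) ∧ (∀ y, Ψ (Gen.cre (Sum.inl y) n) = 0)) :
    modePair N lq k n Φ Ψ = 0 := by
  rw [modePair_apply]
  simp only [annShift, crePart, Fintype.sum_sum_type]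
  rcases h with ⟨h1, h2⟩ | ⟨h1, h2⟩
  · simp [h1, h2, kappa]
  · simp [h1, h2, kappa]

theorem zero_of_cross {Φ Ψ : LinForm N}
    (h : (∀ x, Φ (Gen.mom (Sum.inl x)) = 0) ∧ (∀ y, Ψ (Gen.pos (Sum.inr y)) = 0) ∨
      (∀ x, Φ (Gen.mom (Sum.inr x)) = 0) ∧ (∀ y, Ψ (Gen.pos (Sum.inl y)) = 0)) :
    zeroForm N k Φ Ψ = 0 := by
  rw [zeroForm_apply, zeroPair]
  simp only [posShift, Fintype.sum_sum_type]
  rcases h with ⟨h1, h2⟩ | ⟨h1, h2⟩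
  · simp [h1, h2, rho]
  · simp [h1, h2, rho]

variable (i₀ j₀ : Fin (N - 1)) (α : ℂ)

theorem modePair_bP_aV : modePair N lq k n (bP N lq i j a) (aV N lq k j₀ α a') = 0 :=
  pair_atRoot_left _ _ _ (fun _ => pair_of_cross (Or.inl
    ⟨fun _ => by simp [plusF], fun _ => by simp [aV, field]⟩)) _ _

theorem modePair_bc_aV : modePair N lq k n (bc N lq i j a) (aV N lq k j₀ α a') = 0 :=
  pair_atRoot_left _ _ _ (fun _ => pair_of_cross (Or.inl
    ⟨fun _ => by simp [field], fun _ => by simp [aV, field]⟩)) _ _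

theorem modePair_aV_bM : modePair N lq k n (aV N lq k j₀ α a) (bM N lq i j a') = 0 :=
  pair_atRoot_right _ _ _ (fun _ => pair_of_cross (Or.inr
    ⟨fun _ => by simp [aV, field], fun _ => by simp [minusF]⟩)) _ _

theorem modePair_aV_bc : modePair N lq k n (aV N lq k j₀ α a) (bc N lq i j a') = 0 :=
  pair_atRoot_right _ _ _ (fun _ => pair_of_cross (Or.inr
    ⟨fun _ => by simp [aV, field], fun _ => by simp [field]⟩)) _ _

theorem modePair_bP_am : modePair N lq k n (bP N lq i j a) (minusF lq (aB i₀) a') = 0 :=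
  pair_atRoot_left _ _ _ (fun _ => pair_of_cross (Or.inl
    ⟨fun _ => by simp [plusF], fun _ => by simp [minusF]⟩)) _ _

theorem modePair_bc_am : modePair N lq k n (bc N lq i j a) (minusF lq (aB i₀) a') = 0 :=
  pair_atRoot_left _ _ _ (fun _ => pair_of_cross (Or.inl
    ⟨fun _ => by simp [field], fun _ => by simp [minusF]⟩)) _ _

theorem modePair_ap_bM : modePair N lq k n (plusF lq (aB i₀) a) (bM N lq i j a') = 0 :=
  pair_atRoot_right _ _ _ (fun _ => pair_of_cross (Or.inr
    ⟨fun _ => by simp [plusF], fun _ => by simp [minusF]⟩)) _ _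

theorem modePair_ap_bc : modePair N lq k n (plusF lq (aB i₀) a) (bc N lq i j a') = 0 :=
  pair_atRoot_right _ _ _ (fun _ => pair_of_cross (Or.inr
    ⟨fun _ => by simp [plusF], fun _ => by simp [field]⟩)) _ _

theorem zeroForm_bP_aV : zeroForm N k (bP N lq i j a) (aV N lq k j₀ α a') = 0 :=
  pair_atRoot_left _ _ _ (fun _ => zero_of_cross (Or.inl
    ⟨fun _ => by simp [plusF], fun _ => by simp [aV, field]⟩)) _ _

theorem zeroForm_bM_aV : zeroForm N k (bM N lq i j a) (aV N lq k j₀ α a') = 0 :=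
  pair_atRoot_left _ _ _ (fun _ => zero_of_cross (Or.inl
    ⟨fun _ => by simp [minusF], fun _ => by simp [aV, field]⟩)) _ _

theorem zeroForm_bc_aV : zeroForm N k (bc N lq i j a) (aV N lq k j₀ α a') = 0 :=
  pair_atRoot_left _ _ _ (fun _ => zero_of_cross (Or.inl
    ⟨fun _ => by simp [field], fun _ => by simp [aV, field]⟩)) _ _

theorem zeroForm_aV_bc : zeroForm N k (aV N lq k j₀ α a) (bc N lq i j a') = 0 :=
  pair_atRoot_right _ _ _ (fun _ => zero_of_cross (Or.inr
    ⟨fun _ => by simp [aV, field], fun _ => by simp [field]⟩)) _ _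

theorem zeroForm_ap_bc : zeroForm N k (plusF lq (aB i₀) a) (bc N lq i j a') = 0 :=
  pair_atRoot_right _ _ _ (fun _ => zero_of_cross (Or.inr
    ⟨fun _ => by simp [plusF], fun _ => by simp [field]⟩)) _ _

theorem zeroForm_am_bc : zeroForm N k (minusF lq (aB i₀) a) (bc N lq i j a') = 0 :=
  pair_atRoot_right _ _ _ (fun _ => zero_of_cross (Or.inr
    ⟨fun _ => by simp [minusF], fun _ => by simp [field]⟩)) _ _

theorem Generic.qnum_k_ne_zero (h : Generic N lq k) : qnum lq ((k + N) * n) ≠ 0 :=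
  h.qnum_ne n n.pos

/-- The contraction of `a_+` with the vertex form, with `A` the entry of the Cartan matrix. -/
theorem modePair_ap_aV (h : Generic N lq k) :
    modePair N lq k n (plusF lq (aB i₀) a) (aV N lq k j₀ α a') =
      -((qpow lq ((CartanMatrix.A (N - 1) i₀ j₀ : ℂ) * n) -
        (qpow lq ((CartanMatrix.A (N - 1) i₀ j₀ : ℂ) * n))⁻¹) * zn n (a' - α * lq - a)) := by
  have hn : (n : ℂ) ≠ 0 := Nat.cast_ne_zero.mpr n.ne_zero
  have h1 := h.qnum_k_ne_zero n
  rw [modePair_single (x := aB i₀) (y := aB j₀), plusF_ann, aV_cre _ _ _ (h.qnum_ne_zero n),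
    ← h.qd_mul_qnum]
  · have : zn n (a' - α * lq - a) = qpow lq (-α * n) * zn n a' * (zn n a)⁻¹ := by
      rw [zn_sub]; congr 1; rw [qpow, zn, zn, ← Complex.exp_add]; ring_nf
    rw [this]
    simp only [kappa]
    -- The factor `[(k + N) n]` of the commutator of the bosons `a` cancels the denominator in the
    -- vertex form.
    generalize qnum lq ((k + N) * n) = Q at *
    field_simp
  · intro x hx; simp only [plusF, if_neg hx]
  · intro x hx; simp only [aV, field, Pi.neg_apply, if_neg hx, neg_zero]

theorem modePair_aV_am (h : Generic N lq k) :
    modePair N lq k n (aV N lq k j₀ α a) (minusF lq (aB i₀) a') =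
      -((qpow lq ((CartanMatrix.A (N - 1) j₀ i₀ : ℂ) * n) -
        (qpow lq ((CartanMatrix.A (N - 1) j₀ i₀ : ℂ) * n))⁻¹) * zn n (a' - α * lq - a)) := by
  have hn : (n : ℂ) ≠ 0 := Nat.cast_ne_zero.mpr n.ne_zero
  have h1 := h.qnum_k_ne_zero n
  rw [modePair_single (x := aB j₀) (y := aB i₀), minusF_cre, aV_ann _ _ _ (h.qnum_ne_zero n),
    ← h.qd_mul_qnum]
  · have : zn n (a' - α * lq - a) = qpow lq (-α * n) * zn n a' * (zn n a)⁻¹ := by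
      rw [zn_sub]; congr 1; rw [qpow, zn, zn, ← Complex.exp_add]; ring_nf
    rw [this]
    simp only [kappa]
    generalize qnum lq ((k + N) * n) = Q at *
    field_simp
  · intro x hx; simp only [aV, field, Pi.neg_apply, if_neg hx, neg_zero]
  · intro x hx; simp only [minusF, if_neg hx]

/-- Otherwise `[(k + N) n]` would already vanish at `n = 1`. -/
theorem Generic.k_add_ne_zero (h : Generic N lq k) : k + N ≠ 0 := fun h0 => by
  have := h.qnum_ne 1 one_pos
  rw [h0] at this
  simp [qnum, qpow] at this

theorem zeroForm_ap_aV (h : Generic N lq k) :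
    zeroForm N k (plusF lq (aB i₀) a) (aV N lq k j₀ α a') =
      -((CartanMatrix.A (N - 1) i₀ j₀ : ℂ) * lq) := by
  have h1 := h.k_add_ne_zero
  rw [zeroForm_single (x := aB i₀) (y := aB j₀)]
  · simp only [rho, plusF, aV, field, Pi.neg_apply, if_true, List.prod_cons, List.prod_nil]
    field_simp
  · intro x hx; simp only [plusF, if_neg hx]
  · intro x hx; simp only [aV, field, Pi.neg_apply, if_neg hx, neg_zero]

theorem zeroForm_am_aV (h : Generic N lq k) :
    zeroForm N k (minusF lq (aB i₀) a) (aV N lq k j₀ α a') =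
      (CartanMatrix.A (N - 1) i₀ j₀ : ℂ) * lq := by
  have h1 := h.k_add_ne_zero
  rw [zeroForm_single (x := aB i₀) (y := aB j₀)]
  · simp only [rho, minusF, aV, field, Pi.neg_apply, if_true, List.prod_cons, List.prod_nil]
    field_simp
  · intro x hx; simp only [minusF, if_neg hx]
  · intro x hx; simp only [aV, field, Pi.neg_apply, if_neg hx, neg_zero]

end Values

end Fields

end

end UqSlN

namespace UqSlN

noncomputable section

open scoped BigOperators
open Filter Topology

/-! ### The exponents of the screening currents -/

section Screening

variable {N : ℕ} {lq k : ℂ}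

/-- The logarithm of the point at which `b ^ {lc}` enters the current `S̃ ^ j(z)`, `z = exp v`. -/
def sPt (N : ℕ) (lq : ℂ) (j l c : ℕ) (v : ℂ) : ℂ := v + ((N : ℂ) - c + l - j) * lq

/-- The common part of the exponents of both terms with index `m` in `S̃ ^ j(z)`. -/
def sTail (N : ℕ) (lq : ℂ) (j m : ℕ) (v : ℂ) : LinForm N :=
  ∑ c ∈ Finset.Icc (m + 1) N,
    (bM N lq (j + 1) c (sPt N lq j (j + 1) c v) - bM N lq j c (sPt N lq j j c v))

/-- The exponents in `S̃ ^ j(z)`: those of the positive terms, then those of the negative ones. -/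
def sTerm (N : ℕ) (lq : ℂ) (j : ℕ) : ℕ ⊕ ℕ → ℂ → LinForm N
  | Sum.inl m, v => bc N lq (j + 1) m (sPt N lq j (j + 1) m v - lq)
      - bM N lq j m (sPt N lq j j m v) - bc N lq j m (sPt N lq j j m v + lq) + sTail N lq j m v
  | Sum.inr m, v => bc N lq (j + 1) m (sPt N lq j (j + 1) m v - lq)
      - bP N lq j m (sPt N lq j j m v) - bc N lq j m (sPt N lq j j m v - lq) + sTail N lq j m v

/-- The index of a term. -/
@[reducible] def tIdx : ℕ ⊕ ℕ → ℕ
  | Sum.inl m => m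
  | Sum.inr m => m


/-- The rows that occur in `S̃ ^ j`, with signs. -/
def sRow (j l : ℕ) : ℂ := (if l = j + 1 then 1 else 0) - (if l = j then 1 else 0)

/-- A fixed root meets the sum over columns at most once in each of the rows `j` and `j + 1`. -/
theorem sum_ite_rows (P : Prop) [Decidable P] (l j c : ℕ) (s : Finset ℕ) (F G : ℕ → ℂ) :
    ∑ c' ∈ s, ((if P ∧ l = j + 1 ∧ c = c' then F c' else 0) -
      (if P ∧ l = j ∧ c = c' then G c' else 0)) =
    if P ∧ c ∈ s then (if l = j + 1 then F c else 0) - (if l = j then G c else 0) else 0 := by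
  by_cases hc : c ∈ s
  · rw [Finset.sum_eq_single c]
    · by_cases hP : P <;> simp [hP, hc]
    · intro c' _ hne
      rw [if_neg fun h => hne h.2.2.symm, if_neg fun h => hne h.2.2.symm, sub_zero]
    · exact fun h => absurd hc h
  · rw [if_neg fun h => hc h.2]
    refine Finset.sum_eq_zero fun c' hc' => ?_
    have : c ≠ c' := fun h => hc (h ▸ hc')
    rw [if_neg fun h => this h.2.2, if_neg fun h => this h.2.2, sub_zero]

variable (n : ℕ+) (j l c m : ℕ) (a v : ℂ)

theorem pair_bM_sTail {β : LinForm N →ₗ[ℂ] LinForm N →ₗ[ℂ] ℂ} {Φ : LinForm N} {D : ℂ}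
    (h : ∀ i' j' a', β Φ (bM N lq i' j' a') =
      if IsRoot N l c ∧ l = i' ∧ c = j' then D * zn n (a' - a) else 0) (hr : IsRoot N l c) :
    β Φ (sTail N lq j m v) =
      sRow j l * (if m < c then D else 0) * zn n (sPt N lq j l c v - a) := by
  rw [sTail, map_sum]
  simp only [map_sub, h]
  rw [sum_ite_rows]
  have hc : c ≤ N := hr.2.2
  simp only [hr, true_and, Finset.mem_Icc, hc, and_true, Nat.succ_le_iff, sRow]
  by_cases h1 : m < c
  · simp only [h1, if_true]
    by_cases h2 : l = j + 1
    · subst h2; simp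
    · by_cases h3 : l = j
      · subst h3; simp
      · simp [h2, h3]
  · simp [h1]

theorem modePair_bP_sTail (hG : Generic N lq k) (hr : IsRoot N l c) :
    modePair N lq k n (bP N lq l c a) (sTail N lq j m v) =
      sRow j l * (if m < c then qb lq n ^ 2 else 0) * zn n (sPt N lq j l c v - a) :=
  pair_bM_sTail n j l c m a v (fun _ _ _ => modePair_bP_bM n _ _ _ _ _ _ hG) hr

theorem modePair_bc_sTail (hG : Generic N lq k) (hr : IsRoot N l c) :
    modePair N lq k n (bc N lq l c a) (sTail N lq j m v) =
      sRow j l * (if m < c then -qb lq n else 0) * zn n (sPt N lq j l c v - a) :=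
  pair_bM_sTail n j l c m a v (fun i' j' a' => by
    rw [modePair_bc_bM n _ _ _ _ _ _ hG]; congr 1; ring) hr

theorem zeroForm_sTail_right (Φ : LinForm N) : zeroForm N k Φ (sTail N lq j m v) = 0 := by
  simp [sTail, zeroForm_bM_right]

theorem modePair_sTail_left (Ψ : LinForm N) :
    modePair N lq k n (sTail N lq j m v) Ψ = 0 := by
  simp [sTail, modePair_bM_left]

theorem zeroForm_sTail_bc (hr : IsRoot N l c) :
    zeroForm N k (sTail N lq j m v) (bc N lq l c a) = sRow j l * (if m < c then lq else 0) := by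
  rw [sTail, map_sum, LinearMap.sum_apply]
  simp only [map_sub, LinearMap.sub_apply, zeroForm_bM_bc]
  have e : ∀ x i' : ℕ, (IsRoot N i' x ∧ i' = l ∧ x = c) ↔ (IsRoot N l c ∧ l = i' ∧ c = x) :=
    fun x i' => ⟨fun ⟨h1, h2, h3⟩ => ⟨hr, h2.symm, h3.symm⟩,
      fun ⟨h1, h2, h3⟩ => ⟨by rw [← h2, ← h3]; exact hr, h2.symm, h3.symm⟩⟩
  simp only [e]
  rw [sum_ite_rows]
  have hc : c ≤ N := hr.2.2
  simp only [hr, true_and, Finset.mem_Icc, hc, and_true, Nat.succ_le_iff, sRow]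
  by_cases h1 : m < c
  · simp only [h1, if_true]
    by_cases h2 : l = j + 1
    · subst h2; simp
    · by_cases h3 : l = j
      · subst h3; simp
      · simp [h2, h3]
  · simp [h1]

variable (β : ℕ ⊕ ℕ)

/-- The column dependence of the contraction of `b_+` with a screening current. -/
def sCol (lq : ℂ) (n : ℕ+) (m c : ℕ) : ℂ :=
  (if m ≤ c then (qn lq n)⁻¹ else 0) - (if m < c then qn lq n else 0)

/-- The positive and the negative term with the same index contract equally with `b_+`. At the root
`(j, m)` the positive term gives `-qb ^ 2` from `b_-` and `qb q ^ n` from the shifted `b + c`. Their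
sum is `qb q ^ (-n)`, which is what the oppositely shifted `b + c` of the negative term gives alone.
-/
theorem modePair_bP_sTerm (hG : Generic N lq k) (hr : IsRoot N l c) :
    modePair N lq k n (bP N lq l c a) (sTerm N lq j β v) =
      -qb lq n * sRow j l * sCol lq n (tIdx β) c * zn n (sPt N lq j l c v - a) := by
  have ht := qn_ne_zero lq n
  rcases β with m | m
  all_goals
    simp only [sTerm, map_add, map_sub, modePair_bP_bc n _ _ _ _ _ _ hG,
      modePair_bP_bM n _ _ _ _ _ _ hG, modePair_bP_sTail n _ _ _ _ _ _ hG hr, zn_add_lq,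
      zn_sub_lq, hr, true_and, modePair_bP_right]
    by_cases h1 : l = j + 1
    · subst h1
      rcases lt_trichotomy c m with h | rfl | h
      · simp [sRow, sCol, h.ne, h.not_gt, h.not_ge]
      · simp [sRow, sCol]; ring
      · simp [sRow, sCol, h.ne', h, h.le, qb]; exact Or.inl (by ring)
    · by_cases h2 : l = j
      · subst h2
        rcases lt_trichotomy c m with h | rfl | h
        · simp [sRow, sCol, h.ne, h.not_gt, h.not_ge]
        · simp [sRow, sCol, qb]; try ring
        · simp [sRow, sCol, h.ne', h, h.le, qb]; ring
      · simp [sRow, h1, h2]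

/-- Fields `b + c` to the left contract only with `b_-`. Here the two kinds of terms differ, since
only the positive one contains `b_-` at the root `(j, m)`. -/
theorem modePair_bc_sTerm_inl (hG : Generic N lq k) (hr : IsRoot N l c) :
    modePair N lq k n (bc N lq l c a) (sTerm N lq j (Sum.inl m) v) =
      -qb lq n * (sRow j l * (if m < c then 1 else 0) - if l = j ∧ c = m then 1 else 0) *
        zn n (sPt N lq j l c v - a) := by
  simp only [sTerm, map_add, map_sub, modePair_bc_bc n _ _ _ _ _ _ hG,
      modePair_bc_bM n _ _ _ _ _ _ hG, modePair_bc_sTail n _ _ _ _ _ _ hG hr, hr, true_and]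
  by_cases h2 : l = j ∧ c = m
  · obtain ⟨rfl, rfl⟩ := h2
    simp
  · simp only [h2, if_false]
    split_ifs <;> ring

theorem modePair_bc_sTerm_inr (hG : Generic N lq k) (hr : IsRoot N l c) :
    modePair N lq k n (bc N lq l c a) (sTerm N lq j (Sum.inr m) v) =
      -qb lq n * (sRow j l * (if m < c then 1 else 0)) * zn n (sPt N lq j l c v - a) := by
  simp only [sTerm, map_add, map_sub, modePair_bc_bc n _ _ _ _ _ _ hG, modePair_bP_right,
      modePair_bc_sTail n _ _ _ _ _ _ hG hr]
  split_ifs <;> ring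

theorem isRoot_symm_iff (hr : IsRoot N l c) (x i' : ℕ) :
    (IsRoot N i' x ∧ i' = l ∧ x = c) ↔ (l = i' ∧ c = x) :=
  ⟨fun ⟨_, h2, h3⟩ => ⟨h2.symm, h3.symm⟩,
      fun ⟨h2, h3⟩ => ⟨by rw [← h2, ← h3]; exact hr, h2.symm, h3.symm⟩⟩

/-- As for `b_+` on the other side, the two kinds of terms agree: at `(j, m)` the `b_+` of the
negative term compensates the opposite shift of its `b + c`. -/
theorem modePair_sTerm_bM (hG : Generic N lq k) (hr : IsRoot N l c) :
    modePair N lq k n (sTerm N lq j β v) (bM N lq l c a) =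
      -qb lq n * ((if l = j + 1 ∧ c = tIdx β then qn lq n else 0) -
        if l = j ∧ c = tIdx β then (qn lq n)⁻¹ else 0) * zn n (a - sPt N lq j l c v) := by
  have ht := qn_ne_zero lq n
  rcases β with m | m
  all_goals
    simp only [sTerm, map_add, map_sub, LinearMap.add_apply, LinearMap.sub_apply,
      modePair_bP_bM n _ _ _ _ _ _ hG, modePair_bM_left,
      modePair_bc_bM n _ _ _ _ _ _ hG, modePair_sTail_left, zn_sub_add_lq,
      zn_sub_sub_lq, isRoot_symm_iff l c hr]
    by_cases h1 : l = j + 1 ∧ c = m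
    · obtain ⟨rfl, rfl⟩ := h1
      simp; try ring
    · simp only [h1, if_false]
      by_cases h2 : l = j ∧ c = m
      · obtain ⟨rfl, rfl⟩ := h2
        simp [qb]; try ring
      · simp [h2]

theorem modePair_sTerm_bc_inl (hG : Generic N lq k) :
    modePair N lq k n (sTerm N lq j (Sum.inl m) v) (bc N lq l c a) = 0 := by
  simp only [sTerm, map_add, map_sub, LinearMap.add_apply, LinearMap.sub_apply, modePair_bM_left,
      modePair_bc_bc n _ _ _ _ _ _ hG, modePair_sTail_left, sub_zero, add_zero]

theorem modePair_sTerm_bc_inr (hG : Generic N lq k) (hr : IsRoot N l c) :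
    modePair N lq k n (sTerm N lq j (Sum.inr m) v) (bc N lq l c a) =
      (if l = j ∧ c = m then qb lq n else 0) * zn n (a - sPt N lq j l c v) := by
  simp only [sTerm, map_add, map_sub, LinearMap.add_apply, LinearMap.sub_apply,
      modePair_bP_bc n _ _ _ _ _ _ hG, modePair_bc_bc n _ _ _ _ _ _ hG, modePair_sTail_left,
      isRoot_symm_iff l c hr]
  by_cases h2 : l = j ∧ c = m
  · obtain ⟨rfl, rfl⟩ := h2
    simp
  · simp [h2]

theorem zeroForm_bP_sTerm (hr : IsRoot N l c) :
    zeroForm N k (bP N lq l c a) (sTerm N lq j β v) =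
      -lq * (if c = tIdx β then sRow j l else 0) := by
  rcases β with m | m
  all_goals
    simp only [sTerm, map_add, map_sub, zeroForm_bP_bc, zeroForm_bM_right, zeroForm_bP_right,
      zeroForm_sTail_right, hr, true_and, sRow]
    split_ifs <;> simp_all

theorem zeroForm_bM_sTerm (hr : IsRoot N l c) :
    zeroForm N k (bM N lq l c a) (sTerm N lq j β v) =
      lq * (if c = tIdx β then sRow j l else 0) := by
  rcases β with m | m
  all_goals
    simp only [sTerm, map_add, map_sub, zeroForm_bM_bc, zeroForm_bM_right, zeroForm_bP_right,
      zeroForm_sTail_right, hr, true_and, sRow]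
    split_ifs <;> simp_all

theorem zeroForm_bc_sTerm : zeroForm N k (bc N lq l c a) (sTerm N lq j β v) = 0 := by
  rcases β with m | m
  all_goals
    simp only [sTerm, map_add, map_sub, zeroForm_bc_bc, zeroForm_bM_right, zeroForm_bP_right,
      zeroForm_sTail_right, sub_zero, add_zero]

theorem zeroForm_sTerm_bc_inl (hr : IsRoot N l c) :
    zeroForm N k (sTerm N lq j (Sum.inl m) v) (bc N lq l c a) =
      lq * (sRow j l * (if m < c then 1 else 0) - if l = j ∧ c = m then 1 else 0) := by
  simp only [sTerm, map_add, map_sub, LinearMap.add_apply, LinearMap.sub_apply, zeroForm_bc_bc,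
    zeroForm_bM_bc, zeroForm_sTail_bc _ _ _ _ _ _ hr, isRoot_symm_iff l c hr]
  split_ifs <;> ring

theorem zeroForm_sTerm_bc_inr (hr : IsRoot N l c) :
    zeroForm N k (sTerm N lq j (Sum.inr m) v) (bc N lq l c a) =
      lq * (sRow j l * (if m < c then 1 else 0) + if l = j ∧ c = m then 1 else 0) := by
  simp only [sTerm, map_add, map_sub, LinearMap.add_apply, LinearMap.sub_apply, zeroForm_bc_bc,
    zeroForm_bP_bc, zeroForm_sTail_bc _ _ _ _ _ _ hr, isRoot_symm_iff l c hr]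
  split_ifs <;> ring

theorem bc_of_not_isRoot (h : ¬IsRoot N l c) : bc N lq l c a = 0 := dif_neg h

theorem bP_of_not_isRoot (h : ¬IsRoot N l c) : bP N lq l c a = 0 := dif_neg h

theorem bM_of_not_isRoot (h : ¬IsRoot N l c) : bM N lq l c a = 0 := dif_neg h

end Screening

end

end UqSlN

namespace UqSlN

noncomputable section

open scoped BigOperators
open Filter Topology

/-! ### Families of forms with elementary matrix elements -/

section Families

variable {N : ℕ} {lq k : ℂ}

/-- An affine function of `u` and `v` with integral slope in `u`. -/
def IntAffine (p : ℂ → ℂ → ℂ) : Prop :=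
  ∃ (a : ℤ) (b c : ℂ), ∀ u v, p u v = a * u + b * v + c

theorem IntAffine.add {p r : ℂ → ℂ → ℂ} (hp : IntAffine p) (hr : IntAffine r) :
    IntAffine fun u v => p u v + r u v := by
  obtain ⟨a, b, c, h⟩ := hp
  obtain ⟨a', b', c', h'⟩ := hr
  exact ⟨a + a', b + b', c + c', fun u v => by simp only [h, h']; push_cast; ring⟩

theorem IntAffine.neg {p : ℂ → ℂ → ℂ} (hp : IntAffine p) : IntAffine fun u v => -p u v := by
  obtain ⟨a, b, c, h⟩ := hp
  exact ⟨-a, -b, -c, fun u v => by simp only [h]; push_cast; ring⟩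

theorem IntAffine.int_mul {p : ℂ → ℂ → ℂ} (hp : IntAffine p) (m : ℤ) :
    IntAffine fun u v => m * p u v := by
  obtain ⟨a, b, c, h⟩ := hp
  exact ⟨m * a, m * b, m * c, fun u v => by simp only [h]; push_cast; ring⟩

theorem IntAffine.const (c : ℂ) : IntAffine fun _ _ => c := ⟨0, 0, c, fun u v => by simp⟩

theorem IntAffine.fst : IntAffine fun u _ => u := ⟨1, 0, 0, fun u v => by simp⟩

theorem IntAffine.snd : IntAffine fun _ v => v := ⟨0, 1, 0, fun u v => by simp⟩

theorem IntAffine.add_const {p : ℂ → ℂ → ℂ} (hp : IntAffine p) (c : ℂ) :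
    IntAffine fun u v => p u v + c := hp.add (.const c)

theorem IntAffine.sub_const {p : ℂ → ℂ → ℂ} (hp : IntAffine p) (c : ℂ) :
    IntAffine fun u v => p u v - c := by
  simpa only [sub_eq_add_neg] using hp.add_const (-c)

theorem IntAffine.exp {p : ℂ → ℂ → ℂ} (hp : IntAffine p) :
    (fun u v => Complex.exp (p u v)) ∈ expAlg := by
  obtain ⟨a, b, c, h⟩ := hp
  simp only [h]
  exact expAlg_exp_affine a b c

/-- Families of forms whose normal ordered exponentials have matrix elements in `expAlg`. -/
structure ExpFamily (Θ : ℂ → ℂ → LinForm N) : Prop where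
  ann : ∀ x n, (fun u v => Θ u v (Gen.ann x n)) ∈ expAlg
  cre : ∀ x n, (fun u v => Θ u v (Gen.cre x n)) ∈ expAlg
  pos : ∃ P : Boson N → ℂ, ∀ u v x, Θ u v (Gen.pos x) = P x
  mom : ∀ t : State N, Integral t → IntAffine fun u v => ∑ x, Θ u v (Gen.mom x) * t.1 x

theorem ExpFamily.add {Θ Ξ : ℂ → ℂ → LinForm N} (h : ExpFamily Θ) (h' : ExpFamily Ξ) :
    ExpFamily fun u v => Θ u v + Ξ u v where
  ann x n := expAlg_add (h.ann x n) (h'.ann x n)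
  cre x n := expAlg_add (h.cre x n) (h'.cre x n)
  pos := by
    obtain ⟨P, hP⟩ := h.pos
    obtain ⟨P', hP'⟩ := h'.pos
    exact ⟨P + P', fun u v x => by rw [Pi.add_apply, hP, hP', Pi.add_apply]⟩
  mom t ht := by
    simpa only [Pi.add_apply, add_mul, Finset.sum_add_distrib] using (h.mom t ht).add (h'.mom t ht)

theorem ExpFamily.neg {Θ : ℂ → ℂ → LinForm N} (h : ExpFamily Θ) :
    ExpFamily fun u v => -Θ u v where
  ann x n := expAlg_neg (h.ann x n)
  cre x n := expAlg_neg (h.cre x n)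
  pos := by
    obtain ⟨P, hP⟩ := h.pos
    exact ⟨-P, fun u v x => by rw [Pi.neg_apply, hP, Pi.neg_apply]⟩
  mom t ht := by
    simpa only [Pi.neg_apply, neg_mul, Finset.sum_neg_distrib] using (h.mom t ht).neg

theorem ExpFamily.sub {Θ Ξ : ℂ → ℂ → LinForm N} (h : ExpFamily Θ) (h' : ExpFamily Ξ) :
    ExpFamily fun u v => Θ u v - Ξ u v := by
  simpa only [sub_eq_add_neg] using h.add h'.neg

theorem ExpFamily.zero : ExpFamily fun _ _ => (0 : LinForm N) where
  ann _ _ := expAlg_const 0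
  cre _ _ := expAlg_const 0
  pos := ⟨0, fun _ _ _ => rfl⟩
  mom t _ := by simpa using IntAffine.const 0

theorem ExpFamily.sum {ι : Type*} (s : Finset ι) {Θ : ι → ℂ → ℂ → LinForm N}
    (h : ∀ i ∈ s, ExpFamily (Θ i)) : ExpFamily fun u v => ∑ i ∈ s, Θ i u v := by
  classical
  induction s using Finset.induction_on with
  | empty => simpa using ExpFamily.zero
  | insert a s ha ih =>
    simp only [Finset.sum_insert ha]
    exact (h a (Finset.mem_insert_self a s)).add
      (ih fun i hi => h i (Finset.mem_insert_of_mem hi))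

theorem ExpFamily.shiftHom_coeff {Θ : ℂ → ℂ → LinForm N} (h : ExpFamily Θ)
    (d : (Boson N × ℕ+) →₀ ℕ) : ∀ n, (fun u v => MvPolynomial.coeff n
      (shiftHom (annShift N lq k (Θ u v)) (MvPolynomial.monomial d (1 : ℂ)))) ∈ expAlg := by
  classical
  have hshift : ∀ w, (fun u v => annShift N lq k (Θ u v) w) ∈ expAlg := fun w =>
    expAlg_sum _ fun x _ => expAlg_mul (h.ann x w.2) (expAlg_const _)
  induction d using finsupp_nat_induction with
  | h0 =>
    intro n
    simp only [MvPolynomial.monomial_zero', map_one]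
    exact expAlg_const _
  | h1 d w ih =>
    intro n
    simp only [shiftHom_monomial_add_single, MvPolynomial.coeff_add, MvPolynomial.coeff_smul,
      MvPolynomial.coeff_mul_X', smul_eq_mul]
    refine expAlg_add ?_ (expAlg_mul (hshift w) (ih n))
    split_ifs
    · exact ih _
    · exact expAlg_const 0

/-- The coefficients of the position operators do not depend on `(u, v)`, so the condition linking
initial and final momenta is constant. For fixed states the remaining coefficient involves finitely
many modes, each of them in `expAlg`. -/
theorem ExpFamily.nexp {Θ : ℂ → ℂ → LinForm N} (h : ExpFamily Θ) (s : State N) {t : State N}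
    (ht : Integral t) : (fun u v => nexp N lq k (Θ u v) s t) ∈ expAlg := by
  classical
  obtain ⟨P, hP⟩ := h.pos
  have hpos : ∀ u v, posShift k (Θ u v) = fun y => ∑ x, P x * rho N k y x := fun u v => by
    funext y; simp [posShift, hP]
  simp only [nexp_apply, hpos]
  split_ifs
  · refine expAlg_mul (h.mom t ht).exp ?_
    simp only [MvPowerSeries.coeff_mul]
    refine expAlg_sum _ fun p _ => expAlg_mul ?_ ?_
    · simp only [coeff_expSeries, Finsupp.prod, div_eq_mul_inv, crePart]
      exact expAlg_prod _ fun w _ => expAlg_mul (expAlg_pow (h.cre _ _) _) (expAlg_const _)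
    · simp only [MvPolynomial.coeff_coe]
      exact h.shiftHom_coeff t.2 p.2
  · exact expAlg_const 0

theorem expAlg_zn {p : ℂ → ℂ → ℂ} (hp : IntAffine p) (n : ℕ+) :
    (fun u v => Complex.exp ((n : ℂ) * p u v)) ∈ expAlg := by
  simpa using (hp.int_mul n).exp

theorem ExpFamily.plusF {p : ℂ → ℂ → ℂ} (hp : IntAffine p) (x : Boson N) :
    ExpFamily fun u v => plusF lq x (p u v) where
  ann y n := by
    simp only [UqSlN.plusF]
    split_ifs
    · simp only [neg_mul, ← mul_neg]
      exact expAlg_const_mul _ (expAlg_zn hp.neg n)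
    · exact expAlg_const 0
  cre _ _ := expAlg_const 0
  pos := ⟨0, fun _ _ _ => rfl⟩
  mom t _ := IntAffine.const (∑ x', (if x' = x then lq else 0) * t.1 x')

theorem ExpFamily.minusF {p : ℂ → ℂ → ℂ} (hp : IntAffine p) (x : Boson N) :
    ExpFamily fun u v => minusF lq x (p u v) where
  cre y n := by
    simp only [UqSlN.minusF]
    split_ifs
    · exact expAlg_neg (expAlg_const_mul _ (expAlg_zn hp n))
    · exact expAlg_const 0
  ann _ _ := expAlg_const 0
  pos := ⟨0, fun _ _ _ => rfl⟩
  mom t _ := IntAffine.const (∑ x', (if x' = x then -lq else 0) * t.1 x')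

theorem field_osc_mem {p : ℂ → ℂ → ℂ} (hp : IntAffine p) (L M : List ℂ) (α : ℂ) (m : ℤ) :
    (fun u v => fieldCoeff lq L M α (p u v) m) ∈ expAlg := by
  simp only [fieldCoeff]
  refine expAlg_const_mul _ ?_
  simpa using (hp.int_mul (-m)).exp

theorem field_ann_mem {p : ℂ → ℂ → ℂ} (hp : IntAffine p) (L M : List ℂ) (α : ℂ) (x y : Boson N)
    (n : ℕ+) : (fun u v => field lq L M x α (p u v) (Gen.ann y n)) ∈ expAlg := by
  simp only [field]
  split_ifs
  · exact field_osc_mem hp L M α _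
  · exact expAlg_const 0

theorem field_cre_mem {p : ℂ → ℂ → ℂ} (hp : IntAffine p) (L M : List ℂ) (α : ℂ) (x y : Boson N)
    (n : ℕ+) : (fun u v => field lq L M x α (p u v) (Gen.cre y n)) ∈ expAlg := by
  simp only [field]
  split_ifs
  · exact field_osc_mem hp L M α _
  · exact expAlg_const 0

/-- This is where integrality of the states enters: the exponent of `z` is the eigenvalue of `p_b +
p_c` at this root. -/
theorem ExpFamily.bc {p : ℂ → ℂ → ℂ} (hp : IntAffine p) (i j : ℕ) :
    ExpFamily fun u v => bc N lq i j (p u v) := by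
  by_cases h : IsRoot N i j
  · unfold UqSlN.bc atRoot
    simp only [show 1 ≤ i ∧ i < j ∧ j ≤ N from h, and_self, dite_true]
    refine ⟨fun y n => expAlg_add (field_ann_mem hp _ _ _ _ _ _) (field_ann_mem hp _ _ _ _ _ _),
      fun y n => expAlg_add (field_cre_mem hp _ _ _ _ _ _) (field_cre_mem hp _ _ _ _ _ _),
      ⟨fun x => _ + _, fun u v x => rfl⟩, fun t ht => ?_⟩
    simp only [Pi.add_apply, field, List.prod_nil, div_one, one_mul, add_mul, ite_mul, zero_mul,
      Finset.sum_add_distrib, Finset.sum_ite_eq', Finset.mem_univ, if_true, ← mul_add]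
    obtain ⟨m, hm⟩ := ht ⟨(⟨i - 1, by have := h.1; have := h.2; omega⟩,
      ⟨j - 1, by have := h.1; have := h.2; omega⟩), Fin.mk_lt_mk.mpr
        (by have := h.1; have := h.2; omega)⟩
    simp only [hm]
    simpa only [mul_comm] using hp.int_mul m
  · simp only [bc_of_not_isRoot _ _ _ h]
    exact ExpFamily.zero

theorem ExpFamily.bP {p : ℂ → ℂ → ℂ} (hp : IntAffine p) (i j : ℕ) :
    ExpFamily fun u v => bP N lq i j (p u v) := by
  unfold UqSlN.bP atRoot
  split_ifs
  · exact .plusF hp _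
  · exact .zero

theorem ExpFamily.bM {p : ℂ → ℂ → ℂ} (hp : IntAffine p) (i j : ℕ) :
    ExpFamily fun u v => bM N lq i j (p u v) := by
  unfold UqSlN.bM atRoot
  split_ifs
  · exact .minusF hp _
  · exact .zero

/-- The momentum exponent of this vertex operator is an arbitrary complex number, so it may depend
on the second variable only. -/
theorem ExpFamily.aV (j₀ : Fin (N - 1)) (α : ℂ) :
    ExpFamily fun _ v => aV N lq k j₀ α v := by
  refine ExpFamily.neg ⟨fun y n => field_ann_mem .snd _ _ _ _ _ _,
    fun y n => field_cre_mem .snd _ _ _ _ _ _, ⟨_, fun u v x => rfl⟩, fun t _ => ?_⟩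
  simp only [field, ite_mul, zero_mul, Finset.sum_ite_eq', Finset.mem_univ, if_true]
  refine ⟨0, [(1 : ℂ)].prod / [k + (N : ℂ)].prod * t.1 (aB j₀), 0, fun u v => ?_⟩
  push_cast
  ring

theorem ExpFamily.sTail {p : ℂ → ℂ → ℂ} (hp : IntAffine p) (j m : ℕ) :
    ExpFamily fun u v => sTail N lq j m (p u v) :=
  .sum _ fun _ _ => (ExpFamily.bM (hp.add_const _) _ _).sub (.bM (hp.add_const _) _ _)

theorem ExpFamily.sTerm {p : ℂ → ℂ → ℂ} (hp : IntAffine p) (j : ℕ) (β : ℕ ⊕ ℕ) :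
    ExpFamily fun u v => sTerm N lq j β (p u v) := by
  rcases β with m | m
  · exact (((ExpFamily.bc ((hp.add_const _).sub_const _) _ _).sub (.bM (hp.add_const _) _ _)).sub
      (.bc ((hp.add_const _).add_const _) _ _)).add (.sTail hp _ _)
  · exact (((ExpFamily.bc ((hp.add_const _).sub_const _) _ _).sub (.bP (hp.add_const _) _ _)).sub
      (.bc ((hp.add_const _).sub_const _) _ _)).add (.sTail hp _ _)

end Families

/-! ### Growth of the fields -/

section Growth

variable {N : ℕ} {lq k : ℂ}

/-- Sequences of at most exponential growth. -/
def ExpBdd (f : ℕ+ → ℂ) : Prop := ∃ C ρ : ℝ, 0 ≤ C ∧ 0 ≤ ρ ∧ ∀ n : ℕ+, ‖f n‖ ≤ C * ρ ^ (n : ℕ)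

theorem ExpBdd.mul {f g : ℕ+ → ℂ} (hf : ExpBdd f) (hg : ExpBdd g) : ExpBdd fun n => f n * g n := by
  obtain ⟨C, ρ, hC, hρ, h⟩ := hf
  obtain ⟨D, τ, hD, hτ, h'⟩ := hg
  refine ⟨C * D, ρ * τ, by positivity, by positivity, fun n => ?_⟩
  rw [norm_mul, mul_pow, mul_mul_mul_comm]
  exact mul_le_mul (h n) (h' n) (norm_nonneg _) (by positivity)

theorem ExpBdd.sub {f g : ℕ+ → ℂ} (hf : ExpBdd f) (hg : ExpBdd g) : ExpBdd fun n => f n - g n := by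
  obtain ⟨C, ρ, hC, hρ, h⟩ := hf
  obtain ⟨D, τ, hD, hτ, h'⟩ := hg
  refine ⟨C + D, max ρ τ, by positivity, by positivity, fun n => (norm_sub_le _ _).trans ?_⟩
  simpa using exp_growth_add (X := 1) hC hD hρ hτ zero_le_one (by simpa using h n)
    (by simpa using h' n)

theorem ExpBdd.const (c : ℂ) : ExpBdd fun _ => c :=
  ⟨‖c‖, 1, norm_nonneg _, zero_le_one, fun n => by simp⟩

theorem ExpBdd.neg {f : ℕ+ → ℂ} (hf : ExpBdd f) : ExpBdd fun n => -f n := by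
  simpa using (ExpBdd.const 0).sub hf

theorem ExpBdd.exp (c : ℂ) : ExpBdd fun n => zn n c :=
  ⟨1, ‖Complex.exp c‖, zero_le_one, norm_nonneg _, fun n => by
    simp only [zn, Complex.exp_nat_mul, norm_pow, one_mul, le_refl]⟩

theorem ExpBdd.inv_natCast : ExpBdd fun n => 1 / (n : ℂ) :=
  ⟨1, 1, zero_le_one, zero_le_one, fun n => by
    have : (1 : ℝ) ≤ (n : ℕ) := by exact_mod_cast n.pos
    rw [norm_div, norm_one, Complex.norm_natCast, one_pow, mul_one]
    exact (div_le_one (by linarith)).2 this⟩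

theorem ExpBdd.qpow (x : ℂ) : ExpBdd fun n => qpow lq (x * n) := by
  simpa only [UqSlN.qpow, zn, mul_comm x, mul_assoc] using ExpBdd.exp (x * lq)

theorem ExpBdd.qnum (x : ℂ) : ExpBdd fun n => qnum lq (x * n) := by
  simp only [UqSlN.qnum, ← neg_mul, div_eq_mul_inv]
  exact ((ExpBdd.qpow x).sub (.qpow (-x))).mul (.const _)

/-- `1 / [n] = (q - q⁻¹) q ^ n / (q ^ (2 n) - 1)`, and the denominator stays at distance at least `1
- |q|` from zero because `|q| < 1`. -/
theorem ExpBdd.qnum_inv (h : Generic N lq k) : ExpBdd fun n => (UqSlN.qnum lq n)⁻¹ := by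
  have h1 := h.norm_lt
  set r := ‖Complex.exp lq‖ with hr
  refine ⟨‖qd lq‖ * (1 - r)⁻¹, 1, mul_nonneg (norm_nonneg _) (inv_nonneg.2 (by linarith)),
    zero_le_one, fun n => ?_⟩
  have ht := qn_ne_zero lq n
  have hn : ‖qn lq n‖ ≤ r := by
    rw [qn_eq_pow, norm_pow]
    exact pow_le_of_le_one (norm_nonneg _) h1.le n.ne_zero
  have h2 : (UqSlN.qnum lq n)⁻¹ = qd lq * (qn lq n * (qn lq n * qn lq n - 1)⁻¹) := by
    have h3 := h.qd_mul_qnum_natCast n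
    have h4 := h.qn_sub_ne_zero n
    have h5 := h.qnum_ne_zero n
    have h6 : qn lq n * qn lq n - 1 ≠ 0 := fun h7 => h4 (by
      field_simp; linear_combination h7)
    rw [qb] at h3
    refine inv_eq_of_mul_eq_one_left ?_
    have hX := mul_inv_cancel₀ h6
    have h8 : qn lq n - (qn lq n)⁻¹ = (qn lq n * qn lq n - 1) * (qn lq n)⁻¹ := by field_simp
    generalize (qn lq n * qn lq n - 1)⁻¹ = X at *
    trans (qd lq * UqSlN.qnum lq n) * (qn lq n * X)
    · ring
    · rw [h3, h8, mul_assoc, inv_mul_cancel_left₀ ht, hX]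
  simp only []
  rw [h2, norm_mul, one_pow, mul_one, norm_mul]
  refine mul_le_mul_of_nonneg_left ?_ (norm_nonneg _)
  rw [norm_inv]
  have h7 : 1 - r ≤ ‖qn lq n * qn lq n - 1‖ := by
    have := norm_sub_norm_le (1 : ℂ) (qn lq n * qn lq n)
    rw [norm_one, norm_sub_rev, norm_mul] at this
    have : ‖qn lq n‖ * ‖qn lq n‖ ≤ r := by
      nlinarith [norm_nonneg (qn lq n)]
    linarith
  calc ‖qn lq n‖ * ‖qn lq n * qn lq n - 1‖⁻¹ ≤ 1 * (1 - r)⁻¹ :=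
        mul_le_mul (hn.trans h1.le) (inv_anti₀ (by linarith) h7) (by positivity) zero_le_one
    _ = (1 - r)⁻¹ := one_mul _

theorem AnnTame.of_single {W : Boson N → ℕ+ → ℝ} {Φ : ℂ → LinForm N} (x : Boson N) (f : ℕ+ → ℂ)
    (h0 : ∀ u n x', x' ≠ x → Φ u (Gen.ann x' n) = 0)
    (h1 : ∀ u n, Φ u (Gen.ann x n) = f n * (zn n u)⁻¹) (hW : ∀ y n, 0 ≤ W y n)
    (hf : ∀ y, ∃ g, ExpBdd g ∧ ∀ n, ‖f n * kappa N lq k x y n‖ ≤ ‖g n‖ * W y n) :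
    AnnTame lq k W Φ := by
  choose g hg hfg using hf
  choose C ρ hC hρ hg using hg
  -- There are finitely many bosons `y`, so the sums of the individual constants bound all of them
  -- at once.
  refine ⟨∑ y, C y, ∑ y, ρ y, Finset.sum_nonneg fun y _ => hC y,
    Finset.sum_nonneg fun y _ => hρ y, fun u y n => ?_⟩
  have h2 : annShift N lq k (Φ u) (y, n) = (f n * kappa N lq k x y n) * (zn n u)⁻¹ := by
    rw [annShift, Finset.sum_eq_single x, h1]
    · ring
    · intro x' _ hx'; rw [h0 u n x' hx', zero_mul]
    · simp
  have h3 : ‖(zn n u)⁻¹‖ = ‖Complex.exp (-u)‖ ^ (n : ℕ) := by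
    rw [zn, ← Complex.exp_neg, ← mul_neg, Complex.exp_nat_mul, norm_pow]
  rw [h2, norm_mul, h3]
  calc ‖f n * kappa N lq k x y n‖ * ‖Complex.exp (-u)‖ ^ (n : ℕ)
      ≤ (C y * ρ y ^ (n : ℕ) * W y n) * ‖Complex.exp (-u)‖ ^ (n : ℕ) := by
        refine mul_le_mul_of_nonneg_right ((hfg y n).trans ?_) (by positivity)
        exact mul_le_mul_of_nonneg_right (hg y n) (hW y n)
    _ = C y * ρ y ^ (n : ℕ) * ‖Complex.exp (-u)‖ ^ (n : ℕ) * W y n := by ring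
    _ ≤ _ := by
        have h4 : C y ≤ ∑ y, C y :=
          Finset.single_le_sum (f := C) (fun y _ => hC y) (Finset.mem_univ y)
        have h5 : ρ y ≤ ∑ y, ρ y :=
          Finset.single_le_sum (f := ρ) (fun y _ => hρ y) (Finset.mem_univ y)
        have := hW y n
        have := hC y
        have := hρ y
        have := (this.trans h5)
        have := (hC y).trans h4
        gcongr

theorem CreTame.of_single {W : Boson N → ℕ+ → ℝ} {Φ : ℂ → LinForm N} (x : Boson N) (f : ℕ+ → ℂ)
    (h0 : ∀ u n x', x' ≠ x → Φ u (Gen.cre x' n) = 0)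
    (h1 : ∀ u n, Φ u (Gen.cre x n) = f n * zn n u) (hW : ∀ n, 0 ≤ W x n)
    (hf : ExpBdd fun n => W x n * f n) :
    CreTame W Φ := by
  obtain ⟨C, ρ, hC, hρ, h⟩ := hf
  refine ⟨C, ρ, hC, hρ, fun u y n => ?_⟩
  by_cases hy : y = x
  · subst hy
    have h3 : ‖zn n u‖ = ‖Complex.exp u‖ ^ (n : ℕ) := by
      rw [zn, Complex.exp_nat_mul, norm_pow]
    rw [crePart, h1, norm_mul, h3, ← mul_assoc]
    refine mul_le_mul_of_nonneg_right ?_ (by positivity)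
    have := h n
    rwa [norm_mul, Complex.norm_real, Real.norm_of_nonneg (hW n)] at this
  · rw [crePart, h0 u n y hy, norm_zero, mul_zero]
    positivity

/-- Nonnegative weights that are trivial on the bosons `b` and `c`. -/
structure IsWeight (W : Boson N → ℕ+ → ℝ) : Prop where
  nonneg : ∀ y n, 0 ≤ W y n
  eq_one : ∀ y n, W (Sum.inr y) n = 1

theorem IsWeight.one : IsWeight fun (_ : Boson N) _ => 1 := ⟨fun _ _ => zero_le_one, fun _ _ => rfl⟩

/-- The weight that compensates the denominators in the vertex operators of the bosons `a`. -/
def aWeight (N : ℕ) (lq k : ℂ) : Boson N → ℕ+ → ℝ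
  | Sum.inl _, n => ‖qnum lq ((k + N) * n)‖
  | Sum.inr _, _ => 1

theorem IsWeight.aWeight : IsWeight (aWeight N lq k) where
  nonneg y n := by
    rcases y with y | y
    · exact norm_nonneg _
    · exact zero_le_one
  eq_one _ _ := rfl

variable {W W' : Boson N → ℕ+ → ℝ}

theorem zn_add (n : ℕ+) (x y : ℂ) : zn n (x + y) = zn n x * zn n y := by
  rw [zn, zn, zn, ← Complex.exp_add, mul_add]

theorem zn_neg (n : ℕ+) (x : ℂ) : zn n (-x) = (zn n x)⁻¹ := by
  rw [zn, zn, ← Complex.exp_neg, mul_neg]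

/-- Multiples of the commutators of the bosons `b` and `c` have exponential growth. -/
theorem exists_expBdd_kappa (hW : IsWeight W) {f : ℕ+ → ℂ} (hf : ExpBdd f)
    (x : PosRoot N ⊕ PosRoot N) (y : Boson N) :
    ∃ g, ExpBdd g ∧ ∀ n, ‖f n * kappa N lq k (Sum.inr x) y n‖ ≤ ‖g n‖ * W y n := by
  have h1 : ExpBdd fun n => qnum lq n := by simpa using ExpBdd.qnum (lq := lq) 1
  have hg : ExpBdd fun n => f n * (1 / (n : ℂ) * (qnum lq n * qnum lq n)) :=
    hf.mul (ExpBdd.inv_natCast.mul (h1.mul h1))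
  refine ⟨_, hg, fun n => ?_⟩
  have h0 : (0 : ℝ) ≤ ‖f n * (1 / (n : ℂ) * (qnum lq n * qnum lq n))‖ * W y n :=
    mul_nonneg (norm_nonneg _) (hW.nonneg y n)
  rcases x with r | r <;> rcases y with i | t | t
  all_goals
    simp only [kappa, mul_zero, norm_zero, h0]
    try
      split_ifs
      · rw [hW.eq_one, mul_one]
        simp only [neg_mul, mul_neg, norm_neg, pow_two, le_refl]
      · simpa using h0

theorem Tame.plusF (hW : IsWeight W) (x : PosRoot N ⊕ PosRoot N) (c : ℂ) :
    Tame lq k W W' fun u => plusF lq (Sum.inr x) (u + c) := by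
  refine ⟨.of_single (Sum.inr x) (fun n => qd lq * (zn n (-c))) ?_ ?_ hW.nonneg fun y =>
      exists_expBdd_kappa hW ((ExpBdd.const _).mul (.exp _)) _ y, .of_zero fun _ _ _ => rfl⟩
  · intro u n x' hx; simp only [UqSlN.plusF, if_neg hx]
  · intro u n; rw [plusF_ann, zn_add, mul_inv, zn_neg]; ring

theorem Tame.minusF (x : Boson N) (hW' : ∀ n, W' x n = 1) (c : ℂ) :
    Tame lq k W W' fun u => minusF lq x (u + c) := by
  refine ⟨.of_zero fun _ _ _ => by simp [annShift, UqSlN.minusF],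
      .of_single x (fun n => -(qd lq * zn n c)) ?_ ?_ (fun n => by rw [hW']; exact zero_le_one) ?_⟩
  · intro u n x' hx; simp only [UqSlN.minusF, if_neg hx]
  · intro u n; rw [minusF_cre, zn_add]; ring
  · simp only [hW', Complex.ofReal_one, one_mul]
    exact ((ExpBdd.const _).mul (.exp _)).neg

variable {p : ℂ → ℂ} {c : ℂ}

theorem Tame.bP (hW : IsWeight W) (i j : ℕ) (hp : ∀ u, p u = u + c) :
    Tame lq k W W' fun u => bP N lq i j (p u) := by
  unfold UqSlN.bP atRoot
  simp only [hp]
  split_ifs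
  · exact .plusF hW _ _
  · exact .zero

theorem Tame.bM (hW' : IsWeight W') (i j : ℕ) (hp : ∀ u, p u = u + c) :
    Tame lq k W W' fun u => bM N lq i j (p u) := by
  unfold UqSlN.bM atRoot
  simp only [hp]
  split_ifs
  · exact .minusF _ (fun _ => hW'.eq_one _ _) _
  · exact .zero

theorem Tame.field (hG : Generic N lq k) (hW : IsWeight W) (hW' : IsWeight W')
    (x : PosRoot N ⊕ PosRoot N) (c : ℂ) :
    Tame lq k W W' fun u => field lq [] [] (Sum.inr x) 0 (u + c) := by
  refine ⟨.of_single (Sum.inr x) (fun n => -(qnum lq n)⁻¹ * zn n (-c)) ?_ ?_ hW.nonneg fun y =>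
      exists_expBdd_kappa hW ((ExpBdd.qnum_inv hG).neg.mul (.exp _)) _ y,
    .of_single (Sum.inr x) (fun n => (qnum lq n)⁻¹ * zn n c) ?_ ?_ (fun n => hW'.nonneg _ n) ?_⟩
  · intro u n x' hx; simp only [UqSlN.field, if_neg hx]
  · intro u n; rw [field_ann, zn_add, mul_inv, zn_neg]; ring
  · intro u n x' hx; simp only [UqSlN.field, if_neg hx]
  · intro u n; rw [field_cre, zn_add]; ring
  · simp only [hW'.eq_one, Complex.ofReal_one, one_mul]
    exact (ExpBdd.qnum_inv hG).mul (.exp _)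

theorem Tame.bc (hG : Generic N lq k) (hW : IsWeight W) (hW' : IsWeight W') (i j : ℕ)
    (hp : ∀ u, p u = u + c) : Tame lq k W W' fun u => bc N lq i j (p u) := by
  unfold UqSlN.bc atRoot
  simp only [hp]
  split_ifs
  · exact (Tame.field hG hW hW' _ c).add hW.nonneg hW'.nonneg (.field hG hW hW' _ c)
  · exact .zero

/-- The commutator of `a_+` with the modes of `a` contains `[(k + N) n]`, and this factor is exactly
the weight. -/
theorem Tame.ap (i₀ : Fin (N - 1)) (c : ℂ) :
    Tame lq k (UqSlN.aWeight N lq k) W' fun u => UqSlN.plusF lq (aB i₀) (u + c) := by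
  refine ⟨.of_single (aB i₀) (fun n => qd lq * zn n (-c)) ?_ ?_ IsWeight.aWeight.nonneg fun y => ?_,
    .of_zero fun _ _ _ => rfl⟩
  · intro u n x' hx; simp only [UqSlN.plusF, if_neg hx]
  · intro u n; rw [plusF_ann, zn_add, mul_inv, zn_neg]; ring
  · rcases y with j | y
    · refine ⟨_, ((ExpBdd.const (qd lq)).mul (.exp (-c))).mul (ExpBdd.inv_natCast.mul
        (.qnum (lq := lq) (CartanMatrix.A (N - 1) i₀ j : ℂ))), fun n => le_of_eq ?_⟩
      simp only [kappa, UqSlN.aWeight, norm_mul]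
      ring
    · exact ⟨_, .const 0, fun n => by simp [kappa]⟩

/-- If `|q ^ (k + N)| = 1`, then `1 / [(k + N) n]` may grow faster than any exponential. On the
annihilation side the commutator cancels it, so the weight there is one; on the creation side it is
absorbed into `aWeight`. Hence a current is tame for `(aWeight, 1)` and the screening current for
`(1, aWeight)`, which match in both orders of the product. -/
theorem Tame.aV (hG : Generic N lq k) (j₀ : Fin (N - 1)) (α : ℂ) :
    Tame lq k (fun _ _ => 1) (UqSlN.aWeight N lq k) fun u => aV N lq k j₀ α u := by
  refine ⟨.of_single (aB j₀) (fun n => (qnum lq ((k + N) * n))⁻¹ * qpow lq (-α * n)) ?_ ?_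
      (fun _ _ => zero_le_one) fun y => ?_,
    .of_single (aB j₀) (fun n => -(qnum lq ((k + N) * n))⁻¹ * qpow lq (-α * n)) ?_ ?_
      (fun n => IsWeight.aWeight.nonneg _ n) ?_⟩
  · intro u n x' hx; simp only [UqSlN.aV, UqSlN.field, Pi.neg_apply, if_neg hx, neg_zero]
  · intro u n; exact aV_ann _ _ _ (hG.qnum_ne_zero n) _
  · rcases y with j | y
    · refine ⟨_, (ExpBdd.qpow (lq := lq) (-α)).mul (ExpBdd.inv_natCast.mul
        (.qnum (lq := lq) (CartanMatrix.A (N - 1) j₀ j : ℂ))), fun n => le_of_eq ?_⟩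
      have := norm_ne_zero_iff.2 (hG.qnum_k_ne_zero n)
      simp only [kappa, norm_mul, norm_inv]
      field_simp
    · exact ⟨_, .const 0, fun n => by simp [kappa]⟩
  · intro u n x' hx; simp only [UqSlN.aV, UqSlN.field, Pi.neg_apply, if_neg hx, neg_zero]
  · intro u n; exact aV_cre _ _ _ (hG.qnum_ne_zero n) _
  · obtain ⟨C, ρ, hC, hρ, h⟩ := ExpBdd.qpow (lq := lq) (-α)
    refine ⟨C, ρ, hC, hρ, fun n => ?_⟩
    have := norm_ne_zero_iff.2 (hG.qnum_k_ne_zero n)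
    simp only [UqSlN.aWeight, norm_mul, norm_neg, norm_inv, Complex.norm_real, norm_norm]
    rw [← mul_assoc, mul_inv_cancel₀ this, one_mul]
    exact h n

theorem Tame.sTail (hW : IsWeight W) (hW' : IsWeight W') (j m : ℕ) :
    Tame lq k W W' (sTail N lq j m) :=
  .sum _ hW.nonneg hW'.nonneg fun _ _ =>
    (Tame.bM hW' _ _ fun _ => rfl).sub hW.nonneg hW'.nonneg (.bM hW' _ _ fun _ => rfl)

theorem Tame.sTerm (hG : Generic N lq k) (hW : IsWeight W) (hW' : IsWeight W') (j : ℕ)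
    (β : ℕ ⊕ ℕ) : Tame lq k W W' (sTerm N lq j β) := by
  have h := hW.nonneg
  have h' := hW'.nonneg
  rcases β with m | m
  · exact Tame.add h h' (.sub h h' (.sub h h' (.bc hG hW hW' _ _ fun _ => add_sub_assoc _ _ _)
      (.bM hW' _ _ fun _ => rfl)) (.bc hG hW hW' _ _ fun _ => add_assoc _ _ _)) (.sTail hW hW' _ _)
  · exact Tame.add h h' (.sub h h' (.sub h h' (.bc hG hW hW' _ _ fun _ => add_sub_assoc _ _ _)
      (.bP hW _ _ fun _ => rfl)) (.bc hG hW hW' _ _ fun _ => add_sub_assoc _ _ _))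
      (.sTail hW hW' _ _)

end Growth

end

end UqSlN

namespace UqSlN

noncomputable section

open scoped BigOperators
open Filter Topology

/-! ### Operator product expansions from residues -/

section Residues

variable {N : ℕ} {lq k : ℂ}

/-- The contractions of `Φ u` and `Ψ v` in both orders are the expansions of
`q ^ c (z - q ^ a w) / (z - q ^ b w)`. -/
structure Contraction (lq k : ℂ) (Φ Ψ : ℂ → LinForm N) (c a b : ℂ) : Prop where
  zw : HalfPair lq k Φ Ψ c a b
  wz : HalfPair lq k Ψ Φ (c + a - b) (-a) (-b)

theorem exp_sub_exp_neg (u v x lq : ℂ) : Complex.exp v - Complex.exp (u + -x * lq) =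
    -(qpow lq (-x)) * (Complex.exp u - Complex.exp (v + x * lq)) := by
  rw [neg_mul, neg_mul, mul_sub, neg_sub, qpow, neg_mul, ← Complex.exp_add, ← Complex.exp_add,
    add_comm (-(x * lq)) u]
  congr 2
  ring

/-- Since `w - q ^ (-x) z = -q ^ (-x) (z - q ^ x w)`, the reversed contraction is the same rational
function exactly when its constant is `c + a - b`. -/
theorem contraction_swap {c a b u v : ℂ}
    (h : Complex.exp v - Complex.exp (u + -b * lq) ≠ 0) :
    Complex.exp u - Complex.exp (v + b * lq) ≠ 0 ∧
    qpow lq (c + a - b) * ((Complex.exp v - Complex.exp (u + -a * lq)) /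
      (Complex.exp v - Complex.exp (u + -b * lq))) =
    qpow lq c * ((Complex.exp u - Complex.exp (v + a * lq)) /
      (Complex.exp u - Complex.exp (v + b * lq))) := by
  rw [exp_sub_exp_neg] at h ⊢
  rw [exp_sub_exp_neg]
  have h1 := right_ne_zero_of_mul h
  refine ⟨h1, ?_⟩
  have h2 := qpow_ne_zero (lq := lq) a
  have h3 := qpow_ne_zero (lq := lq) b
  rw [sub_eq_add_neg, qpow_add, qpow_add, qpow_neg, qpow_neg]
  field_simp

/-- The combination of products that determines the residue at `z = q ^ b w`. -/
def residue {ι κ Λ : Type*} [DecidableEq Λ] (lq k : ℂ) (I : Finset ι) (J : Finset κ)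
    (ε : ι → ℂ) (η : κ → ℂ) (Φ : ι → ℂ → LinForm N) (Ψ : κ → ℂ → LinForm N) (c a : ι → κ → ℂ)
    (π : ι → κ → Λ) (b : Λ → ℂ) (l : Λ) (v : ℂ) : FockOp N :=
  ∑ x ∈ (I ×ˢ J) with π x.1 x.2 = l,
    (ε x.1 * η x.2 * (qpow lq (c x.1 x.2) * (qpow lq (b l) - qpow lq (a x.1 x.2)))) •
      nexp N lq k (Φ x.1 (v + b l * lq) + Ψ x.2 v)

variable {ι κ Λ : Type*} {I : Finset ι} {J : Finset κ}
    {ε : ι → ℂ} {η : κ → ℂ} {Φ : ι → ℂ → LinForm N} {Ψ : κ → ℂ → LinForm N} {c a : ι → κ → ℂ}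
    {π : ι → κ → Λ} {b : Λ → ℂ} {P : Finset Λ} {W W' : Boson N → ℕ+ → ℝ} {A B : ℂ → FockOp N} {p : ℂ}

/-- Both orders of the product are expansions of one sum of rational multiples of normal ordered
exponentials. Its terms are grouped by their pole; in each group the exponentials are evaluated at
the pole, and the error is divisible by the denominator. Terms with equal zero and pole have
coefficient zero in the residue, so it does not matter which pole they are assigned to. -/
theorem ope_of_residues [DecidableEq Λ] (hπ : ∀ i ∈ I, ∀ j ∈ J, π i j ∈ P)
    (hA : ∀ u, A u = (p * Complex.exp (-u)) • ∑ i ∈ I, ε i • nexp N lq k (Φ i u))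
    (hB : ∀ v, B v = (p * Complex.exp (-v)) • ∑ j ∈ J, η j • nexp N lq k (Ψ j v))
    (hΦ : ∀ i ∈ I, Tame lq k W W' (Φ i)) (hΨ : ∀ j ∈ J, Tame lq k W' W (Ψ j))
    (hΦf : ∀ i ∈ I, ExpFamily fun u _ => Φ i u) (hΨf : ∀ j ∈ J, ExpFamily fun _ v => Ψ j v)
    (h : ∀ i ∈ I, ∀ j ∈ J, Contraction lq k (Φ i) (Ψ j) (c i j) (a i j) (b (π i j))) :
    OPE A B (fun _ _ => 1) (fun _ _ => 1) (fun u v => ∑ l ∈ P,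
      (1 / (Complex.exp u - Complex.exp (v + b l * lq))) • (p ^ 2 * Complex.exp (-(v + b l * lq))) •
        residue lq k I J ε η Φ Ψ c a π b l v) := by
  set T := residue lq k I J ε η Φ Ψ c a π b with hT
  -- The residue with `z` left free; `T` is its restriction to the divisor `z = q ^ b w`.
  set F : Λ → ℂ → ℂ → FockOp N := fun l u v => ∑ x ∈ (I ×ˢ J) with π x.1 x.2 = l,
    (ε x.1 * η x.2 * (qpow lq (c x.1 x.2) * (qpow lq (b l) - qpow lq (a x.1 x.2)))) •
      nexp N lq k (Φ x.1 u + Ψ x.2 v) with hF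
  have hfam : ∀ i ∈ I, ∀ j ∈ J, ExpFamily fun u v => Φ i u + Ψ j v :=
    fun i hi j hj => (hΦf i hi).add (hΨf j hj)
  have hFmem : ∀ l s t, Integral t → (fun u v => F l u v s t) ∈ expAlg := by
    intro l s t ht
    simp only [hF, Finset.sum_apply, Pi.smul_apply, smul_eq_mul]
    refine expAlg_sum _ fun x hx => expAlg_const_mul _ ((hfam _ ?_ _ ?_).nexp s ht)
    · exact (Finset.mem_product.1 (Finset.mem_filter.1 hx).1).1
    · exact (Finset.mem_product.1 (Finset.mem_filter.1 hx).1).2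
  have hTF : ∀ l v, T l v = F l (v + b l * lq) v := fun l v => rfl
  have hTmem : ∀ l s t, Integral t → (fun (_ : ℂ) v => T l v s t) ∈ expAlg := fun l s t ht => by
    simp only [hTF]; exact expAlg_restrict (hFmem l s t ht) _
  have hH : ∀ l s t, ∃ H : ℂ → ℂ → ℂ, Integral t → H ∈ expAlg ∧ ∀ u v, F l u v s t - T l v s t =
      (Complex.exp u - Complex.exp (v + b l * lq)) * H u v := by
    intro l s t
    by_cases ht : Integral t
    · obtain ⟨H, h1, h2⟩ := expAlg_dvd (expAlg_sub (hFmem l s t ht) (hTmem l s t ht)) (b l * lq)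
        fun v => by rw [hTF, sub_self]
      exact ⟨H, fun _ => ⟨h1, h2⟩⟩
    · exact ⟨0, fun h => absurd h ht⟩
  choose H hH using hH
  -- The common rational expression whose expansions are the two orders of the product.
  set C : ℂ → ℂ → FockOp N := fun u v => (p * Complex.exp (-u)) • ∑ i ∈ I, ε i •
    (p * Complex.exp (-v)) • ∑ j ∈ J, η j •
      (qpow lq (c i j) * ((Complex.exp u - Complex.exp (v + a i j * lq)) /
        (Complex.exp u - Complex.exp (v + b (π i j) * lq)))) • nexp N lq k (Φ i u + Ψ j v) with hC
  set G : ℂ → ℂ → FockOp N := fun u v s t =>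
    p ^ 2 * Complex.exp (-u) * Complex.exp (-v) * ((∑ i ∈ I, ∑ j ∈ J,
      (ε i * η j * qpow lq (c i j)) * nexp N lq k (Φ i u + Ψ j v) s t) +
      ∑ l ∈ P, Complex.exp v * H l s t u v) -
    ∑ l ∈ P, p ^ 2 * Complex.exp (-u) * Complex.exp (-(v + b l * lq)) * T l v s t with hG
  have key : ∀ u v s t, Integral t →
      (∀ l ∈ P, Complex.exp u - Complex.exp (v + b l * lq) ≠ 0) →
      C u v s t = G u v s t + (∑ l ∈ P, (1 / (Complex.exp u - Complex.exp (v + b l * lq))) •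
        (p ^ 2 * Complex.exp (-(v + b l * lq))) • T l v) s t := by
    intro u v s t ht hne
    have e1 : C u v s t = p ^ 2 * Complex.exp (-u) * Complex.exp (-v) *
        ∑ i ∈ I, ∑ j ∈ J, (ε i * η j * (qpow lq (c i j) *
          ((Complex.exp u - Complex.exp (v + a i j * lq)) /
            (Complex.exp u - Complex.exp (v + b (π i j) * lq))))) *
              nexp N lq k (Φ i u + Ψ j v) s t := by
      simp only [hC, Finset.sum_apply, Pi.smul_apply, smul_eq_mul, Finset.mul_sum]
      exact Finset.sum_congr rfl fun i _ => Finset.sum_congr rfl fun j _ => by ring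
    have e2 : ∀ i ∈ I, ∀ j ∈ J, (ε i * η j * (qpow lq (c i j) *
          ((Complex.exp u - Complex.exp (v + a i j * lq)) /
            (Complex.exp u - Complex.exp (v + b (π i j) * lq))))) *
              nexp N lq k (Φ i u + Ψ j v) s t =
        (ε i * η j * qpow lq (c i j)) * nexp N lq k (Φ i u + Ψ j v) s t +
        ∑ l ∈ P, if π i j = l then
          Complex.exp v / (Complex.exp u - Complex.exp (v + b l * lq)) *
          ((ε i * η j * (qpow lq (c i j) * (qpow lq (b l) - qpow lq (a i j)))) *
            nexp N lq k (Φ i u + Ψ j v) s t) else 0 := by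
      intro i hi j hj
      rw [Finset.sum_ite_eq, if_pos (hπ i hi j hj)]
      have h1 := hne _ (hπ i hi j hj)
      -- Partial fractions: `z - q ^ a w = (z - q ^ b w) + w (q ^ b - q ^ a)`.
      have h2 : Complex.exp u - Complex.exp (v + a i j * lq) =
        (Complex.exp u - Complex.exp (v + b (π i j) * lq)) +
          Complex.exp v * (qpow lq (b (π i j)) - qpow lq (a i j)) := by
        rw [Complex.exp_add, Complex.exp_add, qpow, qpow]; ring
      rw [h2]
      field_simp
    have e3 : ∀ l ∈ P, ∑ i ∈ I, ∑ j ∈ J, (if π i j = l then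
          Complex.exp v / (Complex.exp u - Complex.exp (v + b l * lq)) *
          ((ε i * η j * (qpow lq (c i j) * (qpow lq (b l) - qpow lq (a i j)))) *
            nexp N lq k (Φ i u + Ψ j v) s t) else 0) =
        Complex.exp v * H l s t u v +
          Complex.exp v / (Complex.exp u - Complex.exp (v + b l * lq)) * T l v s t := by
      intro l hl
      have h1 := hne l hl
      have h2 := (hH l s t ht).2 u v
      rw [← Finset.sum_product', ← Finset.sum_filter, ← Finset.mul_sum]
      have h3 : F l u v s t = ∑ x ∈ (I ×ˢ J) with π x.1 x.2 = l,
        (ε x.1 * η x.2 * (qpow lq (c x.1 x.2) * (qpow lq (b l) - qpow lq (a x.1 x.2)))) *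
          nexp N lq k (Φ x.1 u + Ψ x.2 v) s t := by
        simp only [hF, Finset.sum_apply, Pi.smul_apply, smul_eq_mul]
      rw [← h3, sub_eq_iff_eq_add.1 h2]
      field_simp
    rw [e1, Finset.sum_congr rfl fun i hi => Finset.sum_congr rfl (e2 i hi)]
    simp only [Finset.sum_add_distrib]
    have e5 : ∀ f : ι → κ → Λ → ℂ,
        ∑ i ∈ I, ∑ j ∈ J, ∑ l ∈ P, f i j l = ∑ l ∈ P, ∑ i ∈ I, ∑ j ∈ J, f i j l := fun f => by
      rw [Finset.sum_comm (s := P)]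
      exact Finset.sum_congr rfl fun i _ => Finset.sum_comm
    rw [e5, Finset.sum_congr rfl e3, Finset.sum_add_distrib]
    simp only [hG, Finset.sum_apply, Pi.smul_apply, smul_eq_mul]
    -- The singular part carries the prefactor `z⁻¹` evaluated at the pole `x = q ^ b w`. The
    -- correction is regular by `1 / (x (z - x)) = 1 / (z x) + 1 / (z (z - x))`, and it accounts for
    -- the last sum in `G`.
    have e4 : ∀ l ∈ P, 1 / (Complex.exp u - Complex.exp (v + b l * lq)) *
        (p ^ 2 * Complex.exp (-(v + b l * lq)) * T l v s t) =
        p ^ 2 * Complex.exp (-u) * Complex.exp (-(v + b l * lq)) * T l v s t +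
        p ^ 2 * Complex.exp (-u) * Complex.exp (-v) *
        (Complex.exp v / (Complex.exp u - Complex.exp (v + b l * lq)) * T l v s t) := by
      intro l hl
      have h1 := hne l hl
      have h2 := Complex.exp_ne_zero u
      have h3 := Complex.exp_ne_zero v
      have h4 := Complex.exp_ne_zero (v + b l * lq)
      rw [Complex.exp_neg, Complex.exp_neg, Complex.exp_neg]
      field_simp
      ring
    rw [Finset.sum_congr rfl e4, Finset.sum_add_distrib, mul_add, mul_add, mul_add,
      Finset.mul_sum (s := P), Finset.mul_sum (s := P)]
    ring
  refine ⟨G, fun s t ht => ?_, ?_⟩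
  · refine expAlg_analytic (F := fun u v => G u v s t) ?_
    have hu : (fun u _ => p ^ 2 * Complex.exp (-u)) ∈ expAlg :=
      expAlg_const_mul _ expAlg_exp_neg_fst
    have hv : ∀ c : ℂ, (fun (_ : ℂ) v => Complex.exp (-(v + c))) ∈ expAlg := fun c =>
      (IntAffine.snd.add_const c).neg.exp
    refine expAlg_sub (expAlg_mul (expAlg_mul hu (by simpa using hv 0)) (expAlg_add ?_ ?_)) ?_
    · exact expAlg_sum _ fun i hi => expAlg_sum _ fun j hj =>
        expAlg_const_mul _ ((hfam i hi j hj).nexp s ht)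
    · exact expAlg_sum _ fun l _ => expAlg_mul IntAffine.snd.exp (hH l s t ht).1
    · exact expAlg_sum _ fun l _ => expAlg_mul (expAlg_mul hu (hv _)) (hTmem l s t ht)
  have far : ∀ x : ℂ, ∀ᶠ y : ℂ × ℂ in farFilter,
      Complex.exp y.1 - Complex.exp (y.2 + x * lq) ≠ 0 := fun x => by
    filter_upwards [farFilter_eventually_lt ‖Complex.exp (x * lq)‖] with y hy h0
    rw [sub_eq_zero.1 h0, Complex.exp_add, norm_mul, mul_comm] at hy
    exact lt_irrefl _ hy
  have hzw : ∀ᶠ x in farFilter, HasComp (A x.1) (B x.2) (C x.1 x.2) ∧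
      ∀ l ∈ P, Complex.exp x.1 - Complex.exp (x.2 + b l * lq) ≠ 0 := by
    have h1 : ∀ᶠ x in farFilter, ∀ i ∈ I, ∀ j ∈ J, _ := (eventually_all_finset I).2 fun i hi =>
      (eventually_all_finset J).2 fun j hj => (h i hi j hj).zw.hasComp (hΦ i hi).1 (hΨ j hj).2
    filter_upwards [h1, (eventually_all_finset P).2 fun l _ => far (b l)] with x hx hx'
    refine ⟨?_, hx'⟩
    rw [hA, hB]
    exact HasComp.smul_sum_smul_sum I J _ _ ε η fun i hi j hj => (hx i hi j hj).2
  have hwz : ∀ᶠ x in farFilter, HasComp (B x.1) (A x.2) (C x.2 x.1) ∧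
      ∀ l ∈ P, Complex.exp x.2 - Complex.exp (x.1 + b l * lq) ≠ 0 := by
    have h1 : ∀ᶠ x in farFilter, ∀ i ∈ I, ∀ j ∈ J, _ := (eventually_all_finset I).2 fun i hi =>
      (eventually_all_finset J).2 fun j hj => (h i hi j hj).wz.hasComp (hΨ j hj).1 (hΦ i hi).2
    filter_upwards [h1, (eventually_all_finset P).2 fun l _ => far (-b l)] with x hx hx'
    -- Only the nonvanishing of the denominator is needed here, so `c` and `a` are dummies.
    refine ⟨?_, fun l hl => (contraction_swap (c := 0) (a := 0) (hx' l hl)).1⟩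
    rw [hA, hB]
    have := HasComp.smul_sum_smul_sum J I (p * Complex.exp (-x.1)) (p * Complex.exp (-x.2)) η ε
      fun j hj i hi => (hx i hi j hj).2
    convert this using 1
    simp only [hC, Finset.smul_sum]
    rw [Finset.sum_comm]
    refine Finset.sum_congr rfl fun j hj => Finset.sum_congr rfl fun i hi => ?_
    rw [(contraction_swap (hx i hi j hj).1).2, add_comm (Φ i x.2)]
    simp only [smul_smul]
    congr 1
    ring
  obtain ⟨R₁, h1⟩ := exists_of_farFilter hzw
  obtain ⟨R₂, h2⟩ := exists_of_farFilter hwz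
  refine ⟨max R₁ R₂, fun u v huv s t ht => ?_, fun u v huv s t ht => ?_⟩
  · obtain ⟨h3, h4⟩ := h1 _ (le_max_left _ _) u v huv
    exact ⟨h3.composable s t, by rw [one_mul, h3.comp_eq]; exact key u v s t ht h4⟩
  · obtain ⟨h3, h4⟩ := h2 _ (le_max_right _ _) v u huv
    exact ⟨h3.composable s t, by rw [one_mul, h3.comp_eq]; exact key u v s t ht h4⟩

/-- The two halves of `E ^ -` have different sets of poles and are expanded separately; the larger
of the two radii serves for their sum. -/
theorem OPE.add {A A' B : ℂ → FockOp N} {S S' : ℂ → ℂ → FockOp N}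
    (h : OPE A B (fun _ _ => 1) (fun _ _ => 1) S)
    (h' : OPE A' B (fun _ _ => 1) (fun _ _ => 1) S') :
    OPE (fun u => A u + A' u) B (fun _ _ => 1) (fun _ _ => 1) (fun u v => S u v + S' u v) := by
  obtain ⟨G, hG, R, h1, h2⟩ := h
  obtain ⟨G', hG', R', h1', h2'⟩ := h'
  have hR : ∀ {x y : ℂ}, max R R' * ‖Complex.exp y‖ < ‖Complex.exp x‖ →
      R * ‖Complex.exp y‖ < ‖Complex.exp x‖ ∧ R' * ‖Complex.exp y‖ < ‖Complex.exp x‖ := fun hx =>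
    ⟨(mul_le_mul_of_nonneg_right (le_max_left _ _) (norm_nonneg _)).trans_lt hx,
      (mul_le_mul_of_nonneg_right (le_max_right _ _) (norm_nonneg _)).trans_lt hx⟩
  refine ⟨fun u v => G u v + G' u v, fun s t ht => (hG s t ht).add (hG' s t ht), max R R',
    fun u v huv s t ht => ?_, fun u v huv s t ht => ?_⟩
  · obtain ⟨e1, e2⟩ := h1 u v (hR huv).1 s t ht
    obtain ⟨e1', e2'⟩ := h1' u v (hR huv).2 s t ht
    have := e1.hasSum.add e1'.hasSum
    simp only [← add_mul] at this
    refine ⟨this.summable, ?_⟩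
    rw [comp, show (∑' m, (A u + A' u) s m * B v m t) = _ from this.tsum_eq]
    simp only [Pi.add_apply]
    rw [comp] at e2 e2'
    linear_combination e2 + e2'
  · obtain ⟨e1, e2⟩ := h2 u v (hR huv).1 s t ht
    obtain ⟨e1', e2'⟩ := h2' u v (hR huv).2 s t ht
    have := e1.hasSum.add e1'.hasSum
    simp only [← mul_add] at this
    refine ⟨this.summable, ?_⟩
    rw [comp, show (∑' m, B v s m * (A u + A' u) m t) = _ from this.tsum_eq]
    simp only [Pi.add_apply]
    rw [comp] at e2 e2'
    linear_combination e2 + e2'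

/-- A product with one pole in each order, and no residue after multiplication by the
denominator. -/
theorem ope_of_denominator {e : ℂ}
    (hA : ∀ u, A u = (p * Complex.exp (-u)) • ∑ i ∈ I, ε i • nexp N lq k (Φ i u))
    (hB : ∀ v, B v = (p * Complex.exp (-v)) • ∑ j ∈ J, η j • nexp N lq k (Ψ j v))
    (hΦ : ∀ i ∈ I, Tame lq k W W' (Φ i)) (hΨ : ∀ j ∈ J, Tame lq k W' W (Ψ j))
    (hΦf : ∀ i ∈ I, ExpFamily fun u _ => Φ i u) (hΨf : ∀ j ∈ J, ExpFamily fun _ v => Ψ j v)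
    (hzw : ∀ i ∈ I, ∀ j ∈ J, HalfPair lq k (Φ i) (Ψ j) (c i j) (a i j) e)
    (hwz : ∀ i ∈ I, ∀ j ∈ J, HalfPair lq k (Ψ j) (Φ i) (c i j + a i j) (-a i j) e) :
    OPE A B (fun u v => Complex.exp u - qpow lq e * Complex.exp v)
      (fun u v => qpow lq e * Complex.exp u - Complex.exp v) 0 := by
  have hexp : ∀ v x : ℂ, Complex.exp (v + x * lq) = qpow lq x * Complex.exp v := fun v x => by
    rw [Complex.exp_add, qpow, mul_comm]
  set G : ℂ → ℂ → FockOp N := fun u v => (p * Complex.exp (-u)) • ∑ i ∈ I, ε i •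
    (p * Complex.exp (-v)) • ∑ j ∈ J, η j •
      (qpow lq (c i j) * (Complex.exp u - Complex.exp (v + a i j * lq))) •
        nexp N lq k (Φ i u + Ψ j v) with hG
  have h1 : ∀ᶠ x in farFilter, ∃ X, HasComp (A x.1) (B x.2) X ∧
      (Complex.exp x.1 - qpow lq e * Complex.exp x.2) • X = G x.1 x.2 := by
    have h1 : ∀ᶠ x in farFilter, ∀ i ∈ I, ∀ j ∈ J, _ := (eventually_all_finset I).2 fun i hi =>
      (eventually_all_finset J).2 fun j hj => (hzw i hi j hj).hasComp (hΦ i hi).1 (hΨ j hj).2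
    filter_upwards [h1] with x hx
    refine ⟨_, by
      rw [hA, hB]
      exact HasComp.smul_sum_smul_sum I J _ _ ε η fun i hi j hj => (hx i hi j hj).2, ?_⟩
    simp only [hG, Finset.smul_sum]
    refine Finset.sum_congr rfl fun i hi => Finset.sum_congr rfl fun j hj => ?_
    have h2 := (hx i hi j hj).1
    simp only [smul_smul]
    congr 1
    simp only [hexp] at h2 ⊢
    field_simp
  have h2 : ∀ᶠ x in farFilter, ∃ X, HasComp (B x.1) (A x.2) X ∧
      (qpow lq e * Complex.exp x.2 - Complex.exp x.1) • X = G x.2 x.1 := by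
    have h1 : ∀ᶠ x in farFilter, ∀ i ∈ I, ∀ j ∈ J, _ := (eventually_all_finset I).2 fun i hi =>
      (eventually_all_finset J).2 fun j hj => (hwz i hi j hj).hasComp (hΨ j hj).1 (hΦ i hi).2
    filter_upwards [h1] with x hx
    refine ⟨_, by
      rw [hA, hB]
      exact HasComp.smul_sum_smul_sum J I _ _ η ε fun j hj i hi => (hx i hi j hj).2, ?_⟩
    simp only [hG, Finset.smul_sum]
    rw [Finset.sum_comm]
    refine Finset.sum_congr rfl fun i hi => Finset.sum_congr rfl fun j hj => ?_
    have h2 := (hx i hi j hj).1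
    -- In the reversed order the numerator is `w - q ^ (-a) z = -q ^ (-a) (z - q ^ a w)`. The power
    -- of `q` turns `q ^ (c + a)` into `q ^ c`, and the sign is absorbed because the prefactor is
    -- minus the denominator `w - q ^ e z`.
    rw [exp_sub_exp_neg, add_comm (Ψ j x.1), qpow_add, qpow_neg]
    simp only [smul_smul]
    congr 1
    have h3 := qpow_ne_zero (lq := lq) (a i j)
    simp only [hexp] at h2 ⊢
    field_simp
    ring
  obtain ⟨R₁, h1⟩ := exists_of_farFilter h1
  obtain ⟨R₂, h2⟩ := exists_of_farFilter h2
  refine ⟨G, fun s t ht => ?_, max R₁ R₂, fun u v huv s t ht => ?_, fun u v huv s t ht => ?_⟩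
  · refine expAlg_analytic (F := fun u v => G u v s t) ?_
    simp only [hG, Finset.sum_apply, Pi.smul_apply, smul_eq_mul]
    have hv : (fun (_ : ℂ) v => p * Complex.exp (-v)) ∈ expAlg :=
      expAlg_const_mul _ IntAffine.snd.neg.exp
    refine expAlg_mul (expAlg_const_mul _ expAlg_exp_neg_fst) (expAlg_sum _ fun i hi =>
      expAlg_const_mul _ (expAlg_mul hv (expAlg_sum _ fun j hj => expAlg_const_mul _
        (expAlg_mul (expAlg_const_mul _ (expAlg_sub expAlg_exp_fst
          (IntAffine.snd.add_const _).exp)) (((hΦf i hi).add (hΨf j hj)).nexp s ht)))))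
  · obtain ⟨X, h3, h4⟩ := h1 _ (le_max_left _ _) u v huv
    refine ⟨h3.composable s t, ?_⟩
    rw [h3.comp_eq, ← h4]
    simp
  · obtain ⟨X, h3, h4⟩ := h2 _ (le_max_right _ _) v u huv
    refine ⟨h3.composable s t, ?_⟩
    rw [h3.comp_eq, ← h4]
    simp

end Residues

end

end UqSlN

namespace UqSlN

noncomputable section

open scoped BigOperators
open Filter Topology

/-! ### The currents as combinations of normal ordered exponentials -/

section Currents

variable {N : ℕ} {lq k : ℂ}

/-- The signs of the terms of a current. -/
def sgn : ℕ ⊕ ℕ → ℂ := Sum.elim (fun _ => 1) (fun _ => -1)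

@[simp] theorem sgn_inl (m : ℕ) : sgn (Sum.inl m) = 1 := rfl
@[simp] theorem sgn_inr (m : ℕ) : sgn (Sum.inr m) = -1 := rfl

theorem neg_one_div_qd_mul_exp (u : ℂ) :
    -1 / (qd lq * Complex.exp u) = -(qd lq)⁻¹ * Complex.exp (-u) := by
  rw [Complex.exp_neg]; field_simp

theorem sTerm_inl_eq (j m : ℕ) (v : ℂ) : sTerm N lq j (Sum.inl m) v =
    bc N lq (j + 1) m (v + ((N : ℂ) - m) * lq) + (-bM N lq j m (v + ((N : ℂ) - m) * lq)
      - bc N lq j m (v + ((N : ℂ) - m + 1) * lq))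
      + ∑ l ∈ Finset.Icc (m + 1) N, (bM N lq (j + 1) l (v + ((N : ℂ) - l + 1) * lq)
          - bM N lq j l (v + ((N : ℂ) - l) * lq)) := by
  have h1 : ∀ c : ℕ, sPt N lq j (j + 1) c v = v + ((N : ℂ) - c + 1) * lq := fun c => by
    rw [sPt]; push_cast; ring
  have h2 : ∀ c : ℕ, sPt N lq j j c v = v + ((N : ℂ) - c) * lq := fun c => by
    rw [sPt]; ring
  simp only [sTerm, sTail, h1, h2]
  rw [show v + ((N : ℂ) - m + 1) * lq - lq = v + ((N : ℂ) - m) * lq by ring,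
    show v + ((N : ℂ) - m) * lq + lq = v + ((N : ℂ) - m + 1) * lq by ring]
  abel

theorem sTerm_inr_eq (j m : ℕ) (v : ℂ) : sTerm N lq j (Sum.inr m) v =
    bc N lq (j + 1) m (v + ((N : ℂ) - m) * lq) + (-bP N lq j m (v + ((N : ℂ) - m) * lq)
      - bc N lq j m (v + ((N : ℂ) - m - 1) * lq))
      + ∑ l ∈ Finset.Icc (m + 1) N, (bM N lq (j + 1) l (v + ((N : ℂ) - l + 1) * lq)
          - bM N lq j l (v + ((N : ℂ) - l) * lq)) := by
  have h1 : ∀ c : ℕ, sPt N lq j (j + 1) c v = v + ((N : ℂ) - c + 1) * lq := fun c => by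
    rw [sPt]; push_cast; ring
  have h2 : ∀ c : ℕ, sPt N lq j j c v = v + ((N : ℂ) - c) * lq := fun c => by
    rw [sPt]; ring
  simp only [sTerm, sTail, h1, h2]
  rw [show v + ((N : ℂ) - m + 1) * lq - lq = v + ((N : ℂ) - m) * lq by ring,
    show v + ((N : ℂ) - m) * lq - lq = v + ((N : ℂ) - m - 1) * lq by ring]
  abel

theorem sum_disjSum_sgn (s : Finset ℕ) (F : ℕ ⊕ ℕ → FockOp N) :
    ∑ α ∈ s.disjSum s, sgn α • F α = ∑ m ∈ s, (F (Sum.inl m) - F (Sum.inr m)) := by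
  rw [Finset.sum_disjSum, Finset.sum_sub_distrib]
  simp [sub_eq_add_neg]

/-- The labels of the terms of a screening current. -/
def sIdx (N j : ℕ) : Finset (ℕ ⊕ ℕ) := (Finset.Icc (j + 1) N).disjSum (Finset.Icc (j + 1) N)

theorem mem_sIdx {j : ℕ} {β : ℕ ⊕ ℕ} : β ∈ sIdx N j ↔ j + 1 ≤ tIdx β ∧ tIdx β ≤ N := by
  rcases β with m | m <;> simp [sIdx]

theorem Stilde_eq (j₀ : Fin (N - 1)) (v : ℂ) : Stilde N lq k j₀ v =
    (-(qd lq)⁻¹ * Complex.exp (-v)) • ∑ β ∈ sIdx N (j₀ + 1),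
      sgn β • nexp N lq k (sTerm N lq (j₀ + 1) β v) := by
  rw [sIdx, sum_disjSum_sgn, ← neg_one_div_qd_mul_exp]
  simp only [sTerm_inl_eq, sTerm_inr_eq]
  rfl

/-- The exponents in the screening current `S ^ j(z)`. -/
def fTerm (N : ℕ) (lq k : ℂ) (j₀ : Fin (N - 1)) (β : ℕ ⊕ ℕ) (v : ℂ) : LinForm N :=
  aV N lq k j₀ ((k + N) / 2) v + sTerm N lq (j₀ + 1) β v

theorem annShift_aV_inr (j₀ : Fin (N - 1)) (α v : ℂ) (y : PosRoot N ⊕ PosRoot N) (n : ℕ+) :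
    annShift N lq k (aV N lq k j₀ α v) (Sum.inr y, n) = 0 := by
  simp [annShift, aV, field, kappa]

theorem cre_inl_of_sTerm (j : ℕ) (β : ℕ ⊕ ℕ) (v : ℂ) (i₀ : Fin (N - 1)) (n : ℕ+) :
    sTerm N lq j β v (Gen.cre (aB i₀) n) = 0 := by
  have h1 : ∀ i j a, bc N lq i j a (Gen.cre (aB i₀) n) = 0 := fun i j a => by
    unfold bc atRoot; split_ifs <;> simp [field]
  have h2 : ∀ i j a, bM N lq i j a (Gen.cre (aB i₀) n) = 0 := fun i j a => by
    unfold bM atRoot; split_ifs <;> simp [minusF]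
  have h3 : ∀ i j a, bP N lq i j a (Gen.cre (aB i₀) n) = 0 := fun i j a => by
    unfold bP atRoot; split_ifs <;> simp [plusF]
  rcases β with m | m <;>
    simp [sTerm, sTail, h1, h2, h3, Finset.sum_apply]

theorem pos_inl_of_sTerm (j : ℕ) (β : ℕ ⊕ ℕ) (v : ℂ) (i₀ : Fin (N - 1)) :
    sTerm N lq j β v (Gen.pos (aB i₀)) = 0 := by
  have h1 : ∀ i j a, bc N lq i j a (Gen.pos (aB i₀)) = 0 := fun i j a => by
    unfold bc atRoot; split_ifs <;> simp [field]
  have h2 : ∀ i j a, bM N lq i j a (Gen.pos (aB i₀)) = 0 := fun i j a => by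
    unfold bM atRoot; split_ifs <;> simp [minusF]
  have h3 : ∀ i j a, bP N lq i j a (Gen.pos (aB i₀)) = 0 := fun i j a => by
    unfold bP atRoot; split_ifs <;> simp [plusF]
  rcases β with m | m <;>
    simp [sTerm, sTail, h1, h2, h3, Finset.sum_apply]

/-- The boson `a` commutes with `b` and `c`, so the contraction vanishes and the product is the
exponential of the sum. -/
theorem hasComp_aV_sTerm (j₀ : Fin (N - 1)) (j : ℕ) (β : ℕ ⊕ ℕ) (α v v' : ℂ) :
    HasComp (nexp N lq k (aV N lq k j₀ α v)) (nexp N lq k (sTerm N lq j β v'))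
      (nexp N lq k (aV N lq k j₀ α v + sTerm N lq j β v')) := by
  have h1 : ∀ w, annShift N lq k (aV N lq k j₀ α v) w * crePart (sTerm N lq j β v') w = 0 := by
    rintro ⟨y | y, n⟩
    · rw [crePart, cre_inl_of_sTerm, mul_zero]
    · rw [annShift_aV_inr, zero_mul]
  have h2 : zeroPair k (aV N lq k j₀ α v) (sTerm N lq j β v') = 0 := by
    rw [← zeroForm_apply]
    exact zero_of_cross (Or.inr ⟨fun _ => by simp [aV, field], fun _ => pos_inl_of_sTerm _ _ _ _⟩)
  have := hasComp_nexp (N := N) (lq := lq) (k := k) (Φ := aV N lq k j₀ α v)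
    (Ψ := sTerm N lq j β v') (by simp only [h1]; exact summable_zero)
  simpa [h1, h2] using this

theorem Scurrent_eq (j₀ : Fin (N - 1)) (v : ℂ) : Scurrent N lq k j₀ v =
    (-(qd lq)⁻¹ * Complex.exp (-v)) • ∑ β ∈ sIdx N (j₀ + 1),
      sgn β • nexp N lq k (fTerm N lq k j₀ β v) := by
  rw [Scurrent, Stilde_eq]
  exact (HasComp.smul_right _ (HasComp.sum_right _ fun β _ =>
    (hasComp_aV_sTerm j₀ _ β _ v v).smul_right _)).comp_eq

theorem Tame.fTerm (hG : Generic N lq k) (j₀ : Fin (N - 1)) (β : ℕ ⊕ ℕ) :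
    Tame lq k (fun _ _ => 1) (UqSlN.aWeight N lq k) (fTerm N lq k j₀ β) :=
  (Tame.aV hG _ _).add IsWeight.one.nonneg IsWeight.aWeight.nonneg
    (.sTerm hG .one .aWeight _ _)

theorem ExpFamily.fTerm (j₀ : Fin (N - 1)) (β : ℕ ⊕ ℕ) :
    ExpFamily fun _ v => fTerm N lq k j₀ β v :=
  (ExpFamily.aV _ _).add (.sTerm .snd _ _)

theorem HalfPair.add_left {Φ Φ' Ψ : ℂ → LinForm N} {c a b : ℂ} (h : HalfPair lq k Φ Ψ c a b)
    (h1 : ∀ n u v, modePair N lq k n (Φ' u) (Ψ v) = 0) (h2 : ∀ u v, zeroForm N k (Φ' u) (Ψ v) = 0) :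
    HalfPair lq k (fun u => Φ' u + Φ u) Ψ c a b := fun u v => by
  refine ⟨fun n => ?_, ?_⟩
  · rw [map_add, LinearMap.add_apply, h1, zero_add, (h u v).1]
  · rw [map_add, LinearMap.add_apply, h2, zero_add, (h u v).2]

theorem HalfPair.add_right {Φ Ψ Ψ' : ℂ → LinForm N} {c a b : ℂ} (h : HalfPair lq k Φ Ψ c a b)
    (h1 : ∀ n u v, modePair N lq k n (Φ u) (Ψ' v) = 0) (h2 : ∀ u v, zeroForm N k (Φ u) (Ψ' v) = 0) :
    HalfPair lq k Φ (fun v => Ψ' v + Ψ v) c a b := fun u v => by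
  refine ⟨fun n => ?_, ?_⟩
  · rw [map_add, h1, zero_add, (h u v).1]
  · rw [map_add, h2, zero_add, (h u v).2]

theorem Contraction.add_right {Φ Ψ Ψ' : ℂ → LinForm N} {c a b : ℂ}
    (h : Contraction lq k Φ Ψ c a b)
    (h1 : ∀ n u v, modePair N lq k n (Φ u) (Ψ' v) = 0) (h2 : ∀ u v, zeroForm N k (Φ u) (Ψ' v) = 0)
    (h3 : ∀ n u v, modePair N lq k n (Ψ' v) (Φ u) = 0)
    (h4 : ∀ u v, zeroForm N k (Ψ' v) (Φ u) = 0) :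
    Contraction lq k Φ (fun v => Ψ' v + Ψ v) c a b :=
  ⟨h.zw.add_right h1 h2, h.wz.add_left (fun n v u => h3 n u v) fun v u => h4 u v⟩

/-! ### `E ^ +` and the screening currents -/

/-- The logarithm of the point at which `b ^ {lc}` enters the current `E ^ {+,i}(z)`. -/
def ePt (lq : ℂ) (i l c : ℕ) (u : ℂ) : ℂ := u + ((l : ℂ) + i - c) * lq

/-- The common part of the exponents of both terms with index `n` in `E ^ {+,i}(z)`. -/
def eTail (N : ℕ) (lq : ℂ) (i n : ℕ) (u : ℂ) : LinForm N :=
  ∑ l ∈ Finset.Ico 1 n, (bP N lq l (i + 1) (ePt lq i l (i + 1) u) - bP N lq l i (ePt lq i l i u))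

/-- The exponents in `E ^ {+,i}(z)`. -/
def eTerm (N : ℕ) (lq : ℂ) (i : ℕ) : ℕ ⊕ ℕ → ℂ → LinForm N
  | Sum.inl n, u => bc N lq n i (ePt lq i n i u - lq) + bP N lq n (i + 1) (ePt lq i n (i + 1) u)
      - bc N lq n (i + 1) (ePt lq i n (i + 1) u + lq) + eTail N lq i n u
  | Sum.inr n, u => bc N lq n i (ePt lq i n i u - lq) + bM N lq n (i + 1) (ePt lq i n (i + 1) u)
      - bc N lq n (i + 1) (ePt lq i n (i + 1) u - lq) + eTail N lq i n u

theorem ePt_self_sub (i l : ℕ) (u : ℂ) : ePt lq i l i u - lq = u + ((l : ℂ) - 1) * lq := by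
  rw [ePt]; ring

theorem ePt_self (i l : ℕ) (u : ℂ) : ePt lq i l i u = u + (l : ℂ) * lq := by
  rw [ePt]; ring

theorem ePt_succ (i l : ℕ) (u : ℂ) : ePt lq i l (i + 1) u = u + ((l : ℂ) - 1) * lq := by
  rw [ePt]; push_cast; ring

theorem ePt_succ_add (i l : ℕ) (u : ℂ) : ePt lq i l (i + 1) u + lq = u + (l : ℂ) * lq := by
  rw [ePt]; push_cast; ring

theorem ePt_succ_sub (i l : ℕ) (u : ℂ) :
    ePt lq i l (i + 1) u - lq = u + ((l : ℂ) - 2) * lq := by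
  rw [ePt]; push_cast; ring

theorem Eplus_eq (i₀ : Fin (N - 1)) (u : ℂ) : Eplus N lq k i₀ u =
    (-(qd lq)⁻¹ * Complex.exp (-u)) •
      ∑ α ∈ (Finset.Icc 1 ((i₀ : ℕ) + 1)).disjSum (Finset.Icc 1 ((i₀ : ℕ) + 1)),
        sgn α • nexp N lq k (eTerm N lq (i₀ + 1) α u) := by
  rw [sum_disjSum_sgn, ← neg_one_div_qd_mul_exp]
  simp only [eTerm, eTail, ePt_self_sub, ePt_succ_add, ePt_succ_sub]
  simp only [ePt_self, ePt_succ]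
  simp only [Eplus, add_sub_assoc]

variable (W W' : Boson N → ℕ+ → ℝ)

theorem ExpFamily.eTerm (i : ℕ) (α : ℕ ⊕ ℕ) : ExpFamily fun u _ => eTerm N lq i α u := by
  have hp : ∀ l c, IntAffine fun u _ => ePt lq i l c u := fun _ _ => IntAffine.fst.add_const _
  have ht : ∀ n, ExpFamily fun u _ => eTail N lq i n u := fun n =>
    .sum _ fun _ _ => (ExpFamily.bP (hp _ _) _ _).sub (.bP (hp _ _) _ _)
  rcases α with n | n
  · exact (((ExpFamily.bc ((hp _ _).sub_const _) _ _).add (.bP (hp _ _) _ _)).sub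
      (.bc ((hp _ _).add_const _) _ _)).add (ht n)
  · exact (((ExpFamily.bc ((hp _ _).sub_const _) _ _).add (.bM (hp _ _) _ _)).sub
      (.bc ((hp _ _).sub_const _) _ _)).add (ht n)

variable {W W'}

theorem Tame.eTerm (hG : Generic N lq k) (hW : IsWeight W) (hW' : IsWeight W') (i : ℕ)
    (α : ℕ ⊕ ℕ) : Tame lq k W W' (eTerm N lq i α) := by
  have h := hW.nonneg
  have h' := hW'.nonneg
  have ht : ∀ n, Tame lq k W W' (eTail N lq i n) := fun n =>
    .sum _ h h' fun _ _ => (Tame.bP hW _ _ fun _ => rfl).sub h h' (.bP hW _ _ fun _ => rfl)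
  rcases α with n | n
  · exact Tame.add h h' (.sub h h' (.add h h' (.bc hG hW hW' _ _ fun _ => add_sub_assoc _ _ _)
      (.bP hW _ _ fun _ => rfl)) (.bc hG hW hW' _ _ fun _ => add_assoc _ _ _)) (ht n)
  · exact Tame.add h h' (.sub h h' (.add h h' (.bc hG hW hW' _ _ fun _ => add_sub_assoc _ _ _)
      (.bM hW' _ _ fun _ => rfl)) (.bc hG hW hW' _ _ fun _ => add_sub_assoc _ _ _)) (ht n)

end Currents

end

end UqSlN

namespace UqSlN

noncomputable section

open scoped BigOperators
open Filter Topology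

/-! ### Contractions of `E ^ +` with the screening currents. -/

section EplusOPE

variable {N : ℕ} {lq k : ℂ}

/-- `q ^ (n δ)`. -/
def tp (lq : ℂ) (n : ℕ+) (δ : ℂ) : ℂ := Complex.exp (n * (δ * lq))

@[simp] theorem tp_zero (n : ℕ+) : tp lq n 0 = 1 := by simp [tp]

@[simp] theorem tp_one (n : ℕ+) : tp lq n 1 = qn lq n := by simp [tp, qn]

@[simp] theorem tp_neg (n : ℕ+) (δ : ℂ) : tp lq n (-δ) = (tp lq n δ)⁻¹ := by
  rw [tp, tp, ← Complex.exp_neg]; ring_nf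

@[simp] theorem tp_two (n : ℕ+) : tp lq n 2 = qn lq n ^ 2 := by
  rw [tp, qn, ← Complex.exp_nat_mul]; push_cast; ring_nf

/-- With the mode at the pole factored out, only the difference of the exponents at zero and pole
remains. In the applications it is `0`, `1`, `±2` or a similarly small integer, so each mode
identity becomes a rational identity in `q ^ n`. -/
theorem halfPair_iff {Φ Ψ : ℂ → LinForm N} {c a b : ℂ} : HalfPair lq k Φ Ψ c a b ↔
    ∀ u v, (∀ n : ℕ+, modePair N lq k n (Φ u) (Ψ v) =
      zn n (v - u + b * lq) * (1 - tp lq n (a - b))) ∧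
      zeroForm N k (Φ u) (Ψ v) = c * lq := by
  have : ∀ (n : ℕ+) (x : ℂ), Complex.exp (n * (x + b * lq)) - Complex.exp (n * (x + a * lq)) =
      zn n (x + b * lq) * (1 - tp lq n (a - b)) := fun n x => by
    rw [mul_sub, mul_one, zn, tp, ← Complex.exp_add]; ring_nf
  simp only [HalfPair, this]

/-- The rows `j` and `j + 1` enter with opposite signs and cancel, unless the range stops exactly
between them. -/
theorem sum_sRow_Ico {j : ℕ} (hj : 1 ≤ j) (n : ℕ) :
    ∑ l ∈ Finset.Ico 1 n, sRow j l = -(if n = j + 1 then 1 else 0) := by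
  simp only [sRow, Finset.sum_sub_distrib, Finset.sum_ite_eq', Finset.mem_Ico]
  rcases lt_trichotomy n (j + 1) with h | h | h
  · simp (disch := omega) [if_neg]
  · simp (disch := omega) [if_neg, if_pos]
  · simp (disch := omega) [if_neg, if_pos]

/-- The ratio of the points at which a field `b ^ {lc}` enters the two currents is the same for all
roots `(l, c)`. Consequently all contractions of `E ^ {+,i}` with `S̃ ^ j` have the same pole `z = q
^ (N - i - j) w`. -/
theorem sPt_sub_ePt (i j l c : ℕ) (u v : ℂ) :
    sPt N lq j l c v - ePt lq i l c u = v - u + ((N : ℂ) - i - j) * lq := by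
  rw [sPt, ePt]; ring

theorem ePt_sub_sPt (i j l c : ℕ) (u v : ℂ) :
    ePt lq i l c u - sPt N lq j l c v = u - v + -((N : ℂ) - i - j) * lq := by
  rw [sPt, ePt]; ring

variable (n' : ℕ+) {i j n m : ℕ} (u v : ℂ)

/-- The contraction depends on the row of the tail only through `sRow`, so the sum over rows
collapses; the tail is seen only when it ends at row `j`. -/
theorem modePair_eTail_sTerm (hG : Generic N lq k) (hj : 1 ≤ j) (hn : n ≤ i) (hi : i + 1 ≤ N)
    (β : ℕ ⊕ ℕ) : modePair N lq k n' (eTail N lq i n u) (sTerm N lq j β v) =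
      (if n = j + 1 then qb lq n' * (sCol lq n' (tIdx β) (i + 1) - sCol lq n' (tIdx β) i) else 0) *
        zn n' (v - u + ((N : ℂ) - i - j) * lq) := by
  rw [eTail, map_sum, LinearMap.sum_apply]
  trans ∑ l ∈ Finset.Ico 1 n, (-qb lq n' * (sCol lq n' (tIdx β) (i + 1) - sCol lq n' (tIdx β) i) *
    zn n' (v - u + ((N : ℂ) - i - j) * lq)) * sRow j l
  · refine Finset.sum_congr rfl fun l hl => ?_
    have hl := Finset.mem_Ico.1 hl
    rw [map_sub, LinearMap.sub_apply,
      modePair_bP_sTerm _ _ _ _ _ _ _ hG ⟨hl.1, by omega, by omega⟩,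
      modePair_bP_sTerm _ _ _ _ _ _ _ hG ⟨hl.1, by omega, by omega⟩, sPt_sub_ePt, sPt_sub_ePt]
    ring
  · rw [← Finset.mul_sum, sum_sRow_Ico hj]
    split_ifs <;> ring

theorem zeroForm_eTail_sTerm (hj : 1 ≤ j) (hn : n ≤ i) (hi : i + 1 ≤ N)
    (β : ℕ ⊕ ℕ) : zeroForm N k (eTail N lq i n u) (sTerm N lq j β v) =
      lq * (if n = j + 1 then (if i + 1 = tIdx β then 1 else 0) - (if i = tIdx β then 1 else 0)
        else 0) := by
  rw [eTail, map_sum, LinearMap.sum_apply]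
  trans ∑ l ∈ Finset.Ico 1 n, (-lq * ((if i + 1 = tIdx β then 1 else 0) -
    (if i = tIdx β then 1 else 0))) * sRow j l
  · refine Finset.sum_congr rfl fun l hl => ?_
    have hl := Finset.mem_Ico.1 hl
    rw [map_sub, LinearMap.sub_apply,
      zeroForm_bP_sTerm _ _ _ _ _ _ ⟨hl.1, by omega, by omega⟩,
      zeroForm_bP_sTerm _ _ _ _ _ _ ⟨hl.1, by omega, by omega⟩]
    split_ifs <;> ring
  · rw [← Finset.mul_sum, sum_sRow_Ico hj]
    split_ifs <;> ring

theorem modePair_eTail_right (Ψ : LinForm N) : modePair N lq k n' Ψ (eTail N lq i n u) = 0 := by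
  simp [eTail, modePair_bP_right]

theorem zeroForm_eTail_right (Ψ : LinForm N) : zeroForm N k Ψ (eTail N lq i n u) = 0 := by
  simp [eTail, zeroForm_bP_right]

/-! The contraction of `(b + c) ^ {lc}` for `l = c` is included, where both sides vanish. -/

variable (l c : ℕ) (a : ℂ)

theorem isRoot_of_le {l c : ℕ} (h1 : 1 ≤ l) (h2 : l ≤ c) (h3 : c ≤ N) :
    IsRoot N l c ∨ l = c ∧ ∀ (lq : ℂ) a, bc N lq l c a = 0 := by
  rcases h2.eq_or_lt with rfl | h
  · exact Or.inr ⟨rfl, fun lq a => bc_of_not_isRoot _ _ _ fun h => lt_irrefl _ h.2.1⟩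
  · exact Or.inl ⟨h1, h, h3⟩

theorem modePair_bc_sTerm_inl_of_le (hG : Generic N lq k) (hm : j < m) (h1 : 1 ≤ l) (h2 : l ≤ c)
    (h3 : c ≤ N) : modePair N lq k n' (bc N lq l c a) (sTerm N lq j (Sum.inl m) v) =
      -qb lq n' * (sRow j l * (if m < c then 1 else 0) - if l = j ∧ c = m then 1 else 0) *
        zn n' (sPt N lq j l c v - a) := by
  rcases isRoot_of_le h1 h2 h3 with hr | ⟨rfl, h⟩
  · exact modePair_bc_sTerm_inl _ _ _ _ _ _ _ hG hr
  · rw [h, map_zero, LinearMap.zero_apply, sRow]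
    split_ifs <;> first | omega | simp

theorem modePair_bc_sTerm_inr_of_le (hG : Generic N lq k) (hm : j < m) (h1 : 1 ≤ l) (h2 : l ≤ c)
    (h3 : c ≤ N) : modePair N lq k n' (bc N lq l c a) (sTerm N lq j (Sum.inr m) v) =
      -qb lq n' * (sRow j l * (if m < c then 1 else 0)) * zn n' (sPt N lq j l c v - a) := by
  rcases isRoot_of_le h1 h2 h3 with hr | ⟨rfl, h⟩
  · exact modePair_bc_sTerm_inr _ _ _ _ _ _ _ hG hr
  · rw [h, map_zero, LinearMap.zero_apply, sRow]
    split_ifs <;> first | omega | simp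

theorem modePair_sTerm_bc_inr_of_le (hG : Generic N lq k) (hm : j < m) (h1 : 1 ≤ l) (h2 : l ≤ c)
    (h3 : c ≤ N) : modePair N lq k n' (sTerm N lq j (Sum.inr m) v) (bc N lq l c a) =
      (if l = j ∧ c = m then qb lq n' else 0) * zn n' (a - sPt N lq j l c v) := by
  rcases isRoot_of_le h1 h2 h3 with hr | ⟨rfl, h⟩
  · exact modePair_sTerm_bc_inr _ _ _ _ _ _ _ hG hr
  · rw [h, map_zero, if_neg (by omega), zero_mul]

theorem zeroForm_sTerm_bc_inl_of_le (hm : j < m) (h1 : 1 ≤ l) (h2 : l ≤ c) (h3 : c ≤ N) :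
    zeroForm N k (sTerm N lq j (Sum.inl m) v) (bc N lq l c a) =
      lq * (sRow j l * (if m < c then 1 else 0) - if l = j ∧ c = m then 1 else 0) := by
  rcases isRoot_of_le h1 h2 h3 with hr | ⟨rfl, h⟩
  · exact zeroForm_sTerm_bc_inl _ _ _ _ _ _ hr
  · rw [h, map_zero, sRow]
    split_ifs <;> first | omega | simp

theorem zeroForm_sTerm_bc_inr_of_le (hm : j < m) (h1 : 1 ≤ l) (h2 : l ≤ c) (h3 : c ≤ N) :
    zeroForm N k (sTerm N lq j (Sum.inr m) v) (bc N lq l c a) =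
      lq * (sRow j l * (if m < c then 1 else 0) + if l = j ∧ c = m then 1 else 0) := by
  rcases isRoot_of_le h1 h2 h3 with hr | ⟨rfl, h⟩
  · exact zeroForm_sTerm_bc_inr _ _ _ _ _ _ hr
  · rw [h, map_zero, sRow]
    split_ifs <;> first | omega | simp

/-- The power of `q` in the contraction of `E ^ {+,i}` with `S̃ ^ j`. -/
def eConst (i j : ℕ) : ℕ ⊕ ℕ → ℕ ⊕ ℕ → ℂ
  | Sum.inl n, β => if n = j ∧ tIdx β = i + 1 then 1 else if n = j + 1 ∧ tIdx β = i then -1 else 0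
  | Sum.inr n, β => if n = j ∧ tIdx β = i + 1 then -1 else if n = j + 1 ∧ tIdx β = i then -1 else
      if n = j + 1 ∧ tIdx β = i + 1 then 2 else 0

/-- The difference of the exponents at the zero and the pole in this contraction. -/
def eShift (i j : ℕ) : ℕ ⊕ ℕ → ℕ ⊕ ℕ → ℂ
  | Sum.inl _, Sum.inl _ => 0
  | Sum.inl n, Sum.inr m => if n = j ∧ m = i then 2 else if n = j ∧ m = i + 1 then -2 else 0
  | Sum.inr n, Sum.inl m => if n = j ∧ m = i + 1 then 2 else if n = j + 1 ∧ m = i + 1 then -2 else 0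
  | Sum.inr n, Sum.inr m => if n = j ∧ m = i then 2 else if n = j + 1 ∧ m = i + 1 then -2 else 0

/-- The term of `E ^ {+,i}` has only the columns `i`, `i + 1` and the screening current only the
rows `j`, `j + 1`. So it suffices to compare `n` with `j`, `j + 1` and `m` with `i`, `i + 1`; in
each case the mode identity is a rational identity in `q ^ n`. -/
theorem halfPair_eTerm_sTerm (hG : Generic N lq k) (hj : 1 ≤ j) (hi : i + 1 ≤ N) {α β : ℕ ⊕ ℕ}
    (h1 : 1 ≤ tIdx α) (h2 : tIdx α ≤ i) (h3 : j < tIdx β) :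
    HalfPair lq k (eTerm N lq i α) (sTerm N lq j β) (eConst i j α β)
      ((N : ℂ) - i - j + eShift i j α β) ((N : ℂ) - i - j) := by
  rw [halfPair_iff]
  intro u v
  rw [add_sub_cancel_left]
  refine ⟨fun n' => ?_, ?_⟩
  · have ht := qn_ne_zero lq n'
    rcases α with n | n <;> rcases β with m | m <;> dsimp only [tIdx] at h1 h2 h3
    all_goals
      have hr : IsRoot N n (i + 1) := ⟨h1, by omega, hi⟩
      simp only [eTerm, map_add, map_sub, LinearMap.add_apply, LinearMap.sub_apply,
        modePair_eTail_sTerm _ _ _ hG hj h2 hi, modePair_bP_sTerm _ _ _ _ _ _ _ hG hr,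
        modePair_bM_left, modePair_bc_sTerm_inl_of_le _ _ _ _ _ hG h3 h1 h2 (by omega : i ≤ N),
        modePair_bc_sTerm_inr_of_le _ _ _ _ _ hG h3 h1 h2 (by omega : i ≤ N),
        modePair_bc_sTerm_inl _ _ _ _ _ _ _ hG hr, modePair_bc_sTerm_inr _ _ _ _ _ _ _ hG hr,
        zn_sub_sub_lq, zn_sub_add_lq, sPt_sub_ePt, sRow, sCol, eShift]
      generalize zn n' _ = X
      rcases (by omega : n = j ∨ n = j + 1 ∨ (n ≠ j ∧ n ≠ j + 1)) with rfl | rfl | hn <;>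
      rcases (by omega : m < i ∨ m = i ∨ m = i + 1 ∨ i + 1 < m) with hm | rfl | rfl | hm <;>
      first
        | omega
        | (simp (disch := omega) only [tIdx, and_self, if_true, if_pos, if_neg, tp_zero, tp_two, tp_neg, qb]
           try field_simp
           try ring)
  · rcases α with n | n <;> rcases β with m | m <;> dsimp only [tIdx] at h1 h2 h3
    all_goals
      have hr : IsRoot N n (i + 1) := ⟨h1, by omega, hi⟩
      simp only [eTerm, map_add, map_sub, LinearMap.add_apply, LinearMap.sub_apply,
        zeroForm_eTail_sTerm _ _ hj h2 hi, zeroForm_bP_sTerm _ _ _ _ _ _ hr,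
        zeroForm_bM_sTerm _ _ _ _ _ _ hr, zeroForm_bc_sTerm, sRow, eConst]
      rcases (by omega : n = j ∨ n = j + 1 ∨ (n ≠ j ∧ n ≠ j + 1)) with rfl | rfl | hn <;>
      rcases (by omega : m < i ∨ m = i ∨ m = i + 1 ∨ i + 1 < m) with hm | rfl | rfl | hm <;>
      first
        | omega
        | (simp (disch := omega) only [tIdx, and_self, if_true, if_pos, if_neg]
           try ring)

theorem halfPair_sTerm_eTerm (hG : Generic N lq k) (hi : i + 1 ≤ N) {α β : ℕ ⊕ ℕ}
    (h1 : 1 ≤ tIdx α) (h2 : tIdx α ≤ i) (h3 : j < tIdx β) :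
    HalfPair lq k (sTerm N lq j β) (eTerm N lq i α)
      (eConst i j α β + eShift i j α β)
      (-((N : ℂ) - i - j + eShift i j α β)) (-((N : ℂ) - i - j)) := by
  rw [halfPair_iff]
  intro v u
  rw [neg_add, add_sub_cancel_left]
  refine ⟨fun n' => ?_, ?_⟩
  · have ht := qn_ne_zero lq n'
    rcases α with n | n <;> rcases β with m | m <;> dsimp only [tIdx] at h1 h2 h3
    all_goals
      have hr : IsRoot N n (i + 1) := ⟨h1, by omega, hi⟩
      simp only [eTerm, map_add, map_sub, modePair_eTail_right, modePair_bP_right,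
        modePair_sTerm_bc_inl _ _ _ _ _ _ _ hG,
        modePair_sTerm_bc_inr_of_le _ _ _ _ _ hG h3 h1 h2 (by omega : i ≤ N),
        modePair_sTerm_bc_inr _ _ _ _ _ _ _ hG hr,
        modePair_sTerm_bM _ _ _ _ _ _ _ hG hr,
        zn_sub_lq, zn_add_lq, ePt_sub_sPt, eShift]
      generalize zn n' _ = X
      rcases (by omega : n = j ∨ n = j + 1 ∨ (n ≠ j ∧ n ≠ j + 1)) with rfl | rfl | hn <;>
      rcases (by omega : m < i ∨ m = i ∨ m = i + 1 ∨ i + 1 < m) with hm | rfl | rfl | hm <;>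
      first
        | omega
        | (simp (disch := omega) only [tIdx, and_self, if_true, if_pos, if_neg, tp_zero, tp_two, tp_neg, qb]
           try field_simp
           try ring)
  · rcases α with n | n <;> rcases β with m | m <;> dsimp only [tIdx] at h1 h2 h3
    all_goals
      have hr : IsRoot N n (i + 1) := ⟨h1, by omega, hi⟩
      simp only [eTerm, map_add, map_sub, zeroForm_eTail_right, zeroForm_bP_right,
        zeroForm_bM_right, zeroForm_sTerm_bc_inl _ _ _ _ _ _ hr,
        zeroForm_sTerm_bc_inr _ _ _ _ _ _ hr,
        zeroForm_sTerm_bc_inl_of_le _ _ _ _ h3 h1 h2 (by omega : i ≤ N),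
        zeroForm_sTerm_bc_inr_of_le _ _ _ _ h3 h1 h2 (by omega : i ≤ N),
        sRow, eConst, eShift]
      rcases (by omega : n = j ∨ n = j + 1 ∨ (n ≠ j ∧ n ≠ j + 1)) with rfl | rfl | hn <;>
      rcases (by omega : m < i ∨ m = i ∨ m = i + 1 ∨ i + 1 < m) with hm | rfl | rfl | hm <;>
      first
        | omega
        | (simp (disch := omega) only [tIdx, and_self, if_true, if_pos, if_neg]
           try ring)

end EplusOPE

end

end UqSlN

namespace UqSlN

noncomputable section

open scoped BigOperators
open Filter Topology

/-! ### Cancellation of the residues of `E ^ +` with the screening currents. -/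

section EplusResidue

variable {N : ℕ} {lq k : ℂ}

@[simp] theorem qpow_zero : qpow lq 0 = 1 := by simp [qpow]

theorem qpow_two : qpow lq 2 = qpow lq 1 ^ 2 := by
  rw [← one_add_one_eq_two, qpow_add, pow_two]

theorem sTail_pred (j : ℕ) {m : ℕ} (hm : m + 1 ≤ N) (v : ℂ) : sTail N lq j m v =
    bM N lq (j + 1) (m + 1) (sPt N lq j (j + 1) (m + 1) v) -
      bM N lq j (m + 1) (sPt N lq j j (m + 1) v) + sTail N lq j (m + 1) v := by
  rw [sTail, sTail, ← Finset.insert_Icc_add_one_left_eq_Icc hm, Finset.sum_insert (by simp)]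

theorem eTail_succ (i : ℕ) {n : ℕ} (hn : 1 ≤ n) (u : ℂ) : eTail N lq i (n + 1) u =
    eTail N lq i n u + (bP N lq n (i + 1) (ePt lq i n (i + 1) u) -
      bP N lq n i (ePt lq i n i u)) := by
  rw [eTail, eTail, Finset.sum_Ico_succ_top hn]

/-- On the pole each `b ^ {lc}` sits at the same point in both currents, so forms from one can
cancel or replace forms from the other. -/
theorem ePt_eq_sPt (i j l c : ℕ) (v : ℂ) :
    ePt lq i l c (v + ((N : ℂ) - i - j) * lq) = sPt N lq j l c v := by
  rw [sPt, ePt]; ring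

variable {i j : ℕ} (v : ℂ)

/-- Passing from row `j` to `j + 1` lengthens the tail of `E ^ +`, and passing from column `i` to `i
+ 1` shortens that of the screening current. On the pole these changes are compensated by the
explicit fields `b_±` and `b + c` of the two terms. -/
theorem eTerm_add_sTerm_inl_inr (hj : 1 ≤ j) (hi : i + 1 ≤ N) :
    eTerm N lq i (Sum.inl j) (v + ((N : ℂ) - i - j) * lq) + sTerm N lq j (Sum.inr i) v =
    eTerm N lq i (Sum.inr (j + 1)) (v + ((N : ℂ) - i - j) * lq) +
      sTerm N lq j (Sum.inl (i + 1)) v := by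
  simp only [eTerm, sTerm, eTail_succ _ hj, sTail_pred _ hi, ePt_eq_sPt]
  abel

theorem eTerm_add_sTerm_inr_inr (hj : 1 ≤ j) (hi : i + 1 ≤ N) :
    eTerm N lq i (Sum.inr j) (v + ((N : ℂ) - i - j) * lq) + sTerm N lq j (Sum.inr i) v =
    eTerm N lq i (Sum.inr (j + 1)) (v + ((N : ℂ) - i - j) * lq) +
      sTerm N lq j (Sum.inr (i + 1)) v := by
  simp only [eTerm, sTerm, eTail_succ _ hj, sTail_pred _ hi, ePt_eq_sPt]
  abel

theorem eTerm_add_sTerm_inl_inr_succ :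
    eTerm N lq i (Sum.inl j) (v + ((N : ℂ) - i - j) * lq) + sTerm N lq j (Sum.inr (i + 1)) v =
    eTerm N lq i (Sum.inr j) (v + ((N : ℂ) - i - j) * lq) +
      sTerm N lq j (Sum.inl (i + 1)) v := by
  simp only [eTerm, sTerm, ePt_eq_sPt]
  abel

/-- Two terms of a residue cancel. -/
theorem smul_nexp_add_eq_zero {c d : ℂ} {Φ Ψ : LinForm N} (h : Φ = Ψ) (hc : c + d = 0) :
    c • nexp N lq k Φ + d • nexp N lq k Ψ = 0 := by
  rw [h, ← add_smul, hc, zero_smul]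

/-- The pairing of the terms whose residues cancel. -/
def ePair (i j : ℕ) : (ℕ ⊕ ℕ) × (ℕ ⊕ ℕ) → (ℕ ⊕ ℕ) × (ℕ ⊕ ℕ)
  | (Sum.inl n, Sum.inl m) => (Sum.inl n, Sum.inl m)
  | (Sum.inl n, Sum.inr m) =>
      if n = j ∧ m = i then (Sum.inr (j + 1), Sum.inl (i + 1))
      else if n = j ∧ m = i + 1 then (Sum.inr j, Sum.inl (i + 1)) else (Sum.inl n, Sum.inr m)
  | (Sum.inr n, Sum.inl m) =>
      if n = j ∧ m = i + 1 then (Sum.inl j, Sum.inr (i + 1))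
      else if n = j + 1 ∧ m = i + 1 then (Sum.inl j, Sum.inr i) else (Sum.inr n, Sum.inl m)
  | (Sum.inr n, Sum.inr m) =>
      if n = j ∧ m = i then (Sum.inr (j + 1), Sum.inr (i + 1))
      else if n = j + 1 ∧ m = i + 1 then (Sum.inr j, Sum.inr i) else (Sum.inr n, Sum.inr m)

/-- `ePair` exchanges the terms that have a pole, with equal exponents on the pole and opposite
coefficients, and fixes the others. The spectator form `Ξ` will be the vertex form of the boson `a`,
which does not take part in the contraction. -/
theorem residue_eTerm (Ξ : LinForm N) (hj : 1 ≤ j) (hi : i + 1 ≤ N) :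
    ∑ x ∈ (Finset.Icc 1 i).disjSum (Finset.Icc 1 i) ×ˢ sIdx N j,
      (sgn x.1 * sgn x.2 * (qpow lq (eConst i j x.1 x.2) * (qpow lq ((N : ℂ) - i - j) -
        qpow lq ((N : ℂ) - i - j + eShift i j x.1 x.2)))) •
      nexp N lq k (eTerm N lq i x.1 (v + ((N : ℂ) - i - j) * lq) + (Ξ + sTerm N lq j x.2 v)) =
      0 := by
  have hq := qpow_ne_zero (lq := lq) 1
  refine Finset.sum_involution (fun x _ => ePair i j x) ?_ ?_ ?_ ?_
  · rintro ⟨n | n, m | m⟩ -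
    all_goals
      simp only [ePair]
      first
        | split_ifs with h1 h2
        | skip
      all_goals
        first
          -- Fixed points of `ePair` have `eShift = 0`: zero and pole coincide and the coefficient
          -- is zero.
          | (simp (disch := omega) only [eShift, if_neg, add_zero, sub_self, mul_zero, zero_smul]; done)
          | skip
      all_goals
        obtain ⟨rfl, rfl⟩ := ‹_ ∧ _›
        simp only [← add_assoc, add_right_comm _ Ξ]
        refine smul_nexp_add_eq_zero ?_ ?_
        · simp only [eTerm_add_sTerm_inl_inr v hj hi, eTerm_add_sTerm_inr_inr v hj hi,
            eTerm_add_sTerm_inl_inr_succ v]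
        · simp (disch := omega) only [eShift, eConst, tIdx, and_self, if_true, if_neg, if_pos,
            sgn_inl, sgn_inr, qpow_add, qpow_neg, qpow_two, qpow_zero]
          field_simp
          ring
  · rintro ⟨n | n, m | m⟩ - h0 <;> simp only [ePair] at h0 ⊢
    all_goals
      first
        | split_ifs with h1 h2
        | skip
      all_goals
        first
          | (exfalso; refine h0 ?_
             simp (disch := omega) only [eShift, if_neg, add_zero, sub_self, mul_zero, zero_smul]
             done)
          | (simp; done)
          | (simp; omega)
  · rintro ⟨n | n, m | m⟩ hx <;>
      simp only [ePair, Finset.mem_product, mem_sIdx, Finset.inl_mem_disjSum,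
        Finset.inr_mem_disjSum, Finset.mem_Icc, tIdx] at hx ⊢
    all_goals
      first
        | split_ifs with h1 h2
        | skip
      all_goals
        try simp only [Finset.mem_product, mem_sIdx, Finset.inl_mem_disjSum,
          Finset.inr_mem_disjSum, Finset.mem_Icc]
        omega
  · rintro ⟨n | n, m | m⟩ - <;> simp only [ePair]
    all_goals
      first
        | split_ifs with h1 h2
        | skip
      all_goals
        simp only [ePair]
        first
          | rfl
          | (simp (disch := omega) only [and_self, if_true, if_neg, if_pos]
             done)
          | (simp (disch := omega) only [and_self, if_true, if_neg, if_pos]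
             obtain ⟨rfl, rfl⟩ := ‹_ ∧ _›
             rfl)

theorem modePair_eTerm_aV (α : ℕ ⊕ ℕ) (n : ℕ+) (u v : ℂ) (j₀ : Fin (N - 1)) (s : ℂ) :
    modePair N lq k n (eTerm N lq i α u) (aV N lq k j₀ s v) = 0 := by
  rcases α with m | m <;>
    simp [eTerm, eTail, modePair_bP_aV, modePair_bc_aV, modePair_bM_left]

theorem zeroForm_eTerm_aV (α : ℕ ⊕ ℕ) (u v : ℂ) (j₀ : Fin (N - 1)) (s : ℂ) :
    zeroForm N k (eTerm N lq i α u) (aV N lq k j₀ s v) = 0 := by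
  rcases α with m | m <;>
    simp [eTerm, eTail, zeroForm_bP_aV, zeroForm_bc_aV, zeroForm_bM_aV]

theorem modePair_aV_eTerm (α : ℕ ⊕ ℕ) (n : ℕ+) (u v : ℂ) (j₀ : Fin (N - 1)) (s : ℂ) :
    modePair N lq k n (aV N lq k j₀ s v) (eTerm N lq i α u) = 0 := by
  rcases α with m | m <;>
    simp [eTerm, eTail, modePair_bP_right, modePair_aV_bc, modePair_aV_bM]

theorem zeroForm_aV_eTerm (α : ℕ ⊕ ℕ) (u v : ℂ) (j₀ : Fin (N - 1)) (s : ℂ) :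
    zeroForm N k (aV N lq k j₀ s v) (eTerm N lq i α u) = 0 := by
  rcases α with m | m <;>
    simp [eTerm, eTail, zeroForm_bP_right, zeroForm_aV_bc, zeroForm_bM_right]

/-- The product of `E ^ {+,i}(z)` and `S ^ j(w)` is regular. -/
theorem ope_Eplus_Scurrent (hG : Generic N lq k) (i₀ j₀ : Fin (N - 1)) :
    OPE (Eplus N lq k i₀) (Scurrent N lq k j₀) (fun _ _ => 1) (fun _ _ => 1) 0 := by
  have hi : (i₀ : ℕ) + 1 + 1 ≤ N := by omega
  have h := ope_of_residues (N := N) (lq := lq) (k := k) (P := Finset.univ)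
    (π := fun (_ _ : ℕ ⊕ ℕ) => ()) (b := fun _ => (N : ℂ) - ((i₀ : ℕ) + 1 : ℕ) - ((j₀ : ℕ) + 1 : ℕ))
    (c := eConst (i₀ + 1) (j₀ + 1))
    (a := fun α β => (N : ℂ) - ((i₀ : ℕ) + 1 : ℕ) - ((j₀ : ℕ) + 1 : ℕ) +
      eShift (i₀ + 1) (j₀ + 1) α β)
    (fun _ _ _ _ => Finset.mem_univ _) (Eplus_eq i₀) (Scurrent_eq j₀)
    (fun α _ => Tame.eTerm hG .aWeight .one _ α) (fun β _ => Tame.fTerm hG j₀ β)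
    (fun α _ => ExpFamily.eTerm _ α) (fun β _ => ExpFamily.fTerm j₀ β) (fun α hα β hβ => by
      have h1 : 1 ≤ tIdx α ∧ tIdx α ≤ i₀ + 1 := by rcases α with n | n <;> simpa using hα
      have h2 := mem_sIdx.1 hβ
      refine Contraction.add_right ⟨halfPair_eTerm_sTerm hG (by omega) hi h1.1 h1.2 h2.1, ?_⟩
        (fun n u v => modePair_eTerm_aV _ _ _ _ _ _) (fun u v => zeroForm_eTerm_aV _ _ _ _ _)
        (fun n u v => modePair_aV_eTerm _ _ _ _ _ _) (fun u v => zeroForm_aV_eTerm _ _ _ _ _)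
      have := halfPair_sTerm_eTerm (k := k) hG hi h1.1 h1.2 h2.1
      convert this using 1
      ring)
  convert h using 1
  funext u v
  simp only [residue, Finset.filter_true, fTerm, residue_eTerm _ _ (by omega : 1 ≤ (j₀ : ℕ) + 1) hi,
    smul_zero, Finset.sum_const_zero]
  rfl

end EplusResidue

end

end UqSlN

namespace UqSlN

noncomputable section

open scoped BigOperators
open Filter Topology

/-! ### Products of two currents `S̃`. -/

section ScreeningProducts

variable {N : ℕ} {lq k : ℂ}

theorem tp_add (n : ℕ+) (x y : ℂ) : tp lq n (x + y) = tp lq n x * tp lq n y := by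
  rw [tp, tp, tp, ← Complex.exp_add]; ring_nf

theorem tp_sub (n : ℕ+) (x y : ℂ) : tp lq n (x - y) = tp lq n x * (tp lq n y)⁻¹ := by
  rw [sub_eq_add_neg, tp_add, tp_neg]

theorem zn_add_mul_lq (n : ℕ+) (x a : ℂ) : zn n (x + a * lq) = zn n x * tp lq n a := by
  rw [zn, zn, tp, ← Complex.exp_add]; ring_nf

/-- The power of `q` in the contraction of two screening currents. -/
def ssConst (i j : ℕ) (α β : ℕ ⊕ ℕ) : ℂ :=
  (if tIdx α < tIdx β then sRow j (i + 1) - sRow j i else 0) -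
    if tIdx α = tIdx β then sgn α * sRow j i else 0

/-- The exponent at the zero of the contraction of two screening currents. -/
def ssZero (i j : ℕ) (α β : ℕ ⊕ ℕ) : ℂ :=
  if i = j then if tIdx α < tIdx β then -2 else if tIdx β < tIdx α then 2 else sgn β - sgn α
  else if j = i + 1 then
    if tIdx α < tIdx β then 1 else if tIdx β < tIdx α then -1 else -sgn β
  else if i = j + 1 then
    if tIdx α < tIdx β then 1 else if tIdx β < tIdx α then -1 else sgn α
  else 0

/-- The exponent at the pole of the contraction of two screening currents. -/
def ssPole (i j : ℕ) : ℂ := if i = j then -2 else if j = i + 1 ∨ i = j + 1 then 1 else 0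

theorem ssPole_eq (i₀ j₀ : Fin (N - 1)) :
    ssPole (i₀ + 1) (j₀ + 1) = -(CartanMatrix.A (N - 1) i₀ j₀ : ℂ) := by
  simp only [ssPole, CartanMatrix.A, Matrix.of_apply, Fin.ext_iff]
  split_ifs <;> first | omega | simp

theorem ssPole_comm (i j : ℕ) : ssPole i j = ssPole j i := by
  simp only [ssPole]; split_ifs <;> first | omega | rfl

/-- Together with `ssConst_swap` and `ssPole_comm` this deduces the contraction in the reversed
order from the one computation `halfPair_sTerm_sTerm`. -/
theorem ssZero_swap (i j : ℕ) (α β : ℕ ⊕ ℕ) : ssZero j i β α = -ssZero i j α β := by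
  simp only [ssZero]
  rcases (by omega : i = j ∨ j = i + 1 ∨ i = j + 1 ∨ (i ≠ j ∧ j ≠ i + 1 ∧ i ≠ j + 1)) with
    rfl | rfl | rfl | h <;>
  rcases lt_trichotomy (tIdx α) (tIdx β) with h' | h' | h' <;>
  (simp (disch := omega) only [if_true, if_pos, if_neg]; try ring)

theorem ssConst_swap (i j : ℕ) (α β : ℕ ⊕ ℕ) :
    ssConst j i β α = ssConst i j α β + ssZero i j α β := by
  simp only [ssZero, ssConst, sRow]
  rcases (by omega : i = j ∨ j = i + 1 ∨ i = j + 1 ∨ (i ≠ j ∧ j ≠ i + 1 ∧ i ≠ j + 1)) with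
    rfl | rfl | rfl | h <;>
  rcases lt_trichotomy (tIdx α) (tIdx β) with h' | h' | h' <;>
  (simp (disch := omega) only [if_true, if_pos, if_neg]; try ring)

theorem zeroForm_sTail_sTerm (i j : ℕ) {n : ℕ} (u v : ℂ) (β : ℕ ⊕ ℕ) (h0 : 1 ≤ i) (hn : i < n)
    (hβ : tIdx β ≤ N) :
    zeroForm N k (sTail N lq i n u) (sTerm N lq j β v) =
      lq * (if n < tIdx β then sRow j (i + 1) - sRow j i else 0) := by
  rw [sTail, map_sum, LinearMap.sum_apply]
  trans ∑ c ∈ Finset.Icc (n + 1) N,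
    if c = tIdx β then lq * (sRow j (i + 1) - sRow j i) else 0
  · refine Finset.sum_congr rfl fun c hc => ?_
    have hc := Finset.mem_Icc.1 hc
    rw [map_sub, LinearMap.sub_apply, zeroForm_bM_sTerm _ _ _ _ _ _ ⟨by omega, by omega, hc.2⟩,
      zeroForm_bM_sTerm _ _ _ _ _ _ ⟨h0, by omega, hc.2⟩]
    split_ifs <;> ring
  · rw [Finset.sum_ite_eq']
    simp only [Finset.mem_Icc, hβ, and_true, Nat.succ_le_iff]
    split_ifs <;> ring

/-- The ratio of the points at which a given `b ^ {lc}` enters two screening currents is `q ^ (i -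
j)` for every root. -/
theorem sPt_sub_sPt (i j l c : ℕ) (u v : ℂ) :
    sPt N lq j l c v - sPt N lq i l c u = v - u + ((i : ℂ) - j) * lq := by
  rw [sPt, sPt]; ring

/-- The two currents share rows only if `i = j` or `|i - j| = 1`; otherwise nothing contracts. When
they do, the result depends on the columns only through their order, and for equal columns through
the signs of the terms. The pole never depends on the columns, which is why a single prefactor
clears all of them. -/
theorem halfPair_sTerm_sTerm (hG : Generic N lq k) {i j : ℕ} (hi : 1 ≤ i) {α β : ℕ ⊕ ℕ}
    (h1 : i < tIdx α) (h2 : tIdx α ≤ N) (h3 : j < tIdx β) (h4 : tIdx β ≤ N) :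
    HalfPair lq k (sTerm N lq i α) (sTerm N lq j β) (ssConst i j α β) (ssZero i j α β)
      (ssPole i j) := by
  rw [halfPair_iff]
  intro u v
  refine ⟨fun n' => ?_, ?_⟩
  · have ht := qn_ne_zero lq n'
    rcases α with n | n <;> rw [sTerm] <;> rcases β with m | m <;> dsimp only [tIdx] at h1 h2 h3 h4
    all_goals
      have hr : IsRoot N i n := ⟨hi, h1, h2⟩
      simp only [map_add, map_sub, LinearMap.add_apply, LinearMap.sub_apply,
        modePair_sTail_left, modePair_bP_sTerm _ _ _ _ _ _ _ hG hr, modePair_bM_left,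
        modePair_bc_sTerm_inl_of_le _ _ _ _ _ hG h3 (by omega : 1 ≤ i + 1) (by omega : i + 1 ≤ n) h2,
        modePair_bc_sTerm_inr_of_le _ _ _ _ _ hG h3 (by omega : 1 ≤ i + 1) (by omega : i + 1 ≤ n) h2,
        modePair_bc_sTerm_inl _ _ _ _ _ _ _ hG hr, modePair_bc_sTerm_inr _ _ _ _ _ _ _ hG hr,
        zn_sub_sub_lq, zn_sub_add_lq, sPt_sub_sPt, zn_add_mul_lq, sRow, sCol, ssZero, ssPole]
      generalize zn n' _ = X
      have e1 : ((i : ℂ) - (i + 1 : ℕ)) = -1 := by push_cast; ring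
      have e2 : (((j + 1 : ℕ) : ℂ) - j) = 1 := by push_cast; ring
      rcases (by omega : i = j ∨ j = i + 1 ∨ i = j + 1 ∨ (i ≠ j ∧ j ≠ i + 1 ∧ i ≠ j + 1)) with
        rfl | rfl | rfl | h <;>
      rcases lt_trichotomy n m with h' | rfl | h' <;>
      (simp (disch := omega) only [tIdx, and_self, true_or, or_true, if_true, if_pos, if_neg, tp_zero, tp_one, tp_two,
          tp_neg, tp_sub, qb, sub_self, e1, e2, sgn_inl, sgn_inr]
       try field_simp
       try ring)
  · rcases α with n | n <;> dsimp only [tIdx] at h1 h2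
    all_goals
      have hr : IsRoot N i n := ⟨hi, h1, h2⟩
      rw [sTerm]
      simp only [map_add, map_sub, LinearMap.add_apply, LinearMap.sub_apply,
        zeroForm_sTail_sTerm i j _ _ β hi h1 h4, zeroForm_bP_sTerm _ _ _ _ _ _ hr,
        zeroForm_bM_sTerm _ _ _ _ _ _ hr, zeroForm_bc_sTerm, ssConst, tIdx, sgn_inl, sgn_inr]
      split_ifs <;> ring

theorem ope_Stilde_Stilde (hG : Generic N lq k) (i₀ j₀ : Fin (N - 1)) :
    OPE (Stilde N lq k i₀) (Stilde N lq k j₀)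
      (fun u v => Complex.exp u
        - qpow lq (-(CartanMatrix.A (N - 1) i₀ j₀ : ℂ)) * Complex.exp v)
      (fun u v => qpow lq (-(CartanMatrix.A (N - 1) i₀ j₀ : ℂ)) * Complex.exp u
        - Complex.exp v) 0 := by
  rw [← ssPole_eq]
  refine ope_of_denominator (Stilde_eq i₀) (Stilde_eq j₀)
    (fun α _ => Tame.sTerm hG .one .one _ α) (fun β _ => Tame.sTerm hG .one .one _ β)
    (fun α _ => ExpFamily.sTerm .fst _ α) (fun β _ => ExpFamily.sTerm .snd _ β)
    (c := ssConst (i₀ + 1) (j₀ + 1)) (a := ssZero (i₀ + 1) (j₀ + 1))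
    (fun α hα β hβ => ?_) (fun α hα β hβ => ?_) <;>
    obtain ⟨h1, h2⟩ := mem_sIdx.1 hα <;> obtain ⟨h3, h4⟩ := mem_sIdx.1 hβ
  · exact halfPair_sTerm_sTerm hG (by omega) h1 h2 h3 h4
  · rw [← ssConst_swap, ← ssZero_swap, ssPole_comm]
    exact halfPair_sTerm_sTerm hG (by omega) h3 h4 h1 h2

theorem ope_Stilde_Stilde_of_eq_zero (hG : Generic N lq k) (i₀ j₀ : Fin (N - 1))
    (h : CartanMatrix.A (N - 1) i₀ j₀ = 0) :
    OPE (Stilde N lq k i₀) (Stilde N lq k j₀) (fun _ _ => 1) (fun _ _ => 1) 0 := by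
  have hp : ssPole (i₀ + 1) (j₀ + 1) = 0 := by rw [ssPole_eq, h]; simp
  have hne : (i₀ : ℕ) ≠ j₀ ∧ (j₀ : ℕ) ≠ i₀ + 1 ∧ (i₀ : ℕ) ≠ j₀ + 1 := by
    by_contra h0
    simp only [ssPole] at hp
    split_ifs at hp <;> first | omega | simp at hp
  have hz : ∀ α β, ssZero (i₀ + 1) (j₀ + 1) α β = 0 := fun α β => by
    simp (disch := omega) only [ssZero, if_neg]
  have hc : ∀ α β, ssConst (i₀ + 1) (j₀ + 1) α β = 0 := fun α β => by
    simp (disch := omega) only [ssConst, sRow, if_neg, sub_self, mul_zero, ite_self]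
  -- All contractions equal one, with zero and pole both placed at exponent `0`, so every residue
  -- coefficient contains `q ^ 0 - q ^ 0`.
  have hope := ope_of_residues (N := N) (lq := lq) (k := k) (P := Finset.univ)
    (π := fun (_ _ : ℕ ⊕ ℕ) => ()) (b := fun _ => 0) (c := fun _ _ => 0) (a := fun _ _ => 0)
    (fun _ _ _ _ => Finset.mem_univ _) (Stilde_eq i₀) (Stilde_eq j₀)
    (fun α _ => Tame.sTerm hG .one .one _ α) (fun β _ => Tame.sTerm hG .one .one _ β)
    (fun α _ => ExpFamily.sTerm .fst _ α) (fun β _ => ExpFamily.sTerm .snd _ β)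
    (fun α hα β hβ => by
      obtain ⟨h1, h2⟩ := mem_sIdx.1 hα
      obtain ⟨h3, h4⟩ := mem_sIdx.1 hβ
      have e1 := halfPair_sTerm_sTerm (j := j₀ + 1) hG (by omega) h1 h2 h3 h4
      have e2 := halfPair_sTerm_sTerm (j := i₀ + 1) hG (by omega) h3 h4 h1 h2
      rw [ssConst_swap (i₀ + 1), ssZero_swap (i₀ + 1), ssPole_comm, hc, hz, hp] at e2
      rw [hc, hz, hp] at e1
      exact ⟨e1, by simpa using e2⟩)
  convert hope using 1
  funext u v
  simp [residue]

end ScreeningProducts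

end

end UqSlN

namespace UqSlN

noncomputable section

open scoped BigOperators
open Filter Topology

/-! ### Contractions of the Cartan type tails with the screening currents. -/

section CartanFields

variable {N : ℕ} {lq k : ℂ}

/-- The form `A ^ i_{n,+}` at `z = exp u`. -/
def rTail (N : ℕ) (lq k : ℂ) (i₀ : Fin (N - 1)) (n : ℕ) (u : ℂ) : LinForm N :=
  plusF lq (aB i₀) (u + (k + N) / 2 * lq) + ∑ c ∈ Finset.Icc n N,
    (bP N lq (i₀ + 1) c (u + (k + c) * lq) - bP N lq (i₀ + 1 + 1) c (u + (k + c - 1) * lq))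

/-- The form `A ^ i_{i+1,-}` with the rows of index greater than `n` at `z = exp u`. -/
def lTail (N : ℕ) (lq k : ℂ) (i₀ : Fin (N - 1)) (n : ℕ) (u : ℂ) : LinForm N :=
  (∑ l ∈ Finset.Icc (n + 1) (i₀ + 1), (bM N lq l (i₀ + 1 + 1) (u + -(k + l - 1) * lq)
      - bM N lq l (i₀ + 1) (u + -(k + l) * lq)))
    + minusF lq (aB i₀) (u + -((k + N) / 2) * lq)
    + ∑ c ∈ Finset.Icc ((i₀ : ℕ) + 1 + 1) N, (bM N lq (i₀ + 1) c (u + -(k + c) * lq)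
      - bM N lq (i₀ + 1 + 1) c (u + -(k + c - 1) * lq))

variable {i₀ j₀ : Fin (N - 1)}

/-- The Cartan matrix is the Gram matrix of differences of consecutive basis vectors. In this form
the contribution of the boson `a` can be compared row by row with those of the bosons `b`. -/
theorem cartan_eq (i₀ j₀ : Fin (N - 1)) :
    (CartanMatrix.A (N - 1) i₀ j₀ : ℂ) = sRow (j₀ + 1) (i₀ + 1 + 1) - sRow (j₀ + 1) (i₀ + 1) := by
  simp only [sRow, CartanMatrix.A, Matrix.of_apply, Fin.ext_iff]
  split_ifs <;> first | omega | (push_cast; ring)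

theorem cartan_comm (i₀ j₀ : Fin (N - 1)) :
    CartanMatrix.A (N - 1) i₀ j₀ = CartanMatrix.A (N - 1) j₀ i₀ := by
  simp only [CartanMatrix.A, Matrix.of_apply, Fin.ext_iff]
  split_ifs <;> first | rfl | omega

theorem modePair_ap_sTerm (n : ℕ+) (j : ℕ) (β : ℕ ⊕ ℕ) (u v : ℂ) :
    modePair N lq k n (plusF lq (aB i₀) u) (sTerm N lq j β v) = 0 := by
  rcases β with m | m <;>
    simp [sTerm, sTail, modePair_ap_bc, modePair_ap_bM, modePair_bP_right]

theorem zeroForm_am_sTerm (j : ℕ) (β : ℕ ⊕ ℕ) (u v : ℂ) :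
    zeroForm N k (minusF lq (aB i₀) u) (sTerm N lq j β v) = 0 := by
  rcases β with m | m <;>
    simp [sTerm, sTail, zeroForm_am_bc, zeroForm_bM_right, zeroForm_bP_right]

theorem zeroForm_ap_sTerm (j : ℕ) (β : ℕ ⊕ ℕ) (u v : ℂ) :
    zeroForm N k (plusF lq (aB i₀) u) (sTerm N lq j β v) = 0 := by
  rcases β with m | m <;>
    simp [sTerm, sTail, zeroForm_ap_bc, zeroForm_bM_right, zeroForm_bP_right]

theorem modePair_sTerm_am (n : ℕ+) (j : ℕ) (β : ℕ ⊕ ℕ) (u v : ℂ) :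
    modePair N lq k n (sTerm N lq j β v) (minusF lq (aB i₀) u) = 0 := by
  rcases β with m | m <;>
    simp [sTerm, sTail, modePair_bc_am, modePair_bM_left, modePair_bP_am]

variable (n' : ℕ+) (u v a : ℂ) {β : ℕ ⊕ ℕ}

theorem modePair_bP_fTerm (l c : ℕ) :
    modePair N lq k n' (bP N lq l c a) (fTerm N lq k j₀ β v) =
      modePair N lq k n' (bP N lq l c a) (sTerm N lq (j₀ + 1) β v) := by
  rw [fTerm, map_add, modePair_bP_aV, zero_add]

theorem zeroForm_bP_fTerm (l c : ℕ) :
    zeroForm N k (bP N lq l c a) (fTerm N lq k j₀ β v) =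
      zeroForm N k (bP N lq l c a) (sTerm N lq (j₀ + 1) β v) := by
  rw [fTerm, map_add, zeroForm_bP_aV, zero_add]

theorem zeroForm_bM_fTerm (l c : ℕ) :
    zeroForm N k (bM N lq l c a) (fTerm N lq k j₀ β v) =
      zeroForm N k (bM N lq l c a) (sTerm N lq (j₀ + 1) β v) := by
  rw [fTerm, map_add, zeroForm_bM_aV, zero_add]

theorem modePair_fTerm_bM (l c : ℕ) :
    modePair N lq k n' (fTerm N lq k j₀ β v) (bM N lq l c a) =
      modePair N lq k n' (sTerm N lq (j₀ + 1) β v) (bM N lq l c a) := by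
  rw [fTerm, map_add, LinearMap.add_apply, modePair_aV_bM, zero_add]

/-- This puts the contribution of the boson `a` into the shape of the boundary term that the
telescoping sums of the `b ^ {lc}` leave at the last column. -/
theorem neg_qpow_cartan (i₀ j₀ : Fin (N - 1)) :
    -(qpow lq ((CartanMatrix.A (N - 1) i₀ j₀ : ℂ) * n') -
      (qpow lq ((CartanMatrix.A (N - 1) i₀ j₀ : ℂ) * n'))⁻¹) =
    qb lq n' * tp lq n' ((i₀ + 1 : ℕ) - (j₀ + 1 : ℕ)) *
      (sRow (j₀ + 1) (i₀ + 1) * (qn lq n')⁻¹ - sRow (j₀ + 1) (i₀ + 1 + 1) * qn lq n') := by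
  have ht := qn_ne_zero lq n'
  have e : ∀ x : ℂ, qpow lq (x * n') = tp lq n' x := fun x => by rw [qpow, tp]; ring_nf
  rw [e, cartan_eq]
  generalize (i₀ : ℕ) + 1 = i
  generalize (j₀ : ℕ) + 1 = j
  have e1 : ((i : ℂ) - (i + 1 : ℕ)) = -1 := by push_cast; ring
  have e2 : (((j + 1 : ℕ) : ℂ) - j) = 1 := by push_cast; ring
  simp only [sRow]
  rcases (by omega : i = j ∨ j = i + 1 ∨ i = j + 1 ∨ (i ≠ j ∧ j ≠ i + 1 ∧ i ≠ j + 1)) with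
    rfl | rfl | rfl | h <;>
  (simp (disch := omega) only [if_true, if_neg, sub_self, sub_zero, zero_sub,
    sub_neg_eq_add, one_add_one_eq_two, tp_zero, tp_one, tp_two, tp_neg, qb, e1, e2]
   try field_simp
   try ring)

/-- The sum over the columns telescopes. -/
theorem sum_sCol_mul_zn {m : ℕ} {a b : ℕ} (hab : a ≤ b + 1) (hb : m ≤ b) (x : ℂ) :
    ∑ c ∈ Finset.Icc a b, sCol lq n' m c * zn n' (x - 2 * c * lq) =
      zn n' (x - (2 * b + 1) * lq) - if m < a then zn n' (x - (2 * a - 1) * lq) else 0 := by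
  -- A discrete primitive: moving to the next column multiplies the point by `q ^ (-2)`, so `sCol`
  -- times the mode is the increment of `h`.
  set h : ℕ → ℂ := fun c => if m < c then zn n' (x - (2 * c - 1) * lq) else 0 with hh
  have h1 : ∀ c, sCol lq n' m c * zn n' (x - 2 * c * lq) = h (c + 1) - h c := fun c => by
    have e1 : zn n' (x - (2 * (c + 1 : ℕ) - 1) * lq) = zn n' (x - 2 * c * lq) * (qn lq n')⁻¹ := by
      rw [← zn_sub_add_lq]; push_cast; ring_nf
    have e2 : zn n' (x - (2 * c - 1) * lq) = zn n' (x - 2 * c * lq) * qn lq n' := by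
      rw [← zn_sub_sub_lq]; ring_nf
    simp only [hh, e1, e2, sCol, Nat.lt_succ_iff]
    split_ifs <;> ring
  have h2 : ∑ c ∈ Finset.Icc a b, (h (c + 1) - h c) = h (b + 1) - h a := by
    rw [← Finset.Ico_add_one_right_eq_Icc]
    exact Finset.sum_Ico_sub h hab
  rw [Finset.sum_congr rfl fun c _ => h1 c, h2]
  simp only [hh, Nat.lt_succ_of_le hb, if_true]
  push_cast; ring_nf

/-- In both rows the sum over columns telescopes. The boundary terms at column `N` cancel against
`a_+`, so only those at column `n` remain. The case `n = i + 1` is special because the field in row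
`i + 1` would be `b ^ {i+1,i+1} = 0`. -/
theorem modePair_rTail_fTerm (hG : Generic N lq k) {n : ℕ} (hn : (i₀ : ℕ) + 1 + 1 ≤ n) (hN : n ≤ N)
    (h2 : tIdx β ≤ N) :
    modePair N lq k n' (rTail N lq k i₀ n u) (fTerm N lq k j₀ β v) =
      qb lq n' * (sRow (j₀ + 1) (i₀ + 1) * (if tIdx β < n then (qn lq n')⁻¹ else 0) -
        sRow (j₀ + 1) (i₀ + 1 + 1) * (if n = i₀ + 1 + 1 then
          if tIdx β ≤ n then (qn lq n')⁻¹ else 0 else if tIdx β < n then qn lq n' else 0)) *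
      zn n' (v - u + ((N : ℂ) + (i₀ + 1 : ℕ) - (j₀ + 1 : ℕ) - k - 2 * n + 2) * lq) := by
  set x : ℂ := v - u + ((N : ℂ) + (i₀ + 1 : ℕ) - (j₀ + 1 : ℕ) - k) * lq with hx
  have hA : ∀ c ∈ Finset.Icc n N, modePair N lq k n' (bP N lq (i₀ + 1) c (u + (k + c) * lq))
      (fTerm N lq k j₀ β v) = -qb lq n' * sRow (j₀ + 1) (i₀ + 1) *
        (sCol lq n' (tIdx β) c * zn n' (x - 2 * c * lq)) := fun c hc => by
    have hc := Finset.mem_Icc.1 hc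
    rw [modePair_bP_fTerm, modePair_bP_sTerm _ _ _ _ _ _ _ hG ⟨by omega, by omega, by omega⟩,
      mul_assoc (-qb lq n' * _), hx, sPt]
    congr 3; ring
  have hB : ∀ c ∈ Finset.Icc n N,
      modePair N lq k n' (bP N lq (i₀ + 1 + 1) c (u + (k + c - 1) * lq)) (fTerm N lq k j₀ β v) =
      if c = i₀ + 1 + 1 then 0 else -qb lq n' * sRow (j₀ + 1) (i₀ + 1 + 1) *
        (sCol lq n' (tIdx β) c * zn n' ((x + 2 * lq) - 2 * c * lq)) := fun c hc => by
    have hc := Finset.mem_Icc.1 hc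
    split_ifs with h
    · rw [bP_of_not_isRoot _ _ _ (fun h' => by have := h'.2.1; omega), map_zero,
        LinearMap.zero_apply]
    rw [modePair_bP_fTerm, modePair_bP_sTerm _ _ _ _ _ _ _ hG ⟨by omega, by omega, by omega⟩,
      mul_assoc (-qb lq n' * _), hx, sPt]
    congr 3; push_cast; ring
  have hB' : ∑ c ∈ Finset.Icc n N,
      modePair N lq k n' (bP N lq (i₀ + 1 + 1) c (u + (k + c - 1) * lq)) (fTerm N lq k j₀ β v) =
      -qb lq n' * sRow (j₀ + 1) (i₀ + 1 + 1) * (zn n' ((x + 2 * lq) - (2 * N + 1) * lq) -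
        if n = i₀ + 1 + 1 then if tIdx β ≤ n then zn n' (x - (2 * n - 1) * lq) else 0
        else if tIdx β < n then zn n' ((x + 2 * lq) - (2 * n - 1) * lq) else 0) := by
    rw [Finset.sum_congr rfl hB]
    split_ifs with h h' h'
    all_goals
      first
        | rw [← Finset.insert_Icc_add_one_left_eq_Icc hN, Finset.sum_insert (by simp), if_pos h,
            zero_add, Finset.sum_congr rfl fun c hc =>
              if_neg (by have := Finset.mem_Icc.1 hc; omega), ← Finset.mul_sum,
            sum_sCol_mul_zn _ (by omega) h2]
        | rw [Finset.sum_congr rfl fun c hc =>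
              if_neg (by have := Finset.mem_Icc.1 hc; omega), ← Finset.mul_sum,
            sum_sCol_mul_zn _ (by omega) h2]
      simp (disch := omega) only [if_pos, if_neg]
      try (push_cast; ring_nf)
  have h0 : x - (2 * N + 1) * lq = (x - 2 * N * lq) - (0 + lq) := by ring
  have h0' : x + 2 * lq - (2 * N + 1) * lq = (x - 2 * N * lq) - (0 - lq) := by ring
  have h3 : x - (2 * n - 1) * lq =
    v - u + ((N : ℂ) + (i₀ + 1 : ℕ) - (j₀ + 1 : ℕ) - k - 2 * n + 2) * lq - (0 + lq) := by
      rw [hx]; ring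
  have h4 : x + 2 * lq - (2 * n - 1) * lq =
    v - u + ((N : ℂ) + (i₀ + 1 : ℕ) - (j₀ + 1 : ℕ) - k - 2 * n + 2) * lq - (0 - lq) := by
      rw [hx]; ring
  rw [rTail, map_add, LinearMap.add_apply, map_sum, LinearMap.sum_apply]
  simp only [map_sub, LinearMap.sub_apply]
  rw [Finset.sum_sub_distrib, hB', Finset.sum_congr rfl hA, ← Finset.mul_sum,
    sum_sCol_mul_zn _ (by omega) h2, h0, h0', h3, h4, zn_sub_add_lq, zn_sub_sub_lq, zn_sub_add_lq,
    zn_sub_sub_lq, sub_zero, sub_zero]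
  generalize zn n' (v - u + _) = Y
  -- This is minus the sum of the two boundary terms at column `N`.
  have h5 : modePair N lq k n' (plusF lq (aB i₀) (u + (k + N) / 2 * lq)) (fTerm N lq k j₀ β v) =
      qb lq n' * zn n' (x - 2 * N * lq) * (sRow (j₀ + 1) (i₀ + 1) * (qn lq n')⁻¹ -
        sRow (j₀ + 1) (i₀ + 1 + 1) * qn lq n') := by
    have h6 : x - 2 * N * lq = v - u + -(k + N) * lq + ((i₀ + 1 : ℕ) - (j₀ + 1 : ℕ)) * lq := by
      rw [hx]; ring
    rw [fTerm, map_add, modePair_ap_sTerm, add_zero, modePair_ap_aV _ _ _ _ _ _ hG, h6,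
      zn_add_mul_lq, ← neg_mul, neg_qpow_cartan]
    rw [show v - (k + N) / 2 * lq - (u + (k + N) / 2 * lq) = v - u + -(k + N) * lq by ring]
    ring
  rw [h5]
  split_ifs <;> ring

theorem zeroForm_rTail_fTerm (hG : Generic N lq k) {n : ℕ} (hn : (i₀ : ℕ) + 1 + 1 ≤ n) (hN : n ≤ N)
    (h2 : tIdx β ≤ N) :
    zeroForm N k (rTail N lq k i₀ n u) (fTerm N lq k j₀ β v) =
      lq * (sRow (j₀ + 1) (i₀ + 1) * (if tIdx β < n then 1 else 0) -
        sRow (j₀ + 1) (i₀ + 1 + 1) *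
          (if tIdx β < n ∨ n = i₀ + 1 + 1 ∧ tIdx β = n then 1 else 0)) := by
  rw [rTail, map_add, LinearMap.add_apply, map_sum, LinearMap.sum_apply]
  have e : ∀ c ∈ Finset.Icc n N, zeroForm N k (bP N lq (i₀ + 1) c (u + (k + c) * lq)
      - bP N lq (i₀ + 1 + 1) c (u + (k + c - 1) * lq)) (fTerm N lq k j₀ β v) =
      if c = tIdx β then -lq * (sRow (j₀ + 1) (i₀ + 1) - if c = i₀ + 1 + 1 then 0 else
        sRow (j₀ + 1) (i₀ + 1 + 1)) else 0 := fun c hc => by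
    have hc := Finset.mem_Icc.1 hc
    rw [map_sub, LinearMap.sub_apply, zeroForm_bP_fTerm, zeroForm_bP_fTerm,
      zeroForm_bP_sTerm _ _ _ _ _ _ ⟨by omega, by omega, by omega⟩]
    by_cases h : c = i₀ + 1 + 1
    · rw [bP_of_not_isRoot _ _ _ (fun h' => by have := h'.2.1; omega), map_zero,
        LinearMap.zero_apply, if_pos h]
      split_ifs <;> ring
    · rw [zeroForm_bP_sTerm _ _ _ _ _ _ ⟨by omega, by omega, by omega⟩, if_neg h]
      split_ifs <;> ring
  rw [Finset.sum_congr rfl e, Finset.sum_ite_eq', fTerm, map_add, zeroForm_ap_aV _ _ _ _ _ hG,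
    zeroForm_ap_sTerm, cartan_eq]
  simp only [Finset.mem_Icc, h2, and_true]
  by_cases h3 : tIdx β < n
  · simp (disch := omega) only [if_pos, if_neg]; ring
  · by_cases h4 : n = i₀ + 1 + 1 ∧ tIdx β = n
    · obtain ⟨rfl, h4⟩ := h4
      rw [if_pos (Or.inr ⟨rfl, h4⟩)]
      simp (disch := omega) only [if_pos, if_neg]; ring
    · by_cases h5 : tIdx β = i₀ + 1 + 1
      · omega
      · simp (disch := omega) only [if_pos, if_neg]; ring

theorem sum_rows_ite {p : Prop} [Decidable p] (s : Finset ℕ) (j : ℕ) (F G : ℕ → ℂ) :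
    ∑ l ∈ s, ((if l = j + 1 ∧ p then F l else 0) - if l = j ∧ p then G l else 0) =
      if p then (if j + 1 ∈ s then F (j + 1) else 0) - if j ∈ s then G j else 0 else 0 := by
  by_cases hp : p
  · simp [hp, Finset.sum_sub_distrib]
  · simp [hp]

/-- With all rows present the contributions of `a_-`, of the rows and of the columns cancel.
Something survives only if the cut at `n` separates row `j` from row `j + 1`, or in the corner `n =
i = m = j + 1`, with `m` the index of the term, where the compensating field would be `b ^ {ii} =
0`. -/
theorem zeroForm_lTail_fTerm (hG : Generic N lq k) {n : ℕ} (hn : n ≤ i₀ + 1)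
    (h1 : (j₀ : ℕ) + 1 < tIdx β) (h2 : tIdx β ≤ N) :
    zeroForm N k (lTail N lq k i₀ n u) (fTerm N lq k j₀ β v) =
      lq * if n = j₀ + 1 then (if tIdx β = i₀ + 1 + 1 then 1 else 0) -
          (if tIdx β = i₀ + 1 then 1 else 0)
        else if n = i₀ + 1 ∧ j₀ + 1 = (i₀ : ℕ) ∧ tIdx β = i₀ + 1 then -1 else 0 := by
  have hi : (i₀ : ℕ) + 1 + 1 ≤ N := by omega
  have eR : ∀ c ∈ Finset.Icc ((i₀ : ℕ) + 1 + 1) N, zeroForm N k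
      (bM N lq (i₀ + 1) c (u + -(k + c) * lq) - bM N lq (i₀ + 1 + 1) c (u + -(k + c - 1) * lq))
      (fTerm N lq k j₀ β v) =
      if c = tIdx β then lq * (sRow (j₀ + 1) (i₀ + 1) - if c = i₀ + 1 + 1 then 0 else
        sRow (j₀ + 1) (i₀ + 1 + 1)) else 0 := fun c hc => by
    have hc := Finset.mem_Icc.1 hc
    rw [map_sub, LinearMap.sub_apply, zeroForm_bM_fTerm, zeroForm_bM_fTerm,
      zeroForm_bM_sTerm _ _ _ _ _ _ ⟨by omega, by omega, by omega⟩]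
    by_cases h : c = i₀ + 1 + 1
    · rw [bM_of_not_isRoot _ _ _ (fun h' => by have := h'.2.1; omega), map_zero,
        LinearMap.zero_apply, if_pos h]
      split_ifs <;> ring
    · rw [zeroForm_bM_sTerm _ _ _ _ _ _ ⟨by omega, by omega, by omega⟩, if_neg h]
      split_ifs <;> ring
  have eA : ∀ l ∈ Finset.Icc (n + 1) ((i₀ : ℕ) + 1), zeroForm N k
      (bM N lq l (i₀ + 1 + 1) (u + -(k + l - 1) * lq) - bM N lq l (i₀ + 1) (u + -(k + l) * lq))
      (fTerm N lq k j₀ β v) =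
      ((if l = j₀ + 1 + 1 ∧ i₀ + 1 + 1 = tIdx β then lq else 0) -
        (if l = j₀ + 1 ∧ i₀ + 1 + 1 = tIdx β then lq else 0)) -
      ((if l = j₀ + 1 + 1 ∧ i₀ + 1 = tIdx β then if l = i₀ + 1 then 0 else lq else 0) -
        (if l = j₀ + 1 ∧ i₀ + 1 = tIdx β then if l = i₀ + 1 then 0 else lq else 0)) :=
      fun l hl => by
    have hl := Finset.mem_Icc.1 hl
    rw [map_sub, LinearMap.sub_apply, zeroForm_bM_fTerm, zeroForm_bM_fTerm,
      zeroForm_bM_sTerm _ _ _ _ _ _ ⟨by omega, by omega, by omega⟩, sRow]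
    by_cases h : l = i₀ + 1
    · rw [bM_of_not_isRoot _ _ _ (fun h' => by have := h'.2.1; omega), map_zero,
        LinearMap.zero_apply]
      simp only [if_pos h]
      split_ifs <;> first | omega | ring
    · rw [zeroForm_bM_sTerm _ _ _ _ _ _ ⟨by omega, by omega, by omega⟩, sRow]
      simp only [if_neg h]
      split_ifs <;> first | omega | ring
  rw [lTail, map_add, map_add, LinearMap.add_apply, LinearMap.add_apply, map_sum, map_sum,
    LinearMap.sum_apply, LinearMap.sum_apply, Finset.sum_congr rfl eA, Finset.sum_congr rfl eR,
    Finset.sum_ite_eq', Finset.sum_sub_distrib, sum_rows_ite, sum_rows_ite, fTerm, map_add,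
    zeroForm_am_aV _ _ _ _ _ hG, zeroForm_am_sTerm, cartan_eq]
  simp only [Finset.mem_Icc, h2, and_true, sRow]
  generalize tIdx β = m at *
  generalize (j₀ : ℕ) = j at *
  generalize (i₀ : ℕ) = i at *
  rcases (by omega : m < i + 1 ∨ m = i + 1 ∨ m = i + 1 + 1 ∨ i + 1 + 1 < m) with
    hm | hm | hm | hm <;>
  rcases (by omega : n < j + 1 ∨ n = j + 1 ∨ n = j + 2 ∨ j + 2 < n) with
    hx | hx | hx | hx <;>
  rcases (by omega : j + 1 < i ∨ i = j + 1 ∨ i = j ∨ j = i + 1 ∨ i + 1 < j) with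
    hy | hy | hy | hy | hy <;>
  first
    | omega
    | (simp (disch := omega) only [if_pos, if_neg]; ring)

/-- The mode version of the same cancellation. The extra powers `q ^ (±2)` in the points depend on
the row and bring every contribution to the common point `Y`. -/
theorem modePair_fTerm_lTail (hG : Generic N lq k) {n : ℕ} (hn : n ≤ i₀ + 1)
    (h1 : (j₀ : ℕ) + 1 < tIdx β) (h2 : tIdx β ≤ N) :
    modePair N lq k n' (fTerm N lq k j₀ β v) (lTail N lq k i₀ n u) =
      (if n = j₀ + 1 then -qb lq n' * ((if tIdx β = i₀ + 1 + 1 then qn lq n' else 0) -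
          (if tIdx β = i₀ + 1 then (qn lq n')⁻¹ else 0))
        else if n = i₀ + 1 ∧ j₀ + 1 = (i₀ : ℕ) ∧ tIdx β = i₀ + 1 then qb lq n' * (qn lq n')⁻¹
        else 0) *
      zn n' (u - v + -((N : ℂ) - (i₀ + 1 : ℕ) + (j₀ + 1 : ℕ) + k) * lq) := by
  have hi : (i₀ : ℕ) + 1 + 1 ≤ N := by omega
  have ht := qn_ne_zero lq n'
  set x : ℂ := u - v + -((N : ℂ) - (i₀ + 1 : ℕ) + (j₀ + 1 : ℕ) + k) * lq with hx
  set Y := zn n' x with hY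
  have z0 : ∀ l : ℕ, zn n' (u + -(k + l - 1) * lq - sPt N lq (j₀ + 1) l (i₀ + 1 + 1) v) =
      Y * tp lq n' (2 * (j₀ + 1 : ℕ) - 2 * l + 2) := fun l => by
    rw [hY, ← zn_add_mul_lq, hx, sPt]; push_cast; ring_nf
  have z1 : ∀ l : ℕ, zn n' (u + -(k + l) * lq - sPt N lq (j₀ + 1) l (i₀ + 1) v) =
      Y * tp lq n' (2 * (j₀ + 1 : ℕ) - 2 * l) := fun l => by
    rw [hY, ← zn_add_mul_lq, hx, sPt]; ring_nf
  have z2 : ∀ c : ℕ, zn n' (u + -(k + c) * lq - sPt N lq (j₀ + 1) (i₀ + 1) c v) =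
      Y * tp lq n' (2 * (j₀ + 1 : ℕ) - 2 * (i₀ + 1 : ℕ)) := fun c => by
    rw [hY, ← zn_add_mul_lq, hx, sPt]; ring_nf
  have z3 : ∀ c : ℕ, zn n' (u + -(k + c - 1) * lq - sPt N lq (j₀ + 1) (i₀ + 1 + 1) c v) =
      Y * tp lq n' (2 * (j₀ + 1 : ℕ) - 2 * (i₀ + 1 : ℕ)) := fun c => by
    rw [hY, ← zn_add_mul_lq, hx, sPt]; push_cast; ring_nf
  have t1 : ∀ j : ℕ, (2 * (j : ℂ) - 2 * (j + 1 : ℕ)) = -2 := fun j => by push_cast; ring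
  have t2 : ∀ j : ℕ, (2 * ((j + 1 : ℕ) : ℂ) - 2 * j) = 2 := fun j => by push_cast; ring
  have eR : ∀ c ∈ Finset.Icc ((i₀ : ℕ) + 1 + 1) N, modePair N lq k n' (fTerm N lq k j₀ β v)
      (bM N lq (i₀ + 1) c (u + -(k + c) * lq) - bM N lq (i₀ + 1 + 1) c (u + -(k + c - 1) * lq)) =
      if c = tIdx β then -qb lq n' * Y * (
          ((if (i₀ : ℕ) = j₀ + 1 then (qn lq n')⁻¹ else 0) - if i₀ = (j₀ : ℕ) then (qn lq n')⁻¹ else 0)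
          - if c = i₀ + 1 + 1 then 0 else (if i₀ = (j₀ : ℕ) then qn lq n' else 0) -
            if i₀ + 1 = (j₀ : ℕ) then qn lq n' else 0) else 0 := fun c hc => by
    have hc := Finset.mem_Icc.1 hc
    rw [map_sub, modePair_fTerm_bM, modePair_fTerm_bM,
      modePair_sTerm_bM _ _ _ _ _ _ _ hG ⟨by omega, by omega, by omega⟩, z2]
    have hB : modePair N lq k n' (sTerm N lq (j₀ + 1) β v)
        (bM N lq (i₀ + 1 + 1) c (u + -(k + c - 1) * lq)) = if c = tIdx β then -qb lq n' * Y *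
          if c = i₀ + 1 + 1 then 0 else (if i₀ = (j₀ : ℕ) then qn lq n' else 0) -
            if i₀ + 1 = (j₀ : ℕ) then qn lq n' else 0 else 0 := by
      by_cases h : c = i₀ + 1 + 1
      · rw [bM_of_not_isRoot _ _ _ (fun h' => by have := h'.2.1; omega), map_zero, if_pos h,
          mul_zero, ite_self]
      · rw [modePair_sTerm_bM _ _ _ _ _ _ _ hG ⟨by omega, by omega, by omega⟩, z3, if_neg h]
        generalize (i₀ : ℕ) = i at *
        generalize (j₀ : ℕ) = j at *
        by_cases hm : c = tIdx β
        · rcases (by omega : i = j ∨ j = i + 1 ∨ (i ≠ j ∧ j ≠ i + 1)) with rfl | rfl | hij <;>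
          (simp (disch := omega) only [hm, and_true, if_true, if_pos, if_neg, t2, tp_two,
            sub_self, tp_zero]
           try field_simp
           try ring)
        · simp (disch := omega) only [hm, and_false, if_false]; ring
    rw [hB]
    generalize (i₀ : ℕ) = i at *
    generalize (j₀ : ℕ) = j at *
    by_cases hm : c = tIdx β
    · simp only [hm, and_true, if_true]
      generalize (if tIdx β = i + 1 + 1 then _ else _ : ℂ) = R
      rcases (by omega : i = j ∨ i = j + 1 ∨ (i ≠ j ∧ i ≠ j + 1)) with rfl | rfl | hij <;>
      (simp (disch := omega) only [if_true, if_neg, t1, tp_neg, tp_two,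
        sub_self, tp_zero]
       try field_simp
       try ring)
    · simp (disch := omega) only [hm, and_false, if_false]; ring
  have eA : ∀ l ∈ Finset.Icc (n + 1) ((i₀ : ℕ) + 1), modePair N lq k n' (fTerm N lq k j₀ β v)
      (bM N lq l (i₀ + 1 + 1) (u + -(k + l - 1) * lq) - bM N lq l (i₀ + 1) (u + -(k + l) * lq)) =
      -qb lq n' * Y * (
      ((if l = j₀ + 1 + 1 ∧ i₀ + 1 + 1 = tIdx β then qn lq n' else 0) -
        (if l = j₀ + 1 ∧ i₀ + 1 + 1 = tIdx β then qn lq n' else 0)) -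
      ((if l = j₀ + 1 + 1 ∧ i₀ + 1 = tIdx β then if l = i₀ + 1 then 0 else (qn lq n')⁻¹ else 0) -
        (if l = j₀ + 1 ∧ i₀ + 1 = tIdx β then if l = i₀ + 1 then 0 else (qn lq n')⁻¹ else 0))) :=
      fun l hl => by
    have hl := Finset.mem_Icc.1 hl
    rw [map_sub, modePair_fTerm_bM, modePair_fTerm_bM,
      modePair_sTerm_bM _ _ _ _ _ _ _ hG ⟨by omega, by omega, by omega⟩, z0]
    have hB : modePair N lq k n' (sTerm N lq (j₀ + 1) β v)
        (bM N lq l (i₀ + 1) (u + -(k + l) * lq)) = -qb lq n' * Y *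
      ((if l = j₀ + 1 + 1 ∧ i₀ + 1 = tIdx β then if l = i₀ + 1 then 0 else (qn lq n')⁻¹ else 0) -
        (if l = j₀ + 1 ∧ i₀ + 1 = tIdx β then if l = i₀ + 1 then 0 else (qn lq n')⁻¹ else 0)) := by
      by_cases h : l = i₀ + 1
      · rw [bM_of_not_isRoot _ _ _ (fun h' => by have := h'.2.1; omega), map_zero]
        simp only [if_pos h, ite_self, sub_self, mul_zero]
      · rw [modePair_sTerm_bM _ _ _ _ _ _ _ hG ⟨by omega, by omega, by omega⟩, z1]
        simp only [if_neg h]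
        rcases (by omega : l = j₀ + 1 ∨ l = j₀ + 1 + 1 ∨ (l ≠ j₀ + 1 ∧ l ≠ j₀ + 1 + 1)) with
          rfl | rfl | hij <;> by_cases hm : i₀ + 1 = tIdx β <;>
        (simp (disch := omega) only [hm, and_true, and_false, if_true, if_false, if_neg, t1, tp_neg,
          tp_two, sub_self, tp_zero]
         try field_simp
         try ring)
    rw [hB, mul_sub (-qb lq n' * Y)]
    rcases (by omega : l = j₀ + 1 ∨ l = j₀ + 1 + 1 ∨ (l ≠ j₀ + 1 ∧ l ≠ j₀ + 1 + 1)) with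
          rfl | rfl | hij <;> by_cases hm : i₀ + 1 + 1 = tIdx β <;>
    (simp (disch := omega) only [hm, and_true, and_false, if_true, if_false, if_pos, if_neg, t1, tp_two,
          sub_self, zero_add, neg_add_cancel, tp_zero]
     try field_simp
     try ring)
  have e5 : modePair N lq k n' (fTerm N lq k j₀ β v)
      (minusF lq (aB i₀) (u + -((k + N) / 2) * lq)) = qb lq n' * Y *
      (sRow (j₀ + 1) (i₀ + 1) * (qn lq n')⁻¹ - sRow (j₀ + 1) (i₀ + 1 + 1) * qn lq n') := by
    have e6 : u + -((k + N) / 2) * lq - (k + N) / 2 * lq - v =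
        x + -(((i₀ + 1 : ℕ) : ℂ) - (j₀ + 1 : ℕ)) * lq := by
      rw [hx]; ring
    have e7 := Complex.exp_ne_zero (n' * ((((i₀ + 1 : ℕ) : ℂ) - (j₀ + 1 : ℕ)) * lq))
    rw [fTerm, map_add, LinearMap.add_apply, modePair_sTerm_am, add_zero,
      modePair_aV_am _ _ _ _ _ _ hG, e6, zn_add_mul_lq, ← cartan_comm, ← neg_mul,
      neg_qpow_cartan, tp_neg, tp, ← hY]
    field_simp
  rw [lTail, map_add, map_add, map_sum, map_sum, Finset.sum_congr rfl eA, Finset.sum_congr rfl eR,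
    Finset.sum_ite_eq', ← Finset.mul_sum, Finset.sum_sub_distrib, sum_rows_ite, sum_rows_ite, e5]
  simp only [Finset.mem_Icc, h2, and_true, sRow]
  generalize tIdx β = m at *
  generalize (j₀ : ℕ) = j at *
  generalize (i₀ : ℕ) = i at *
  clear eA eR e5 z0 z1 z2 z3 t1 t2
  rcases (by omega : m < i + 1 ∨ m = i + 1 ∨ m = i + 1 + 1 ∨ i + 1 + 1 < m) with
    hm | hm | hm | hm <;>
  rcases (by omega : n < j + 1 ∨ n = j + 1 ∨ n = j + 2 ∨ j + 2 < n) with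
    hx | hx | hx | hx <;>
  rcases (by omega : j + 1 < i ∨ i = j + 1 ∨ i = j ∨ j = i + 1 ∨ i + 1 < j) with
    hy | hy | hy | hy | hy <;>
  first
    | omega
    | (simp (disch := omega) only [if_pos, if_neg]; ring)

theorem modePair_lTail_left (n : ℕ) (Ψ : LinForm N) :
    modePair N lq k n' (lTail N lq k i₀ n u) Ψ = 0 := by
  simp [lTail, modePair_bM_left, modePair_am_left]

theorem zeroForm_lTail_right (n : ℕ) (Ψ : LinForm N) :
    zeroForm N k Ψ (lTail N lq k i₀ n u) = 0 := by
  simp [lTail, zeroForm_bM_right, zeroForm_am_right]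

theorem modePair_rTail_right (n : ℕ) (Ψ : LinForm N) :
    modePair N lq k n' Ψ (rTail N lq k i₀ n u) = 0 := by
  simp [rTail, modePair_bP_right, modePair_ap_right]

theorem zeroForm_rTail_right (n : ℕ) (Ψ : LinForm N) :
    zeroForm N k Ψ (rTail N lq k i₀ n u) = 0 := by
  simp [rTail, zeroForm_bP_right, zeroForm_ap_right]

end CartanFields

end

end UqSlN

namespace UqSlN

noncomputable section

open scoped BigOperators
open Filter Topology

/-! ### Commutators of the modes of `H` with the screening currents. -/

section CartanCurrent

variable {N : ℕ} {lq k : ℂ}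

/-- The modes of `H` and the linear forms behind them are the same combination of elementary pieces.
A relation between an operator and a functional of its form that cuts out a subspace therefore
passes from the pieces to the whole. -/
theorem hComb_mem (S : Submodule ℂ (FockOp N × ℂ)) (f : Boson N → ℂ → FockOp N)
    (F : Boson N → ℂ → LinForm N) (L : LinForm N →ₗ[ℂ] ℂ) (h : ∀ x s, (f x s, L (F x s)) ∈ S)
    (i : ℕ) (x : Boson N) :
    (hComb N k i (fun i j s => atRoot N (fun r => f (bB r) s) i j) (f x),
      L (hComb N k i (fun i j s => atRoot N (fun r => F (bB r) s) i j) (F x))) ∈ S := by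
  have hb : ∀ i j s, (atRoot N (fun r => f (bB r) s) i j,
      L (atRoot N (fun r => F (bB r) s) i j)) ∈ S := fun i j s => by
    unfold atRoot
    split_ifs
    · exact h _ _
    · rw [map_zero]; exact S.zero_mem
  have := S.add_mem (S.add_mem (S.sum_mem fun j (_ : j ∈ Finset.Icc 1 i) =>
      S.sub_mem (hb j (i + 1) (k / 2 + j - 1)) (hb j i (k / 2 + j))) (h x (N / 2)))
    (S.sum_mem fun j (_ : j ∈ Finset.Icc (i + 1) N) =>
      S.sub_mem (hb i j (k / 2 + j)) (hb (i + 1) j (k / 2 + j - 1)))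
  convert this using 1
  refine Prod.ext ?_ ?_
  · simp only [hComb, Prod.fst_add, Prod.fst_sum, Prod.fst_sub]
  · simp only [hComb, Prod.snd_add, Prod.snd_sum, Prod.snd_sub, map_add, map_sum, map_sub]

variable {i₀ j₀ : Fin (N - 1)}

/-- The negative part of `H ^ i`. -/
theorem hComb_minusF (i₀ : Fin (N - 1)) :
    hComb N k (i₀ + 1) (fun i j s => atRoot N (fun r => minusF lq (bB r) (-s * lq)) i j)
      (fun s => minusF lq (aB i₀) (-s * lq)) = lTail N lq k i₀ 0 (k / 2 * lq) := by
  rw [hComb, lTail]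
  refine congrArg₂ _ (congrArg₂ _ (Finset.sum_congr rfl fun l _ => ?_) ?_)
    (Finset.sum_congr rfl fun l _ => ?_)
  · refine congrArg₂ _ ?_ ?_
    · rw [bM]; ring_nf
    · rw [bM]; ring_nf
  · ring_nf
  · refine congrArg₂ _ ?_ ?_
    · rw [bM]; ring_nf
    · rw [bM]; ring_nf

/-- The positive part of `H ^ i`. -/
theorem hComb_plusF (i₀ : Fin (N - 1)) :
    hComb N k (i₀ + 1) (fun i j s => atRoot N (fun r => plusF lq (bB r) (s * lq)) i j)
      (fun s => plusF lq (aB i₀) (s * lq)) =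
    eTail N lq (i₀ + 1) (i₀ + 1) (k / 2 * lq) + bP N lq (i₀ + 1) (i₀ + 1 + 1)
      (ePt lq (i₀ + 1) (i₀ + 1) (i₀ + 1 + 1) (k / 2 * lq)) +
      rTail N lq k i₀ (i₀ + 1 + 1) (-(k / 2) * lq) := by
  have h0 : eTail N lq (i₀ + 1) (i₀ + 1) (k / 2 * lq) + bP N lq (i₀ + 1) (i₀ + 1 + 1)
      (ePt lq (i₀ + 1) (i₀ + 1) (i₀ + 1 + 1) (k / 2 * lq)) =
      eTail N lq (i₀ + 1) (i₀ + 1 + 1) (k / 2 * lq) := by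
    rw [eTail_succ (n := i₀ + 1) _ (by omega), bP_of_not_isRoot _ _ _ (fun h => lt_irrefl _ h.2.1), sub_zero]
  rw [h0, hComb, rTail, eTail, ← add_assoc, Finset.Ico_add_one_right_eq_Icc]
  refine congrArg₂ _ (congrArg₂ _ (Finset.sum_congr rfl fun l _ => ?_) ?_)
    (Finset.sum_congr rfl fun l _ => ?_)
  · rw [ePt_self, ePt_succ]
    refine congrArg₂ _ ?_ ?_
    · rw [bP]; ring_nf
    · rw [bP]; ring_nf
  · ring_nf
  · refine congrArg₂ _ ?_ ?_
    · rw [bP]; ring_nf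
    · rw [bP]; ring_nf

/-- The commutator is written as a linear functional of the form of `x_+(q ^ s z)` at `z = 1`, as
`hComb_mem` requires. The factor `n⁻¹` undoes the normalisation of `modePair`. -/
theorem hasComm_plusMode_succ (Φ : LinForm N) (x : Boson N) (s : ℂ) (m : ℕ) :
    HasComm lq k Φ (plusMode N lq k x s (Int.ofNat (m + 1))) (((m.succPNat : ℂ)⁻¹ •
      (modePair N lq k m.succPNat).flip Φ) (plusF lq x (s * lq))) := by
  have hm : (m.succPNat : ℂ) ≠ 0 := Nat.cast_ne_zero.2 m.succPNat.ne_zero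
  have e : ((m.succPNat : ℂ)⁻¹ • (modePair N lq k m.succPNat).flip Φ) (plusF lq x (s * lq)) =
      qd lq * qpow lq (-s * (m + 1)) * ∑ y, kappa N lq k x y m.succPNat *
        crePart Φ (y, m.succPNat) := by
    rw [LinearMap.smul_apply, LinearMap.flip_apply, modePair_apply, smul_eq_mul,
      inv_mul_cancel_left₀ hm, Finset.mul_sum]
    refine Finset.sum_congr rfl fun y _ => ?_
    rw [annShift, Finset.sum_eq_single x]
    · simp only [plusF, if_true, qpow, Nat.succPNat_coe, Nat.cast_succ]
      ring_nf
    · intro y' _ hy; simp [plusF, hy]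
    · simp
  rw [e]
  exact (hasComm_annOp Φ x m.succPNat).smul _

theorem hasComm_minusMode_negSucc (Φ : LinForm N) (x : Boson N) (s : ℂ) (m : ℕ) :
    HasComm lq k Φ (minusMode N lq x (-s) (Int.negSucc m)) (((-(m.succPNat : ℂ)⁻¹) •
      modePair N lq k m.succPNat Φ) (minusF lq x (-s * lq))) := by
  have hm : (m.succPNat : ℂ) ≠ 0 := Nat.cast_ne_zero.2 m.succPNat.ne_zero
  have e : ((-(m.succPNat : ℂ)⁻¹) • modePair N lq k m.succPNat Φ) (minusF lq x (-s * lq)) =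
      -(qd lq * qpow lq (-s * (m + 1))) * -annShift N lq k Φ (x, m.succPNat) := by
    rw [LinearMap.smul_apply, modePair_apply, smul_eq_mul, neg_mul,
      inv_mul_cancel_left₀ hm, Finset.sum_eq_single x]
    · simp only [crePart, minusF, if_true, qpow, Nat.succPNat_coe, Nat.cast_succ]
      ring_nf
    · intro y' _ hy; simp [crePart, minusF, hy]
    · simp
  rw [e]
  have h := (hasComm_creOp (lq := lq) (k := k) Φ x m.succPNat).smul
    (-(qd lq * qpow lq (-s * (m + 1))))
  rwa [neg_smul] at h

theorem hasComm_plusMode_zero (Φ : LinForm N) (x : Boson N) (s : ℂ) :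
    HasComm lq k Φ (plusMode N lq k x s 0) (lq * posShift k Φ x) :=
  (hasComm_momOp Φ x).smul lq

theorem hasComm_minusMode_zero (Φ : LinForm N) (x : Boson N) (s : ℂ) :
    HasComm lq k Φ (minusMode N lq x s 0) (-lq * posShift k Φ x) := by
  have h := (hasComm_momOp (lq := lq) (k := k) Φ x).smul (-lq)
  rwa [neg_smul] at h

theorem zeroForm_minusF (Φ : LinForm N) (x : Boson N) (a : ℂ) :
    zeroForm N k (minusF lq x a) Φ = -lq * posShift k Φ x := by
  rw [zeroForm_apply, zeroPair, Finset.sum_eq_single x]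
  · simp [minusF]
  · intro y' _ hy; simp [minusF, hy]
  · simp

/-- Positive modes see only the `x_+`, negative ones only the `x_-`, and the zero mode both. In each
case the multiple is a pairing with the whole combination `H`. On the negative side it vanishes
because `lTail` with `n = 0` omits no row; on the positive side the two tails and the field between
them cancel. -/
theorem hasComm_Hmode (hG : Generic N lq k) (n : ℤ) {β : ℕ ⊕ ℕ} (hβ : β ∈ sIdx N (j₀ + 1))
    (v : ℂ) : HasComm lq k (fTerm N lq k j₀ β v) (Hmode N lq k i₀ n) 0 := by
  obtain ⟨h1, h2⟩ := mem_sIdx.1 hβ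
  set Φ := fTerm N lq k j₀ β v with hΦ
  have hi : (i₀ : ℕ) + 1 + 1 ≤ N := by omega
  suffices h : ∀ (L L' : LinForm N →ₗ[ℂ] ℂ) (F : Boson N → ℂ → LinForm N),
      (∀ x s, HasComm lq k Φ (plusMode N lq k x s n) (L (F x s))) →
      (∀ x s, HasComm lq k Φ (minusMode N lq x (-s) n) (L' (minusF lq x (-s * lq)))) →
      L (hComb N k (i₀ + 1) (fun i j s => atRoot N (fun r => F (bB r) s) i j) (F (aB i₀))) = 0 →
      L' (lTail N lq k i₀ 0 (k / 2 * lq)) = 0 →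
      HasComm lq k Φ (Hmode N lq k i₀ n) 0 by
    have hl : ∀ n', modePair N lq k n' Φ (lTail N lq k i₀ 0 (k / 2 * lq)) = 0 := fun n' => by
      rw [hΦ, modePair_fTerm_lTail _ _ _ hG (by omega) h1 h2, if_neg (by omega),
        if_neg (by omega), zero_mul]
    have hz : zeroForm N k (lTail N lq k i₀ 0 (k / 2 * lq)) Φ = 0 := by
      rw [hΦ, zeroForm_lTail_fTerm _ _ hG (by omega) h1 h2, if_neg (by omega),
        if_neg (by omega), mul_zero]
    rcases n with (_ | m) | m
    -- `x_+` and `x_-` have opposite zero modes, so the positive half is treated as minus the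
    -- negative one and no second computation is needed.
    · refine h (-(zeroForm N k).flip Φ) ((zeroForm N k).flip Φ) (fun x s => minusF lq x (-s * lq))
        (fun x s => ?_) (fun x s => ?_) ?_ hz
      · rw [LinearMap.neg_apply, LinearMap.flip_apply, zeroForm_minusF, neg_mul, neg_neg]
        exact hasComm_plusMode_zero Φ x s
      · rw [LinearMap.flip_apply, zeroForm_minusF]
        exact hasComm_minusMode_zero Φ x (-s)
      · rw [hComb_minusF, LinearMap.neg_apply, LinearMap.flip_apply, hz, neg_zero]
    · refine h _ 0 _ (fun x s => hasComm_plusMode_succ Φ x s m)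
        (fun _ _ => HasComm.zero) ?_ rfl
      rw [hComb_plusF, LinearMap.smul_apply, LinearMap.flip_apply, map_add, map_add,
        LinearMap.add_apply, LinearMap.add_apply, hΦ,
        modePair_rTail_fTerm _ _ _ hG le_rfl hi h2, if_pos rfl, modePair_bP_fTerm,
        modePair_bP_sTerm _ _ _ _ _ _ _ hG ⟨by omega, by omega, hi⟩, fTerm, map_add]
      have h3 : modePair N lq k m.succPNat (eTail N lq (i₀ + 1) (i₀ + 1) (k / 2 * lq))
          (aV N lq k j₀ ((k + N) / 2) v) = 0 := by
        simp [eTail, modePair_bP_aV]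
      rw [h3, modePair_eTail_sTerm _ _ _ hG (by omega) le_rfl hi, sPt_sub_ePt]
      -- The pieces of `hComb_plusF` are taken at `q ^ (±k/2)`, with opposite signs because `k`
      -- enters `rTail` and `eTail` differently; as a result their contractions sit at the same
      -- point.
      have h4 : v - -(k / 2) * lq + ((N : ℂ) + (i₀ + 1 : ℕ) - (j₀ + 1 : ℕ) - k -
          2 * (i₀ + 1 + 1 : ℕ) + 2) * lq =
          v - k / 2 * lq + ((N : ℂ) - (i₀ + 1 : ℕ) - (j₀ + 1 : ℕ)) * lq := by
        push_cast; ring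
      rw [h4]
      generalize zn _ _ = X
      rw [smul_eq_mul]
      refine mul_eq_zero_of_right _ ?_
      simp only [sCol, sRow]
      generalize tIdx β = m at *
      generalize (j₀ : ℕ) = j at *
      generalize (i₀ : ℕ) = i at *
      rcases (by omega : m < i + 1 ∨ m = i + 1 ∨ m = i + 1 + 1 ∨ i + 1 + 1 < m) with
        hm | hm | hm | hm <;>
      rcases (by omega : j + 1 < i ∨ i = j + 1 ∨ i = j ∨ j = i + 1 ∨ i + 1 < j) with
        hy | hy | hy | hy | hy <;>
      first
        | omega
        | (simp (disch := omega) only [if_pos, if_neg]; ring)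
    · refine h 0 _ (fun _ _ => 0) (fun _ _ => HasComm.zero)
        (fun x s => hasComm_minusMode_negSucc Φ x s m) rfl ?_
      rw [LinearMap.smul_apply, hl, smul_zero]
  intro L L' F hp hm h3 h4
  have e1 := hComb_mem (k := k) (commSpace lq k Φ) _ F L hp (i₀ + 1) (aB i₀)
  have e2 := hComb_mem (k := k) (commSpace lq k Φ) (fun x s => minusMode N lq x (-s) n)
    (fun x s => minusF lq x (-s * lq)) L' hm (i₀ + 1) (aB i₀)
  rw [h3] at e1
  rw [hComb_minusF, h4] at e2
  have := (commSpace lq k Φ).smul_mem (qd lq)⁻¹ ((commSpace lq k Φ).sub_mem e1 e2)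
  rw [Prod.mk_sub_mk, Prod.smul_mk, sub_zero, smul_zero] at this
  exact this

/-- The modes of `H ^ i` commute with the screening currents. -/
theorem Hmode_comm_Scurrent (hG : Generic N lq k) (i₀ j₀ : Fin (N - 1)) (n : ℤ) (v : ℂ) :
    (∀ s t, Composable (Hmode N lq k i₀ n) (Scurrent N lq k j₀ v) s t ∧
      Composable (Scurrent N lq k j₀ v) (Hmode N lq k i₀ n) s t) ∧
    comp (Hmode N lq k i₀ n) (Scurrent N lq k j₀ v)
      - comp (Scurrent N lq k j₀ v) (Hmode N lq k i₀ n) = 0 := by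
  choose! X Y hX hY hXY using fun (β : ℕ ⊕ ℕ) (hβ : β ∈ sIdx N (j₀ + 1)) =>
    hasComm_Hmode (i₀ := i₀) hG n hβ v
  have e1 := HasComp.smul_right (-(qd lq)⁻¹ * Complex.exp (-v))
    (HasComp.sum_right (sIdx N (j₀ + 1)) fun β hβ => (hX β hβ).smul_right (sgn β))
  have e2 := HasComp.smul_left (-(qd lq)⁻¹ * Complex.exp (-v))
    (HasComp.sum_left (sIdx N (j₀ + 1)) fun β hβ => (hY β hβ).smul_left (sgn β))
  rw [← Scurrent_eq] at e1 e2
  refine ⟨fun s t => ⟨e1.composable s t, e2.composable s t⟩, ?_⟩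
  rw [e1.comp_eq, e2.comp_eq, ← smul_sub, ← Finset.sum_sub_distrib,
    Finset.sum_eq_zero fun β hβ => ?_, smul_zero]
  rw [← smul_sub, hXY β hβ, zero_smul, smul_zero]

end CartanCurrent

end

end UqSlN

namespace UqSlN

noncomputable section

open scoped BigOperators
open Filter Topology

/-! ### `E ^ -` and the screening currents -/

section EminusTerms

variable {N : ℕ} {lq k : ℂ}

/-- The logarithm of the point at which `b ^ {lc}`, `c = i, i + 1`, enters `E ^ {-,i}(z)`. -/
def lPt (lq k : ℂ) (i l c : ℕ) (u : ℂ) : ℂ := u + ((c : ℂ) - i - l - k) * lq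

/-- The logarithm of the point at which `b ^ {lc}`, `l = i, i + 1`, enters `E ^ {-,i}(z)`. -/
def rPt (lq k : ℂ) (i l c : ℕ) (u : ℂ) : ℂ := u + (k + c - l + i) * lq

/-- The exponents in `E ^ {-,i}(z)` with negative tails. -/
def lTerm (N : ℕ) (lq k : ℂ) (i₀ : Fin (N - 1)) : ℕ ⊕ ℕ → ℂ → LinForm N
  | Sum.inl n, u => bc N lq n (i₀ + 1 + 1) (lPt lq k (i₀ + 1) n (i₀ + 1 + 1) u - lq)
      - bM N lq n (i₀ + 1) (lPt lq k (i₀ + 1) n (i₀ + 1) u)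
      - bc N lq n (i₀ + 1) (lPt lq k (i₀ + 1) n (i₀ + 1) u + lq) + lTail N lq k i₀ n u
  | Sum.inr n, u => bc N lq n (i₀ + 1 + 1) (lPt lq k (i₀ + 1) n (i₀ + 1 + 1) u - lq)
      - bP N lq n (i₀ + 1) (lPt lq k (i₀ + 1) n (i₀ + 1) u)
      - bc N lq n (i₀ + 1) (lPt lq k (i₀ + 1) n (i₀ + 1) u - lq) + lTail N lq k i₀ n u

/-- The exponents in `E ^ {-,i}(z)` with positive tails. -/
def rTerm (N : ℕ) (lq k : ℂ) (i₀ : Fin (N - 1)) : ℕ ⊕ ℕ → ℂ → LinForm N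
  | Sum.inl n, u => bc N lq (i₀ + 1) n (rPt lq k (i₀ + 1) (i₀ + 1) n u - lq)
      + bM N lq (i₀ + 1 + 1) n (rPt lq k (i₀ + 1) (i₀ + 1 + 1) n u)
      - bc N lq (i₀ + 1 + 1) n (rPt lq k (i₀ + 1) (i₀ + 1 + 1) n u - lq) + rTail N lq k i₀ n u
  | Sum.inr n, u => bc N lq (i₀ + 1) n (rPt lq k (i₀ + 1) (i₀ + 1) n u - lq)
      + bP N lq (i₀ + 1 + 1) n (rPt lq k (i₀ + 1) (i₀ + 1 + 1) n u)
      - bc N lq (i₀ + 1 + 1) n (rPt lq k (i₀ + 1) (i₀ + 1 + 1) n u + lq) + rTail N lq k i₀ n u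

/-- The labels of the terms of `E ^ {-,i}(z)` with negative tails. -/
def lIdx (i : ℕ) : Finset (ℕ ⊕ ℕ) := (Finset.Icc 1 i).disjSum (Finset.Ico 1 i)

/-- The labels of the terms of `E ^ {-,i}(z)` with positive tails. -/
def rIdx (N i : ℕ) : Finset (ℕ ⊕ ℕ) := (Finset.Icc (i + 2) N).disjSum (Finset.Icc (i + 1) N)

theorem lTerm_inl_eq (i₀ : Fin (N - 1)) (n : ℕ) (u : ℂ) : lTerm N lq k i₀ (Sum.inl n) u =
    bc N lq n (i₀ + 1 + 1) (u + -(k + n) * lq) + (-bM N lq n (i₀ + 1) (u + -(k + n) * lq)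
      - bc N lq n (i₀ + 1) (u + -(k + n - 1) * lq)) + lTail N lq k i₀ n u := by
  rw [lTerm, lPt, lPt, show u + (((i₀ + 1 + 1 : ℕ) : ℂ) - (i₀ + 1 : ℕ) - n - k) * lq - lq =
    u + -(k + n) * lq by push_cast; ring, show u + (((i₀ + 1 : ℕ) : ℂ) - (i₀ + 1 : ℕ) - n - k) * lq
    = u + -(k + n) * lq by ring, show u + -(k + n) * lq + lq = u + -(k + n - 1) * lq by ring]
  abel

theorem lTerm_inr_eq (i₀ : Fin (N - 1)) (n : ℕ) (u : ℂ) : lTerm N lq k i₀ (Sum.inr n) u =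
    bc N lq n (i₀ + 1 + 1) (u + -(k + n) * lq) + (-bP N lq n (i₀ + 1) (u + -(k + n) * lq)
      - bc N lq n (i₀ + 1) (u + -(k + n + 1) * lq)) + lTail N lq k i₀ n u := by
  rw [lTerm, lPt, lPt, show u + (((i₀ + 1 + 1 : ℕ) : ℂ) - (i₀ + 1 : ℕ) - n - k) * lq - lq =
    u + -(k + n) * lq by push_cast; ring, show u + (((i₀ + 1 : ℕ) : ℂ) - (i₀ + 1 : ℕ) - n - k) * lq
    = u + -(k + n) * lq by ring, show u + -(k + n) * lq - lq = u + -(k + n + 1) * lq by ring]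
  abel

/-- The middle term of `E ^ -` is the positive term with `n = i`, since `b ^ {ii} = c ^ {ii} = 0`.
This explains why `lIdx` has one more positive than negative label. -/
theorem lTerm_inl_self (i₀ : Fin (N - 1)) (u : ℂ) : lTerm N lq k i₀ (Sum.inl (i₀ + 1)) u =
    bc N lq (i₀ + 1) (i₀ + 1 + 1) (u + -(k + (i₀ + 1 : ℕ)) * lq)
      + (minusF lq (aB i₀) (u + -((k + N) / 2) * lq) +
      ∑ c ∈ Finset.Icc ((i₀ : ℕ) + 1 + 1) N, (bM N lq (i₀ + 1) c (u + -(k + c) * lq)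
      - bM N lq (i₀ + 1 + 1) c (u + -(k + c - 1) * lq))) := by
  rw [lTerm_inl_eq, lTail, Finset.Icc_eq_empty (by omega), Finset.sum_empty, zero_add,
    bM_of_not_isRoot _ _ _ (fun h => lt_irrefl _ h.2.1),
    bc_of_not_isRoot _ _ _ (fun h => lt_irrefl _ h.2.1), neg_zero, sub_zero, add_zero]

theorem rTerm_inl_eq (i₀ : Fin (N - 1)) (n : ℕ) (u : ℂ) : rTerm N lq k i₀ (Sum.inl n) u =
    bc N lq (i₀ + 1) n (u + (k + n - 1) * lq) + (bM N lq (i₀ + 1 + 1) n (u + (k + n - 1) * lq)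
      - bc N lq (i₀ + 1 + 1) n (u + (k + n - 2) * lq)) + rTail N lq k i₀ n u := by
  rw [rTerm, rPt, rPt, show u + (k + n - ((i₀ + 1 + 1 : ℕ) : ℂ) + (i₀ + 1 : ℕ)) * lq =
    u + (k + n - 1) * lq by push_cast; ring, show u + (k + n - ((i₀ + 1 : ℕ) : ℂ) + (i₀ + 1 : ℕ))
    * lq - lq = u + (k + n - 1) * lq by ring, show u + (k + n - 1) * lq - lq =
    u + (k + n - 2) * lq by ring]
  abel

theorem rTerm_inr_eq (i₀ : Fin (N - 1)) (n : ℕ) (u : ℂ) : rTerm N lq k i₀ (Sum.inr n) u =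
    bc N lq (i₀ + 1) n (u + (k + n - 1) * lq) + (bP N lq (i₀ + 1 + 1) n (u + (k + n - 1) * lq)
      - bc N lq (i₀ + 1 + 1) n (u + (k + n) * lq)) + rTail N lq k i₀ n u := by
  rw [rTerm, rPt, rPt, show u + (k + n - ((i₀ + 1 + 1 : ℕ) : ℂ) + (i₀ + 1 : ℕ)) * lq =
    u + (k + n - 1) * lq by push_cast; ring, show u + (k + n - ((i₀ + 1 : ℕ) : ℂ) + (i₀ + 1 : ℕ))
    * lq - lq = u + (k + n - 1) * lq by ring, show u + (k + n - 1) * lq + lq =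
    u + (k + n) * lq by ring]
  abel

theorem rTerm_inr_self (i₀ : Fin (N - 1)) (u : ℂ) : rTerm N lq k i₀ (Sum.inr (i₀ + 1 + 1)) u =
    bc N lq (i₀ + 1) (i₀ + 1 + 1) (u + (k + (i₀ + 1 : ℕ)) * lq)
      + rTail N lq k i₀ (i₀ + 1 + 1) u := by
  rw [rTerm_inr_eq, bP_of_not_isRoot _ _ _ (fun h => lt_irrefl _ h.2.1),
    bc_of_not_isRoot _ _ _ (fun h => lt_irrefl _ h.2.1), sub_zero, add_zero]
  push_cast
  ring_nf

/-- The terms of `E ^ {-,i}(z)` with negative tails. -/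
def Eleft (N : ℕ) (lq k : ℂ) (i₀ : Fin (N - 1)) (u : ℂ) : FockOp N :=
  (-(qd lq)⁻¹ * Complex.exp (-u)) •
    ∑ α ∈ lIdx (i₀ + 1), sgn α • nexp N lq k (lTerm N lq k i₀ α u)

/-- The terms of `E ^ {-,i}(z)` with positive tails. -/
def Eright (N : ℕ) (lq k : ℂ) (i₀ : Fin (N - 1)) (u : ℂ) : FockOp N :=
  (-(qd lq)⁻¹ * Complex.exp (-u)) •
    ∑ α ∈ rIdx N (i₀ + 1), sgn α • nexp N lq k (rTerm N lq k i₀ α u)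

/-- The two unpaired middle terms are assigned to the halves as the labels `n = i` and `n = i + 1`
where the missing fields vanish. The terms with positive tails occur in `E ^ -` with the opposite
overall sign, hence the positive labels of `rTerm` carry `b_-` and the negative ones `b_+`. -/
theorem Eminus_eq (i₀ : Fin (N - 1)) (u : ℂ) :
    Eminus N lq k i₀ u = Eleft N lq k i₀ u + Eright N lq k i₀ u := by
  have hi : (i₀ : ℕ) + 1 + 1 ≤ N := by omega
  have hL : ∑ α ∈ lIdx (i₀ + 1), sgn α • nexp N lq k (lTerm N lq k i₀ α u) =
      ∑ n ∈ Finset.Ico 1 ((i₀ : ℕ) + 1), (nexp N lq k (lTerm N lq k i₀ (Sum.inl n) u) -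
        nexp N lq k (lTerm N lq k i₀ (Sum.inr n) u)) +
      nexp N lq k (lTerm N lq k i₀ (Sum.inl (i₀ + 1)) u) := by
    rw [lIdx, Finset.sum_disjSum, ← Finset.Ico_add_one_right_eq_Icc,
      Finset.sum_Ico_succ_top (by omega), Finset.sum_sub_distrib]
    simp only [sgn_inl, sgn_inr, one_smul, neg_smul, Finset.sum_neg_distrib]
    abel
  have hR : ∑ α ∈ rIdx N (i₀ + 1), sgn α • nexp N lq k (rTerm N lq k i₀ α u) =
      -nexp N lq k (rTerm N lq k i₀ (Sum.inr (i₀ + 1 + 1)) u) -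
      ∑ n ∈ Finset.Icc ((i₀ : ℕ) + 1 + 2) N, (nexp N lq k (rTerm N lq k i₀ (Sum.inr n) u) -
        nexp N lq k (rTerm N lq k i₀ (Sum.inl n) u)) := by
    rw [rIdx, Finset.sum_disjSum, ← Finset.insert_Icc_add_one_left_eq_Icc hi,
      Finset.sum_insert (by simp), Finset.sum_sub_distrib]
    simp only [sgn_inl, sgn_inr, one_smul, neg_smul, Finset.sum_neg_distrib]
    abel
  rw [Eleft, Eright, hL, hR, lTerm_inl_self, rTerm_inr_self, ← neg_one_div_qd_mul_exp, ← smul_add]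
  simp only [lTerm_inl_eq, lTerm_inr_eq, rTerm_inl_eq, rTerm_inr_eq, lTail, rTail]
  rw [Eminus]
  refine congrArg _ ?_
  simp only [sub_eq_add_neg, add_assoc]

theorem ExpFamily.lTerm (i₀ : Fin (N - 1)) (α : ℕ ⊕ ℕ) :
    ExpFamily fun u _ => lTerm N lq k i₀ α u := by
  have hp : ∀ l c, IntAffine fun u _ => lPt lq k (i₀ + 1) l c u :=
    fun _ _ => IntAffine.fst.add_const _
  have ht : ∀ n, ExpFamily fun u _ => lTail N lq k i₀ n u := fun n =>
    ((ExpFamily.sum _ fun _ _ => (ExpFamily.bM (IntAffine.fst.add_const _) _ _).sub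
      (.bM (IntAffine.fst.add_const _) _ _)).add
      (.minusF (IntAffine.fst.add_const _) _)).add
    (.sum _ fun _ _ => (ExpFamily.bM (IntAffine.fst.add_const _) _ _).sub
      (.bM (IntAffine.fst.add_const _) _ _))
  rcases α with n | n
  · exact (((ExpFamily.bc ((hp _ _).sub_const _) _ _).sub (.bM (hp _ _) _ _)).sub
      (.bc ((hp _ _).add_const _) _ _)).add (ht n)
  · exact (((ExpFamily.bc ((hp _ _).sub_const _) _ _).sub (.bP (hp _ _) _ _)).sub
      (.bc ((hp _ _).sub_const _) _ _)).add (ht n)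

theorem ExpFamily.rTerm (i₀ : Fin (N - 1)) (α : ℕ ⊕ ℕ) :
    ExpFamily fun u _ => rTerm N lq k i₀ α u := by
  have hp : ∀ l c, IntAffine fun u _ => rPt lq k (i₀ + 1) l c u :=
    fun _ _ => IntAffine.fst.add_const _
  have ht : ∀ n, ExpFamily fun u _ => rTail N lq k i₀ n u := fun n =>
    (ExpFamily.plusF (IntAffine.fst.add_const _) _).add
    (.sum _ fun _ _ => (ExpFamily.bP (IntAffine.fst.add_const _) _ _).sub
      (.bP (IntAffine.fst.add_const _) _ _))
  rcases α with n | n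
  · exact (((ExpFamily.bc ((hp _ _).sub_const _) _ _).add (.bM (hp _ _) _ _)).sub
      (.bc ((hp _ _).sub_const _) _ _)).add (ht n)
  · exact (((ExpFamily.bc ((hp _ _).sub_const _) _ _).add (.bP (hp _ _) _ _)).sub
      (.bc ((hp _ _).add_const _) _ _)).add (ht n)

theorem Tame.lTerm (hG : Generic N lq k) (i₀ : Fin (N - 1)) (α : ℕ ⊕ ℕ) :
    Tame lq k (aWeight N lq k) (fun _ _ => 1) (lTerm N lq k i₀ α) := by
  have hW : IsWeight (aWeight N lq k) := .aWeight
  have hW' : IsWeight fun (_ : Boson N) (_ : ℕ+) => (1 : ℝ) := .one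
  have h := hW.nonneg
  have h' := hW'.nonneg
  have ht : ∀ n, Tame lq k (aWeight N lq k) (fun _ _ => 1) (lTail N lq k i₀ n) := fun n =>
    .add h h' (.add h h' (.sum _ h h' fun _ _ => (Tame.bM hW' _ _ fun _ => rfl).sub h h'
      (.bM hW' _ _ fun _ => rfl)) (.minusF _ (fun _ => rfl) _))
      (.sum _ h h' fun _ _ => (Tame.bM hW' _ _ fun _ => rfl).sub h h' (.bM hW' _ _ fun _ => rfl))
  rcases α with n | n
  · exact Tame.add h h' (.sub h h' (.sub h h' (.bc hG hW hW' _ _ fun _ => add_sub_assoc _ _ _)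
      (.bM hW' _ _ fun _ => rfl)) (.bc hG hW hW' _ _ fun _ => add_assoc _ _ _)) (ht n)
  · exact Tame.add h h' (.sub h h' (.sub h h' (.bc hG hW hW' _ _ fun _ => add_sub_assoc _ _ _)
      (.bP hW _ _ fun _ => rfl)) (.bc hG hW hW' _ _ fun _ => add_sub_assoc _ _ _)) (ht n)

theorem Tame.rTerm (hG : Generic N lq k) (i₀ : Fin (N - 1)) (α : ℕ ⊕ ℕ) :
    Tame lq k (aWeight N lq k) (fun _ _ => 1) (rTerm N lq k i₀ α) := by
  have hW : IsWeight (aWeight N lq k) := .aWeight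
  have hW' : IsWeight fun (_ : Boson N) (_ : ℕ+) => (1 : ℝ) := .one
  have h := hW.nonneg
  have h' := hW'.nonneg
  have ht : ∀ n, Tame lq k (aWeight N lq k) (fun _ _ => 1) (rTail N lq k i₀ n) := fun n =>
    .add h h' (.ap _ _)
      (.sum _ h h' fun _ _ => (Tame.bP hW _ _ fun _ => rfl).sub h h' (.bP hW _ _ fun _ => rfl))
  rcases α with n | n
  · exact Tame.add h h' (.sub h h' (.add h h' (.bc hG hW hW' _ _ fun _ => add_sub_assoc _ _ _)
      (.bM hW' _ _ fun _ => rfl)) (.bc hG hW hW' _ _ fun _ => add_sub_assoc _ _ _)) (ht n)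
  · exact Tame.add h h' (.sub h h' (.add h h' (.bc hG hW hW' _ _ fun _ => add_sub_assoc _ _ _)
      (.bP hW _ _ fun _ => rfl)) (.bc hG hW hW' _ _ fun _ => add_assoc _ _ _)) (ht n)

end EminusTerms

end

end UqSlN

namespace UqSlN

noncomputable section

open scoped BigOperators
open Filter Topology

/-! ### Contractions of the negative tail half of `E ^ -` with the screening currents. -/

section EminusLeft

variable {N : ℕ} {lq k : ℂ}

theorem modePair_bc_fTerm (n : ℕ+) (l c : ℕ) (a : ℂ) (j₀ : Fin (N - 1)) (β : ℕ ⊕ ℕ) (v : ℂ) :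
    modePair N lq k n (bc N lq l c a) (fTerm N lq k j₀ β v) =
      modePair N lq k n (bc N lq l c a) (sTerm N lq (j₀ + 1) β v) := by
  rw [fTerm, map_add, modePair_bc_aV, zero_add]

theorem modePair_fTerm_bc (n : ℕ+) (l c : ℕ) (a : ℂ) (j₀ : Fin (N - 1)) (β : ℕ ⊕ ℕ) (v : ℂ) :
    modePair N lq k n (fTerm N lq k j₀ β v) (bc N lq l c a) =
      modePair N lq k n (sTerm N lq (j₀ + 1) β v) (bc N lq l c a) := by
  rw [fTerm, map_add, LinearMap.add_apply, modePair_aV_bc, zero_add]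

theorem zeroForm_bc_fTerm (l c : ℕ) (a : ℂ) (j₀ : Fin (N - 1)) (β : ℕ ⊕ ℕ) (v : ℂ) :
    zeroForm N k (bc N lq l c a) (fTerm N lq k j₀ β v) = 0 := by
  rw [fTerm, map_add, zeroForm_bc_aV, zero_add, zeroForm_bc_sTerm]

theorem zeroForm_fTerm_bc (l c : ℕ) (a : ℂ) (j₀ : Fin (N - 1)) (β : ℕ ⊕ ℕ) (v : ℂ) :
    zeroForm N k (fTerm N lq k j₀ β v) (bc N lq l c a) =
      zeroForm N k (sTerm N lq (j₀ + 1) β v) (bc N lq l c a) := by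
  rw [fTerm, map_add, LinearMap.add_apply, zeroForm_aV_bc, zero_add]

/-- The power of `q` in the contraction of `Eleft` with a screening current. -/
def lConst (i j : ℕ) : ℕ ⊕ ℕ → ℕ ⊕ ℕ → ℂ
  | Sum.inl n, β => if n = j ∧ tIdx β = i + 1 then 1 else if n = j + 1 ∧ tIdx β = i then -1 else 0
  | Sum.inr n, β => if n = j ∧ tIdx β = i + 1 then 1 else if n = j + 1 ∧ tIdx β = i then 1 else
      if n = j ∧ tIdx β = i then -2 else 0

/-- The difference of the exponents at the zero and the pole in this contraction. -/
def lShift (i j : ℕ) : ℕ ⊕ ℕ → ℕ ⊕ ℕ → ℂ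
  | Sum.inl n, Sum.inl m => if n = j ∧ m = i + 1 then -2 else if n = j + 1 ∧ m = i then 2 else 0
  | Sum.inl n, Sum.inr m => if n = j ∧ m = i then -2 else if n = j + 1 ∧ m = i then 2 else 0
  | Sum.inr n, Sum.inl m => if n = j ∧ m = i + 1 then -2 else if n = j ∧ m = i then 2 else 0
  | Sum.inr _, Sum.inr _ => 0

variable {i₀ j₀ : Fin (N - 1)}

/-- Unlike for `E ^ +`, the ratio of the points depends on the root, through a power of `q ^ 2` that
is trivial at `(j, i)`. Only the rows `j`, `j + 1` and the columns `i`, `i + 1` matter, and there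
these shifts still leave one common pole. -/
theorem sPt_sub_lPt (i j l c : ℕ) (u v : ℂ) : sPt N lq j l c v - lPt lq k i l c u =
    v - u + ((N : ℂ) - i + j + k) * lq + (2 * l - 2 * j - (2 * c - 2 * i)) * lq := by
  rw [sPt, lPt]; ring

theorem lPt_sub_sPt (i j l c : ℕ) (u v : ℂ) : lPt lq k i l c u - sPt N lq j l c v =
    u - v + -((N : ℂ) - i + j + k) * lq + (2 * j - 2 * l + (2 * c - 2 * i)) * lq := by
  rw [sPt, lPt]; ring

theorem two_mul_succ_sub (j : ℕ) : (2 * ((j + 1 : ℕ) : ℂ) - 2 * j) = 2 := by push_cast; ring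

theorem two_mul_sub_succ (j : ℕ) : (2 * (j : ℂ) - 2 * ((j + 1 : ℕ) : ℂ)) = -2 := by
  push_cast; ring

/-- The tail has no annihilation part, so only the explicit fields contribute to the modes, at most
in the rows `j`, `j + 1` and columns `i`, `i + 1`. The tail enters through its zero modes alone. The
boundary case `n = i`, where `b ^ {ni}` is absent, is treated separately. -/
theorem halfPair_lTerm_fTerm (hG : Generic N lq k) {α β : ℕ ⊕ ℕ} (hα : α ∈ lIdx (i₀ + 1))
    (hβ : β ∈ sIdx N (j₀ + 1)) :
    HalfPair lq k (lTerm N lq k i₀ α) (fTerm N lq k j₀ β) (lConst (i₀ + 1) (j₀ + 1) α β)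
      ((N : ℂ) - (i₀ + 1 : ℕ) + (j₀ + 1 : ℕ) + k + lShift (i₀ + 1) (j₀ + 1) α β)
      ((N : ℂ) - (i₀ + 1 : ℕ) + (j₀ + 1 : ℕ) + k) := by
  rw [halfPair_iff]
  intro u v
  rw [add_sub_cancel_left]
  have hi : (i₀ : ℕ) + 1 + 1 ≤ N := by omega
  obtain ⟨h1, h2⟩ := mem_sIdx.1 hβ
  refine ⟨fun n' => ?_, ?_⟩
  · have ht := qn_ne_zero lq n'
    rcases α with n | n <;> rcases β with m | m <;> dsimp only [tIdx] at h1 h2 <;>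
      simp only [lIdx, Finset.inl_mem_disjSum, Finset.inr_mem_disjSum, Finset.mem_Icc,
        Finset.mem_Ico] at hα <;> obtain ⟨h3, h4⟩ := hα
    all_goals
      have hr : IsRoot N n (i₀ + 1 + 1) := ⟨h3, by omega, hi⟩
      have h5 : n ≤ (i₀ : ℕ) + 1 := by omega
      have h6 : (i₀ : ℕ) + 1 ≤ N := by omega
      simp only [lTerm, map_add, map_sub, LinearMap.add_apply, LinearMap.sub_apply,
        modePair_lTail_left, modePair_bM_left, modePair_bP_fTerm, modePair_bc_fTerm,
        modePair_bc_sTerm_inl_of_le _ _ _ _ _ hG h1 h3 h5 h6,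
        modePair_bc_sTerm_inr_of_le _ _ _ _ _ hG h1 h3 h5 h6,
        modePair_bc_sTerm_inl _ _ _ _ _ _ _ hG hr, modePair_bc_sTerm_inr _ _ _ _ _ _ _ hG hr]
      try rw [modePair_bP_sTerm _ _ _ _ _ _ _ hG ⟨h3, h4, h6⟩]
      simp only [zn_sub_sub_lq, zn_sub_add_lq, sPt_sub_lPt, sRow, sCol, lShift, sub_self, sub_zero,
        two_mul_succ_sub, zn_add_mul_lq _ (v - u + _)]
      generalize zn n' _ = X
      generalize (i₀ : ℕ) + 1 = i at *
      generalize (j₀ : ℕ) + 1 = j at *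
      rcases (by omega : n = j ∨ n = j + 1 ∨ (n ≠ j ∧ n ≠ j + 1)) with rfl | rfl | hn <;>
      rcases (by omega : m < i ∨ m = i ∨ m = i + 1 ∨ i + 1 < m) with hm | rfl | rfl | hm <;>
      first
        | omega
        | (simp (disch := omega) only [tIdx, and_self, if_true, if_pos, if_neg, tp_zero, tp_two,
            tp_neg, qb, sub_self, two_mul_succ_sub, zero_sub]
           try field_simp
           try ring)
  · have hl := fun n hn => zeroForm_lTail_fTerm (k := k) (i₀ := i₀) (n := n) u v hG hn h1 h2
    rcases α with n | n <;> rcases β with m | m <;> dsimp only [tIdx] at h1 h2 hl <;>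
      simp only [lIdx, Finset.inl_mem_disjSum, Finset.inr_mem_disjSum, Finset.mem_Icc,
        Finset.mem_Ico] at hα <;> obtain ⟨h3, h4⟩ := hα
    all_goals
      simp only [lTerm, map_add, map_sub, LinearMap.add_apply, LinearMap.sub_apply,
        zeroForm_bP_fTerm, zeroForm_bM_fTerm, zeroForm_bc_fTerm,
        hl n (by omega), lConst]
      clear hl
      first
        | rw [zeroForm_bP_sTerm _ _ _ _ _ _ ⟨h3, h4, by omega⟩]
        | (rcases h4.eq_or_lt with h7 | h7 <;>
           first
             | rw [zeroForm_bM_sTerm _ _ _ _ _ _ ⟨h3, h7, by omega⟩]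
             | rw [bM_of_not_isRoot _ _ _ (fun h => by have := h.2.1; omega), map_zero,
                 LinearMap.zero_apply])
    all_goals
      try simp only [sRow]
      generalize (i₀ : ℕ) = i at *
      generalize (j₀ : ℕ) = j at *
      rcases (by omega : n = j + 1 ∨ n = j + 1 + 1 ∨ (n ≠ j + 1 ∧ n ≠ j + 1 + 1)) with
        h8 | h8 | h8 <;>
      rcases (by omega : m < i + 1 ∨ m = i + 1 ∨ m = i + 1 + 1 ∨ i + 1 + 1 < m) with
        hm | hm | hm | hm <;>
      rcases (by omega : n = i + 1 ∨ n < i + 1) with h9 | h9 <;>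
      first
        | omega
        | (simp (disch := omega) only [tIdx, if_pos, if_neg]; ring)

theorem halfPair_fTerm_lTerm (hG : Generic N lq k) {α β : ℕ ⊕ ℕ} (hα : α ∈ lIdx (i₀ + 1))
    (hβ : β ∈ sIdx N (j₀ + 1)) :
    HalfPair lq k (fTerm N lq k j₀ β) (lTerm N lq k i₀ α)
      (lConst (i₀ + 1) (j₀ + 1) α β + lShift (i₀ + 1) (j₀ + 1) α β)
      (-((N : ℂ) - (i₀ + 1 : ℕ) + (j₀ + 1 : ℕ) + k + lShift (i₀ + 1) (j₀ + 1) α β))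
      (-((N : ℂ) - (i₀ + 1 : ℕ) + (j₀ + 1 : ℕ) + k)) := by
  rw [halfPair_iff]
  intro v u
  rw [neg_add _ (lShift _ _ _ _), add_sub_cancel_left]
  have hi : (i₀ : ℕ) + 1 + 1 ≤ N := by omega
  obtain ⟨h1, h2⟩ := mem_sIdx.1 hβ
  refine ⟨fun n' => ?_, ?_⟩
  · have ht := qn_ne_zero lq n'
    have hl := fun n hn => modePair_fTerm_lTail (k := k) (i₀ := i₀) (n := n) n' u v hG hn h1 h2
    rcases α with n | n <;> rcases β with m | m <;> dsimp only [tIdx] at h1 h2 hl <;>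
      simp only [lIdx, Finset.inl_mem_disjSum, Finset.inr_mem_disjSum, Finset.mem_Icc,
        Finset.mem_Ico] at hα <;> obtain ⟨h3, h4⟩ := hα
    all_goals
      have hr : IsRoot N n (i₀ + 1 + 1) := ⟨h3, by omega, hi⟩
      have h5 : n ≤ (i₀ : ℕ) + 1 := by omega
      have h6 : (i₀ : ℕ) + 1 ≤ N := by omega
      simp only [lTerm, map_add, map_sub, hl n h5, modePair_fTerm_bM,
        modePair_fTerm_bc, modePair_bP_right, modePair_sTerm_bc_inl _ _ _ _ _ _ _ hG,
        modePair_sTerm_bc_inr_of_le _ _ _ _ _ hG h1 h3 h5 h6,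
        modePair_sTerm_bc_inr _ _ _ _ _ _ _ hG hr]
    all_goals
      first
        | (rcases h4.eq_or_lt with h7 | h7 <;>
           first
             | rw [modePair_sTerm_bM _ _ _ _ _ _ _ hG ⟨h3, h7, h6⟩]
             | rw [bM_of_not_isRoot _ _ _ (fun h => by have := h.2.1; omega), map_zero])
        | skip
    all_goals
      clear hl
      simp only [zn_sub_lq, zn_add_lq, lPt_sub_sPt, lShift, sub_self, add_zero,
        two_mul_succ_sub, zn_add_mul_lq _ (u - v + _)]
      generalize zn n' _ = X
      generalize (i₀ : ℕ) = i at *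
      generalize (j₀ : ℕ) = j at *
      rcases (by omega : n = j + 1 ∨ n = j + 1 + 1 ∨ (n ≠ j + 1 ∧ n ≠ j + 1 + 1)) with
        rfl | rfl | h8 <;>
      rcases (by omega : m < i + 1 ∨ m = i + 1 ∨ m = i + 1 + 1 ∨ i + 1 + 1 < m) with
        hm | rfl | rfl | hm <;>
      first
        | omega
        | (simp (disch := omega) only [tIdx, and_self, if_true, if_pos, if_neg, tp_zero, tp_two,
            tp_neg, qb, and_true, sub_self, two_mul_sub_succ, zero_add, neg_add_cancel, neg_zero]
           try field_simp
           try ring)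
  · rcases α with n | n <;> rcases β with m | m <;> dsimp only [tIdx] at h1 h2 <;>
      simp only [lIdx, Finset.inl_mem_disjSum, Finset.inr_mem_disjSum, Finset.mem_Icc,
        Finset.mem_Ico] at hα <;> obtain ⟨h3, h4⟩ := hα
    all_goals
      have hr : IsRoot N n (i₀ + 1 + 1) := ⟨h3, by omega, hi⟩
      have h5 : n ≤ (i₀ : ℕ) + 1 := by omega
      have h6 : (i₀ : ℕ) + 1 ≤ N := by omega
      simp only [lTerm, map_add, map_sub, zeroForm_lTail_right, zeroForm_bP_right,
        zeroForm_bM_right, zeroForm_fTerm_bc, zeroForm_sTerm_bc_inl _ _ _ _ _ _ hr,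
        zeroForm_sTerm_bc_inr _ _ _ _ _ _ hr,
        zeroForm_sTerm_bc_inl_of_le _ _ _ _ h1 h3 h5 h6,
        zeroForm_sTerm_bc_inr_of_le _ _ _ _ h1 h3 h5 h6, sRow, lConst, lShift]
      generalize (i₀ : ℕ) + 1 = i at *
      generalize (j₀ : ℕ) + 1 = j at *
      rcases (by omega : n = j ∨ n = j + 1 ∨ (n ≠ j ∧ n ≠ j + 1)) with rfl | rfl | hn <;>
      rcases (by omega : m < i ∨ m = i ∨ m = i + 1 ∨ i + 1 < m) with hm | rfl | rfl | hm <;>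
      first
        | omega
        | (simp (disch := omega) only [tIdx, and_self, if_true, if_pos, if_neg]
           try ring)

end EminusLeft

end

end UqSlN

namespace UqSlN

noncomputable section

open scoped BigOperators
open Filter Topology

/-! ### Contractions of the positive tail half of `E ^ -` with the screening currents. -/

section EminusRight

variable {N : ℕ} {lq k : ℂ}

/-- The power of `q` in the contraction of `Eright` with a screening current. -/
def rConst (i j : ℕ) : ℕ ⊕ ℕ → ℕ ⊕ ℕ → ℂ
  | Sum.inl n, β => (if tIdx β < n then sRow j i - sRow j (i + 1) else 0) +
      if tIdx β = n then sRow j (i + 1) else 0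
  | Sum.inr n, β => (if tIdx β < n then sRow j i - sRow j (i + 1) else 0) -
      if tIdx β = n then sRow j (i + 1) else 0

/-- The difference of the exponents at the zero and the pole in this contraction. -/
def rShift (i j : ℕ) : ℕ ⊕ ℕ → ℕ ⊕ ℕ → ℂ
  | Sum.inl n, Sum.inl m => if n = m then if i = j then -2 else if j = i + 1 then 2 else 0 else 0
  | Sum.inr n, Sum.inr m => if n = m then if i = j then 2 else if j = i + 1 then -2 else 0 else 0
  | _, _ => 0

/-- The label of the pole of this contraction. -/
def rLabel (i j : ℕ) : ℕ ⊕ ℕ → ℕ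
  | Sum.inl n => if i = j then n - 1 else n
  | Sum.inr n => n

/-- The exponent at the pole with a given label. -/
def rPole (N : ℕ) (k : ℂ) (i j l : ℕ) : ℂ := N - k - 2 * l + if i = j then 0 else 1

variable {i₀ j₀ : Fin (N - 1)}

theorem sPt_sub_rPt (i j l c : ℕ) (u v : ℂ) : sPt N lq j l c v - rPt lq k i l c u =
    v - u + ((N : ℂ) + i - j - k - 2 * c) * lq + (2 * l - 2 * i) * lq := by
  rw [sPt, rPt]; ring

theorem rPt_sub_sPt (i j l c : ℕ) (u v : ℂ) : rPt lq k i l c u - sPt N lq j l c v =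
    u - v + -((N : ℂ) + i - j - k - 2 * c) * lq + (2 * i - 2 * l) * lq := by
  rw [sPt, rPt]; ring

theorem rPole_self (i l : ℕ) (u v : ℂ) : v - u + rPole N k i i l * lq =
    v - u + ((N : ℂ) + i - i - k - 2 * l) * lq := by
  rw [rPole, if_pos rfl]; ring

theorem rPole_self_pred (i : ℕ) {l : ℕ} (hl : 0 < l) (u v : ℂ) :
    v - u + rPole N k i i (l - 1) * lq =
      v - u + ((N : ℂ) + i - i - k - 2 * l) * lq + 2 * lq := by
  rw [rPole, if_pos rfl, Nat.cast_pred hl]; ring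

theorem rPole_succ (i l : ℕ) (u v : ℂ) : v - u + rPole N k i (i + 1) l * lq =
    v - u + ((N : ℂ) + i - (i + 1 : ℕ) - k - 2 * l) * lq + 2 * lq := by
  rw [rPole, if_neg (by omega)]; push_cast; ring

theorem neg_rPole_self (i l : ℕ) (u v : ℂ) : u - v + -rPole N k i i l * lq =
    u - v + -((N : ℂ) + i - i - k - 2 * l) * lq := by
  rw [rPole, if_pos rfl]; ring

theorem neg_rPole_self_pred (i : ℕ) {l : ℕ} (hl : 0 < l) (u v : ℂ) :
    u - v + -rPole N k i i (l - 1) * lq =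
      u - v + -((N : ℂ) + i - i - k - 2 * l) * lq + -2 * lq := by
  rw [rPole, if_pos rfl, Nat.cast_pred hl]; ring

theorem neg_rPole_succ (i l : ℕ) (u v : ℂ) : u - v + -rPole N k i (i + 1) l * lq =
    u - v + -((N : ℂ) + i - (i + 1 : ℕ) - k - 2 * l) * lq + -2 * lq := by
  rw [rPole, if_neg (by omega)]; push_cast; ring

/-- The point of `b ^ {lc}` now moves by `q ^ (-2)` relative to the screening current from one
column to the next, so each column has its own pole. For `i = j` the pole of the positive term of
column `n` coincides with that of the negative term of column `n - 1`, and `rLabel` identifies the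
two. Where `rShift = 0` the contraction is constant and its label is immaterial. -/
theorem halfPair_rTerm_fTerm (hG : Generic N lq k) {α β : ℕ ⊕ ℕ} (hα : α ∈ rIdx N (i₀ + 1))
    (hβ : β ∈ sIdx N (j₀ + 1)) :
    HalfPair lq k (rTerm N lq k i₀ α) (fTerm N lq k j₀ β) (rConst (i₀ + 1) (j₀ + 1) α β)
      (rPole N k (i₀ + 1) (j₀ + 1) (rLabel (i₀ + 1) (j₀ + 1) α) + rShift (i₀ + 1) (j₀ + 1) α β)
      (rPole N k (i₀ + 1) (j₀ + 1) (rLabel (i₀ + 1) (j₀ + 1) α)) := by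
  rw [halfPair_iff]
  intro u v
  rw [add_sub_cancel_left]
  obtain ⟨h1, h2⟩ := mem_sIdx.1 hβ
  refine ⟨fun n' => ?_, ?_⟩
  · have ht := qn_ne_zero lq n'
    have hl := fun n hn hN => modePair_rTail_fTerm (k := k) (i₀ := i₀) (j₀ := j₀) (n := n) n' u v
      hG hn hN h2
    rcases α with n | n <;> rcases β with m | m <;> dsimp only [tIdx] at h1 h2 hl <;>
      simp only [rIdx, Finset.inl_mem_disjSum, Finset.inr_mem_disjSum, Finset.mem_Icc] at hα <;>
      obtain ⟨h3, h4⟩ := hα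
    all_goals
      have hr : IsRoot N (i₀ + 1) n := ⟨by omega, by omega, h4⟩
      have h5 : (i₀ : ℕ) + 1 + 1 ≤ n := by omega
      have h6 : 1 ≤ (i₀ : ℕ) + 1 + 1 := by omega
      simp only [rTerm, map_add, map_sub, LinearMap.add_apply, LinearMap.sub_apply,
        hl n h5 h4, modePair_bM_left, modePair_bP_fTerm, modePair_bc_fTerm,
        modePair_bc_sTerm_inl_of_le _ _ _ _ _ hG h1 h6 h5 h4,
        modePair_bc_sTerm_inr_of_le _ _ _ _ _ hG h1 h6 h5 h4,
        modePair_bc_sTerm_inl _ _ _ _ _ _ _ hG hr, modePair_bc_sTerm_inr _ _ _ _ _ _ _ hG hr]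
      clear hl
      try
        rcases h3.eq_or_lt with h7 | h7 <;>
        first
          | rw [modePair_bP_sTerm _ _ _ _ _ _ _ hG ⟨h6, h7, h4⟩]
          | rw [bP_of_not_isRoot _ _ _ (fun h => by have := h.2.1; omega), map_zero,
              LinearMap.zero_apply]
    all_goals
      have e2 : v - u + ((N : ℂ) + (i₀ + 1 : ℕ) - (j₀ + 1 : ℕ) - k - 2 * n + 2) * lq =
        v - u + ((N : ℂ) + (i₀ + 1 : ℕ) - (j₀ + 1 : ℕ) - k - 2 * n) * lq + 2 * lq := by ring
      simp only [e2, zn_sub_sub_lq, zn_sub_add_lq, sPt_sub_rPt, sub_self,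
        two_mul_succ_sub, zn_add_mul_lq _ (v - u + _), tp_zero, tp_two]
      clear e2
      generalize (i₀ : ℕ) + 1 = i at *
      generalize (j₀ : ℕ) + 1 = j at *
      rcases (by omega : i = j ∨ j = i + 1 ∨ (i ≠ j ∧ j ≠ i + 1)) with rfl | rfl | hij <;>
      rcases lt_trichotomy n m with hm | rfl | hm <;>
      rcases (by omega : n = i + 1 ∨ i + 1 < n) with h8 | h8 <;>
      first
        | omega
        | skip
    all_goals
      simp (disch := omega) only [tIdx, and_self, rShift, rLabel, if_true, if_pos, if_neg, rPole_self,
        rPole_self_pred _ ((Nat.succ_pos _).trans_le h5), rPole_succ, tp_zero, sub_self, mul_zero,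
        zn_add_mul_lq _ (v - u + _), tp_two, tp_neg, sRow, sCol, qb]
      generalize zn n' _ = X
      try field_simp
      try ring
  · have hl := fun n hn hN => zeroForm_rTail_fTerm (k := k) (i₀ := i₀) (j₀ := j₀) (n := n) u v
      hG hn hN h2
    rcases α with n | n <;> rcases β with m | m <;> dsimp only [tIdx] at h1 h2 hl <;>
      simp only [rIdx, Finset.inl_mem_disjSum, Finset.inr_mem_disjSum, Finset.mem_Icc] at hα <;>
      obtain ⟨h3, h4⟩ := hα
    all_goals
      have h5 : (i₀ : ℕ) + 1 + 1 ≤ n := by omega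
      simp only [rTerm, map_add, map_sub, LinearMap.add_apply, LinearMap.sub_apply,
        zeroForm_bP_fTerm, zeroForm_bM_fTerm, zeroForm_bc_fTerm,
        hl n h5 h4, rConst]
      clear hl
      rcases h3.eq_or_lt with h7 | h7 <;>
      first
        | rw [zeroForm_bP_sTerm _ _ _ _ _ _ ⟨by omega, h7, h4⟩]
        | rw [zeroForm_bM_sTerm _ _ _ _ _ _ ⟨by omega, by omega, h4⟩]
        | rw [bP_of_not_isRoot _ _ _ (fun h => by have := h.2.1; omega), map_zero,
            LinearMap.zero_apply]
    all_goals
      rcases lt_trichotomy n m with h8 | h8 | h8 <;>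
      (simp (disch := omega) only [tIdx, if_pos, if_neg]; ring)

theorem halfPair_fTerm_rTerm (hG : Generic N lq k) {α β : ℕ ⊕ ℕ} (hα : α ∈ rIdx N (i₀ + 1))
    (hβ : β ∈ sIdx N (j₀ + 1)) :
    HalfPair lq k (fTerm N lq k j₀ β) (rTerm N lq k i₀ α)
      (rConst (i₀ + 1) (j₀ + 1) α β + rShift (i₀ + 1) (j₀ + 1) α β)
      (-(rPole N k (i₀ + 1) (j₀ + 1) (rLabel (i₀ + 1) (j₀ + 1) α) +
        rShift (i₀ + 1) (j₀ + 1) α β))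
      (-rPole N k (i₀ + 1) (j₀ + 1) (rLabel (i₀ + 1) (j₀ + 1) α)) := by
  rw [halfPair_iff]
  intro v u
  rw [neg_add _ (rShift _ _ _ _), add_sub_cancel_left]
  obtain ⟨h1, h2⟩ := mem_sIdx.1 hβ
  refine ⟨fun n' => ?_, ?_⟩
  · have ht := qn_ne_zero lq n'
    rcases α with n | n <;> rcases β with m | m <;> dsimp only [tIdx] at h1 h2 <;>
      simp only [rIdx, Finset.inl_mem_disjSum, Finset.inr_mem_disjSum, Finset.mem_Icc] at hα <;>
      obtain ⟨h3, h4⟩ := hα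
    all_goals
      have hr : IsRoot N (i₀ + 1) n := ⟨by omega, by omega, h4⟩
      have h5 : (i₀ : ℕ) + 1 + 1 ≤ n := by omega
      have h6 : 1 ≤ (i₀ : ℕ) + 1 + 1 := by omega
      simp only [rTerm, map_add, map_sub, modePair_rTail_right, modePair_fTerm_bM,
        modePair_fTerm_bc, modePair_bP_right, modePair_sTerm_bc_inl _ _ _ _ _ _ _ hG,
        modePair_sTerm_bc_inr_of_le _ _ _ _ _ hG h1 h6 h5 h4,
        modePair_sTerm_bc_inr _ _ _ _ _ _ _ hG hr]
      try rw [modePair_sTerm_bM _ _ _ _ _ _ _ hG ⟨h6, h3, h4⟩]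
      simp only [zn_sub_lq, zn_add_lq, rPt_sub_sPt, sub_self, add_zero,
        two_mul_sub_succ, zn_add_mul_lq _ (u - v + _), tp_zero, tp_neg, tp_two]
      generalize (i₀ : ℕ) + 1 = i at *
      generalize (j₀ : ℕ) + 1 = j at *
      rcases (by omega : i = j ∨ j = i + 1 ∨ (i ≠ j ∧ j ≠ i + 1)) with rfl | rfl | hij <;>
      rcases lt_trichotomy n m with hm | rfl | hm
    all_goals
      simp (disch := omega) only [tIdx, and_self, rShift, rLabel, if_true, if_pos, if_neg,
        neg_rPole_self, neg_rPole_self_pred _ ((Nat.succ_pos _).trans_le h5), neg_rPole_succ,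
        tp_zero, sub_self, mul_zero, zn_add_mul_lq _ (u - v + _), tp_two,
        tp_neg, qb]
      generalize zn n' _ = X
      try field_simp
      try ring
  · rcases α with n | n <;> rcases β with m | m <;> dsimp only [tIdx] at h1 h2 <;>
      simp only [rIdx, Finset.inl_mem_disjSum, Finset.inr_mem_disjSum, Finset.mem_Icc] at hα <;>
      obtain ⟨h3, h4⟩ := hα
    all_goals
      have hr : IsRoot N (i₀ + 1) n := ⟨by omega, by omega, h4⟩
      have h5 : (i₀ : ℕ) + 1 + 1 ≤ n := by omega
      have h6 : 1 ≤ (i₀ : ℕ) + 1 + 1 := by omega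
      simp only [rTerm, map_add, map_sub, zeroForm_rTail_right, zeroForm_bP_right,
        zeroForm_bM_right, zeroForm_fTerm_bc, zeroForm_sTerm_bc_inl _ _ _ _ _ _ hr,
        zeroForm_sTerm_bc_inr _ _ _ _ _ _ hr,
        zeroForm_sTerm_bc_inl_of_le _ _ _ _ h1 h6 h5 h4,
        zeroForm_sTerm_bc_inr_of_le _ _ _ _ h1 h6 h5 h4, sRow, rConst, rShift]
      generalize (i₀ : ℕ) + 1 = i at *
      generalize (j₀ : ℕ) + 1 = j at *
      rcases (by omega : i = j ∨ j = i + 1 ∨ i = j + 1 ∨ (i ≠ j ∧ j ≠ i + 1 ∧ i ≠ j + 1)) with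
        rfl | rfl | rfl | hij <;>
      rcases lt_trichotomy n m with hm | rfl | hm <;>
      first
        | omega
        | (simp (disch := omega) only [tIdx, and_self, if_true, if_pos, if_neg]
           try ring)

end EminusRight

end

end UqSlN

namespace UqSlN

noncomputable section

open scoped BigOperators
open Filter Topology

/-! ### Cancellation of residues by involutions. -/

section ResidueCancel

variable {N : ℕ} {lq k : ℂ} {ι κ Λ : Type*} [DecidableEq Λ] {I : Finset ι} {J : Finset κ}
    {ε : ι → ℂ} {η : κ → ℂ} {Φ : ι → ℂ → LinForm N} {Ψ : κ → ℂ → LinForm N} {c a : ι → κ → ℂ}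
    {π : ι → κ → Λ} {b : Λ → ℂ}

/-- A residue vanishes if its terms cancel in pairs, except for those without a pole. -/
theorem residue_eq_zero_of_involution (g : ι × κ → ι × κ) (l : Λ) (v : ℂ)
    (h : ∀ x ∈ I ×ˢ J, π x.1 x.2 = l → a x.1 x.2 ≠ b l → g x ∈ I ×ˢ J ∧
      π (g x).1 (g x).2 = l ∧ a (g x).1 (g x).2 ≠ b l ∧ g (g x) = x ∧
      Φ x.1 (v + b l * lq) + Ψ x.2 v = Φ (g x).1 (v + b l * lq) + Ψ (g x).2 v ∧
      ε x.1 * η x.2 * (qpow lq (c x.1 x.2) * (qpow lq (b l) - qpow lq (a x.1 x.2))) +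
        ε (g x).1 * η (g x).2 * (qpow lq (c (g x).1 (g x).2) *
          (qpow lq (b l) - qpow lq (a (g x).1 (g x).2))) = 0) :
    residue lq k I J ε η Φ Ψ c a π b l v = 0 := by
  rw [residue, ← Finset.sum_filter_of_ne (p := fun x => a x.1 x.2 ≠ b l) fun x _ hx h0 => hx (by
    rw [h0, sub_self, mul_zero, mul_zero, zero_smul])]
  refine Finset.sum_involution (fun x _ => g x) ?_ ?_ ?_ ?_ <;> intro x hx <;>
    obtain ⟨hx, h3⟩ := Finset.mem_filter.1 hx <;> obtain ⟨h1, h2⟩ := Finset.mem_filter.1 hx <;>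
    obtain ⟨g1, g2, g3, g4, g5, g6⟩ := h x h1 h2 h3
  · exact smul_nexp_add_eq_zero g5 g6
  · intro h0 hg
    -- A fixed point of `g` would cancel against itself, so twice its coefficient is zero.
    rw [hg, ← two_mul, mul_eq_zero, or_iff_right two_ne_zero] at g6
    exact h0 (by rw [g6, zero_smul])
  · exact Finset.mem_filter.2 ⟨Finset.mem_filter.2 ⟨g1, g2⟩, g3⟩
  · exact g4

end ResidueCancel

/-! ### Merging of `a_±` with the vertex operator of `a`. -/

section CartanVertex

variable {N : ℕ} {lq k : ℂ}

theorem tp_eq_qpow (m : ℕ+) (δ : ℂ) : tp lq m δ = qpow lq (δ * m) := by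
  rw [tp, qpow]; ring_nf

theorem qpow_mul_eq_sq (x : ℂ) (m : ℕ+) : qpow lq (x * m) = qpow lq (x / 2 * m) ^ 2 := by
  rw [pow_two, ← qpow_add]; ring_nf

/-- With `x = (k + N) m`, creation modes combine by `q ^ (-x/2) + (q ^ x - q ^ (-x)) q ^ (x/2) = q ^
(3x/2)`. Annihilation modes are unchanged because `q ^ (-x/2) = q ^ (x/2) q ^ (-x)`. The momentum of
`a_-` supplies the change of `log z`. -/
theorem minusF_add_aV (hG : Generic N lq k) (j : Fin (N - 1)) (v : ℂ) :
    minusF lq (aB j) (v + (k + N) / 2 * lq) + aV N lq k j ((k + N) / 2) v =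
      aV N lq k j (-((k + N) / 2)) (v + (k + N) * lq) := by
  have hk := hG.k_add_ne_zero
  funext g
  rcases g with ⟨x, m⟩ | ⟨x, m⟩ | x | x <;> by_cases hx : x = aB j <;>
    simp only [Pi.add_apply, minusF, hx, if_true, if_false, zero_add]
  · have h1 := hG.qnum_k_ne_zero m
    have h2 := hG.qd_mul_qnum ((k + N) * m)
    have h3 := qpow_ne_zero (lq := lq) ((k + N) / 2 * m)
    rw [aV_cre _ _ _ (hG.qnum_ne_zero m), aV_cre _ _ _ (hG.qnum_ne_zero m), ← zn, zn_add_mul_lq,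
      zn_add_mul_lq, tp_eq_qpow, tp_eq_qpow, neg_neg, neg_mul ((k + N) / 2), qpow_neg]
    rw [qpow_mul_eq_sq (k + N)] at h2 ⊢
    generalize qnum lq ((k + N) * m) = X at *
    generalize qpow lq ((k + N) / 2 * m) = h at *
    field_simp at h2 ⊢
    linear_combination -zn m v * h2
  · simp [aV, field, hx]
  · have h3 := qpow_ne_zero (lq := lq) ((k + N) / 2 * m)
    rw [aV_ann _ _ _ (hG.qnum_ne_zero m), aV_ann _ _ _ (hG.qnum_ne_zero m), zn_add_mul_lq,
      tp_eq_qpow, neg_neg, neg_mul ((k + N) / 2), qpow_neg, qpow_mul_eq_sq (k + N)]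
    generalize qpow lq ((k + N) / 2 * m) = h at *
    field_simp
  · simp [aV, field, hx]
  · simp [aV, field]
    field_simp
    ring
  · simp [aV, field, hx]
  · simp [aV, field]
  · simp [aV, field, hx]

/-- The mirror image: here the annihilation modes are completed by `a_+` and the creation modes are
unchanged. -/
theorem plusF_add_aV (hG : Generic N lq k) (j : Fin (N - 1)) (v : ℂ) :
    plusF lq (aB j) (v + -((k + N) / 2) * lq) + aV N lq k j ((k + N) / 2) v =
      aV N lq k j (-((k + N) / 2)) (v + -(k + N) * lq) := by
  have hk := hG.k_add_ne_zero
  funext g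
  rcases g with ⟨x, m⟩ | ⟨x, m⟩ | x | x <;> by_cases hx : x = aB j <;>
    simp only [Pi.add_apply, plusF, hx, if_true, if_false, zero_add]
  · have h3 := qpow_ne_zero (lq := lq) ((k + N) / 2 * m)
    rw [aV_cre _ _ _ (hG.qnum_ne_zero m), aV_cre _ _ _ (hG.qnum_ne_zero m), zn_add_mul_lq, tp_neg,
      tp_eq_qpow, neg_neg, neg_mul ((k + N) / 2), qpow_neg, qpow_mul_eq_sq (k + N)]
    generalize qpow lq ((k + N) / 2 * m) = h at *
    field_simp
  · simp [aV, field, hx]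
  · have h1 := hG.qnum_k_ne_zero m
    have h2 := hG.qd_mul_qnum ((k + N) * m)
    have h3 := qpow_ne_zero (lq := lq) ((k + N) / 2 * m)
    have h4 := zn_ne_zero m v
    rw [aV_ann _ _ _ (hG.qnum_ne_zero m), aV_ann _ _ _ (hG.qnum_ne_zero m), neg_mul (m : ℂ),
      Complex.exp_neg, ← zn, zn_add_mul_lq, zn_add_mul_lq, tp_neg, tp_neg, tp_eq_qpow,
      tp_eq_qpow, neg_neg, neg_mul ((k + N) / 2), qpow_neg]
    rw [qpow_mul_eq_sq (k + N)] at h2 ⊢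
    generalize qnum lq ((k + N) * m) = X at *
    generalize qpow lq ((k + N) / 2 * m) = h at *
    field_simp at h2 ⊢
    linear_combination h2
  · simp [aV, field, hx]
  · simp [aV, field]
    field_simp
    ring
  · simp [aV, field, hx]
  · simp [aV, field]
  · simp [aV, field, hx]

end CartanVertex

/-! ### Residues of the negative tail half of `E ^ -`. -/

section EminusResidues

variable {N : ℕ} {lq k : ℂ} {i₀ j₀ : Fin (N - 1)}

theorem lTail_pred {n : ℕ} (hn : n < i₀ + 1) (u : ℂ) : lTail N lq k i₀ n u =
    bM N lq (n + 1) (i₀ + 1 + 1) (lPt lq k (i₀ + 1) (n + 1) (i₀ + 1 + 1) u) -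
      bM N lq (n + 1) (i₀ + 1) (lPt lq k (i₀ + 1) (n + 1) (i₀ + 1) u) +
      lTail N lq k i₀ (n + 1) u := by
  rw [lTail, lTail, ← Finset.insert_Icc_add_one_left_eq_Icc (by omega : n + 1 ≤ i₀ + 1),
    Finset.sum_insert (by simp), lPt, lPt,
    show ((i₀ + 1 + 1 : ℕ) : ℂ) - (i₀ + 1 : ℕ) - (n + 1 : ℕ) - k = -(k + (n + 1 : ℕ) - 1) by
      push_cast; ring,
    show ((i₀ + 1 : ℕ) : ℂ) - (i₀ + 1 : ℕ) - (n + 1 : ℕ) - k = -(k + (n + 1 : ℕ)) by ring]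
  abel

theorem rTail_succ {n : ℕ} (hn : n ≤ N) (u : ℂ) : rTail N lq k i₀ n u =
    bP N lq (i₀ + 1) n (rPt lq k (i₀ + 1) (i₀ + 1) n u) -
      bP N lq (i₀ + 1 + 1) n (rPt lq k (i₀ + 1) (i₀ + 1 + 1) n u) +
      rTail N lq k i₀ (n + 1) u := by
  rw [rTail, rTail, ← Finset.insert_Icc_add_one_left_eq_Icc hn,
    Finset.sum_insert (by simp), rPt, rPt,
    show k + n - ((i₀ + 1 + 1 : ℕ) : ℂ) + (i₀ + 1 : ℕ) = k + n - 1 by push_cast; ring,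
    show k + n - ((i₀ + 1 : ℕ) : ℂ) + (i₀ + 1 : ℕ) = k + n by ring]
  abel

/-- The pairing of the terms of `Eleft` and a screening current whose residues cancel. -/
def lPair (i j : ℕ) : (ℕ ⊕ ℕ) × (ℕ ⊕ ℕ) → (ℕ ⊕ ℕ) × (ℕ ⊕ ℕ)
  | (Sum.inl n, Sum.inl _) => if n = j then (Sum.inl (j + 1), Sum.inl i)
      else (Sum.inl j, Sum.inl (i + 1))
  | (Sum.inl n, Sum.inr _) => if n = j then (Sum.inr j, Sum.inl i)
      else (Sum.inr j, Sum.inl (i + 1))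
  | (Sum.inr _, Sum.inl m) => if m = i then (Sum.inl j, Sum.inr i)
      else (Sum.inl (j + 1), Sum.inr i)
  | x => x

/-- For `i ≠ j` a contraction with a pole forces `j < i`. Then row `j + 1` occurs in `E ^ {-,i}` and
column `i` in `S̃ ^ j`, so each such term has a partner under `lPair`. -/
theorem residue_lTerm (hij : i₀ ≠ j₀) (v : ℂ) :
    residue lq k (lIdx (i₀ + 1)) (sIdx N (j₀ + 1)) sgn sgn (lTerm N lq k i₀) (fTerm N lq k j₀)
      (lConst (i₀ + 1) (j₀ + 1))
      (fun α β => (N : ℂ) - (i₀ + 1 : ℕ) + (j₀ + 1 : ℕ) + k + lShift (i₀ + 1) (j₀ + 1) α β)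
      (fun _ _ => ()) (fun _ => (N : ℂ) - (i₀ + 1 : ℕ) + (j₀ + 1 : ℕ) + k) () v = 0 := by
  have hij' : (i₀ : ℕ) ≠ j₀ := fun h => hij (Fin.ext h)
  have hi : (i₀ : ℕ) + 1 + 1 ≤ N := by omega
  have hq := qpow_ne_zero (lq := lq) 1
  obtain ⟨u, hu⟩ : ∃ u, u = v + ((N : ℂ) - (i₀ + 1 : ℕ) + (j₀ + 1 : ℕ) + k) * lq := ⟨_, rfl⟩
  -- At the pole the fields in the rows `j`, `j + 1` and columns `i`, `i + 1` enter at `w` or `q ^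
  -- (±1) w` for this single point, so that equality of the exponents becomes linear algebra.
  obtain ⟨w, hw⟩ : ∃ w, w = v + ((N : ℂ) - (i₀ + 1 : ℕ)) * lq := ⟨_, rfl⟩
  have p1 : lPt lq k (i₀ + 1) (j₀ + 1) (i₀ + 1) u = w := by
    rw [lPt, hu, hw]; ring
  have p2 : lPt lq k (i₀ + 1) (j₀ + 1) (i₀ + 1 + 1) u = w + lq := by
    rw [lPt, hu, hw]; push_cast; ring
  have p3 : lPt lq k (i₀ + 1) (j₀ + 1 + 1) (i₀ + 1 + 1) u = w := by
    rw [lPt, hu, hw]; push_cast; ring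
  have p4 : lPt lq k (i₀ + 1) (j₀ + 1 + 1) (i₀ + 1) u = w - lq := by
    rw [lPt, hu, hw]; push_cast; ring
  have s1 : sPt N lq (j₀ + 1) (j₀ + 1) (i₀ + 1) v = w := by
    rw [sPt, hw]; ring
  have s2 : sPt N lq (j₀ + 1) (j₀ + 1) (i₀ + 1 + 1) v = w - lq := by
    rw [sPt, hw]; push_cast; ring
  have s3 : sPt N lq (j₀ + 1) (j₀ + 1 + 1) (i₀ + 1 + 1) v = w := by
    rw [sPt, hw]; push_cast; ring
  have s4 : sPt N lq (j₀ + 1) (j₀ + 1 + 1) (i₀ + 1) v = w + lq := by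
    rw [sPt, hw]; push_cast; ring
  refine residue_eq_zero_of_involution (lPair (i₀ + 1) (j₀ + 1)) _ _ ?_
  rintro ⟨n | n, m | m⟩ hx - hs <;>
    simp only [Finset.mem_product, mem_sIdx, tIdx, lIdx, Finset.inl_mem_disjSum,
      Finset.inr_mem_disjSum, Finset.mem_Icc, Finset.mem_Ico] at hx <;>
    simp only [ne_eq, add_eq_left, lShift] at hs
  all_goals
    first
      | exact absurd trivial hs
      | split_ifs at hs with h1 h2
    all_goals
      first
        | exact absurd rfl hs
        | skip
    all_goals
      obtain ⟨h3, h4⟩ := ‹_ ∧ _›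
      have hji : (j₀ : ℕ) + 1 < i₀ + 1 := by omega
      subst h3 h4
      simp (disch := omega) only [lPair, if_true, if_neg]
      refine ⟨?_, trivial, ?_, trivial, ?_, ?_⟩
      · simp only [Finset.mem_product, mem_sIdx, tIdx, lIdx, Finset.inl_mem_disjSum,
          Finset.inr_mem_disjSum, Finset.mem_Icc, Finset.mem_Ico]
        omega
      · simp (disch := omega) only [lShift, and_self, if_true, if_neg, ne_eq, add_eq_left,
          neg_eq_zero, two_ne_zero, not_false_eq_true]
      · rw [← hu]
        simp only [lTerm, fTerm, sTerm, lTail_pred hji, sTail_pred _ hi, p1, p2, p3, p4, s1, s2,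
          s3, s4, add_sub_cancel_right, sub_add_cancel]
        abel
      · simp (disch := omega) only [lShift, lConst, tIdx, and_self, if_true, if_neg,
          sgn_inl, sgn_inr, qpow_add, qpow_neg, qpow_two, qpow_zero]
        field_simp
        ring

/-- At the pole `z = q ^ (k+g) w` the `b_-` part of this tail is the negative of the tail of the
screening current. -/
theorem lTail_self (v : ℂ) : lTail N lq k i₀ (i₀ + 1) (v + (k + N) * lq) =
    minusF lq (aB i₀) (v + (k + N) / 2 * lq) - sTail N lq (i₀ + 1) (i₀ + 1) v := by
  rw [lTail, Finset.Icc_eq_empty (by omega), Finset.sum_empty, zero_add, sTail,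
    sub_eq_add_neg (minusF _ _ _), ← Finset.sum_neg_distrib,
    show v + (k + N) * lq + -((k + N) / 2) * lq = v + (k + N) / 2 * lq by ring]
  refine congrArg _ (Finset.sum_congr rfl fun c _ => ?_)
  rw [neg_sub, sPt, sPt]
  push_cast
  ring_nf

/-- All `b` and `c` fields cancel at this pole, since `b ^ {ii}` and `b ^ {i+1,i+1}` vanish. What
remains is `a_-` together with the vertex form of `a`. -/
theorem lTerm_add_fTerm_self (hG : Generic N lq k) (v : ℂ) :
    lTerm N lq k i₀ (Sum.inl (i₀ + 1)) (v + (k + N) * lq) +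
      fTerm N lq k i₀ (Sum.inl (i₀ + 1 + 1)) v =
    aV N lq k i₀ (-((k + N) / 2)) (v + (k + N) * lq) := by
  have hi : (i₀ : ℕ) + 1 + 1 ≤ N := by omega
  have hn : ∀ n, ¬IsRoot N n n := fun n h => lt_irrefl _ h.2.1
  have e : lPt lq k (i₀ + 1) (i₀ + 1) (i₀ + 1 + 1) (v + (k + N) * lq) - lq =
      sPt N lq (i₀ + 1) (i₀ + 1) (i₀ + 1 + 1) v + lq := by
    rw [lPt, sPt]; push_cast; ring
  rw [← minusF_add_aV hG, lTerm, fTerm, sTerm, lTail_self, sTail_pred _ hi, e]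
  simp only [bM_of_not_isRoot _ _ _ (hn _), bc_of_not_isRoot _ _ _ (hn _)]
  abel

theorem exp_neg_add_mul (v x : ℂ) :
    Complex.exp (-(v + x * lq)) = (Complex.exp v * qpow lq x)⁻¹ := by
  rw [Complex.exp_neg, Complex.exp_add, qpow]

/-- For `i = j` the only pair with a pole is the middle term of `E ^ -` and the positive term of
index `i + 1`. Its partner would need row `i + 1` and column `i`, which do not occur, so it
survives. -/
theorem residue_lTerm_self (hG : Generic N lq k) (v : ℂ) :
    residue lq k (lIdx (i₀ + 1)) (sIdx N (i₀ + 1)) sgn sgn (lTerm N lq k i₀) (fTerm N lq k i₀)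
      (lConst (i₀ + 1) (i₀ + 1))
      (fun α β => (N : ℂ) - (i₀ + 1 : ℕ) + (i₀ + 1 : ℕ) + k + lShift (i₀ + 1) (i₀ + 1) α β)
      (fun _ _ => ()) (fun _ => (N : ℂ) - (i₀ + 1 : ℕ) + (i₀ + 1 : ℕ) + k) () v =
      (qpow lq (k + N) * qd lq) • aVertex N lq k i₀ (-((k + N) / 2)) (v + (k + N) * lq) := by
  have hi : (i₀ : ℕ) + 1 + 1 ≤ N := by omega
  rw [residue, Finset.filter_true_of_mem fun _ _ => rfl,
    Finset.sum_eq_single (Sum.inl ((i₀ : ℕ) + 1), Sum.inl ((i₀ : ℕ) + 1 + 1))]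
  · have hq := qpow_ne_zero (lq := lq) 1
    rw [sub_add_cancel, add_comm (N : ℂ) k, lTerm_add_fTerm_self hG]
    refine congrArg (· • _) ?_
    simp only [lShift, lConst, tIdx, and_self, if_true, sgn_inl, qpow_add, qpow_neg, qpow_two, qd]
    field_simp
  · rintro ⟨n | n, m | m⟩ hx hne <;>
      simp only [Finset.mem_product, mem_sIdx, tIdx, lIdx, Finset.inl_mem_disjSum,
        Finset.inr_mem_disjSum, Finset.mem_Icc, Finset.mem_Ico] at hx <;>
      simp only [ne_eq, Prod.mk.injEq, Sum.inl.injEq, reduceCtorEq, and_false, false_and] at hne <;>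
      simp (disch := omega) only [lShift, if_neg, add_zero, sub_self, mul_zero, zero_smul]
  · intro h
    refine absurd ?_ h
    simp only [Finset.mem_product, mem_sIdx, tIdx, lIdx, Finset.inl_mem_disjSum, Finset.mem_Icc]
    omega

theorem ope_Eleft_Scurrent (hG : Generic N lq k) (i₀ j₀ : Fin (N - 1)) :
    OPE (Eleft N lq k i₀) (Scurrent N lq k j₀) (fun _ _ => 1) (fun _ _ => 1) fun u v =>
      (if i₀ = j₀ then (1 : ℂ) else 0) • (qd lq * Complex.exp v)⁻¹ •
        (1 / (Complex.exp u - Complex.exp (v + (k + N) * lq))) •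
          aVertex N lq k j₀ (-((k + N) / 2)) (v + (k + N) * lq) := by
  have h := ope_of_residues (N := N) (lq := lq) (k := k) (P := Finset.univ)
    (π := fun (_ _ : ℕ ⊕ ℕ) => ())
    (b := fun _ => (N : ℂ) - (i₀ + 1 : ℕ) + (j₀ + 1 : ℕ) + k)
    (c := lConst (i₀ + 1) (j₀ + 1))
    (a := fun α β => (N : ℂ) - (i₀ + 1 : ℕ) + (j₀ + 1 : ℕ) + k + lShift (i₀ + 1) (j₀ + 1) α β)
    (A := Eleft N lq k i₀)
    (fun _ _ _ _ => Finset.mem_univ _) (fun _ => rfl) (Scurrent_eq j₀)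
    (fun α _ => Tame.lTerm hG i₀ α) (fun β _ => Tame.fTerm hG j₀ β)
    (fun α _ => ExpFamily.lTerm i₀ α) (fun β _ => ExpFamily.fTerm j₀ β) (fun α hα β hβ => by
      refine ⟨halfPair_lTerm_fTerm hG hα hβ, ?_⟩
      convert halfPair_fTerm_lTerm hG hα hβ using 1
      ring)
  convert h using 1
  funext u v
  rw [Finset.univ_unique, Finset.sum_singleton]
  by_cases hij : i₀ = j₀
  · subst hij
    have hd := hG.qd_ne_zero
    have he := Complex.exp_ne_zero v
    have hb := qpow_ne_zero (lq := lq) (k + N)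
    rw [if_pos rfl, one_smul]
    erw [residue_lTerm_self hG v]
    rw [sub_add_cancel, add_comm (N : ℂ) k, smul_smul, smul_smul, smul_smul, exp_neg_add_mul]
    -- The prefactors `(q - q⁻¹)⁻²` and `(q ^ (k+g) w)⁻¹` meet `q ^ (k+g) (q - q⁻¹)` from the
    -- residue, leaving the `1 / ((q - q⁻¹) w)` of the difference operator.
    refine congrArg (· • _) ?_
    generalize 1 / (Complex.exp u - _) = X
    field_simp
  · rw [if_neg hij, zero_smul]
    erw [residue_lTerm hij v]
    rw [smul_zero, smul_zero]

end EminusResidues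

end

end UqSlN

namespace UqSlN

noncomputable section

open scoped BigOperators
open Filter Topology

/-! ### Residues of the positive tail half and the expansion of `E ^ -`. -/

section EminusRightResidues

variable {N : ℕ} {lq k : ℂ} {i₀ j₀ : Fin (N - 1)}

/-- The pairing of the terms of `Eright` and a screening current whose residues cancel. -/
def rPair (i j : ℕ) : (ℕ ⊕ ℕ) × (ℕ ⊕ ℕ) → (ℕ ⊕ ℕ) × (ℕ ⊕ ℕ)
  | (Sum.inl n, Sum.inl _) => if i = j then (Sum.inr (n - 1), Sum.inr (n - 1))
      else (Sum.inr n, Sum.inr n)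
  | (Sum.inr n, Sum.inr _) => if i = j then (Sum.inl (n + 1), Sum.inl (n + 1))
      else (Sum.inl n, Sum.inl n)
  | x => x

theorem rPt_rPole_self (i r c l : ℕ) (v : ℂ) : rPt lq k i r c (v + rPole N k i i l * lq) =
    v + (N + ((i : ℂ) - r) + ((c : ℂ) - l) - l) * lq := by
  rw [rPt, rPole, if_pos rfl]; ring

theorem rPt_rPole_succ (i r c l : ℕ) (v : ℂ) :
    rPt lq k i r c (v + rPole N k i (i + 1) l * lq) =
    v + (N + ((i : ℂ) - r) + ((c : ℂ) - l) + 1 - l) * lq := by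
  rw [rPt, rPole, if_neg (by omega)]; ring

/-- At the pole labelled `l` the explicit fields cancel and only the two tails remain.
`rTerm_inl_add_sTerm_inl` reaches the same expression from column `l + 1`, so the two contributions
have equal exponents. -/
theorem rTerm_inr_add_sTerm_inr {l : ℕ} (hl : l ≤ N) (v : ℂ) :
    rTerm N lq k i₀ (Sum.inr l) (v + rPole N k (i₀ + 1) (i₀ + 1) l * lq) +
      sTerm N lq (i₀ + 1) (Sum.inr l) v =
    rTail N lq k i₀ (l + 1) (v + rPole N k (i₀ + 1) (i₀ + 1) l * lq) +
      sTail N lq (i₀ + 1) l v := by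
  have e1 : sPt N lq (i₀ + 1) (i₀ + 1) l v =
      rPt lq k (i₀ + 1) (i₀ + 1) l (v + rPole N k (i₀ + 1) (i₀ + 1) l * lq) := by
    rw [rPt_rPole_self, sPt]; ring
  have e2 : sPt N lq (i₀ + 1) (i₀ + 1 + 1) l v - lq =
      rPt lq k (i₀ + 1) (i₀ + 1 + 1) l (v + rPole N k (i₀ + 1) (i₀ + 1) l * lq) + lq := by
    rw [rPt_rPole_self, sPt]; push_cast; ring
  rw [rTerm, sTerm, rTail_succ hl, e1, e2]
  abel

theorem rTerm_inl_add_sTerm_inl {l : ℕ} (hl : l + 1 ≤ N) (v : ℂ) :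
    rTerm N lq k i₀ (Sum.inl (l + 1)) (v + rPole N k (i₀ + 1) (i₀ + 1) l * lq) +
      sTerm N lq (i₀ + 1) (Sum.inl (l + 1)) v =
    rTail N lq k i₀ (l + 1) (v + rPole N k (i₀ + 1) (i₀ + 1) l * lq) +
      sTail N lq (i₀ + 1) l v := by
  have e1 : sPt N lq (i₀ + 1) (i₀ + 1) (l + 1) v + lq =
      rPt lq k (i₀ + 1) (i₀ + 1) (l + 1) (v + rPole N k (i₀ + 1) (i₀ + 1) l * lq) - lq := by
    rw [rPt_rPole_self, sPt]; push_cast; ring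
  have e2 : sPt N lq (i₀ + 1) (i₀ + 1 + 1) (l + 1) v =
      rPt lq k (i₀ + 1) (i₀ + 1 + 1) (l + 1) (v + rPole N k (i₀ + 1) (i₀ + 1) l * lq) := by
    rw [rPt_rPole_self, sPt]; push_cast; ring
  rw [rTerm, sTerm, sTail_pred _ hl, e1, e2]
  abel

/-- For `j = i + 1` the currents share row `i + 1`, and within one column their `b_±` and shifted `b
+ c` are exchanged between the two terms. -/
theorem rTerm_add_sTerm_succ (n : ℕ) (v : ℂ) :
    rTerm N lq k i₀ (Sum.inr n) (v + rPole N k (i₀ + 1) (i₀ + 1 + 1) n * lq) +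
      sTerm N lq (i₀ + 1 + 1) (Sum.inr n) v =
    rTerm N lq k i₀ (Sum.inl n) (v + rPole N k (i₀ + 1) (i₀ + 1 + 1) n * lq) +
      sTerm N lq (i₀ + 1 + 1) (Sum.inl n) v := by
  have e1 : sPt N lq (i₀ + 1 + 1) (i₀ + 1 + 1) n v =
      rPt lq k (i₀ + 1) (i₀ + 1 + 1) n (v + rPole N k (i₀ + 1) (i₀ + 1 + 1) n * lq) := by
    rw [rPt_rPole_succ, sPt]; push_cast; ring
  rw [rTerm, sTerm, rTerm, sTerm, e1]
  abel

/-- For `i = j` the negative terms of column `l` cancel the positive ones of column `l + 1`; the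
partner is missing only at the last column, hence the condition `l ≠ N`. For `j = i + 1` the
cancellation takes place within each column, and otherwise there are no poles. -/
theorem residue_rTerm {l : ℕ} (hl : i₀ = j₀ → l ≠ N) (v : ℂ) :
    residue lq k (rIdx N (i₀ + 1)) (sIdx N (j₀ + 1)) sgn sgn (rTerm N lq k i₀) (fTerm N lq k j₀)
      (rConst (i₀ + 1) (j₀ + 1))
      (fun α β => rPole N k (i₀ + 1) (j₀ + 1) (rLabel (i₀ + 1) (j₀ + 1) α) +
        rShift (i₀ + 1) (j₀ + 1) α β)
      (fun α _ => rLabel (i₀ + 1) (j₀ + 1) α) (rPole N k (i₀ + 1) (j₀ + 1)) l v = 0 := by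
  have hl' : (i₀ : ℕ) + 1 = j₀ + 1 → l ≠ N := fun h => hl (Fin.ext (by omega))
  have hq := qpow_ne_zero (lq := lq) 1
  obtain ⟨Ξ, hΞ⟩ : ∃ Ξ : ℂ → LinForm N, ∀ β v, fTerm N lq k j₀ β v =
    Ξ v + sTerm N lq (j₀ + 1) β v := ⟨_, fun _ _ => rfl⟩
  refine residue_eq_zero_of_involution (rPair (i₀ + 1) (j₀ + 1)) _ _ ?_
  simp only [hΞ]
  clear hl hΞ
  have hi := i₀.2
  generalize (j₀ : ℕ) + 1 = j at *
  rintro ⟨n | n, m | m⟩ hx hπ hs <;> dsimp only at hπ hs <;> subst hπ <;>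
    simp only [Finset.mem_product, mem_sIdx, tIdx, rIdx, Finset.inl_mem_disjSum,
      Finset.inr_mem_disjSum, Finset.mem_Icc] at hx <;>
    simp only [ne_eq, add_eq_left, rShift] at hs
  all_goals
    first
      | exact absurd trivial hs
      | split_ifs at hs with h1 h2 h3
    all_goals
      first
        | exact absurd rfl hs
        | skip
    all_goals
      subst h1
      first
        | subst h2
        | subst h3
      clear hs
      obtain ⟨n, rfl⟩ := Nat.exists_eq_add_of_le' (by omega : 1 ≤ n)
      simp only [rLabel, if_true, Nat.add_sub_cancel, true_implies] at hl'
      simp (disch := omega) only [rPair, rLabel, if_true, if_neg, Nat.add_sub_cancel]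
      refine ⟨?_, trivial, ?_, trivial, ?_, ?_⟩
      · simp only [Finset.mem_product, mem_sIdx, tIdx, rIdx, Finset.inl_mem_disjSum,
          Finset.inr_mem_disjSum, Finset.mem_Icc]
        omega
      · simp (disch := omega) only [rShift, if_true, if_neg, ne_eq, add_eq_left,
          neg_eq_zero, two_ne_zero, not_false_eq_true]
      · simp only [← add_assoc, add_right_comm _ (Ξ v)]
        refine congrArg (· + Ξ v) ?_
        first
          | rw [rTerm_add_sTerm_succ]
          | (rw [rTerm_inr_add_sTerm_inr (by omega), rTerm_inl_add_sTerm_inl (by omega)])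
      · simp (disch := omega) only [rShift, rConst, sRow, tIdx, if_true, if_neg,
          sgn_inl, sgn_inr, zero_sub, qpow_add, qpow_neg, qpow_two, qpow_zero]
        field_simp
        ring

theorem rPole_top (i : ℕ) : rPole N k i i N = -(k + N) := by
  rw [rPole, if_pos rfl]; ring

/-- The last column contributes only its negative terms. There the tails contain no `b` fields any
more, so `a_+` and the vertex form of `a` are all that is left. -/
theorem residue_rTerm_self (hG : Generic N lq k) (v : ℂ) :
    residue lq k (rIdx N (i₀ + 1)) (sIdx N (i₀ + 1)) sgn sgn (rTerm N lq k i₀) (fTerm N lq k i₀)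
      (rConst (i₀ + 1) (i₀ + 1))
      (fun α β => rPole N k (i₀ + 1) (i₀ + 1) (rLabel (i₀ + 1) (i₀ + 1) α) +
        rShift (i₀ + 1) (i₀ + 1) α β)
      (fun α _ => rLabel (i₀ + 1) (i₀ + 1) α) (rPole N k (i₀ + 1) (i₀ + 1)) N v =
      (-(qpow lq (-(k + N)) * qd lq)) •
        aVertex N lq k i₀ (-((k + N) / 2)) (v + -(k + N) * lq) := by
  have hi : (i₀ : ℕ) + 1 + 1 ≤ N := by omega
  rw [residue, Finset.sum_eq_single (Sum.inr N, Sum.inr N)]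
  · have hq := qpow_ne_zero (lq := lq) 1
    have e : rTerm N lq k i₀ (Sum.inr N) (v + rPole N k (i₀ + 1) (i₀ + 1) N * lq) +
        fTerm N lq k i₀ (Sum.inr N) v =
        aV N lq k i₀ (-((k + N) / 2)) (v + -(k + N) * lq) := by
      rw [fTerm, add_left_comm, rTerm_inr_add_sTerm_inr le_rfl, sTail,
        Finset.Icc_eq_empty (by omega), Finset.sum_empty, add_zero, rTail,
        Finset.Icc_eq_empty (by omega), Finset.sum_empty, add_zero, rPole_top, add_comm,
        ← plusF_add_aV hG]
      ring_nf
    rw [e]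
    refine congrArg (· • _) ?_
    simp only [rLabel, rPole_top, rShift, rConst, sRow, tIdx, if_true, lt_irrefl, if_false,
      sgn_inr, zero_sub, qpow_add, qpow_two, qd]
    rw [if_neg (by omega), sub_zero, qpow_neg 1]
    field_simp
    ring
  · rintro ⟨n | n, m | m⟩ hx hne <;> obtain ⟨hx, hl⟩ := Finset.mem_filter.1 hx <;>
      simp only [Finset.mem_product, mem_sIdx, tIdx, rIdx, Finset.inl_mem_disjSum,
        Finset.inr_mem_disjSum, Finset.mem_Icc] at hx <;>
      simp only [rLabel, if_true] at hl <;>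
      simp only [ne_eq, Prod.mk.injEq, Sum.inr.injEq, reduceCtorEq, and_false, false_and] at hne
    · omega
    · omega
    all_goals
      simp (disch := omega) only [rLabel, rShift, hl, if_neg, add_zero, sub_self, mul_zero,
        zero_smul]
  · intro h
    refine (h (Finset.mem_filter.2 ⟨?_, rfl⟩)).elim
    simp only [Finset.mem_product, mem_sIdx, tIdx, rIdx, Finset.inr_mem_disjSum, Finset.mem_Icc]
    omega

/-- Any finite set containing all labels will do, because the residue at a label that no term
carries is an empty sum. -/
theorem rLabel_mem {i j : ℕ} {α : ℕ ⊕ ℕ} (hα : α ∈ rIdx N i) :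
    rLabel i j α ∈ Finset.range (N + 1) := by
  rcases α with n | n <;>
    simp only [rIdx, Finset.inl_mem_disjSum, Finset.inr_mem_disjSum, Finset.mem_Icc] at hα <;>
    simp only [rLabel, Finset.mem_range] <;> (try split_ifs) <;> omega

theorem ope_Eright_Scurrent (hG : Generic N lq k) (i₀ j₀ : Fin (N - 1)) :
    OPE (Eright N lq k i₀) (Scurrent N lq k j₀) (fun _ _ => 1) (fun _ _ => 1) fun u v =>
      (if i₀ = j₀ then (1 : ℂ) else 0) • -((qd lq * Complex.exp v)⁻¹ •
        (1 / (Complex.exp u - Complex.exp (v - (k + N) * lq))) •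
          aVertex N lq k j₀ (-((k + N) / 2)) (v - (k + N) * lq)) := by
  have h := ope_of_residues (N := N) (lq := lq) (k := k) (P := Finset.range (N + 1))
    (π := fun (α _ : ℕ ⊕ ℕ) => rLabel (i₀ + 1) (j₀ + 1) α)
    (b := rPole N k (i₀ + 1) (j₀ + 1))
    (c := rConst (i₀ + 1) (j₀ + 1))
    (a := fun α β => rPole N k (i₀ + 1) (j₀ + 1) (rLabel (i₀ + 1) (j₀ + 1) α) +
      rShift (i₀ + 1) (j₀ + 1) α β)
    (A := Eright N lq k i₀)
    (fun _ hα _ _ => rLabel_mem hα) (fun _ => rfl) (Scurrent_eq j₀)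
    (fun α _ => Tame.rTerm hG i₀ α) (fun β _ => Tame.fTerm hG j₀ β)
    (fun α _ => ExpFamily.rTerm i₀ α) (fun β _ => ExpFamily.fTerm j₀ β) (fun α hα β hβ => by
      refine ⟨halfPair_rTerm_fTerm hG hα hβ, ?_⟩
      convert halfPair_fTerm_rTerm hG hα hβ using 1
      ring)
  convert h using 1
  funext u v
  by_cases hij : i₀ = j₀
  · subst hij
    have hd := hG.qd_ne_zero
    have he := Complex.exp_ne_zero v
    have hb := qpow_ne_zero (lq := lq) (-(k + N))
    rw [if_pos rfl, one_smul, Finset.sum_eq_single N, residue_rTerm_self hG v, rPole_top,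
      smul_smul, smul_smul, smul_smul, exp_neg_add_mul, sub_eq_add_neg v, ← neg_mul (k + N),
      ← neg_smul]
    -- The powers of `q` and `q - q⁻¹` cancel as for the negative tails, and the sign of the residue
    -- supplies the minus sign in the difference operator.
    · refine congrArg (· • _) ?_
      generalize 1 / (Complex.exp u - _) = X
      field_simp
    · intro l _ hl
      rw [residue_rTerm (fun _ => hl), smul_zero, smul_zero]
    · simp
  · rw [if_neg hij, zero_smul, Finset.sum_eq_zero fun l _ => by
      rw [residue_rTerm fun h => absurd h hij, smul_zero, smul_zero]]

/-- The product of `E ^ {-,i}(z)` and `S ^ j(w)` has a total difference as singular part. -/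
theorem ope_Eminus_Scurrent (hG : Generic N lq k) (i₀ j₀ : Fin (N - 1)) :
    OPE (Eminus N lq k i₀) (Scurrent N lq k j₀) (fun _ _ => 1) (fun _ _ => 1)
      (fun u v => (if i₀ = j₀ then (1 : ℂ) else 0) •
        qdiff lq (k + N) (fun y => (1 / (Complex.exp u - Complex.exp y)) •
          aVertex N lq k j₀ (-((k + N) / 2)) y) v) := by
  have h := (ope_Eleft_Scurrent hG i₀ j₀).add (ope_Eright_Scurrent hG i₀ j₀)
  simp only [← Eminus_eq] at h
  convert h using 1
  funext u v
  rw [qdiff, smul_sub, smul_sub, smul_neg, sub_eq_add_neg]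

end EminusRightResidues

end

end UqSlN

/-! ### The five relations together. -/

theorem proposition3 (N : ℕ) (lq k : ℂ)
    (hq : ‖Complex.exp lq‖ < 1)
    (hk : ∀ n : ℕ, 0 < n → qnum lq ((k + N) * n) ≠ 0) :
    (∀ (i j : Fin (N - 1)) (n : ℤ) (u : ℂ),
      (∀ s t, Composable (Hmode N lq k i n) (Scurrent N lq k j u) s t ∧
        Composable (Scurrent N lq k j u) (Hmode N lq k i n) s t) ∧
      comp (Hmode N lq k i n) (Scurrent N lq k j u)
        - comp (Scurrent N lq k j u) (Hmode N lq k i n) = 0) ∧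
    (∀ i j : Fin (N - 1),
      OPE (Eplus N lq k i) (Scurrent N lq k j) (fun _ _ => 1) (fun _ _ => 1) 0) ∧
    (∀ i j : Fin (N - 1),
      OPE (Eminus N lq k i) (Scurrent N lq k j) (fun _ _ => 1) (fun _ _ => 1)
        (fun u v => (if i = j then (1 : ℂ) else 0) •
          qdiff lq (k + N)
            (fun y => (1 / (Complex.exp u - Complex.exp y)) •
              aVertex N lq k j (-((k + N) / 2)) y) v)) ∧
    (∀ i j : Fin (N - 1),
      OPE (Stilde N lq k i) (Stilde N lq k j)
        (fun u v => Complex.exp u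
          - qpow lq (-(CartanMatrix.A (N - 1) i j : ℂ)) * Complex.exp v)
        (fun u v => qpow lq (-(CartanMatrix.A (N - 1) i j : ℂ)) * Complex.exp u
          - Complex.exp v) 0) ∧
    (∀ i j : Fin (N - 1), CartanMatrix.A (N - 1) i j = 0 →
      OPE (Stilde N lq k i) (Stilde N lq k j) (fun _ _ => 1) (fun _ _ => 1) 0) := by
  have hG : Generic N lq k := ⟨hq, hk⟩
  exact ⟨fun i j n u => Hmode_comm_Scurrent hG i j n u, fun i j => ope_Eplus_Scurrent hG i j,
    fun i j => ope_Eminus_Scurrent hG i j, fun i j => ope_Stilde_Stilde hG i j,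
    fun i j h => ope_Stilde_Stilde_of_eq_zero hG i j h⟩
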